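/- **Setting.** For $n\ge 1$ let $\mathbb M_n$ be the $n\times n$ complex matrices, $\mathrm{tr}_n=\frac1n\mathrm{Tr}$, $\|X\|_2^2=\mathrm{tr}_n(X^*X)$, and $\|X\|_\infty$ the operator norm. Write $\operatorname{Re}x=\frac12(x+x^*)$, $\operatorname{Im}x=\frac1{2i}(x-x^*)$. For $R\ge 0$ put $F_R(t)=\min(\max(t,-R),R)$ and, for $X\in\mathbb M_n$, $F_R(X)=F_R(\operatorname{Re}X)+iF_R(\operatorname{Im}X)$ (functional calculus). Let $(\Omega,\mathcal G,\mathbb P)$ be a probability space with a filtration $(\mathcal G_t)_{t\ge0}$. For every $n$ let $(Z^{(n)}_{t,j})_{t\ge0,j\in\mathbb N}$ be a Brownian motion on $\mathbb M_n$ compatible with the filtration: $Z^{(n)}_{t,j}$ is $\mathcal G_t$-measurable, and for $s<t$ the family $(Z^{(n)}_{t,j}-Z^{(n)}_{s,j})_{j}$ is independent of $\mathcal G_s$ and the real and imaginary parts of all the entries of its members are independent centred Gaussian variables of variance $(t-s)/n$. Put $Z^{(n)}_{s,t,j}=Z^{(n)}_{t,j}-Z^{(n)}_{s,j}$. Let $\mathcal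 U$ be a free ultrafilter on $\{1,2,\dots\}$. Let $M=\prod_{n\to\mathcal U}(L^\infty(\Omega,\mathcal G,\mathbb P)\otimes\mathbb M_n)$ be the tracial ultraproduct (operator-norm bounded sequences modulo $\lim_{n\to\mathcal U}\mathbb E\,\mathrm{tr}_n(X_n^*X_n)=0$), let $M_t\subseteq M$ be the image of the sequences of $\mathcal G_t$-measurable matrices, and $E:M\to Z(M)$, $E([X_n])=[\mathrm{tr}_n(X_n)]$, where $Z(M)$ is the centre. Let $\mathcal V$ be a character of $Z(M)$, $Q=M/\{x:\mathcal V(E(x^*x))=0\}$, $\pi:M\to Q$ the quotient map, $\mathrm{tr}^Q(\pi(x))=\mathcal V(E(x))$, $Q_t=\pi(M_t)$, $D_{t,r}$ the operator-norm ball of radius $r$ of $Q_t$, and $z_{s,t,j}=\pi([F_{3\sqrt{t-s}}(Z^{(n)}_{s,t,j})]_n)$. Let $\mathcal Q=(Q,\mathrm{tr}^Q,(D_{t,r}),(z_{s,t,j}))$. For finite tuples write $\|\mathbf x\|_2^2=\sum_j\mathrm{tr}^Q(x_j^*x_j)$. **Chronological formulas and types.** Terms are built from variables, the constants $1$ and $z_{s,t,j}$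 ($s\le t$, $j\in\mathbb N$) with $+$, $\cdot$, $*$ and complex scalars. The sets $\mathcal F_{\rm chron}(t)$, $t\ge 0$, of formulas are the smallest such that: (a) $\operatorname{Re}\mathrm{tr}(p)$, $\operatorname{Im}\mathrm{tr}(p)$ and $d(p,q)=\|p-q\|_2$ ($p,q$ terms) are in every $\mathcal F_{\rm chron}(t)$; (b) if $\varphi_1,\dots,\varphi_k\in\mathcal F_{\rm chron}(t)$ and $f:\mathbb R^k\to\mathbb R$ is continuous, then $f(\varphi_1,\dots,\varphi_k)\in\mathcal F_{\rm chron}(t)$; (c) if $\varphi\in\mathcal F_{\rm chron}(t)$, $s\le t$ and $r>0$, then $\sup_{y\in D_{s,r}}\varphi$ and $\inf_{y\in D_{s,r}}\varphi$ are in $\mathcal F_{\rm chron}(s)$. The chronological type $\mathrm{tp}_{\rm chron}(\mathbf x)$ is the map $\varphi\mapsto\varphi^{\mathcal Q}(\mathbf x)$ on $\bigcup_t\mathcal F_{\rm chron}(t)$. Let $m\in\mathbb N$, $m'\in\mathbb N\cup\{0,\infty\}$, $\mathbf y_0\in Q_0^{m'}$ and $\mathbf r\in(0,\infty)^m$, and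 let $\mathbb S_{\mathbf r}=\{\mathrm{tp}_{\rm chron}(\mathbf x,\mathbf y_0):x_j\in D_{0,r_j}\}$. An *optimal coupling* of $\mu_0,\mu_1\in\mathbb S_{\mathbf r}$ over $\mathbf y_0$ is a pair $\mathbf x_0,\mathbf x_1\in Q_0^m$ with $\mathrm{tp}_{\rm chron}(\mathbf x_i,\mathbf y_0)=\mu_i$ for $i=0,1$ for which $\|\mathbf x_0-\mathbf x_1\|_2$ is the infimum of its values over all such pairs. **Restricted chronological formulas, and $\Lambda$.** Restricted formulas are built by the following rules; along with each $\varphi$ a function $\Lambda^{(n)}_\varphi$ of matrix tuples is defined. (i) $\varphi(\mathbf x)=\operatorname{Re}\mathrm{tr}\,p\big((\operatorname{Re}x_j+i)^{-1},(\operatorname{Im}x_j+i)^{-1}:j\big)$, $p$ a $*$-polynomial; $\Lambda^{(n)}_\varphi$ is its value with $\mathrm{tr}=\mathrm{tr}_n$. (ii) $\varphi=f(\varphi_1,\dots,\varphi_k)$, $f:\mathbb R^k\to\mathbb R$ Lipschitz; $\Lambda^{(n)}_\varphi=f(\Lambda^{(n)}_{\varphi_1},\dots,\Lambda^{(n)}_{\varphi_k})$.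 (iii) $\psi(\mathbf x)=\sup_{y\in D_{0,r}}\varphi(\mathbf x,y)$, $r>0$; $\Lambda^{(n)}_\psi(\mathbf X)=\sup_{\|Y\|_\infty\le r}\Lambda^{(n)}_\varphi(\mathbf X,Y)$; likewise with $\inf$. (iv) for $t_0>0$, $\psi(\mathbf x)=(S_{t_0}\varphi)(\mathbf x,(z_{0,t_0,j})_j)$, where $S_{t_0}$ adds $t_0$ to all times occurring in $\varphi$ (in domains and constants); $\Lambda^{(n)}_\psi(\mathbf X)=\mathbb E\,\Lambda^{(n)}_\varphi\big(\mathbf X,(F_{3\sqrt{t_0}}(Z^{(n)}_{0,t_0,j}))_j\big)$. **Theorem.** Let $\mu_0,\mu_1\in\mathbb S_{\mathbf r}$ and let $(\mathbf x_0,\mathbf x_1)$ be an optimal coupling of them over $\mathbf y_0$. Let $\mathbf Y^{(n)}_0\in\mathbb M_n^{m'}$ be deterministic with $\sup_n\|Y^{(n)}_{0,j}\|_\infty<\infty$ for each $j$. Let $\mathbf X_0^{(n)}$ be random matrix tuples in $\mathbb M_n^m$ (on any probability space) with $\|X^{(n)}_{0,j}\|_\infty\le r_j$ almost surely, such that $$\lim_{n\to\mathcal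 U}\Lambda^{(n)}_\varphi(\mathbf X_0^{(n)},\mathbf Y_0^{(n)})=\varphi^{\mathcal Q}(\mathbf x_0,\mathbf y_0)\quad\text{in probability}$$ for all restricted chronological formulas $\varphi$ in $m+m'$ variables. Then there are random matrix tuples $\mathbf X_1^{(n)}$ in $\mathbb M_n^m$ such that 1. $\|X^{(n)}_{1,j}\|_\infty\le r_j$ almost surely for all $n$ and $j$; 2. $\mathbf X_1^{(n)}$ is a Borel function of $\mathbf X_0^{(n)}$ for each $n$; 3. $\lim_{n\to\mathcal U}\Lambda^{(n)}_\psi(\mathbf X_0^{(n)},\mathbf X_1^{(n)},\mathbf Y_0^{(n)})=\psi^{\mathcal Q}(\mathbf x_0,\mathbf x_1,\mathbf y_0)$ in probability for all restricted chronological formulas $\psi$ in $2m+m'$ variables; 4. for each $n$, $(\mathbf X_0^{(n)},\mathbf X_1^{(n)})$ is an optimal coupling of its marginal laws for the classical $L^2$-Wasserstein distance on $\mathbb M_n^m$ with the norm $\big(\sum_j\|X_j\|_2^2\big)^{1/2}$. -/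

import Mathlib

open MeasureTheory ProbabilityTheory Filter Topology
open scoped NNReal ENNReal Matrix.Norms.L2Operator

namespace ChronOT

/-! ## Operators: real and imaginary parts, star-polynomials -/

/-- Operator real part `(x + x*) / 2`. -/
noncomputable def opRe {A : Type*} [Ring A] [Algebra ℂ A] [Star A] (x : A) : A :=
  (1 / 2 : ℂ) • (x + star x)

/-- Operator imaginary part `(x - x*) / (2 i)`. -/
noncomputable def opIm {A : Type*} [Ring A] [Algebra ℂ A] [Star A] (x : A) : A :=
  (1 / (2 * Complex.I) : ℂ) • (x - star x)

/-- The resolvent-type element `(x + i)⁻¹` (used for self-adjoint `x`). -/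
noncomputable def resolventI {A : Type*} [Ring A] [Algebra ℂ A] (x : A) : A :=
  Ring.inverse (x + algebraMap ℂ A Complex.I)

/-- Terms in the star-algebra operations, i.e. noncommutative star-polynomials, in variables
indexed by `β`. -/
inductive StarPoly (β : Type) : Type
  | var (b : β) : StarPoly β
  | one : StarPoly β
  | add (p q : StarPoly β) : StarPoly β
  | mul (p q : StarPoly β) : StarPoly β
  | adj (p : StarPoly β) : StarPoly β
  | smul (c : ℂ) (p : StarPoly β) : StarPoly β

/-- Evaluation of a star-polynomial. -/
noncomputable def StarPoly.eval {β : Type} {A : Type*} [Ring A] [Algebra ℂ A] [Star A]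
    (v : β → A) : StarPoly β → A
  | .var b => v b
  | .one => 1
  | .add p q => p.eval v + q.eval v
  | .mul p q => p.eval v * q.eval v
  | .adj p => star (p.eval v)
  | .smul c p => c • p.eval v

/-! ## Matrices -/

/-- `n × n` complex matrices, `n ≥ 1`; the norm is the operator norm. -/
abbrev Mat (n : ℕ+) : Type := Matrix (Fin n) (Fin n) ℂ

/-- The Borel (= entrywise product) sigma-algebra on matrices. -/
noncomputable instance instMeasurableSpaceMat (n : ℕ+) : MeasurableSpace (Mat n) :=
  MeasurableSpace.pi

instance instBorelSpaceMat (n : ℕ+) : BorelSpace (Mat n) :=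
  inferInstanceAs (BorelSpace (Fin n → Fin n → ℂ))

instance instSecondCountableMat (n : ℕ+) : SecondCountableTopology (Mat n) :=
  inferInstanceAs (SecondCountableTopology (Fin n → Fin n → ℂ))

/-- The normalized trace `tr_n`. -/
noncomputable def normTr {n : ℕ+} (X : Mat n) : ℂ := X.trace / (n : ℂ)

/-- The squared normalized Hilbert-Schmidt norm `tr_n (X* X)`. -/
noncomputable def hsSq {n : ℕ+} (X : Mat n) : ℝ := (normTr (star X * X)).re

/-- The cutoff `F_R (t) = min (max t (-R)) R`. -/
noncomputable def cutoff (R t : ℝ) : ℝ := min (max t (-R)) R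

/-- Truncation of a matrix: `F_R` is applied to the operator real and imaginary parts by
functional calculus. -/
noncomputable def truncMat {n : ℕ+} (R : ℝ) (X : Mat n) : Mat n :=
  cfc (cutoff R) (opRe X) + Complex.I • cfc (cutoff R) (opIm X)

lemma isSelfAdjoint_opRe {n : ℕ+} (X : Mat n) : IsSelfAdjoint (opRe X) := by
  simp only [opRe, isSelfAdjoint_iff, star_smul, star_add, star_star]
  rw [add_comm]; congr 1; simp

lemma isSelfAdjoint_opIm {n : ℕ+} (X : Mat n) : IsSelfAdjoint (opIm X) := by
  simp only [opIm, isSelfAdjoint_iff, star_smul, star_sub, star_star]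
  rw [← neg_sub X (star X), smul_neg, ← neg_smul]; congr 1; simp

lemma continuous_cutoff (R : ℝ) : Continuous (cutoff R) := by unfold cutoff; fun_prop

lemma continuous_truncMat {n : ℕ+} (R : ℝ) : Continuous (truncMat R : Mat n → Mat n) := by
  have h1 : Continuous (opRe : Mat n → Mat n) := by unfold opRe; fun_prop
  have h2 : Continuous (opIm : Mat n → Mat n) := by unfold opIm; fun_prop
  have hc := (continuous_cutoff R).continuousOn (s := Set.univ)
  exact (Continuous.cfc_of_mem_nhdsSet (cutoff R) (s := Set.univ) (by simp) h1
      (fun X => isSelfAdjoint_opRe X) hc).add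
    ((Continuous.cfc_of_mem_nhdsSet (cutoff R) (s := Set.univ) (by simp) h2
      (fun X => isSelfAdjoint_opIm X) hc).const_smul Complex.I)

lemma norm_truncMat_le {n : ℕ+} {R : ℝ} (hR : 0 ≤ R) (X : Mat n) : ‖truncMat R X‖ ≤ 2 * R := by
  have h : ∀ Y : Mat n, ‖cfc (cutoff R) Y‖ ≤ R := fun Y => by
    refine norm_cfc_le hR fun t _ => ?_
    rw [Real.norm_eq_abs, abs_le]; unfold cutoff
    exact ⟨le_min (le_max_right _ _) (by linarith), min_le_right _ _⟩
  refine (norm_add_le _ _).trans ?_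
  rw [norm_smul, Complex.norm_I, one_mul, two_mul]
  exact add_le_add (h _) (h _)

lemma hsSq_eq {n : ℕ+} (X : Mat n) : hsSq X = (∑ j, ∑ i, ‖X i j‖ ^ 2) / (n : ℝ) := by
  unfold hsSq normTr
  rw [Matrix.trace]
  simp only [Matrix.diag_apply, Matrix.mul_apply, Matrix.star_apply]
  have : (∑ x, ∑ x_1, star (X x_1 x) * X x_1 x : ℂ) = ((∑ j, ∑ i, ‖X i j‖ ^ 2 : ℝ) : ℂ) := by
    push_cast
    refine Finset.sum_congr rfl fun i _ => Finset.sum_congr rfl fun j _ => ?_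
    simpa using Complex.conj_mul' (X j i)
  rw [this]
  norm_cast

lemma hsSq_nonneg {n : ℕ+} (X : Mat n) : 0 ≤ hsSq X := by rw [hsSq_eq]; positivity

lemma ofReal_hsSq {n : ℕ+} (X : Mat n) : ((hsSq X : ℝ) : ℂ) = normTr (star X * X) := by
  unfold hsSq normTr
  rw [Matrix.trace]
  simp only [Matrix.diag_apply, Matrix.mul_apply, Matrix.star_apply]
  have : (∑ x, ∑ x_1, star (X x_1 x) * X x_1 x : ℂ) = ((∑ j, ∑ i, ‖X i j‖ ^ 2 : ℝ) : ℂ) := by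
    push_cast
    refine Finset.sum_congr rfl fun i _ => Finset.sum_congr rfl fun j _ => ?_
    simpa using Complex.conj_mul' (X j i)
  rw [this]
  norm_cast

lemma hsSq_star {n : ℕ+} (X : Mat n) : hsSq (star X) = hsSq X := by
  rw [hsSq_eq, hsSq_eq, Finset.sum_comm]
  simp [Matrix.star_apply]

lemma hsSq_add_le {n : ℕ+} (X Y : Mat n) : hsSq (X + Y) ≤ 2 * hsSq X + 2 * hsSq Y := by
  simp only [hsSq_eq]
  rw [← mul_div_assoc, ← mul_div_assoc, ← add_div]
  gcongr
  rw [Finset.mul_sum, Finset.mul_sum, ← Finset.sum_add_distrib]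
  refine Finset.sum_le_sum fun i _ => ?_
  rw [Finset.mul_sum, Finset.mul_sum, ← Finset.sum_add_distrib]
  refine Finset.sum_le_sum fun j _ => ?_
  have h := norm_add_le (X j i) (Y j i)
  have h0 := norm_nonneg (X j i + Y j i)
  simp only [Matrix.add_apply]
  nlinarith [sq_nonneg (‖X j i‖ - ‖Y j i‖)]

lemma hsSq_mul_le {n : ℕ+} (A X : Mat n) : hsSq (A * X) ≤ ‖A‖ ^ 2 * hsSq X := by
  simp only [hsSq_eq]
  rw [← mul_div_assoc]
  gcongr
  rw [Finset.mul_sum]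
  refine Finset.sum_le_sum fun j _ => ?_
  have h := A.l2_opNorm_mulVec (WithLp.toLp 2 (fun i => X i j))
  have h2 := pow_le_pow_left₀ (norm_nonneg _) h 2
  rw [mul_pow, EuclideanSpace.norm_sq_eq, EuclideanSpace.norm_sq_eq] at h2
  simpa [Matrix.mulVec, dotProduct, Matrix.mul_apply] using h2

lemma hsSq_mul_le' {n : ℕ+} (X A : Mat n) : hsSq (X * A) ≤ ‖A‖ ^ 2 * hsSq X := by
  rw [← hsSq_star, star_mul]
  refine (hsSq_mul_le _ _).trans ?_
  rw [hsSq_star, norm_star]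

lemma hsSq_le {n : ℕ+} (X : Mat n) : hsSq X ≤ ‖X‖ ^ 2 := by
  have h := hsSq_mul_le X 1
  have h1 : hsSq (1 : Mat n) = 1 := by simp [hsSq, normTr]
  rwa [mul_one, h1, mul_one] at h

lemma norm_normTr_sq_le {n : ℕ+} (X : Mat n) : ‖normTr X‖ ^ 2 ≤ hsSq X := by
  have hn : (0 : ℝ) < (n : ℝ) := by exact_mod_cast n.pos
  rw [hsSq_eq, normTr, norm_div, Complex.norm_natCast, div_pow, Matrix.trace,
    div_le_div_iff₀ (by positivity) hn]
  have h1 : ‖∑ i, X.diag i‖ ^ 2 ≤ n * ∑ i, ‖X i i‖ ^ 2 := by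
    refine (pow_le_pow_left₀ (norm_nonneg _) (norm_sum_le _ _) 2).trans ?_
    simpa using sq_sum_le_card_mul_sum_sq (s := Finset.univ) (f := fun i => ‖X i i‖)
  have h2 : ∑ i, ‖X i i‖ ^ 2 ≤ ∑ j, ∑ i, ‖X i j‖ ^ 2 :=
    Finset.sum_le_sum fun j _ =>
      Finset.single_le_sum (f := fun i => ‖X i j‖ ^ 2) (fun i _ => by positivity)
        (Finset.mem_univ j)
  nlinarith

lemma continuous_normTr {n : ℕ+} : Continuous (normTr : Mat n → ℂ) := by
  unfold normTr; fun_prop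

lemma continuous_hsSq {n : ℕ+} : Continuous (hsSq : Mat n → ℝ) := by
  unfold hsSq
  exact Complex.continuous_re.comp (continuous_normTr.comp (by fun_prop))

/-! ## The random matrix ultraproduct -/

/-- Sequences `(X_n)` of random matrices `X_n : Ω → M_n` that are uniformly bounded in operator
norm, as a star-algebra: bounded sequences in `∏ₙ L^∞(Ω) ⊗ M_n` (through representatives that are
bounded everywhere). -/
noncomputable def boundedSeq (Ω : Type*) [MeasurableSpace Ω] :
    StarSubalgebra ℂ (∀ n : ℕ+, Ω → Mat n) where
  carrier := {X | (∀ n, Measurable (X n)) ∧ ∃ C : ℝ, ∀ n ω, ‖X n ω‖ ≤ C}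
  mul_mem' := by
    rintro X Y ⟨hX, C, hC⟩ ⟨hY, D, hD⟩
    refine ⟨fun n => (hX n).mul (hY n), C * D, fun n ω => ?_⟩
    exact (norm_mul_le _ _).trans (mul_le_mul (hC n ω) (hD n ω) (norm_nonneg _)
      ((norm_nonneg _).trans (hC n ω)))
  add_mem' := by
    rintro X Y ⟨hX, C, hC⟩ ⟨hY, D, hD⟩
    exact ⟨fun n => (hX n).add (hY n), C + D, fun n ω =>
      (norm_add_le _ _).trans (add_le_add (hC n ω) (hD n ω))⟩
  algebraMap_mem' := fun c => ⟨fun n => measurable_const, ‖c‖, fun n ω => by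
    simp only [Pi.algebraMap_apply]
    rw [Algebra.algebraMap_eq_smul_one, norm_smul]
    simp⟩
  star_mem' := by
    rintro X ⟨hX, C, hC⟩
    exact ⟨fun n => continuous_star.measurable.comp (hX n), C, fun n ω => by
      simpa using hC n ω⟩

/-- The star-algebra of bounded sequences of random matrices. -/
abbrev RMSeq (Ω : Type*) [MeasurableSpace Ω] : Type _ := ↥(boundedSeq Ω)

section Ultraproduct

variable {Ω : Type*} [mΩ : MeasurableSpace Ω]

lemma RMSeq.measurable (X : RMSeq Ω) (n : ℕ+) : Measurable (X.1 n) := X.2.1 n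

lemma RMSeq.exists_bound (X : RMSeq Ω) : ∃ C : ℝ, 0 ≤ C ∧ ∀ n ω, ‖X.1 n ω‖ ≤ C := by
  obtain ⟨C, hC⟩ := X.2.2
  exact ⟨max C 0, le_max_right _ _, fun n ω => (hC n ω).trans (le_max_left _ _)⟩

lemma RMSeq.integrable_hsSq (P : Measure Ω) [IsFiniteMeasure P] (X : RMSeq Ω) (n : ℕ+) :
    Integrable (fun ω => hsSq (X.1 n ω)) P := by
  obtain ⟨C, hC0, hC⟩ := X.exists_bound
  refine Integrable.of_bound (C := C ^ 2)
    (continuous_hsSq.measurable.comp (X.measurable n)).aestronglyMeasurable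
    (Eventually.of_forall fun ω => ?_)
  rw [Real.norm_of_nonneg (hsSq_nonneg _)]
  exact (hsSq_le _).trans (pow_le_pow_left₀ (norm_nonneg _) (hC n ω) 2)

/-- The squared `L²`-norm of the `n`-th entry with respect to the trace `𝔼 ⊗ tr_n`. -/
noncomputable def l2Sq (P : Measure Ω) (X : RMSeq Ω) (n : ℕ+) : ℝ := ∫ ω, hsSq (X.1 n ω) ∂P

lemma l2Sq_nonneg (P : Measure Ω) (X : RMSeq Ω) (n : ℕ+) : 0 ≤ l2Sq P X n :=
  integral_nonneg fun _ => hsSq_nonneg _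

lemma tendsto_l2Sq_of_le {P : Measure Ω} [IsFiniteMeasure P] {U : Filter ℕ+} {X Y : RMSeq Ω}
    {C : ℝ} (h : ∀ n ω, hsSq (X.1 n ω) ≤ C * hsSq (Y.1 n ω))
    (hY : Tendsto (l2Sq P Y) U (𝓝 0)) : Tendsto (l2Sq P X) U (𝓝 0) := by
  refine squeeze_zero (l2Sq_nonneg P X) (fun n => ?_) (by simpa using hY.const_mul C)
  unfold l2Sq
  rw [← integral_const_mul]
  exact integral_mono (X.integrable_hsSq P n) ((Y.integrable_hsSq P n).const_mul C) (h n)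

lemma tendsto_l2Sq_add {P : Measure Ω} [IsFiniteMeasure P] {U : Filter ℕ+} {X Y : RMSeq Ω}
    (hX : Tendsto (l2Sq P X) U (𝓝 0)) (hY : Tendsto (l2Sq P Y) U (𝓝 0)) :
    Tendsto (l2Sq P (X + Y)) U (𝓝 0) := by
  refine squeeze_zero (l2Sq_nonneg P _) (fun n => ?_)
    (by simpa using (hX.const_mul 2).add (hY.const_mul 2))
  unfold l2Sq
  rw [← integral_const_mul, ← integral_const_mul, ← integral_add
    ((X.integrable_hsSq P n).const_mul 2) ((Y.integrable_hsSq P n).const_mul 2)]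
  exact integral_mono ((X + Y).integrable_hsSq P n)
    (((X.integrable_hsSq P n).const_mul 2).add ((Y.integrable_hsSq P n).const_mul 2))
    fun ω => hsSq_add_le _ _

/-- The ideal `I_U` of bounded sequences whose `L²`-norm tends to `0` along `U`. -/
noncomputable def nullIdeal (P : Measure Ω) [IsFiniteMeasure P] (U : Filter ℕ+) :
    Ideal (RMSeq Ω) where
  carrier := {X | Tendsto (l2Sq P X) U (𝓝 0)}
  zero_mem' := by
    have : l2Sq P (0 : RMSeq Ω) = fun _ => 0 := by
      funext n; simp [l2Sq, hsSq, normTr]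
    change Tendsto _ U _
    rw [this]; exact tendsto_const_nhds
  add_mem' := fun hX hY => tendsto_l2Sq_add hX hY
  smul_mem' := by
    intro A X hX
    obtain ⟨C, hC0, hC⟩ := A.exists_bound
    refine tendsto_l2Sq_of_le (C := C ^ 2) (fun n ω => ?_) hX
    refine (hsSq_mul_le _ _).trans ?_
    exact mul_le_mul_of_nonneg_right (pow_le_pow_left₀ (norm_nonneg _) (hC n ω) 2)
      (hsSq_nonneg _)

variable (P : Measure Ω) [IsFiniteMeasure P] (U : Filter ℕ+)

lemma mem_nullIdeal {X : RMSeq Ω} : X ∈ nullIdeal P U ↔ Tendsto (l2Sq P X) U (𝓝 0) := Iff.rfl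

instance nullIdeal_isTwoSided : (nullIdeal P U).IsTwoSided where
  mul_mem_of_left := by
    intro X A hX
    obtain ⟨C, hC0, hC⟩ := A.exists_bound
    refine tendsto_l2Sq_of_le (C := C ^ 2) (fun n ω => ?_) hX
    refine (hsSq_mul_le' _ _).trans ?_
    exact mul_le_mul_of_nonneg_right (pow_le_pow_left₀ (norm_nonneg _) (hC n ω) 2)
      (hsSq_nonneg _)

lemma star_mem_nullIdeal {X : RMSeq Ω} (hX : X ∈ nullIdeal P U) : star X ∈ nullIdeal P U :=
  tendsto_l2Sq_of_le (C := 1) (fun n ω => by rw [one_mul]; exact (hsSq_star _).le) hX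

/-- The random matrix ultraproduct `M = ∏_{n → U} L^∞(Ω) ⊗ M_n`. -/
def RMUltraproduct : Type _ := RMSeq Ω ⧸ nullIdeal P U

noncomputable instance instRingUltraproduct : Ring (RMUltraproduct P U) :=
  inferInstanceAs (Ring (RMSeq Ω ⧸ nullIdeal P U))

noncomputable instance instAlgebraUltraproduct : Algebra ℂ (RMUltraproduct P U) :=
  inferInstanceAs (Algebra ℂ (RMSeq Ω ⧸ nullIdeal P U))

/-- The class `[X_n]` of a bounded sequence in the ultraproduct. -/
noncomputable def ultraMk : RMSeq Ω →ₐ[ℂ] RMUltraproduct P U :=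
  Ideal.Quotient.mkₐ ℂ (nullIdeal P U)

lemma ultraMk_surjective : Function.Surjective (ultraMk P U) :=
  Ideal.Quotient.mk_surjective

variable {P U} in
lemma ultraMk_eq_iff {X Y : RMSeq Ω} : ultraMk P U X = ultraMk P U Y ↔ X - Y ∈ nullIdeal P U :=
  Ideal.Quotient.eq

noncomputable instance instStarUltraproduct : Star (RMUltraproduct P U) where
  star := Quotient.map' star fun X Y h => by
    rw [Submodule.quotientRel_def] at h ⊢
    have e : star X - star Y = star (X - Y) := Subtype.ext (star_sub X.1 Y.1).symm
    rw [e]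
    exact star_mem_nullIdeal P U h

lemma star_ultraMk (X : RMSeq Ω) : star (ultraMk P U X) = ultraMk P U (star X) := rfl

/-- Sequences of bounded scalar random variables. -/
def IsBddScalar (f : ℕ+ → Ω → ℂ) : Prop :=
  (∀ n, Measurable (f n)) ∧ ∃ C : ℝ, ∀ n ω, ‖f n ω‖ ≤ C

/-- A bounded sequence of scalar random variables, as a sequence of scalar random matrices. -/
noncomputable def scalarSeq (f : ℕ+ → Ω → ℂ) (hf : IsBddScalar f) : RMSeq Ω :=
  ⟨fun n ω => f n ω • (1 : Mat n), fun n => (hf.1 n).smul_const _, by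
    obtain ⟨C, hC⟩ := hf.2
    exact ⟨C, fun n ω => by rw [norm_smul, norm_one, mul_one]; exact hC n ω⟩⟩

lemma scalarSeq_mem_center (f : ℕ+ → Ω → ℂ) (hf : IsBddScalar f) :
    ultraMk P U (scalarSeq f hf) ∈ Subalgebra.center ℂ (RMUltraproduct P U) := by
  rw [Subalgebra.mem_center_iff]
  intro y
  obtain ⟨Y, rfl⟩ := ultraMk_surjective P U y
  rw [← map_mul, ← map_mul]
  congr 1
  refine Subtype.ext ?_
  funext n ω
  simp [scalarSeq]

/-- The class of a bounded sequence of scalar random variables, in the centre of the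
ultraproduct. -/
noncomputable def scalarCenter (f : ℕ+ → Ω → ℂ) (hf : IsBddScalar f) :
    Subalgebra.center ℂ (RMUltraproduct P U) :=
  ⟨ultraMk P U (scalarSeq f hf), scalarSeq_mem_center P U f hf⟩

lemma isBddScalar_normTr (X : RMSeq Ω) : IsBddScalar (fun n ω => normTr (X.1 n ω)) := by
  obtain ⟨C, hC0, hC⟩ := X.exists_bound
  exact ⟨fun n => continuous_normTr.measurable.comp (X.measurable n), C, fun n ω =>
    (abs_le_of_sq_le_sq' ((norm_normTr_sq_le _).trans ((hsSq_le _).trans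
      (pow_le_pow_left₀ (norm_nonneg _) (hC n ω) 2))) hC0).2⟩

lemma isBddScalar_hsSq (X : RMSeq Ω) : IsBddScalar (fun n ω => (hsSq (X.1 n ω) : ℂ)) := by
  simp only [ofReal_hsSq]
  exact isBddScalar_normTr (star X * X)

/-- The center-valued trace `E : M → Z(M)`, `[X_n] ↦ [tr_n (X_n)]`. -/
noncomputable def centerTrace (x : RMUltraproduct P U) :
    Subalgebra.center ℂ (RMUltraproduct P U) :=
  Quotient.liftOn' x (fun X => scalarCenter P U _ (isBddScalar_normTr X)) fun X Y h => by
    rw [Submodule.quotientRel_def] at h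
    refine Subtype.ext ?_
    refine ultraMk_eq_iff.2 ?_
    refine tendsto_l2Sq_of_le (C := 1) (fun n ω => ?_) h
    have e : (scalarSeq _ (isBddScalar_normTr X) - scalarSeq _ (isBddScalar_normTr Y) :
        RMSeq Ω).1 n ω = normTr ((X - Y : RMSeq Ω).1 n ω) • (1 : Mat n) := by
      change normTr (X.1 n ω) • (1 : Mat n) - normTr (Y.1 n ω) • (1 : Mat n) =
        normTr (X.1 n ω - Y.1 n ω) • (1 : Mat n)
      rw [← sub_smul]
      simp [normTr, sub_div]
    rw [e, one_mul]
    refine le_trans (le_of_eq ?_) (norm_normTr_sq_le _)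
    generalize normTr ((X - Y : RMSeq Ω).1 n ω) = c
    rw [hsSq, star_smul, star_one, smul_mul_smul_comm, one_mul]
    simp only [normTr, Matrix.trace_smul, Matrix.trace_one, Fintype.card_fin, smul_eq_mul]
    rw [mul_div_assoc, div_self (by exact_mod_cast n.ne_zero), mul_one]
    have := Complex.conj_mul' c
    simp only [RCLike.star_def, this]
    norm_cast

lemma centerTrace_ultraMk (X : RMSeq Ω) :
    centerTrace P U (ultraMk P U X) = scalarCenter P U _ (isBddScalar_normTr X) := rfl

/-! ## The quotient by a character of the centre -/

variable {P U} (V : Subalgebra.center ℂ (RMUltraproduct P U) →ₐ[ℂ] ℂ)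

lemma char_add {f g h : ℕ+ → Ω → ℂ} (hf : IsBddScalar f) (hg : IsBddScalar g)
    (hh : IsBddScalar h) (e : ∀ n ω, f n ω + g n ω = h n ω) :
    V (scalarCenter P U f hf) + V (scalarCenter P U g hg) = V (scalarCenter P U h hh) := by
  rw [← map_add]
  congr 1
  refine Subtype.ext ?_
  change ultraMk P U _ + ultraMk P U _ = ultraMk P U _
  rw [← map_add]
  congr 1
  refine Subtype.ext ?_
  funext n ω
  change f n ω • (1 : Mat n) + g n ω • (1 : Mat n) = h n ω • (1 : Mat n)
  rw [← add_smul, e]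

lemma char_mul {f g h : ℕ+ → Ω → ℂ} (hf : IsBddScalar f) (hg : IsBddScalar g)
    (hh : IsBddScalar h) (e : ∀ n ω, f n ω * g n ω = h n ω) :
    V (scalarCenter P U f hf) * V (scalarCenter P U g hg) = V (scalarCenter P U h hh) := by
  rw [← map_mul]
  congr 1
  refine Subtype.ext ?_
  change ultraMk P U _ * ultraMk P U _ = ultraMk P U _
  rw [← map_mul]
  congr 1
  refine Subtype.ext ?_
  funext n ω
  change f n ω • (1 : Mat n) * g n ω • (1 : Mat n) = h n ω • (1 : Mat n)
  rw [smul_mul_smul_comm, one_mul, e]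

lemma isBddScalar_const (c : ℂ) : IsBddScalar (fun (_ : ℕ+) (_ : Ω) => c) :=
  ⟨fun _ => measurable_const, ‖c‖, fun _ _ => le_rfl⟩

lemma char_const (c : ℂ) : V (scalarCenter P U _ (isBddScalar_const c)) = c := by
  have : scalarCenter P U _ (isBddScalar_const c) =
      algebraMap ℂ (Subalgebra.center ℂ (RMUltraproduct P U)) c := by
    refine Subtype.ext ?_
    change ultraMk P U _ = algebraMap ℂ (RMUltraproduct P U) c
    rw [Algebra.algebraMap_eq_smul_one]
    rfl
  rw [this, AlgHom.commutes]
  rfl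

lemma char_real_im {g : ℕ+ → Ω → ℝ} (hg : IsBddScalar (fun n ω => (g n ω : ℂ))) :
    (V (scalarCenter P U _ hg)).im = 0 := by
  by_contra him
  set c := V (scalarCenter P U _ hg) with hc
  have hne : ∀ n ω, |c.im| ≤ ‖(g n ω : ℂ) - c‖ := fun n ω => by
    simpa using Complex.abs_im_le_norm ((g n ω : ℂ) - c)
  have hpos : 0 < |c.im| := abs_pos.2 him
  have h1 : IsBddScalar (fun n ω => ((g n ω : ℂ) - c)⁻¹) :=
    ⟨fun n => ((hg.1 n).sub_const c).inv, |c.im|⁻¹, fun n ω => by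
      rw [norm_inv]; exact inv_anti₀ hpos (hne n ω)⟩
  have h2 : IsBddScalar (fun n ω => (g n ω : ℂ) - c) := by
    obtain ⟨C, hC⟩ := hg.2
    exact ⟨fun n => (hg.1 n).sub_const c, C + ‖c‖, fun n ω =>
      (norm_sub_le _ _).trans (by gcongr; exact hC n ω)⟩
  have e1 := char_add V h2 (isBddScalar_const c) hg (fun n ω => by simp)
  have e2 := char_mul V h2 h1 (isBddScalar_const 1) (fun n ω => by
    refine mul_inv_cancel₀ fun h0 => ?_
    have := hne n ω
    rw [h0, norm_zero] at this
    linarith)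
  rw [char_const] at e1 e2
  have : V (scalarCenter P U _ h2) = 0 := by
    rw [← hc] at e1; linear_combination e1
  rw [this, zero_mul] at e2
  exact zero_ne_one e2

lemma char_nonneg {g : ℕ+ → Ω → ℝ} (hg : IsBddScalar (fun n ω => (g n ω : ℂ)))
    (h0 : ∀ n ω, 0 ≤ g n ω) : 0 ≤ (V (scalarCenter P U _ hg)).re := by
  have hs : IsBddScalar (fun n ω => ((Real.sqrt (g n ω) : ℝ) : ℂ)) := by
    obtain ⟨C, hC⟩ := hg.2
    refine ⟨fun n => ?_, Real.sqrt C, fun n ω => ?_⟩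
    · exact Complex.measurable_ofReal.comp (Real.continuous_sqrt.measurable.comp
        (by simpa [Function.comp_def] using Complex.measurable_re.comp (hg.1 n)))
    · rw [Complex.norm_real, Real.norm_of_nonneg (Real.sqrt_nonneg _)]
      refine Real.sqrt_le_sqrt ?_
      simpa [abs_of_nonneg (h0 n ω)] using hC n ω
  have e := char_mul V hs hs hg (fun n ω => by
    rw [← Complex.ofReal_mul, Real.mul_self_sqrt (h0 n ω)])
  rw [← e, Complex.mul_re, char_real_im V hs]
  nlinarith [sq_nonneg (V (scalarCenter P U _ hs)).re]

lemma char_mono {f g : ℕ+ → Ω → ℝ} (hf : IsBddScalar (fun n ω => (f n ω : ℂ)))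
    (hg : IsBddScalar (fun n ω => (g n ω : ℂ))) (h : ∀ n ω, f n ω ≤ g n ω) :
    (V (scalarCenter P U _ hf)).re ≤ (V (scalarCenter P U _ hg)).re := by
  have hd : IsBddScalar (fun n ω => ((g n ω - f n ω : ℝ) : ℂ)) := by
    obtain ⟨C, hC⟩ := hf.2
    obtain ⟨D, hD⟩ := hg.2
    refine ⟨fun n => by simpa [Pi.sub_def] using (hg.1 n).sub (hf.1 n), D + C, fun n ω => ?_⟩
    push_cast
    exact (norm_sub_le _ _).trans (add_le_add (hD n ω) (hC n ω))
  have e := char_add V hf hd hg (fun n ω => by push_cast; ring)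
  have p := char_nonneg V hd (fun n ω => sub_nonneg.2 (h n ω))
  rw [← e, Complex.add_re]
  linarith

/-- The value of the character on the class of `[tr_n (X_n* X_n)]`. -/
noncomputable def charSq (X : RMSeq Ω) : ℝ := (V (scalarCenter P U _ (isBddScalar_hsSq X))).re

lemma charSq_nonneg (X : RMSeq Ω) : 0 ≤ charSq V X := char_nonneg V _ fun _ _ => hsSq_nonneg _

lemma char_centerTrace_star_mul (X : RMSeq Ω) :
    V (centerTrace P U (star (ultraMk P U X) * ultraMk P U X)) = charSq V X := by
  have e : centerTrace P U (star (ultraMk P U X) * ultraMk P U X) =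
      scalarCenter P U _ (isBddScalar_hsSq X) := by
    rw [star_ultraMk, ← map_mul, centerTrace_ultraMk]
    refine Subtype.ext ?_
    change ultraMk P U _ = ultraMk P U _
    congr 1
    refine Subtype.ext ?_
    funext n ω
    change normTr (star (X.1 n ω) * X.1 n ω) • (1 : Mat n) = _
    rw [← ofReal_hsSq]
    rfl
  rw [e, charSq]
  apply Complex.ext
  · simp
  · simpa using char_real_im V (isBddScalar_hsSq X)

lemma char_const_mul (c : ℂ) {f h : ℕ+ → Ω → ℂ} (hf : IsBddScalar f) (hh : IsBddScalar h)
    (e : ∀ n ω, c * f n ω = h n ω) :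
    c * V (scalarCenter P U f hf) = V (scalarCenter P U h hh) := by
  rw [← char_mul V (isBddScalar_const c) hf hh e, char_const]

lemma IsBddScalar.const_mul {f : ℕ+ → Ω → ℂ} (hf : IsBddScalar f) (c : ℂ) :
    IsBddScalar (fun n ω => c * f n ω) := by
  obtain ⟨C, hC⟩ := hf.2
  exact ⟨fun n => (hf.1 n).const_mul c, ‖c‖ * C, fun n ω => by
    rw [norm_mul]; gcongr; exact hC n ω⟩

lemma charSq_le_of_le {X Y : RMSeq Ω} {C : ℝ}
    (h : ∀ n ω, hsSq (X.1 n ω) ≤ C * hsSq (Y.1 n ω)) : charSq V X ≤ C * charSq V Y := by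
  have hb : IsBddScalar (fun n ω => ((C * hsSq (Y.1 n ω) : ℝ) : ℂ)) := by
    simpa using (isBddScalar_hsSq Y).const_mul (C : ℂ)
  have h1 := char_mono V (isBddScalar_hsSq X) hb h
  have h2 := char_const_mul V (C : ℂ) (isBddScalar_hsSq Y) hb (fun n ω => by push_cast; rfl)
  rw [← h2, Complex.re_ofReal_mul] at h1
  exact h1

lemma charSq_eq_zero_of_le {X Y : RMSeq Ω} {C : ℝ}
    (h : ∀ n ω, hsSq (X.1 n ω) ≤ C * hsSq (Y.1 n ω)) (hY : charSq V Y = 0) :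
    charSq V X = 0 := by
  have := charSq_le_of_le V h
  rw [hY, mul_zero] at this
  exact le_antisymm this (charSq_nonneg V X)

lemma charSq_add_le (X Y : RMSeq Ω) :
    charSq V (X + Y) ≤ 2 * charSq V X + 2 * charSq V Y := by
  have b1 : IsBddScalar (fun n ω => ((2 * hsSq (X.1 n ω) : ℝ) : ℂ)) := by
    simpa using (isBddScalar_hsSq X).const_mul (2 : ℂ)
  have b2 : IsBddScalar (fun n ω => ((2 * hsSq (Y.1 n ω) : ℝ) : ℂ)) := by
    simpa using (isBddScalar_hsSq Y).const_mul (2 : ℂ)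
  have b3 : IsBddScalar (fun n ω => ((2 * hsSq (X.1 n ω) + 2 * hsSq (Y.1 n ω) : ℝ) : ℂ)) := by
    obtain ⟨C, hC⟩ := b1.2
    obtain ⟨D, hD⟩ := b2.2
    refine ⟨fun n => by simpa [Pi.add_def] using (b1.1 n).add (b2.1 n), C + D, fun n ω => ?_⟩
    dsimp only
    rw [Complex.ofReal_add]
    exact (norm_add_le _ _).trans (add_le_add (hC n ω) (hD n ω))
  have h := char_mono V (isBddScalar_hsSq (X + Y)) b3 (fun n ω => hsSq_add_le _ _)
  have e := char_add V b1 b2 b3 (fun n ω => by push_cast; rfl)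
  have e1 := char_const_mul V (2 : ℂ) (isBddScalar_hsSq X) b1 (fun n ω => by push_cast; rfl)
  have e2 := char_const_mul V (2 : ℂ) (isBddScalar_hsSq Y) b2 (fun n ω => by push_cast; rfl)
  rw [← e, ← e1, ← e2] at h
  simpa [charSq] using h

lemma char_centerTrace_eq_zero_iff (X : RMSeq Ω) :
    V (centerTrace P U (star (ultraMk P U X) * ultraMk P U X)) = 0 ↔ charSq V X = 0 := by
  rw [char_centerTrace_star_mul, Complex.ofReal_eq_zero]

lemma charSq_zero : charSq V (0 : RMSeq Ω) = 0 := by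
  have h := charSq_le_of_le V (X := (0 : RMSeq Ω)) (Y := 0) (C := 0) (fun n ω => by
    simp [hsSq, normTr])
  rw [zero_mul] at h
  exact le_antisymm h (charSq_nonneg V 0)

lemma charSq_add {X Y : RMSeq Ω} (hX : charSq V X = 0) (hY : charSq V Y = 0) :
    charSq V (X + Y) = 0 := by
  have h := charSq_add_le V X Y
  rw [hX, hY] at h
  exact le_antisymm (by linarith) (charSq_nonneg V _)

lemma charSq_mul_left (A : RMSeq Ω) {X : RMSeq Ω} (hX : charSq V X = 0) :
    charSq V (A * X) = 0 := by
  obtain ⟨C, hC0, hC⟩ := A.exists_bound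
  refine charSq_eq_zero_of_le V (C := C ^ 2) (fun n ω => ?_) hX
  refine (hsSq_mul_le _ _).trans ?_
  exact mul_le_mul_of_nonneg_right (pow_le_pow_left₀ (norm_nonneg _) (hC n ω) 2)
    (hsSq_nonneg _)

/-- The ideal `I_{E,V} = {x : V (E (x* x)) = 0}` of the ultraproduct. -/
noncomputable def ultrafiberIdeal : Ideal (RMUltraproduct P U) where
  carrier := {x | V (centerTrace P U (star x * x)) = 0}
  zero_mem' := by
    have h := (char_centerTrace_eq_zero_iff V 0).2 (charSq_zero V)
    rw [map_zero] at h
    exact h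
  add_mem' := by
    intro x y hx hy
    obtain ⟨X, rfl⟩ := ultraMk_surjective P U x
    obtain ⟨Y, rfl⟩ := ultraMk_surjective P U y
    have h := (char_centerTrace_eq_zero_iff V (X + Y)).2 (charSq_add V
      ((char_centerTrace_eq_zero_iff V X).1 hx) ((char_centerTrace_eq_zero_iff V Y).1 hy))
    rw [map_add] at h
    exact h
  smul_mem' := by
    intro a x hx
    obtain ⟨A, rfl⟩ := ultraMk_surjective P U a
    obtain ⟨X, rfl⟩ := ultraMk_surjective P U x
    have h := (char_centerTrace_eq_zero_iff V (A * X)).2 (charSq_mul_left V A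
      ((char_centerTrace_eq_zero_iff V X).1 hx))
    rw [map_mul] at h
    exact h

lemma ultraMk_mem_ultrafiberIdeal {X : RMSeq Ω} :
    ultraMk P U X ∈ ultrafiberIdeal V ↔ charSq V X = 0 :=
  char_centerTrace_eq_zero_iff V X

instance ultrafiberIdeal_isTwoSided : (ultrafiberIdeal V).IsTwoSided where
  mul_mem_of_left := by
    intro x a hx
    obtain ⟨A, rfl⟩ := ultraMk_surjective P U a
    obtain ⟨X, rfl⟩ := ultraMk_surjective P U x
    rw [← map_mul]
    rw [ultraMk_mem_ultrafiberIdeal] at hx ⊢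
    obtain ⟨C, hC0, hC⟩ := A.exists_bound
    refine charSq_eq_zero_of_le V (C := C ^ 2) (fun n ω => ?_) hx
    refine (hsSq_mul_le' _ _).trans ?_
    exact mul_le_mul_of_nonneg_right (pow_le_pow_left₀ (norm_nonneg _) (hC n ω) 2)
      (hsSq_nonneg _)

lemma star_mem_ultrafiberIdeal {x : RMUltraproduct P U} (hx : x ∈ ultrafiberIdeal V) :
    star x ∈ ultrafiberIdeal V := by
  obtain ⟨X, rfl⟩ := ultraMk_surjective P U x
  rw [star_ultraMk]
  rw [ultraMk_mem_ultrafiberIdeal] at hx ⊢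
  exact charSq_eq_zero_of_le V (C := 1)
    (fun n ω => by rw [one_mul]; exact (hsSq_star _).le) hx

/-- The quotient `Q = M / I_{E,V}` of the random matrix ultraproduct. -/
def RMQuotient : Type _ := RMUltraproduct P U ⧸ ultrafiberIdeal V

noncomputable instance instRingQuotient : Ring (RMQuotient V) :=
  Ideal.Quotient.ring (ultrafiberIdeal V)

noncomputable instance instAlgebraQuotient : Algebra ℂ (RMQuotient V) :=
  Ideal.Quotient.algebra ℂ (I := ultrafiberIdeal V)

/-- The quotient map `π : M → Q`. -/
noncomputable def quotMk : RMUltraproduct P U →ₐ[ℂ] RMQuotient V :=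
  Ideal.Quotient.mkₐ ℂ (ultrafiberIdeal V)

lemma quotMk_surjective : Function.Surjective (quotMk V) :=
  Ideal.Quotient.mk_surjective

lemma quotMk_eq_iff {x y : RMUltraproduct P U} :
    quotMk V x = quotMk V y ↔ x - y ∈ ultrafiberIdeal V :=
  Ideal.Quotient.eq

noncomputable instance instStarQuotient : Star (RMQuotient V) where
  star := Quotient.map' star fun x y h => by
    rw [Submodule.quotientRel_def] at h ⊢
    have e : star x - star y = star (x - y) := by
      obtain ⟨X, rfl⟩ := ultraMk_surjective P U x
      obtain ⟨Y, rfl⟩ := ultraMk_surjective P U y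
      rw [← map_sub, star_ultraMk, star_ultraMk, star_ultraMk, ← map_sub]
      congr 1
      exact Subtype.ext (star_sub X.1 Y.1).symm
    rw [e]
    exact star_mem_ultrafiberIdeal V h

lemma star_quotMk (x : RMUltraproduct P U) : star (quotMk V x) = quotMk V (star x) := rfl

lemma char_trace_eq_of_sub_mem {x y : RMUltraproduct P U} (h : x - y ∈ ultrafiberIdeal V) :
    V (centerTrace P U x) = V (centerTrace P U y) := by
  obtain ⟨X, rfl⟩ := ultraMk_surjective P U x
  obtain ⟨Y, rfl⟩ := ultraMk_surjective P U y
  rw [← map_sub, ultraMk_mem_ultrafiberIdeal] at h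
  rw [centerTrace_ultraMk, centerTrace_ultraMk]
  have hd := isBddScalar_normTr (X - Y)
  have e := char_add V (isBddScalar_normTr Y) hd (isBddScalar_normTr X) (fun n ω => by
    change normTr (Y.1 n ω) + normTr (X.1 n ω - Y.1 n ω) = normTr (X.1 n ω)
    simp [normTr, sub_div])
  have hz : V (scalarCenter P U _ hd) = 0 := by
    set f := fun n ω => normTr ((X - Y : RMSeq Ω).1 n ω) with hf
    have hre : IsBddScalar (fun n ω => (((f n ω).re : ℝ) : ℂ)) := by
      obtain ⟨C, hC⟩ := hd.2
      refine ⟨fun n => Complex.measurable_ofReal.comp (Complex.measurable_re.comp (hd.1 n)), C,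
        fun n ω => ?_⟩
      rw [Complex.norm_real]
      exact (Complex.abs_re_le_norm _).trans (hC n ω)
    have him : IsBddScalar (fun n ω => (((f n ω).im : ℝ) : ℂ)) := by
      obtain ⟨C, hC⟩ := hd.2
      refine ⟨fun n => Complex.measurable_ofReal.comp (Complex.measurable_im.comp (hd.1 n)), C,
        fun n ω => ?_⟩
      rw [Complex.norm_real]
      exact (Complex.abs_im_le_norm _).trans (hC n ω)
    have key : ∀ {g : ℕ+ → Ω → ℝ} (hg : IsBddScalar (fun n ω => (g n ω : ℂ))),
        (∀ n ω, |g n ω| ≤ ‖f n ω‖) → V (scalarCenter P U _ hg) = 0 := by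
      intro g hg hle
      have hsq : IsBddScalar (fun n ω => ((g n ω ^ 2 : ℝ) : ℂ)) := by
        obtain ⟨C, hC⟩ := hg.2
        refine ⟨fun n => by simpa using (hg.1 n).pow_const 2, C ^ 2, fun n ω => ?_⟩
        push_cast
        rw [norm_pow]
        exact pow_le_pow_left₀ (norm_nonneg _) (hC n ω) 2
      have e1 := char_mul V hg hg hsq (fun n ω => by push_cast; ring)
      have e2 := char_mono V hsq (isBddScalar_hsSq (X - Y)) (fun n ω => by
        refine le_trans ?_ (norm_normTr_sq_le _)
        rw [← sq_abs]
        exact pow_le_pow_left₀ (abs_nonneg _) (hle n ω) 2)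
      have e3 := char_real_im V hg
      change _ ≤ charSq V (X - Y) at e2
      rw [h, ← e1, Complex.mul_re, e3] at e2
      apply Complex.ext
      · have : (V (scalarCenter P U _ hg)).re ^ 2 ≤ 0 := by nlinarith
        simpa using pow_eq_zero_iff (two_ne_zero) |>.1 (le_antisymm this (sq_nonneg _))
      · simpa using e3
    have k1 := key hre fun n ω => Complex.abs_re_le_norm _
    have k2 := key him fun n ω => Complex.abs_im_le_norm _
    have him' := him.const_mul Complex.I
    have e4 := char_const_mul V Complex.I him him' (fun n ω => rfl)
    have e5 := char_add V hre him' hd (fun n ω => by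
      rw [mul_comm]; exact Complex.re_add_im (f n ω))
    rw [← e5, ← e4, k1, k2]
    simp
  rw [← e, hz, add_zero]

/-- The trace `τ_{E,V}` of the quotient, induced by `V ∘ E`. -/
noncomputable def quotTrace (x : RMQuotient V) : ℂ :=
  Quotient.liftOn' x (fun y => V (centerTrace P U y)) fun x y h => by
    rw [Submodule.quotientRel_def] at h
    exact char_trace_eq_of_sub_mem V h

lemma quotTrace_quotMk (x : RMUltraproduct P U) :
    quotTrace V (quotMk V x) = V (centerTrace P U x) := rfl

end Ultraproduct


/-! ## Filtered structures, chronological formulas and types -/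

/-- The data of a structure in the language of filtered tracial algebras with a process: a trace,
the domains `D_{t,r}` (operator-norm balls at time `t`), and the increments `z_{s,t,j}`. -/
structure ProcStructure (A : Type*) where
  tr : A → ℂ
  dom : ℝ≥0 → ℝ → Set A
  z : ℝ≥0 → ℝ≥0 → ℕ → A

namespace ProcStructure

variable {A : Type*}

/-- The set of elements at time `t`: the union of the domains `D_{t,r}`, `r > 0`. -/
def level (S : ProcStructure A) (t : ℝ≥0) : Set A := {x | ∃ r : ℝ, 0 < r ∧ x ∈ S.dom t r}

/-- The structure with all times moved by `t₀`. Evaluating a formula in the shifted structure is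
the same as evaluating the shifted formula in the original structure. -/
def shift (S : ProcStructure A) (t₀ : ℝ≥0) : ProcStructure A where
  tr := S.tr
  dom t r := S.dom (t₀ + t) r
  z s t j := S.z (t₀ + s) (t₀ + t) j

/-- The `L²`-distance of the trace. -/
noncomputable def dist [Ring A] [Star A] (S : ProcStructure A) (x y : A) : ℝ :=
  Real.sqrt (S.tr (star (x - y) * (x - y))).re

/-- The `L²`-distance of finite tuples. -/
noncomputable def tupleDist [Ring A] [Star A] (S : ProcStructure A) {m : ℕ} (x y : Fin m → A) :
    ℝ :=
  Real.sqrt (∑ j, (S.tr (star (x j - y j) * (x j - y j))).re)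

end ProcStructure

/-- The constant symbols `z_{s,t,j}`, `s ≤ t`. -/
structure ZConst : Type where
  s : ℝ≥0
  t : ℝ≥0
  hst : s ≤ t
  j : ℕ

/-- Chronological formulas: `ChronFormula t α` is the set `F_chron (t)` of formulas with free
variables indexed by `α`, in which quantifiers over `D_{s,r}` are outside quantifiers over
`D_{t,r'}` for `s < t`. Basic formulas are the real and imaginary parts of the trace of a term, and
the distance of two terms. In `sup` and `inf`, the bound variable is `none : Option α`. -/
inductive ChronFormula : ℝ≥0 → Type → Type 1
  | reTr {t : ℝ≥0} {α : Type} (p : StarPoly (α ⊕ ZConst)) : ChronFormula t α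
  | imTr {t : ℝ≥0} {α : Type} (p : StarPoly (α ⊕ ZConst)) : ChronFormula t α
  | dist {t : ℝ≥0} {α : Type} (p q : StarPoly (α ⊕ ZConst)) : ChronFormula t α
  | conn {t : ℝ≥0} {α : Type} {k : ℕ} (f : (Fin k → ℝ) → ℝ) (hf : Continuous f)
      (φ : Fin k → ChronFormula t α) : ChronFormula t α
  | sup {s t : ℝ≥0} {α : Type} (hst : s ≤ t) (r : ℝ) (hr : 0 < r)
      (φ : ChronFormula t (Option α)) : ChronFormula s α
  | inf {s t : ℝ≥0} {α : Type} (hst : s ≤ t) (r : ℝ) (hr : 0 < r)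
      (φ : ChronFormula t (Option α)) : ChronFormula s α

section Formulas

variable {A : Type*} [Ring A] [Algebra ℂ A] [Star A]

/-- Evaluation of a term in variables `α` and the constant symbols. -/
noncomputable def termValue (S : ProcStructure A) {α : Type} (x : α → A)
    (p : StarPoly (α ⊕ ZConst)) : A :=
  p.eval (Sum.elim x fun c => S.z c.s c.t c.j)

/-- Evaluation of a chronological formula. -/
noncomputable def ChronFormula.eval (S : ProcStructure A) :
    {t : ℝ≥0} → {α : Type} → ChronFormula t α → (α → A) → ℝ
  | _, _, .reTr p, x => (S.tr (termValue S x p)).re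
  | _, _, .imTr p, x => (S.tr (termValue S x p)).im
  | _, _, .dist p q, x => S.dist (termValue S x p) (termValue S x q)
  | _, _, .conn f _ φ, x => f fun i => (φ i).eval S x
  | s, _, .sup _ r _ φ, x => ⨆ y : S.dom s r, φ.eval S (fun o => o.elim (y : A) x)
  | s, _, .inf _ r _ φ, x => ⨅ y : S.dom s r, φ.eval S (fun o => o.elim (y : A) x)

/-- Chronological types: assignments of a real number to each chronological formula. -/
abbrev ChronType (α : Type) : Type 1 := (Σ t : ℝ≥0, ChronFormula t α) → ℝ

/-- The chronological type of a tuple. -/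
noncomputable def tpChron (S : ProcStructure A) {α : Type} (x : α → A) : ChronType α :=
  fun φ => φ.2.eval S x

/-- The space of chronological types over `y` of tuples `x` with `x_j` in `D_{0,r_j}`. -/
def typeSpace (S : ProcStructure A) {m : ℕ} {κ : Type} (r : Fin m → ℝ) (y : κ → A) :
    Set (ChronType (Fin m ⊕ κ)) :=
  {μ | ∃ x : Fin m → A, (∀ j, x j ∈ S.dom 0 (r j)) ∧ tpChron S (Sum.elim x y) = μ}

/-- `(x₀, x₁)` is a coupling over `y` of the types `μ₀` and `μ₁`, at time `0`. -/
def IsCoupling (S : ProcStructure A) {m : ℕ} {κ : Type} (y : κ → A)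
    (μ₀ μ₁ : ChronType (Fin m ⊕ κ)) (x₀ x₁ : Fin m → A) : Prop :=
  (∀ j, x₀ j ∈ S.level 0) ∧ (∀ j, x₁ j ∈ S.level 0) ∧
    tpChron S (Sum.elim x₀ y) = μ₀ ∧ tpChron S (Sum.elim x₁ y) = μ₁

/-- The Wasserstein distance of chronological types over `y`. -/
noncomputable def wassersteinDist (S : ProcStructure A) {m : ℕ} {κ : Type} (y : κ → A)
    (μ₀ μ₁ : ChronType (Fin m ⊕ κ)) : ℝ :=
  sInf {d | ∃ x₀ x₁ : Fin m → A, IsCoupling S y μ₀ μ₁ x₀ x₁ ∧ d = S.tupleDist x₀ x₁}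

/-- Optimal couplings: couplings which achieve the infimum in the Wasserstein distance. -/
def IsOptimalCoupling (S : ProcStructure A) {m : ℕ} {κ : Type} (y : κ → A)
    (μ₀ μ₁ : ChronType (Fin m ⊕ κ)) (x₀ x₁ : Fin m → A) : Prop :=
  IsCoupling S y μ₀ μ₁ x₀ x₁ ∧ S.tupleDist x₀ x₁ = wassersteinDist S y μ₀ μ₁

end Formulas

/-! ## Restricted chronological formulas -/

/-- Restricted chronological formulas with free variables indexed by `α`. Basic formulas are
`Re tr (p ((Re x_a + i)⁻¹, (Im x_a + i)⁻¹ : a ∈ α))`, where `p` is a star-polynomial in variables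
`inl a` (for the first) and `inr a` (for the second family of arguments); connectives are Lipschitz;
quantifiers are over `D_{0,r}`; and `brownian t₀ φ` is the formula
`(S_{t₀} φ) (x, z_{0,t₀})`, where the shift `S_{t₀}` adds `t₀` to all times in `φ`. -/
inductive RFormula : Type → Type 1
  | basic {α : Type} (p : StarPoly (α ⊕ α)) : RFormula α
  | conn {α : Type} {k : ℕ} (f : (Fin k → ℝ) → ℝ) (hf : ∃ K, LipschitzWith K f)
      (φ : Fin k → RFormula α) : RFormula α
  | sup {α : Type} (r : ℝ) (hr : 0 < r) (φ : RFormula (Option α)) : RFormula α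
  | inf {α : Type} (r : ℝ) (hr : 0 < r) (φ : RFormula (Option α)) : RFormula α
  | brownian {α : Type} (t₀ : ℝ≥0) (ht₀ : 0 < t₀) (φ : RFormula (α ⊕ ℕ)) : RFormula α

/-- The resolvents `(Re x_a + i)⁻¹` and `(Im x_a + i)⁻¹` of a tuple. -/
noncomputable def resolvents {A : Type*} [Ring A] [Algebra ℂ A] [Star A] {α : Type} (x : α → A) :
    α ⊕ α → A :=
  Sum.elim (fun a => resolventI (opRe (x a))) (fun a => resolventI (opIm (x a)))

/-- Evaluation of a restricted chronological formula in a structure. -/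
noncomputable def RFormula.eval {A : Type*} [Ring A] [Algebra ℂ A] [Star A] :
    {α : Type} → RFormula α → ProcStructure A → (α → A) → ℝ
  | _, .basic p, S, x => (S.tr (p.eval (resolvents x))).re
  | _, .conn f _ φ, S, x => f fun i => (φ i).eval S x
  | _, .sup r _ φ, S, x => ⨆ y : S.dom 0 r, φ.eval S (fun o => o.elim (y : A) x)
  | _, .inf r _ φ, S, x => ⨅ y : S.dom 0 r, φ.eval S (fun o => o.elim (y : A) x)
  | _, .brownian t₀ _ φ, S, x => φ.eval (S.shift t₀) (Sum.elim x (S.z 0 t₀))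

/-! ## Matrix Brownian motion and the random matrix structures -/

/-- The truncation radius `3 √(t - s)`. -/
noncomputable def truncRadius (s t : ℝ≥0) : ℝ := 3 * Real.sqrt ((t : ℝ) - s)

/-- `Z_{t,j}`, `j ∈ ℕ`, is a sequence of independent Brownian motions on the complex matrices `M_n`
(their operator real and imaginary parts are independent GUE Brownian motions), compatible with the
filtration `𝓖`: it is adapted, the real and imaginary parts of the entries of the increments
`Z_{t,j} - Z_{s,j}` are independent centred Gaussian variables of variance `(t - s) / n`, and the
increments are independent of `𝓖 s`. -/
structure IsMatrixBM {Ω : Type*} [mΩ : MeasurableSpace Ω] (P : Measure Ω) (𝓖 : Filtration ℝ≥0 mΩ)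
    (n : ℕ+) (Z : ℝ≥0 → ℕ → Ω → Mat n) : Prop where
  adapted : ∀ t j, Measurable[𝓖 t] (Z t j)
  law : ∀ s t : ℝ≥0, s < t → ∀ (j : ℕ) (a b : Fin n),
    P.map (fun ω => (Z t j ω a b - Z s j ω a b).re) = gaussianReal 0 ((t - s) / n) ∧
    P.map (fun ω => (Z t j ω a b - Z s j ω a b).im) = gaussianReal 0 ((t - s) / n)
  indep_entries : ∀ s t : ℝ≥0, s < t →
    iIndepFun (fun (i : (ℕ × Fin n × Fin n) ⊕ (ℕ × Fin n × Fin n)) (ω : Ω) =>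
      Sum.elim (fun e => (Z t e.1 ω e.2.1 e.2.2 - Z s e.1 ω e.2.1 e.2.2).re)
        (fun e => (Z t e.1 ω e.2.1 e.2.2 - Z s e.1 ω e.2.1 e.2.2).im) i) P
  indep_past : ∀ s t : ℝ≥0, s < t →
    Indep (MeasurableSpace.comap (fun ω (j : ℕ) => Z t j ω - Z s j ω) MeasurableSpace.pi) (𝓖 s) P

section RandomMatrices

variable {Ω : Type*} [mΩ : MeasurableSpace Ω] {P : Measure Ω} {𝓖 : Filtration ℝ≥0 mΩ}

lemma IsMatrixBM.measurable {n : ℕ+} {Z : ℝ≥0 → ℕ → Ω → Mat n} (hZ : IsMatrixBM P 𝓖 n Z)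
    (t : ℝ≥0) (j : ℕ) : Measurable (Z t j) :=
  (hZ.adapted t j).mono (𝓖.le t) le_rfl

/-- The bounded sequence `F_{3 √(t-s)} (Z_{t,j} - Z_{s,j})`, `n ≥ 1`. -/
noncomputable def truncIncrement {Z : ∀ n : ℕ+, ℝ≥0 → ℕ → Ω → Mat n}
    (hZ : ∀ n, IsMatrixBM P 𝓖 n (Z n)) (s t : ℝ≥0) (j : ℕ) : RMSeq Ω :=
  ⟨fun n ω => truncMat (truncRadius s t) (Z n t j ω - Z n s j ω),
    fun n => (continuous_truncMat _).measurable.comp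
      (((hZ n).measurable t j).sub ((hZ n).measurable s j)),
    2 * truncRadius s t, fun n ω => norm_truncMat_le (by unfold truncRadius; positivity) _⟩

/-- The structure `𝒬` on the quotient `Q = M / I_{E,V}`: `Q_t = π (M_t)`, where `M_t` consists of
the classes of bounded sequences of `𝓖 t`-measurable random matrices; the domain `D_{t,r}` is the
image of the sequences with operator norms at most `r` (that is, the ball of radius `r` of `Q_t`);
`z_{s,t,j}` is the class of the truncated increments of the Brownian motions. -/
noncomputable def quotStructure [IsFiniteMeasure P] {U : Filter ℕ+}
    (V : Subalgebra.center ℂ (RMUltraproduct P U) →ₐ[ℂ] ℂ)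
    {Z : ∀ n : ℕ+, ℝ≥0 → ℕ → Ω → Mat n} (hZ : ∀ n, IsMatrixBM P 𝓖 n (Z n)) :
    ProcStructure (RMQuotient V) where
  tr := quotTrace V
  dom t r := {q | ∃ X : RMSeq Ω, (∀ n, Measurable[𝓖 t] (X.1 n)) ∧ (∀ n ω, ‖X.1 n ω‖ ≤ r) ∧
    quotMk V (ultraMk P U X) = q}
  z s t j := quotMk V (ultraMk P U (truncIncrement hZ s t j))

/-- The functions `Λ_φ` on matrix tuples associated with restricted chronological formulas: basic
formulas are evaluated with the normalized trace, quantifiers range over operator norm balls of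
`M_n`, and the Brownian motion (after truncation) is averaged out. -/
noncomputable def RFormula.Lam (P : Measure Ω) {n : ℕ+} (Z : ℝ≥0 → ℕ → Ω → Mat n) :
    {α : Type} → RFormula α → (α → Mat n) → ℝ
  | _, .basic p, X => (normTr (p.eval (resolvents X))).re
  | _, .conn f _ φ, X => f fun i => (φ i).Lam P Z X
  | _, .sup r _ φ, X => ⨆ Y : {Y : Mat n // ‖Y‖ ≤ r}, φ.Lam P Z (fun o => o.elim (Y : Mat n) X)
  | _, .inf r _ φ, X => ⨅ Y : {Y : Mat n // ‖Y‖ ≤ r}, φ.Lam P Z (fun o => o.elim (Y : Mat n) X)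
  | _, .brownian t₀ _ φ, X => ∫ ω, φ.Lam P Z
      (Sum.elim X fun j => truncMat (truncRadius 0 t₀) (Z t₀ j ω - Z 0 j ω)) ∂P

end RandomMatrices

/-! ## Classical optimal couplings of random matrix tuples -/

/-- The quadratic cost `∫ ∑_j ‖X_j - Y_j‖₂² dγ (X, Y)` for the normalized Hilbert-Schmidt norm. -/
noncomputable def transportCost {n : ℕ+} {m : ℕ}
    (γ : Measure ((Fin m → Mat n) × (Fin m → Mat n))) : ℝ≥0∞ :=
  ∫⁻ p, ENNReal.ofReal (∑ j, hsSq (p.1 j - p.2 j)) ∂γ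

/-- The joint law of two random tuples is an optimal coupling, for the classical `L²`-Wasserstein
distance, of their laws. -/
def IsClassicalOptimalCoupling {Ω : Type*} [MeasurableSpace Ω] (P : Measure Ω) {n : ℕ+} {m : ℕ}
    (X Y : Ω → Fin m → Mat n) : Prop :=
  ∀ γ : Measure ((Fin m → Mat n) × (Fin m → Mat n)),
    γ.map Prod.fst = P.map X → γ.map Prod.snd = P.map Y →
      transportCost (P.map fun ω => (X ω, Y ω)) ≤ transportCost γ

/-- The index set of a tuple of length `m' ∈ ℕ ∪ {∞}`. -/
abbrev TupleIndex (m' : ℕ∞) : Type := {j : ℕ // (j : ℕ∞) < m'}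

end ChronOT

open ChronOT

/-! Types determine norms, so an optimal coupling of types is one that maximizes the inner product
⟨x₀, x₁⟩. The heart of the matter is the rigidity of displacement interpolation. Let x_t = (1-t) x₀
+ t x₁ with 0 < t < 1, and let y have the type of x_t over y₀ and satisfy ⟨x₀, y⟩ ≥ ⟨x₀, x_t⟩.
Choose a such that (a, y) has the type of (x₀, x_t) over y₀, and solve y = (1-t) a + t b. Then b has
the type of x₁, so ⟨x₀, b⟩ ≤ ⟨x₀, x₁⟩ by optimality. This forces ⟨x₀, a⟩ ≥ ⟨x₀, x₀⟩, and since ‖a‖ =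
‖x₀‖, a = x₀. Hence y has the right joint type with x₀ (`resEq_of_optimal`). The weight 1-t > 0 is
essential: at t = 1 nothing controls a. The end point is therefore reached only through t → 1 and a
diagonal choice (`exists_transport`).

On matrices, F(x) maximizes ⟨x, y⟩ - g(y) over a fine finite net, where g is K times the deviation
of the type of y over Y₀ from that of x_t, measured on the first K formulas of a dense sequence.
Whatever g is, completing the square exhibits a Kantorovich potential, so the map is classically
optimal for every n (`exists_optimal_map`). Matrices with nearly the right type and nearly the right
inner product with X₀ exist with probability tending to 1. If K tends to infinity slowly, F(X₀)
therefore acquires the type of x_t over Y₀ in the limit, with inner product at least ⟨x₀, x_t⟩.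
Every ultrafilter limit of the joint formulas is realized by an adapted tuple in Q, and rigidity
identifies it (`hasLims_of_penalized`).

The dictionary between Q and matrices is as follows. Resolvents are contractions, so the functions Λ
are bounded and Lipschitz for the normalized Hilbert-Schmidt norm, uniformly in n. The character of
the centre yields a filter on ℕ+ × Ω (`charFilter`) along which bounded random scalars converge to
their values. The value of a restricted formula in Q is the limit of Λ along this filter
(`eval_eq_ev`). Quantifiers are handled by measurable near-optimizers on finite nets. The Brownian
rule is handled by concentration: Λ is an O(1/n)-Lipschitz function of a standard Gaussian vector
(`exists_concentration`), and the Poincaré inequality follows by rotating two independent copies.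
Truncation at 3√τ is harmless because the even GUE moments are bounded by Catalan numbers times τᵏ
up to O(n⁻²), and 3 exceeds the semicircle edge 2; so truncated increments are additive in Q.

Two facts about types complete the argument. An infimum of a restricted formula over balls is a
restricted formula, so approximate existence statements transfer between families with equal limits
(`eventually_exists_close`). With a countable dense set of formulas this becomes saturation by
adapted tuples (`exists_adapted_realization`). A back-and-forth argument then shows that restricted
formulas determine chronological types at time 0 (`tpChron_eq_of_resEq`), so optimality among
chronological types applies to tuples compared by restricted formulas only. -/

set_option linter.unusedSectionVars false

namespace ChronOT

/-! ## The normalized Hilbert-Schmidt norm -/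

/-- The normalized Hilbert-Schmidt norm. -/
noncomputable def hsN {n : ℕ+} (X : Mat n) : ℝ := Real.sqrt (hsSq X)

/-- The real part of the normalized Hilbert-Schmidt inner product. -/
noncomputable def hsIn {n : ℕ+} (X Y : Mat n) : ℝ := (normTr (star X * Y)).re

section Norm

variable {n : ℕ+}

lemma hsN_nonneg (X : Mat n) : 0 ≤ hsN X := Real.sqrt_nonneg _

lemma hsN_sq (X : Mat n) : hsN X ^ 2 = hsSq X := Real.sq_sqrt (hsSq_nonneg X)

lemma continuous_hsN : Continuous (hsN : Mat n → ℝ) := Real.continuous_sqrt.comp continuous_hsSq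

lemma normTr_add (X Y : Mat n) : normTr (X + Y) = normTr X + normTr Y := by
  simp [normTr, add_div]

lemma normTr_sub (X Y : Mat n) : normTr (X - Y) = normTr X - normTr Y := by
  simp [normTr, sub_div]

lemma normTr_smul (c : ℂ) (X : Mat n) : normTr (c • X) = c * normTr X := by
  simp [normTr, mul_div_assoc]

lemma normTr_mul_comm (X Y : Mat n) : normTr (X * Y) = normTr (Y * X) := by
  rw [normTr, Matrix.trace_mul_comm, normTr]

lemma normTr_star (X : Mat n) : normTr (star X) = star (normTr X) := by
  simp [normTr, Matrix.star_eq_conjTranspose, Matrix.trace_conjTranspose]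

lemma normTr_one : normTr (1 : Mat n) = 1 := by
  simp [normTr]

lemma norm_normTr_le (X : Mat n) : ‖normTr X‖ ≤ hsN X :=
  Real.le_sqrt_of_sq_le (norm_normTr_sq_le X)

lemma hsIn_self (X : Mat n) : hsIn X X = hsSq X := rfl

lemma hsIn_add_right (X Y Z : Mat n) : hsIn X (Y + Z) = hsIn X Y + hsIn X Z := by
  simp [hsIn, mul_add, normTr_add]

lemma hsIn_sub_right (X Y Z : Mat n) : hsIn X (Y - Z) = hsIn X Y - hsIn X Z := by
  simp [hsIn, mul_sub, normTr_sub]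

lemma hsIn_smul_right (c : ℝ) (X Y : Mat n) : hsIn X ((c : ℂ) • Y) = c * hsIn X Y := by
  rw [hsIn, mul_smul_comm, normTr_smul, Complex.re_ofReal_mul, hsIn]

lemma hsIn_comm (X Y : Mat n) : hsIn X Y = hsIn Y X := by
  have : star X * Y = star (star Y * X) := by simp
  rw [hsIn, this, normTr_star, hsIn]; simp

lemma hsIn_sub_left (X Y Z : Mat n) : hsIn (X - Y) Z = hsIn X Z - hsIn Y Z := by
  rw [hsIn_comm, hsIn_sub_right, hsIn_comm, hsIn_comm Z Y]

lemma hsSq_sub (X Y : Mat n) : hsSq (X - Y) = hsSq X + hsSq Y - 2 * hsIn X Y := by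
  rw [← hsIn_self, hsIn_sub_right, hsIn_sub_left, hsIn_sub_left, hsIn_self, hsIn_self,
    hsIn_comm Y X]; ring

lemma hsSq_add (X Y : Mat n) : hsSq (X + Y) = hsSq X + hsSq Y + 2 * hsIn X Y := by
  have h := hsIn_add_right (X + Y) X Y
  rw [hsIn_self, hsIn_comm _ X, hsIn_comm _ Y, hsIn_add_right, hsIn_add_right, hsIn_self,
    hsIn_self, hsIn_comm Y X] at h
  linarith

lemma hsSq_smul (c : ℂ) (X : Mat n) : hsSq (c • X) = ‖c‖ ^ 2 * hsSq X := by
  simp only [hsSq_eq, Matrix.smul_apply, norm_smul, mul_pow, ← Finset.mul_sum, mul_div_assoc]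

/-- The quadratic polynomial t ↦ `hsSq (X + t Y)` is nonnegative, so its discriminant is
nonpositive. -/
lemma abs_hsIn_le (X Y : Mat n) : |hsIn X Y| ≤ hsN X * hsN Y := by
  have h : ∀ t : ℝ, 0 ≤ hsSq Y * (t * t) + (2 * hsIn X Y) * t + hsSq X := fun t => by
    have := hsSq_nonneg (X + (t : ℂ) • Y)
    rw [hsSq_add, hsSq_smul, hsIn_smul_right, Complex.norm_real, Real.norm_eq_abs, sq_abs] at this
    linarith
  have := discrim_le_zero h
  rw [discrim] at this
  rw [hsN, hsN, ← Real.sqrt_mul (hsSq_nonneg X)]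
  exact Real.le_sqrt_of_sq_le (by rw [sq_abs]; linarith)

lemma hsN_add_le (X Y : Mat n) : hsN (X + Y) ≤ hsN X + hsN Y := by
  refine Real.sqrt_le_iff.2 ⟨add_nonneg (hsN_nonneg _) (hsN_nonneg _), ?_⟩
  rw [hsSq_add, add_sq, hsN_sq, hsN_sq]
  linarith [(abs_le.1 (abs_hsIn_le X Y)).2]

lemma hsN_smul (c : ℂ) (X : Mat n) : hsN (c • X) = ‖c‖ * hsN X := by
  rw [hsN, hsSq_smul, Real.sqrt_mul (by positivity), Real.sqrt_sq (norm_nonneg _), hsN]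

lemma hsN_zero : hsN (0 : Mat n) = 0 := by
  have := hsN_smul (n := n) 0 0
  simpa using this

lemma hsN_neg (X : Mat n) : hsN (-X) = hsN X := by
  have := hsN_smul (-1) X
  simpa using this

lemma hsN_sub_comm (X Y : Mat n) : hsN (X - Y) = hsN (Y - X) := by
  rw [← hsN_neg, neg_sub]

lemma hsN_sub_le (X Y : Mat n) : hsN (X - Y) ≤ hsN X + hsN Y := by
  rw [sub_eq_add_neg, ← hsN_neg Y]; exact hsN_add_le _ _

lemma hsN_mul_le (A X : Mat n) : hsN (A * X) ≤ ‖A‖ * hsN X :=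
  Real.sqrt_le_iff.2 ⟨mul_nonneg (norm_nonneg _) (hsN_nonneg _), by
    rw [mul_pow, hsN_sq]; exact hsSq_mul_le A X⟩

lemma hsN_mul_le' (X A : Mat n) : hsN (X * A) ≤ hsN X * ‖A‖ :=
  Real.sqrt_le_iff.2 ⟨mul_nonneg (hsN_nonneg _) (norm_nonneg _), by
    rw [mul_pow, hsN_sq, mul_comm]; exact hsSq_mul_le' X A⟩

lemma hsN_le_norm (X : Mat n) : hsN X ≤ ‖X‖ :=
  Real.sqrt_le_iff.2 ⟨norm_nonneg _, hsSq_le X⟩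

lemma hsN_star (X : Mat n) : hsN (star X) = hsN X := by rw [hsN, hsSq_star, hsN]

lemma norm_one_mat : ‖(1 : Mat n)‖ = 1 := norm_one

/-! ## Real and imaginary parts, resolvents -/

lemma opRe_sub (X Y : Mat n) : opRe (X - Y) = opRe X - opRe Y := by
  simp only [opRe, star_sub]; rw [← smul_sub]; congr 1; abel

lemma opIm_sub (X Y : Mat n) : opIm (X - Y) = opIm X - opIm Y := by
  simp only [opIm, star_sub]; rw [← smul_sub]; congr 1; abel

lemma hsN_opRe_le (X : Mat n) : hsN (opRe X) ≤ hsN X := by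
  rw [opRe, hsN_smul]
  have := hsN_add_le X (star X)
  rw [hsN_star] at this
  norm_num
  linarith

lemma hsN_opIm_le (X : Mat n) : hsN (opIm X) ≤ hsN X := by
  rw [opIm, hsN_smul]
  have := hsN_sub_le X (star X)
  rw [hsN_star] at this
  simp
  linarith

lemma norm_opRe_le (X : Mat n) : ‖opRe X‖ ≤ ‖X‖ := by
  rw [opRe, norm_smul]
  have := norm_add_le X (star X)
  rw [norm_star] at this
  norm_num
  linarith

lemma norm_opIm_le (X : Mat n) : ‖opIm X‖ ≤ ‖X‖ := by
  rw [opIm, norm_smul]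
  have := norm_sub_le X (star X)
  rw [norm_star] at this
  simp
  linarith

lemma opRe_add_opIm (X : Mat n) : opRe X + Complex.I • opIm X = X := by
  simp only [opRe, opIm, smul_smul]
  have : Complex.I * (1 / (2 * Complex.I)) = 1 / 2 := by field_simp
  rw [this, ← smul_add, add_add_sub_cancel, ← two_smul ℂ X, smul_smul]
  norm_num

lemma isUnit_add_I {H : Mat n} (hH : IsSelfAdjoint H) :
    IsUnit (H + algebraMap ℂ (Mat n) Complex.I) := by
  have h : -Complex.I ∉ spectrum ℂ H := fun h => by
    have := hH.im_eq_zero_of_mem_spectrum h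
    simp at this
  rw [spectrum.notMem_iff] at h
  have e : H + algebraMap ℂ (Mat n) Complex.I = -(algebraMap ℂ (Mat n) (-Complex.I) - H) := by
    rw [map_neg]; abel
  rw [e]; exact h.neg

lemma resolventI_mul {H : Mat n} (hH : IsSelfAdjoint H) :
    resolventI H * (H + algebraMap ℂ (Mat n) Complex.I) = 1 :=
  Ring.inverse_mul_cancel _ (isUnit_add_I hH)

lemma mul_resolventI {H : Mat n} (hH : IsSelfAdjoint H) :
    (H + algebraMap ℂ (Mat n) Complex.I) * resolventI H = 1 :=
  Ring.mul_inverse_cancel _ (isUnit_add_I hH)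

lemma resolventI_eq_cfc {H : Mat n} (hH : IsSelfAdjoint H) :
    resolventI H = cfc (fun z : ℂ => (z + Complex.I)⁻¹) H := by
  have hne : ∀ z ∈ spectrum ℂ H, z + Complex.I ≠ 0 := fun z hz h0 => by
    have h1 := hH.im_eq_zero_of_mem_spectrum hz
    have h2 := congrArg Complex.im h0
    simp [h1] at h2
  have hc : ContinuousOn (fun z : ℂ => (z + Complex.I)⁻¹) (spectrum ℂ H) :=
    ContinuousOn.inv₀ (by fun_prop) hne
  have hn : IsStarNormal H := hH.isStarNormal
  have h1 : H + algebraMap ℂ (Mat n) Complex.I = cfc (fun z : ℂ => z + Complex.I) H := by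
    rw [cfc_add_const Complex.I (fun z => z) H, cfc_id' ℂ H]
  have h2 : cfc (fun z : ℂ => (z + Complex.I)⁻¹) H * (H + algebraMap ℂ (Mat n) Complex.I) = 1 := by
    rw [h1, ← cfc_mul _ _ H hc (by fun_prop), ← cfc_one ℂ H]
    exact cfc_congr fun z hz => by
      simp only [Pi.one_apply]; exact inv_mul_cancel₀ (hne z hz)
  calc resolventI H = cfc (fun z : ℂ => (z + Complex.I)⁻¹) H *
        (H + algebraMap ℂ (Mat n) Complex.I) * resolventI H := by rw [h2, one_mul]
    _ = _ := by rw [mul_assoc, mul_resolventI hH, mul_one]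

/-- For real t one has |t + i| ≥ 1. This contraction property makes the bounds on formulas
independent of the size of the matrices. -/
lemma norm_resolventI_le {H : Mat n} (hH : IsSelfAdjoint H) : ‖resolventI H‖ ≤ 1 := by
  rw [resolventI_eq_cfc hH]
  refine norm_cfc_le zero_le_one fun z hz => ?_
  rw [norm_inv]
  refine inv_le_one_of_one_le₀ ?_
  have h1 := hH.im_eq_zero_of_mem_spectrum hz
  have := Complex.abs_im_le_norm (z + Complex.I)
  simpa [h1] using this

/-- The resolvent identity R(H) - R(K) = R(H) (K - H) R(K), with both outer factors contractions. -/
lemma hsN_resolventI_sub_le {H K : Mat n} (hH : IsSelfAdjoint H) (hK : IsSelfAdjoint K) :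
    hsN (resolventI H - resolventI K) ≤ hsN (H - K) := by
  have e : resolventI H - resolventI K = resolventI H * (K - H) * resolventI K := by
    have : K - H = (K + algebraMap ℂ (Mat n) Complex.I) - (H + algebraMap ℂ (Mat n) Complex.I) := by
      abel
    rw [this, mul_sub, sub_mul, resolventI_mul hH, one_mul, mul_assoc, mul_resolventI hK, mul_one]
  rw [e, hsN_sub_comm H K]
  refine (hsN_mul_le' _ _).trans ?_
  refine (mul_le_of_le_one_right (hsN_nonneg _) (norm_resolventI_le hK)).trans ?_
  refine (hsN_mul_le _ _).trans ?_
  exact mul_le_of_le_one_left (hsN_nonneg _) (norm_resolventI_le hH)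

lemma norm_resolvents_le {α : Type} (x : α → Mat n) (b : α ⊕ α) : ‖resolvents x b‖ ≤ 1 := by
  rcases b with a | a
  · exact norm_resolventI_le (isSelfAdjoint_opRe _)
  · exact norm_resolventI_le (isSelfAdjoint_opIm _)

/-- The index of the variable on which a resolvent depends. -/
def resIdx {α : Type} : α ⊕ α → α := Sum.elim id id

lemma hsN_resolvents_sub_le {α : Type} (x y : α → Mat n) (b : α ⊕ α) :
    hsN (resolvents x b - resolvents y b) ≤ hsN (x (resIdx b) - y (resIdx b)) := by
  rcases b with a | a
  · refine (hsN_resolventI_sub_le (isSelfAdjoint_opRe _) (isSelfAdjoint_opRe _)).trans ?_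
    rw [← opRe_sub]; exact hsN_opRe_le _
  · refine (hsN_resolventI_sub_le (isSelfAdjoint_opIm _) (isSelfAdjoint_opIm _)).trans ?_
    rw [← opIm_sub]; exact hsN_opIm_le _

/-! ## The truncation is Lipschitz -/

/-- With c and d the square roots of the two positive matrices, traciality turns tr(c² d²) into ‖d
c‖₂². -/
lemma re_normTr_cfc_mul_cfc_nonneg {f g : ℝ → ℝ} (hf : Continuous f) (hg : Continuous g)
    (hf0 : ∀ t, 0 ≤ f t) (hg0 : ∀ t, 0 ≤ g t) (A B : Mat n) :
    0 ≤ (normTr (cfc f A * cfc g B)).re := by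
  have hf' : cfc f A = cfc (fun t => Real.sqrt (f t)) A * cfc (fun t => Real.sqrt (f t)) A := by
    rw [← cfc_mul _ _ A (by fun_prop) (by fun_prop)]
    exact cfc_congr fun t _ => (Real.mul_self_sqrt (hf0 t)).symm
  have hg' : cfc g B = cfc (fun t => Real.sqrt (g t)) B * cfc (fun t => Real.sqrt (g t)) B := by
    rw [← cfc_mul _ _ B (by fun_prop) (by fun_prop)]
    exact cfc_congr fun t _ => (Real.mul_self_sqrt (hg0 t)).symm
  set c := cfc (fun t => Real.sqrt (f t)) A
  set d := cfc (fun t => Real.sqrt (g t)) B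
  have hc : star c = c := (cfc_predicate (R := ℝ) (p := IsSelfAdjoint) _ A)
  have hd : star d = d := (cfc_predicate (R := ℝ) (p := IsSelfAdjoint) _ B)
  have e : normTr (cfc f A * cfc g B) = normTr (star (d * c) * (d * c)) := by
    rw [hf', hg', star_mul, hc, hd, mul_assoc, normTr_mul_comm]
    simp only [mul_assoc]
  rw [e]
  exact hsSq_nonneg (d * c)

/-- The variational inequality for the metric projection onto the convex set of self-adjoint
matrices with spectrum in [-R, R]: the residual makes a nonnegative inner product with the vector
from any point of the set to the projection. -/
lemma hsIn_sub_cutoff_nonneg {R : ℝ} (hR : 0 ≤ R) {A B : Mat n} (hA : IsSelfAdjoint A)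
    (hB : IsSelfAdjoint B) :
    0 ≤ hsIn (A - cfc (cutoff R) A) (cfc (cutoff R) A - cfc (cutoff R) B) := by
  have hcut := continuous_cutoff R
  set f : ℝ → ℝ := fun t => max (t - R) 0 with hf
  set g : ℝ → ℝ := fun t => max (-R - t) 0 with hg
  have hfc : Continuous f := by fun_prop
  have hgc : Continuous g := by fun_prop
  -- The residual is the excess above R minus the deficit below -R; on the support of each, the
  -- cutoff is constant.
  have e1 : A - cfc (cutoff R) A = cfc f A - cfc g A := by
    rw [← cfc_sub f g A]
    conv_lhs => enter [1]; rw [← cfc_id' ℝ A]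
    rw [← cfc_sub (fun t => t) (cutoff R) A]
    refine cfc_congr fun t _ => ?_
    simp only [hf, hg, cutoff]
    rcases le_total t (-R) with h | h <;> rcases le_total t R with h' | h' <;>
      simp [h, h', hR] <;> grind
  have e2 : cfc f A * cfc (cutoff R) A = (R : ℂ) • cfc f A := by
    rw [← cfc_mul _ _ A, Complex.coe_smul, ← cfc_smul R f A]
    refine cfc_congr fun t _ => ?_
    simp only [hf, cutoff, smul_eq_mul]
    rcases le_total t R with h' | h'
    · simp [h']
    · have : -R ≤ t := by linarith
      simp [h', this, mul_comm]
  have e3 : cfc g A * cfc (cutoff R) A = (-R : ℂ) • cfc g A := by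
    have : (-R : ℂ) = ((-R : ℝ) : ℂ) := by simp
    rw [← cfc_mul _ _ A, this, Complex.coe_smul, ← cfc_smul (-R) g A]
    refine cfc_congr fun t _ => ?_
    simp only [hg, cutoff, smul_eq_mul]
    rcases le_total t (-R) with h' | h'
    · have : -R ≤ R := by linarith
      simp [h', this, mul_comm]
    · simp [h']
  have f1 : cfc (fun t => R - cutoff R t) B = (R : ℂ) • (1 : Mat n) - cfc (cutoff R) B := by
    rw [cfc_sub (fun _ => R) (cutoff R) B, cfc_const R B, Algebra.algebraMap_eq_smul_one,
      Complex.coe_smul]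
  have f2 : cfc (fun t => cutoff R t + R) B = (R : ℂ) • (1 : Mat n) + cfc (cutoff R) B := by
    rw [cfc_add_const R (cutoff R) B, Algebra.algebraMap_eq_smul_one, Complex.coe_smul, add_comm]
  have hs : star (cfc f A - cfc g A) = cfc f A - cfc g A := by
    rw [star_sub, (cfc_predicate (R := ℝ) (p := IsSelfAdjoint) f A : star (cfc f A) = _),
      (cfc_predicate (R := ℝ) (p := IsSelfAdjoint) g A : star (cfc g A) = _)]
  have p1 := re_normTr_cfc_mul_cfc_nonneg hfc (g := fun t => R - cutoff R t) (by fun_prop)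
    (fun t => le_max_right _ _) (fun t => sub_nonneg.2 (min_le_right _ _)) A B
  have p2 := re_normTr_cfc_mul_cfc_nonneg hgc (g := fun t => cutoff R t + R) (by fun_prop)
    (fun t => le_max_right _ _) (fun t => by
      have : -R ≤ cutoff R t := le_min (le_max_right _ _) (by linarith)
      linarith) A B
  rw [f1] at p1
  rw [f2] at p2
  have e : (cfc f A - cfc g A) * (cfc (cutoff R) A - cfc (cutoff R) B) =
      cfc f A * ((R : ℂ) • (1 : Mat n) - cfc (cutoff R) B) +
      cfc g A * ((R : ℂ) • (1 : Mat n) + cfc (cutoff R) B) := by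
    rw [sub_mul, mul_sub, mul_sub, e2, e3, mul_sub, mul_add]
    simp only [mul_smul_comm, mul_one, neg_smul]
    abel
  rw [hsIn, e1, hs, e, normTr_add, Complex.add_re]
  linarith

/-- A projection onto a convex set is 1-Lipschitz: add the variational inequalities at the two
points and apply Cauchy-Schwarz. -/
lemma hsN_cfc_cutoff_sub_le {R : ℝ} (hR : 0 ≤ R) {A B : Mat n} (hA : IsSelfAdjoint A)
    (hB : IsSelfAdjoint B) : hsN (cfc (cutoff R) A - cfc (cutoff R) B) ≤ hsN (A - B) := by
  have h1 := hsIn_sub_cutoff_nonneg hR hA hB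
  have h2 := hsIn_sub_cutoff_nonneg hR hB hA
  set a := cfc (cutoff R) A
  set b := cfc (cutoff R) B
  have h3 : hsSq (a - b) ≤ hsIn (A - B) (a - b) := by
    rw [← hsIn_self]
    simp only [hsIn_sub_left, hsIn_sub_right] at h1 h2 ⊢
    linarith
  have h4 := (abs_le.1 (abs_hsIn_le (A - B) (a - b))).2
  rw [← hsN_sq] at h3
  rcases (hsN_nonneg (a - b)).eq_or_lt with h0 | h0
  · rw [← h0]; exact hsN_nonneg _
  · nlinarith

lemma abs_cutoff_sub_le (R R' t : ℝ) : |cutoff R t - cutoff R' t| ≤ |R - R'| := by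
  unfold cutoff
  refine (abs_min_sub_min_le_max _ _ _ _).trans (max_le ?_ le_rfl)
  refine (abs_max_sub_max_le_max _ _ _ _).trans (max_le (by simp) ?_)
  rw [neg_sub_neg, abs_sub_comm]

lemma norm_cfc_cutoff_sub_le (R R' : ℝ) (A : Mat n) :
    ‖cfc (cutoff R) A - cfc (cutoff R') A‖ ≤ |R - R'| := by
  have h1 := continuous_cutoff R
  have h2 := continuous_cutoff R'
  rw [← cfc_sub _ _ A]
  exact norm_cfc_le (abs_nonneg _) fun t _ => abs_cutoff_sub_le R R' t

/-- The radius may vary as well, because a change of the time of an increment also changes its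
truncation radius. -/
lemma hsN_truncMat_sub_le {R R' : ℝ} (hR : 0 ≤ R) (X Y : Mat n) :
    hsN (truncMat R X - truncMat R' Y) ≤ 2 * hsN (X - Y) + 2 * |R - R'| := by
  have key : ∀ A B : Mat n, IsSelfAdjoint A → IsSelfAdjoint B →
      hsN (cfc (cutoff R) A - cfc (cutoff R') B) ≤ hsN (A - B) + |R - R'| := fun A B hA hB => by
    have e : cfc (cutoff R) A - cfc (cutoff R') B =
      (cfc (cutoff R) A - cfc (cutoff R) B) + (cfc (cutoff R) B - cfc (cutoff R') B) := by abel
    rw [e]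
    refine (hsN_add_le _ _).trans (add_le_add (hsN_cfc_cutoff_sub_le hR hA hB) ?_)
    exact (hsN_le_norm _).trans (norm_cfc_cutoff_sub_le _ _ _)
  have k1 := key _ _ (isSelfAdjoint_opRe X) (isSelfAdjoint_opRe Y)
  have k2 := key _ _ (isSelfAdjoint_opIm X) (isSelfAdjoint_opIm Y)
  rw [← opRe_sub] at k1
  rw [← opIm_sub] at k2
  have e : truncMat R X - truncMat R' Y =
      (cfc (cutoff R) (opRe X) - cfc (cutoff R') (opRe Y)) +
      Complex.I • (cfc (cutoff R) (opIm X) - cfc (cutoff R') (opIm Y)) := by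
    simp only [truncMat, smul_sub]; abel
  rw [e]
  refine (hsN_add_le _ _).trans ?_
  rw [hsN_smul, Complex.norm_I, one_mul]
  linarith [hsN_opRe_le (X - Y), hsN_opIm_le (X - Y)]

end Norm

end ChronOT

namespace ChronOT

/-! ## Distances of tuples and estimates for star-polynomials -/

/-- The sum of the Hilbert-Schmidt distances of finitely many entries of two tuples. -/
noncomputable def tD {α : Type} {n : ℕ+} (s : Finset α) (X Y : α → Mat n) : ℝ :=
  ∑ a ∈ s, hsN (X a - Y a)

section Tuples

variable {α β : Type} {n : ℕ+}

lemma tD_nonneg (s : Finset α) (X Y : α → Mat n) : 0 ≤ tD s X Y :=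
  Finset.sum_nonneg fun _ _ => hsN_nonneg _

lemma tD_mono {s t : Finset α} (h : s ⊆ t) (X Y : α → Mat n) : tD s X Y ≤ tD t X Y :=
  Finset.sum_le_sum_of_subset_of_nonneg h fun _ _ _ => hsN_nonneg _

lemma exists_tD_le_add {C₁ C₂ : ℝ} (h₁ : 0 ≤ C₁) (h₂ : 0 ≤ C₂) (s₁ s₂ : Finset α) :
    ∃ s : Finset α, ∀ (n : ℕ+) (X Y : α → Mat n),
      C₁ * tD s₁ X Y + C₂ * tD s₂ X Y ≤ (C₁ + C₂) * tD s X Y := by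
  classical
  refine ⟨s₁ ∪ s₂, fun n X Y => ?_⟩
  rw [add_mul]
  exact add_le_add (mul_le_mul_of_nonneg_left (tD_mono Finset.subset_union_left _ _) h₁)
    (mul_le_mul_of_nonneg_left (tD_mono Finset.subset_union_right _ _) h₂)

lemma tD_option (s : Finset (Option α)) (X Y : Option α → Mat n) :
    tD s X Y ≤ hsN (X none - Y none) +
      tD (Finset.eraseNone s) (fun a => X (some a)) (fun a => Y (some a)) := by
  classical
  have h : s ⊆ Finset.insertNone (Finset.eraseNone s) := by
    intro o ho
    cases o with
    | none => simp
    | some a => simpa using ho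
  refine (tD_mono h X Y).trans (le_of_eq ?_)
  rw [tD, Finset.sum_insertNone, tD]

lemma tD_sum (s : Finset (α ⊕ β)) (X Y : α ⊕ β → Mat n) :
    tD s X Y = tD s.toLeft (fun a => X (.inl a)) (fun a => Y (.inl a)) +
      tD s.toRight (fun a => X (.inr a)) (fun a => Y (.inr a)) := by
  conv_lhs => rw [tD, ← Finset.toLeft_disjSum_toRight (u := s), Finset.sum_disjSum]
  rfl

lemma StarPoly.exists_norm_le (p : StarPoly β) (R : β → ℝ) :
    ∃ B : ℝ, 0 ≤ B ∧ ∀ (n : ℕ+) (v : β → Mat n), (∀ b, ‖v b‖ ≤ R b) → ‖p.eval v‖ ≤ B := by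
  induction p with
  | var b => exact ⟨max (R b) 0, le_max_right _ _, fun n v hv => (hv b).trans (le_max_left _ _)⟩
  | one => exact ⟨1, zero_le_one, fun n v _ => (norm_one_mat).le⟩
  | add p q hp hq =>
    obtain ⟨B, hB, h⟩ := hp
    obtain ⟨D, hD, k⟩ := hq
    exact ⟨B + D, add_nonneg hB hD, fun n v hv =>
      (norm_add_le _ _).trans (add_le_add (h n v hv) (k n v hv))⟩
  | mul p q hp hq =>
    obtain ⟨B, hB, h⟩ := hp
    obtain ⟨D, hD, k⟩ := hq
    exact ⟨B * D, mul_nonneg hB hD, fun n v hv =>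
      (norm_mul_le _ _).trans (mul_le_mul (h n v hv) (k n v hv) (norm_nonneg _) hB)⟩
  | adj p hp =>
    obtain ⟨B, hB, h⟩ := hp
    exact ⟨B, hB, fun n v hv => by rw [StarPoly.eval, norm_star]; exact h n v hv⟩
  | smul c p hp =>
    obtain ⟨B, hB, h⟩ := hp
    exact ⟨‖c‖ * B, by positivity, fun n v hv => by
      rw [StarPoly.eval, norm_smul]; exact mul_le_mul_of_nonneg_left (h n v hv) (norm_nonneg _)⟩

lemma StarPoly.exists_lipschitz (p : StarPoly β) (R : β → ℝ) :
    ∃ (C : ℝ) (s : Finset β), 0 ≤ C ∧ ∀ (n : ℕ+) (v w : β → Mat n), (∀ b, ‖v b‖ ≤ R b) →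
      (∀ b, ‖w b‖ ≤ R b) → hsN (p.eval v - p.eval w) ≤ C * tD s v w := by
  induction p with
  | var b => exact ⟨1, {b}, zero_le_one, fun n v w _ _ => by simp [StarPoly.eval, tD]⟩
  | one => exact ⟨0, ∅, le_rfl, fun n v w _ _ => by simp [StarPoly.eval, hsN_zero]⟩
  | add p q hp hq =>
    obtain ⟨C, s, hC, h⟩ := hp
    obtain ⟨D, t, hD, k⟩ := hq
    obtain ⟨u, hu⟩ := exists_tD_le_add hC hD s t
    refine ⟨C + D, u, add_nonneg hC hD, fun n v w hv hw => le_trans ?_ (hu n v w)⟩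
    have e : (p.add q).eval v - (p.add q).eval w =
      (p.eval v - p.eval w) + (q.eval v - q.eval w) := by simp only [StarPoly.eval]; abel
    rw [e]
    exact (hsN_add_le _ _).trans (add_le_add (h n v w hv hw) (k n v w hv hw))
  | mul p q hp hq =>
    obtain ⟨C, s, hC, h⟩ := hp
    obtain ⟨D, t, hD, k⟩ := hq
    obtain ⟨B₁, hB₁, b₁⟩ := p.exists_norm_le R
    obtain ⟨B₂, hB₂, b₂⟩ := q.exists_norm_le R
    obtain ⟨u, hu⟩ := exists_tD_le_add (mul_nonneg hC hB₂) (mul_nonneg hB₁ hD) s t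
    refine ⟨C * B₂ + B₁ * D, u, by positivity, fun n v w hv hw => le_trans ?_ (hu n v w)⟩
    have e : (p.mul q).eval v - (p.mul q).eval w =
      (p.eval v - p.eval w) * q.eval v + p.eval w * (q.eval v - q.eval w) := by
      simp only [StarPoly.eval]; noncomm_ring
    rw [e]
    refine (hsN_add_le _ _).trans (add_le_add ?_ ?_)
    · refine (hsN_mul_le' _ _).trans ?_
      have := mul_le_mul (h n v w hv hw) (b₂ n v hv) (norm_nonneg _)
        (mul_nonneg hC (tD_nonneg _ _ _))
      linarith
    · refine (hsN_mul_le _ _).trans ?_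
      have := mul_le_mul (b₁ n w hw) (k n v w hv hw) (hsN_nonneg _) hB₁
      linarith
  | adj p hp =>
    obtain ⟨C, s, hC, h⟩ := hp
    exact ⟨C, s, hC, fun n v w hv hw => by
      rw [StarPoly.eval, StarPoly.eval, ← star_sub, hsN_star]; exact h n v w hv hw⟩
  | smul c p hp =>
    obtain ⟨C, s, hC, h⟩ := hp
    exact ⟨‖c‖ * C, s, by positivity, fun n v w hv hw => by
      rw [StarPoly.eval, StarPoly.eval, ← smul_sub, hsN_smul, mul_assoc]
      exact mul_le_mul_of_nonneg_left (h n v w hv hw) (norm_nonneg _)⟩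

/-- Substitution of star-polynomials in a star-polynomial. -/
def StarPoly.bind (g : β → StarPoly α) : StarPoly β → StarPoly α
  | .var b => g b
  | .one => .one
  | .add p q => .add (p.bind g) (q.bind g)
  | .mul p q => .mul (p.bind g) (q.bind g)
  | .adj p => .adj (p.bind g)
  | .smul c p => .smul c (p.bind g)

lemma StarPoly.eval_bind {A : Type*} [Ring A] [Algebra ℂ A] [Star A] (g : β → StarPoly α)
    (p : StarPoly β) (v : α → A) : (p.bind g).eval v = p.eval (fun b => (g b).eval v) := by
  induction p with
  | var b => rfl
  | one => rfl
  | add p q hp hq => simp only [StarPoly.bind, StarPoly.eval, hp, hq]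
  | mul p q hp hq => simp only [StarPoly.bind, StarPoly.eval, hp, hq]
  | adj p hp => simp only [StarPoly.bind, StarPoly.eval, hp]
  | smul c p hp => simp only [StarPoly.bind, StarPoly.eval, hp]

/-! ## Suprema of close functions -/

lemma abs_iSup_sub_iSup_le {ι : Type*} [Nonempty ι] {f g : ι → ℝ} {B d : ℝ}
    (hf : ∀ i, |f i| ≤ B) (hg : ∀ i, |g i| ≤ B) (h : ∀ i, |f i - g i| ≤ d) :
    |(⨆ i, f i) - ⨆ i, g i| ≤ d := by
  have bf : BddAbove (Set.range f) := ⟨B, by rintro _ ⟨i, rfl⟩; exact (abs_le.1 (hf i)).2⟩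
  have bg : BddAbove (Set.range g) := ⟨B, by rintro _ ⟨i, rfl⟩; exact (abs_le.1 (hg i)).2⟩
  rw [abs_le]
  constructor
  · have : (⨆ i, g i) ≤ (⨆ i, f i) + d := ciSup_le fun i => by
      linarith [le_ciSup bf i, (abs_le.1 (h i)).1]
    linarith
  · have : (⨆ i, f i) ≤ (⨆ i, g i) + d := ciSup_le fun i => by
      linarith [le_ciSup bg i, (abs_le.1 (h i)).2]
    linarith

/-- No boundedness is needed, since the infimum of a set of reals is defined by negation, default
values included. -/
lemma iInf_eq_neg_iSup_neg {ι : Type*} (f : ι → ℝ) : (⨅ i, f i) = -⨆ i, -f i := by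
  rw [iInf, Real.sInf_def, iSup]
  congr 2
  ext x
  simp only [Set.mem_neg, Set.mem_range]
  exact exists_congr fun i => ⟨fun h => by rw [h, neg_neg], fun h => by rw [← h, neg_neg]⟩

lemma abs_iInf_sub_iInf_le {ι : Type*} [Nonempty ι] {f g : ι → ℝ} {B d : ℝ}
    (hf : ∀ i, |f i| ≤ B) (hg : ∀ i, |g i| ≤ B) (h : ∀ i, |f i - g i| ≤ d) :
    |(⨅ i, f i) - ⨅ i, g i| ≤ d := by
  rw [iInf_eq_neg_iSup_neg, iInf_eq_neg_iSup_neg, neg_sub_neg, abs_sub_comm]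
  exact abs_iSup_sub_iSup_le (B := B) (by simpa using hf) (by simpa using hg) fun i => by
    rw [neg_sub_neg, abs_sub_comm]; exact h i

lemma abs_iSup_le_of_abs_le {ι : Type*} [Nonempty ι] {f : ι → ℝ} {B : ℝ}
    (hf : ∀ i, |f i| ≤ B) : |⨆ i, f i| ≤ B := by
  have := abs_iSup_sub_iSup_le (g := fun _ : ι => (0 : ℝ)) (d := B) hf
    (fun i => by simpa using (abs_nonneg _).trans (hf i)) (fun i => by simpa using hf i)
  simpa using this

lemma abs_iInf_le_of_abs_le {ι : Type*} [Nonempty ι] {f : ι → ℝ} {B : ℝ}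
    (hf : ∀ i, |f i| ≤ B) : |⨅ i, f i| ≤ B := by
  have := abs_iInf_sub_iInf_le (g := fun _ : ι => (0 : ℝ)) (d := B) hf
    (fun i => by simpa using (abs_nonneg _).trans (hf i)) (fun i => by simpa using hf i)
  simpa using this

lemma nonempty_ball {r : ℝ} (hr : 0 < r) : Nonempty {Y : Mat n // ‖Y‖ ≤ r} :=
  ⟨⟨0, by simpa using hr.le⟩⟩

lemma abs_le_of_lipschitz {k : ℕ} {f : (Fin k → ℝ) → ℝ} {K : ℝ≥0} (hf : LipschitzWith K f)
    {u : Fin k → ℝ} {B : ℝ} (hB : 0 ≤ B) (hu : ∀ i, |u i| ≤ B) : |f u| ≤ |f 0| + K * B := by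
  have h := hf.dist_le_mul u 0
  rw [Real.dist_eq] at h
  have h1 : dist u 0 ≤ B := (dist_pi_le_iff hB).2 fun i => by simpa [Real.dist_eq] using hu i
  have h2 : |f u| ≤ |f 0| + |f u - f 0| := by
    have := abs_add_le (f 0) (f u - f 0)
    simpa using this
  have h3 : (K : ℝ) * dist u 0 ≤ K * B := mul_le_mul_of_nonneg_left h1 K.2
  linarith

/-! ## Boundedness, Lipschitz continuity and measurability of `Λ` -/

/-- A Lipschitz bound in terms of the entries indexed by `s` shows that the function depends on
those entries only, and continuously. Measurability is thus reduced to finitely many variables even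
if `α` is infinite. -/
lemma measurable_of_lipschitz {Ω : Type*} [MeasurableSpace Ω] {f : (α → Mat n) → ℝ} {C : ℝ}
    {s : Finset α} (hf : ∀ X Y, |f X - f Y| ≤ C * tD s X Y) {X : Ω → α → Mat n}
    (hX : ∀ a ∈ s, Measurable fun ω => X ω a) : Measurable fun ω => f (X ω) := by
  classical
  set ext : (s → Mat n) → α → Mat n := fun Y a => if h : a ∈ s then Y ⟨a, h⟩ else 0 with hext
  have e : (fun ω => f (X ω)) = (fun Y => f (ext Y)) ∘ fun ω (a : s) => X ω a := by
    funext ω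
    have := hf (X ω) (ext fun a : s => X ω a)
    have h0 : tD s (X ω) (ext fun a : s => X ω a) = 0 :=
      Finset.sum_eq_zero fun a ha => by simp [hext, ha, hsN_zero]
    rw [h0, mul_zero] at this
    exact sub_eq_zero.1 (abs_eq_zero.1 (le_antisymm this (abs_nonneg _)))
  have hc : Continuous fun Y => f (ext Y) := by
    rw [continuous_iff_continuousAt]
    intro Y₀
    rw [ContinuousAt, tendsto_iff_dist_tendsto_zero]
    have hl : Tendsto (fun Y => C * tD s (ext Y) (ext Y₀)) (𝓝 Y₀) (𝓝 0) := by
      have : Continuous fun Y => C * tD s (ext Y) (ext Y₀) := by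
        unfold tD
        refine continuous_const.mul (continuous_finsetSum _ fun a ha => continuous_hsN.comp ?_)
        simp only [hext, ha, dite_true]
        fun_prop
      have h := this.tendsto Y₀
      simpa [tD, hsN_zero] using h
    exact squeeze_zero (fun _ => dist_nonneg) (fun Y => hf _ _) hl
  rw [e]
  exact hc.measurable.comp (measurable_pi_lambda _ fun a => hX a a.2)

/-- Formulas see the variables only through contractive resolvents, so the bound is uniform in the
size, the process and the tuple. -/
lemma RFormula.exists_bound {Ω : Type*} [MeasurableSpace Ω] (P : Measure Ω)
    [IsProbabilityMeasure P] (φ : RFormula α) :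
    ∃ B : ℝ, 0 ≤ B ∧ ∀ (n : ℕ+) (Z : ℝ≥0 → ℕ → Ω → Mat n) (X : α → Mat n),
      |φ.Lam P Z X| ≤ B := by
  induction φ with
  | basic p =>
    obtain ⟨B, hB, h⟩ := p.exists_norm_le (fun _ => 1)
    refine ⟨B, hB, fun n Z X => ?_⟩
    exact (Complex.abs_re_le_norm _).trans ((norm_normTr_le _).trans ((hsN_le_norm _).trans
      (h n _ (norm_resolvents_le X))))
  | @conn α k f hf φ ih =>
    obtain ⟨K, hK⟩ := hf
    choose B hB h using ih
    have hs : ∀ i, B i ≤ ∑ j, B j := fun i =>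
      Finset.single_le_sum (fun j _ => hB j) (Finset.mem_univ i)
    have h0 : 0 ≤ ∑ j, B j := Finset.sum_nonneg fun j _ => hB j
    exact ⟨|f 0| + K * ∑ j, B j, by positivity, fun n Z X =>
      abs_le_of_lipschitz hK h0 fun i => (h i n Z X).trans (hs i)⟩
  | sup r hr φ ih =>
    obtain ⟨B, hB, h⟩ := ih
    refine ⟨B, hB, fun n Z X => ?_⟩
    have := nonempty_ball (n := n) hr
    exact abs_iSup_le_of_abs_le fun Y => h n Z _
  | inf r hr φ ih =>
    obtain ⟨B, hB, h⟩ := ih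
    refine ⟨B, hB, fun n Z X => ?_⟩
    have := nonempty_ball (n := n) hr
    exact abs_iInf_le_of_abs_le fun Y => h n Z _
  | brownian t₀ ht₀ φ ih =>
    obtain ⟨B, hB, h⟩ := ih
    refine ⟨B, hB, fun n Z X => ?_⟩
    have := norm_integral_le_of_norm_le_const (μ := P) (C := B) (f := fun ω => φ.Lam P Z
      (Sum.elim X fun j => truncMat (truncRadius 0 t₀) (Z t₀ j ω - Z 0 j ω)))
      (Eventually.of_forall fun ω => h n Z _)
    simpa [RFormula.Lam] using this

/-- Uniformity in n is what matters; only finitely many variables enter although the Brownian rule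
adds infinitely many. -/
lemma RFormula.exists_lipschitz {Ω : Type*} [MeasurableSpace Ω] (P : Measure Ω)
    [IsProbabilityMeasure P] (φ : RFormula α) :
    ∃ (C : ℝ) (s : Finset α), 0 ≤ C ∧ ∀ (n : ℕ+) (Z : ℝ≥0 → ℕ → Ω → Mat n),
      (∀ t j, Measurable (Z t j)) → ∀ X Y : α → Mat n,
        |φ.Lam P Z X - φ.Lam P Z Y| ≤ C * tD s X Y := by
  classical
  induction φ with
  | @basic α p =>
    obtain ⟨C, s, hC, h⟩ := p.exists_lipschitz (fun _ => 1)
    obtain ⟨u, hu⟩ := exists_tD_le_add hC hC s.toLeft s.toRight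
    refine ⟨C + C, u, add_nonneg hC hC, fun n Z _ X Y => le_trans ?_ (hu n X Y)⟩
    have h1 := h n _ _ (norm_resolvents_le X) (norm_resolvents_le Y)
    rw [tD_sum, mul_add] at h1
    refine le_trans ?_ (h1.trans (add_le_add ?_ ?_))
    · simp only [RFormula.Lam]
      rw [← Complex.sub_re, ← normTr_sub]
      exact (Complex.abs_re_le_norm _).trans (norm_normTr_le _)
    · exact mul_le_mul_of_nonneg_left
        (Finset.sum_le_sum fun a _ => hsN_resolvents_sub_le X Y (.inl a)) hC
    · exact mul_le_mul_of_nonneg_left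
        (Finset.sum_le_sum fun a _ => hsN_resolvents_sub_le X Y (.inr a)) hC
  | @conn α k f hf φ ih =>
    obtain ⟨K, hK⟩ := hf
    choose C s hC h using ih
    have hs : ∀ i, C i ≤ ∑ j, C j := fun i =>
      Finset.single_le_sum (fun j _ => hC j) (Finset.mem_univ i)
    have h0 : 0 ≤ ∑ j, C j := Finset.sum_nonneg fun j _ => hC j
    refine ⟨K * ∑ j, C j, Finset.univ.biUnion s, by positivity, fun n Z hZ X Y => ?_⟩
    have h1 := hK.dist_le_mul (fun i => (φ i).Lam P Z X) (fun i => (φ i).Lam P Z Y)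
    rw [Real.dist_eq] at h1
    refine h1.trans ?_
    rw [mul_assoc]
    refine mul_le_mul_of_nonneg_left ?_ K.2
    refine (dist_pi_le_iff (mul_nonneg h0 (tD_nonneg _ _ _))).2 fun i => ?_
    refine (h i n Z hZ X Y).trans ?_
    exact mul_le_mul (hs i) (tD_mono (Finset.subset_biUnion_of_mem s (Finset.mem_univ i)) _ _)
      (tD_nonneg _ _ _) h0
  | sup r hr φ ih =>
    obtain ⟨C, s, hC, h⟩ := ih
    obtain ⟨B, hB, hb⟩ := φ.exists_bound P
    refine ⟨C, Finset.eraseNone s, hC, fun n Z hZ X Y => ?_⟩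
    have := nonempty_ball (n := n) hr
    refine abs_iSup_sub_iSup_le (fun W => hb n Z _) (fun W => hb n Z _) fun W => ?_
    refine (h n Z hZ _ _).trans (mul_le_mul_of_nonneg_left ((tD_option _ _ _).trans ?_) hC)
    simp [hsN_zero]
  | inf r hr φ ih =>
    obtain ⟨C, s, hC, h⟩ := ih
    obtain ⟨B, hB, hb⟩ := φ.exists_bound P
    refine ⟨C, Finset.eraseNone s, hC, fun n Z hZ X Y => ?_⟩
    have := nonempty_ball (n := n) hr
    refine abs_iInf_sub_iInf_le (fun W => hb n Z _) (fun W => hb n Z _) fun W => ?_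
    refine (h n Z hZ _ _).trans (mul_le_mul_of_nonneg_left ((tD_option _ _ _).trans ?_) hC)
    simp [hsN_zero]
  | @brownian α t₀ ht₀ φ ih =>
    obtain ⟨C, s, hC, h⟩ := ih
    obtain ⟨B, hB, hb⟩ := φ.exists_bound P
    refine ⟨C, s.toLeft, hC, fun n Z hZ X Y => ?_⟩
    have hint : ∀ X : α → Mat n, Integrable (fun ω => φ.Lam P Z
        (Sum.elim X fun j => truncMat (truncRadius 0 t₀) (Z t₀ j ω - Z 0 j ω))) P := fun X => by
      refine Integrable.of_bound (C := B) ?_ (Eventually.of_forall fun ω => hb n Z _)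
      refine (measurable_of_lipschitz (h n Z hZ) fun b _ => ?_).aestronglyMeasurable
      rcases b with a | j
      · exact measurable_const
      · exact (continuous_truncMat _).measurable.comp ((hZ _ _).sub (hZ _ _))
    simp only [RFormula.Lam]
    rw [← integral_sub (hint X) (hint Y)]
    have := norm_integral_le_of_norm_le_const (μ := P) (C := C * tD s.toLeft X Y)
      (f := fun ω => φ.Lam P Z
        (Sum.elim X fun j => truncMat (truncRadius 0 t₀) (Z t₀ j ω - Z 0 j ω)) - φ.Lam P Z
        (Sum.elim Y fun j => truncMat (truncRadius 0 t₀) (Z t₀ j ω - Z 0 j ω)))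
      -- Both tuples receive the same increments, so these contribute nothing to the distance.
      (Eventually.of_forall fun ω => (h n Z hZ _ _).trans (by
        rw [tD_sum]
        refine mul_le_mul_of_nonneg_left (le_of_eq ?_) hC
        simp [tD, hsN_zero]))
    simpa using this

/-! ## Renaming of variables -/

/-- Renaming of the free variables of a restricted formula. -/
def RFormula.map : {α : Type} → RFormula α → {β : Type} → (α → β) → RFormula β
  | _, .basic p, _, e => .basic (p.bind fun b => .var (Sum.map e e b))
  | _, .conn f hf φ, _, e => .conn f hf fun i => (φ i).map e
  | _, .sup r hr φ, _, e => .sup r hr (φ.map (Option.map e))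
  | _, .inf r hr φ, _, e => .inf r hr (φ.map (Option.map e))
  | _, .brownian t₀ ht₀ φ, _, e => .brownian t₀ ht₀ (φ.map (Sum.map e id))

lemma RFormula.Lam_map {Ω : Type*} [MeasurableSpace Ω] (P : Measure Ω) (φ : RFormula α)
    (e : α → β) (Z : ℝ≥0 → ℕ → Ω → Mat n) (X : β → Mat n) :
    (φ.map e).Lam P Z X = φ.Lam P Z (X ∘ e) := by
  induction φ generalizing β with
  | basic p =>
    simp only [RFormula.map, RFormula.Lam, StarPoly.eval_bind]
    congr 3
    funext b
    rcases b with a | a <;> rfl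
  | conn f hf φ ih => simp only [RFormula.map, RFormula.Lam, ih]
  | sup r hr φ ih =>
    simp only [RFormula.map, RFormula.Lam, ih]
    refine iSup_congr fun Y => congrArg _ (funext fun o => ?_)
    cases o <;> rfl
  | inf r hr φ ih =>
    simp only [RFormula.map, RFormula.Lam, ih]
    refine iInf_congr fun Y => congrArg _ (funext fun o => ?_)
    cases o <;> rfl
  | brownian t₀ ht₀ φ ih =>
    simp only [RFormula.map, RFormula.Lam, ih]
    refine integral_congr_ae (Eventually.of_forall fun ω => congrArg _ (funext fun o => ?_))
    cases o <;> rfl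

end Tuples

/-! ## Finite nets and measurable minimizers -/

/-- Compactness of a product of balls in finite dimension. The index type `Fin (N + 1)` is nonempty,
so that minimizers over the net exist. -/
lemma exists_finite_net (n : ℕ+) {m : ℕ} {r : Fin m → ℝ} (hr : ∀ j, 0 < r j) {ε : ℝ}
    (hε : 0 < ε) : ∃ (N : ℕ) (d : Fin (N + 1) → Fin m → Mat n), (∀ i j, ‖d i j‖ ≤ r j) ∧
      ∀ Y : Fin m → Mat n, (∀ j, ‖Y j‖ ≤ r j) → ∃ i, ∀ j, ‖Y j - d i j‖ ≤ ε := by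
  have : ProperSpace (Mat n) := FiniteDimensional.proper ℂ (Mat n)
  set K : Set (Fin m → Mat n) := Set.pi Set.univ fun j => Metric.closedBall 0 (r j) with hK
  have hKc : IsCompact K := isCompact_univ_pi fun j => isCompact_closedBall _ _
  obtain ⟨t, htK, htf, htc⟩ := hKc.finite_cover_balls hε
  have hmem : ∀ Y : Fin m → Mat n, Y ∈ K ↔ ∀ j, ‖Y j‖ ≤ r j := fun Y => by
    simp [hK, Set.mem_pi]
  have hne : t.Nonempty := by
    have h0 : (0 : Fin m → Mat n) ∈ K := (hmem 0).2 fun j => by simpa using (hr j).le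
    obtain ⟨x, hx, _⟩ := Set.mem_iUnion₂.1 (htc h0)
    exact ⟨x, hx⟩
  obtain ⟨k, e⟩ := Finite.exists_equiv_fin (α := t) (h := htf.to_subtype)
  obtain ⟨e⟩ := e
  obtain ⟨x, hx⟩ := hne
  have hk : k ≠ 0 := fun h => by subst h; exact (e ⟨x, hx⟩).elim0
  obtain ⟨N, rfl⟩ := Nat.exists_eq_succ_of_ne_zero hk
  refine ⟨N, fun i => (e.symm i).1, fun i => (hmem _).1 (htK (e.symm i).2), fun Y hY => ?_⟩
  obtain ⟨y, hy, hyY⟩ := Set.mem_iUnion₂.1 (htc ((hmem Y).2 hY))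
  refine ⟨e ⟨y, hy⟩, fun j => ?_⟩
  simp only [Equiv.symm_apply_apply]
  rw [← dist_eq_norm]
  exact (dist_le_pi_dist Y y j).trans (Metric.mem_ball.1 hyY).le

lemma exists_measurable_argmin {Ω : Type*} [MeasurableSpace Ω] {N : ℕ}
    {G : Ω → Fin (N + 1) → ℝ} (hG : ∀ i, Measurable fun ω => G ω i) :
    ∃ i : Ω → Fin (N + 1), Measurable i ∧ ∀ ω j, G ω (i ω) ≤ G ω j := by
  classical
  have hex : ∀ ω, ∃ i, ∀ j, G ω i ≤ G ω j := fun ω => Finite.exists_min (G ω)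
  set A : Fin (N + 1) → Set Ω := fun i => {ω | ∀ j, G ω i ≤ G ω j} with hA
  have hAm : ∀ i, MeasurableSet (A i) := fun i => by
    have : A i = ⋂ j, {ω | G ω i ≤ G ω j} := by ext; simp [hA]
    rw [this]
    exact MeasurableSet.iInter fun j => measurableSet_le (hG i) (hG j)
  have hne : ∀ ω, (Finset.univ.filter fun i => ω ∈ A i).Nonempty := fun ω => by
    obtain ⟨i, hi⟩ := hex ω
    exact ⟨i, Finset.mem_filter.2 ⟨Finset.mem_univ _, hi⟩⟩
  -- Ties are broken by the least index: the event that `i` is chosen is then a finite Boolean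
  -- combination of the measurable sets `A k`.
  refine ⟨fun ω => (Finset.univ.filter fun i => ω ∈ A i).min' (hne ω), ?_, fun ω => ?_⟩
  · refine measurable_to_countable' fun i => ?_
    have : (fun ω => (Finset.univ.filter fun i => ω ∈ A i).min' (hne ω)) ⁻¹' {i} =
        A i ∩ ⋂ k : {k // k < i}, (A k)ᶜ := by
      ext ω
      simp only [Set.mem_preimage, Set.mem_singleton_iff, Set.mem_inter_iff, Set.mem_iInter,
        Set.mem_compl_iff, Subtype.forall]
      rw [Finset.min'_eq_iff]
      simp only [Finset.mem_filter, Finset.mem_univ, true_and]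
      refine and_congr_right fun _ => forall_congr' fun k => ?_
      rw [← not_lt]
      exact imp_not_comm
    rw [this]
    exact (hAm i).inter (MeasurableSet.iInter fun k => (hAm k).compl)
  · have := Finset.min'_mem _ (hne ω)
    simpa [hA] using this

end ChronOT

namespace ChronOT

/-! ## The filter of a character -/

section CharFilter

variable {Ω : Type*} [mΩ : MeasurableSpace Ω] {P : Measure Ω}

lemma IsBddScalar.add {f g : ℕ+ → Ω → ℂ} (hf : IsBddScalar f) (hg : IsBddScalar g) :
    IsBddScalar (fun n ω => f n ω + g n ω) := by
  obtain ⟨C, hC⟩ := hf.2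
  obtain ⟨D, hD⟩ := hg.2
  exact ⟨fun n => (hf.1 n).add (hg.1 n), C + D, fun n ω =>
    (norm_add_le _ _).trans (add_le_add (hC n ω) (hD n ω))⟩

lemma IsBddScalar.mul {f g : ℕ+ → Ω → ℂ} (hf : IsBddScalar f) (hg : IsBddScalar g) :
    IsBddScalar (fun n ω => f n ω * g n ω) := by
  obtain ⟨C, hC⟩ := hf.2
  obtain ⟨D, hD⟩ := hg.2
  refine ⟨fun n => (hf.1 n).mul (hg.1 n), C * D, fun n ω => ?_⟩
  rw [norm_mul]
  exact mul_le_mul (hC n ω) (hD n ω) (norm_nonneg _) ((norm_nonneg _).trans (hC n ω))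

lemma IsBddScalar.conj {f : ℕ+ → Ω → ℂ} (hf : IsBddScalar f) :
    IsBddScalar (fun n ω => (starRingEnd ℂ) (f n ω)) := by
  obtain ⟨C, hC⟩ := hf.2
  exact ⟨fun n => Complex.continuous_conj.measurable.comp (hf.1 n), C, fun n ω => by
    simpa using hC n ω⟩

variable [IsProbabilityMeasure P] {U : Filter ℕ+}
  (V : Subalgebra.center ℂ (RMUltraproduct P U) →ₐ[ℂ] ℂ)

lemma char_congr {f g : ℕ+ → Ω → ℂ} (hf : IsBddScalar f) (hg : IsBddScalar g)
    (h : ∀ n ω, f n ω = g n ω) :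
    V (scalarCenter P U f hf) = V (scalarCenter P U g hg) := by
  have : f = g := funext fun n => funext (h n)
  subst this
  rfl

/-- The filter on `ℕ+ × Ω` along which bounded sequences of random variables converge to the value
of the character. -/
noncomputable def charFilter : Filter (ℕ+ × Ω) where
  -- The sets {g < 1} with g ≥ 0 and V(g) = 0 form a base; the threshold 1 is no restriction, since
  -- g may be rescaled.
  sets := {B | ∃ (g : ℕ+ → Ω → ℝ) (hg : IsBddScalar (fun n ω => (g n ω : ℂ))),
    (∀ n ω, 0 ≤ g n ω) ∧ (V (scalarCenter P U _ hg)).re = 0 ∧ ∀ n ω, g n ω < 1 → (n, ω) ∈ B}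
  univ_sets := ⟨fun _ _ => 0, by simpa using isBddScalar_const 0, fun _ _ => le_rfl, by
    rw [char_congr V _ (isBddScalar_const 0) (fun _ _ => by simp), char_const]; rfl,
    fun _ _ _ => trivial⟩
  sets_of_superset := by
    rintro B B' ⟨g, hg, h0, hV, h⟩ hB
    exact ⟨g, hg, h0, hV, fun n ω hlt => hB (h n ω hlt)⟩
  inter_sets := by
    rintro B B' ⟨g, hg, h0, hV, h⟩ ⟨g', hg', h0', hV', h'⟩
    have hs : IsBddScalar (fun n ω => ((g n ω + g' n ω : ℝ) : ℂ)) := by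
      simpa using hg.add hg'
    refine ⟨fun n ω => g n ω + g' n ω, hs, fun n ω => add_nonneg (h0 n ω) (h0' n ω), ?_,
      fun n ω hlt => ⟨h n ω ?_, h' n ω ?_⟩⟩
    · rw [← char_add V hg hg' hs (fun n ω => by simp), Complex.add_re, hV, hV', add_zero]
    · linarith [h0' n ω]
    · linarith [h0 n ω]

/-- If some {g < 1} were empty then g ≥ 1 everywhere, and V(g) ≥ 1 by monotonicity. -/
instance charFilter_neBot : (charFilter V).NeBot := by
  refine ⟨fun hbot => ?_⟩
  obtain ⟨g, hg, h0, hV, h⟩ := empty_mem_iff_bot.2 hbot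
  have h1 : IsBddScalar (fun (_ : ℕ+) (_ : Ω) => (((1 : ℝ) : ℝ) : ℂ)) := isBddScalar_const _
  have := char_mono V h1 hg (fun n ω => not_lt.1 fun hlt => h n ω hlt)
  rw [hV, char_const] at this
  norm_num at this

/-- With c = V(f), the function |f - c|²/ε² has value 0 under the multiplicative V, and its sublevel
set at 1 is {|f - c| < ε}. -/
lemma tendsto_charFilter {f : ℕ+ → Ω → ℂ} (hf : IsBddScalar f) :
    Tendsto (fun p : ℕ+ × Ω => f p.1 p.2) (charFilter V) (𝓝 (V (scalarCenter P U f hf))) := by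
  rw [Metric.tendsto_nhds]
  intro ε hε
  set c := V (scalarCenter P U f hf) with hc
  have hd : IsBddScalar (fun n ω => f n ω + (-c)) := hf.add (isBddScalar_const (-c))
  have hd' : IsBddScalar (fun n ω => ((ε ^ 2)⁻¹ : ℂ) * (starRingEnd ℂ) (f n ω + (-c))) :=
    hd.conj.const_mul _
  have hg : IsBddScalar (fun n ω => ((‖f n ω + (-c)‖ ^ 2 / ε ^ 2 : ℝ) : ℂ)) := by
    have := hd.mul hd'
    refine (funext fun n => funext fun ω => ?_ : (fun n ω => _) = _) ▸ this
    push_cast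
    rw [← Complex.mul_conj']; ring
  have e1 := char_add V hf (isBddScalar_const (-c)) hd (fun _ _ => rfl)
  rw [char_const, ← hc, add_neg_cancel] at e1
  have e2 := char_mul V hd hd' hg (fun n ω => by
    push_cast
    rw [← Complex.mul_conj']; ring)
  rw [← e1, zero_mul] at e2
  refine ⟨_, hg, fun n ω => by positivity, by rw [← e2]; rfl, fun n ω hlt => ?_⟩
  rw [div_lt_one (by positivity)] at hlt
  change dist _ _ < _
  rw [dist_eq_norm, sub_eq_add_neg]
  exact lt_of_pow_lt_pow_left₀ 2 hε.le hlt

lemma char_eq_zero_of_tendsto {f : ℕ+ → Ω → ℂ} (hf : IsBddScalar f)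
    (h : Tendsto (fun n => ∫ ω, ‖f n ω‖ ^ 2 ∂P) U (𝓝 0)) : V (scalarCenter P U f hf) = 0 := by
  have : scalarCenter P U f hf = 0 := by
    refine Subtype.ext ?_
    change ultraMk P U (scalarSeq f hf) = ultraMk P U 0
    rw [ultraMk_eq_iff, sub_zero, mem_nullIdeal]
    refine h.congr fun n => integral_congr_ae (Eventually.of_forall fun ω => ?_)
    change ‖f n ω‖ ^ 2 = hsSq (f n ω • (1 : Mat n))
    rw [hsSq_smul, ← hsIn_self]
    simp [hsIn, normTr_one]
  rw [this, map_zero]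

lemma tendsto_charFilter_zero {f : ℕ+ → Ω → ℂ} (hf : IsBddScalar f)
    (h : Tendsto (fun n => ∫ ω, ‖f n ω‖ ^ 2 ∂P) U (𝓝 0)) :
    Tendsto (fun p : ℕ+ × Ω => f p.1 p.2) (charFilter V) (𝓝 0) := by
  rw [← char_eq_zero_of_tendsto V hf h]
  exact tendsto_charFilter V hf

/-- For S in the ultraproduct filter, the indicator of the complement of S, as a scalar sequence, is
null in the ultraproduct, hence killed by the character. -/
lemma tendsto_fst_charFilter : Tendsto Prod.fst (charFilter V) U := by
  classical
  intro S hS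
  have hb : IsBddScalar (fun (n : ℕ+) (_ : Ω) => (((if n ∈ S then 0 else 1 : ℝ) : ℝ) : ℂ)) :=
    ⟨fun n => measurable_const, 1, fun n ω => by
      dsimp only; split_ifs <;> simp⟩
  refine ⟨_, hb, fun n ω => by split_ifs <;> simp, ?_, fun n ω hlt => ?_⟩
  · rw [char_eq_zero_of_tendsto V hb]
    · rfl
    · refine tendsto_const_nhds.congr' ?_
      filter_upwards [hS] with n hn
      simp [hn]
  · by_contra hn
    have : n ∉ S := hn
    simp [this] at hlt

end CharFilter

/-! ## Representing sequences -/

section Reps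

variable {Ω : Type*} [mΩ : MeasurableSpace Ω] {P : Measure Ω} [IsProbabilityMeasure P]
  {U : Filter ℕ+} (V : Subalgebra.center ℂ (RMUltraproduct P U) →ₐ[ℂ] ℂ) {α β : Type}

/-- The element of `Q` represented by a bounded sequence. -/
noncomputable def toQ (X : RMSeq Ω) : RMQuotient V := quotMk V (ultraMk P U X)

/-- The entries of a tuple of sequences at a point of `ℕ+ × Ω`. -/
def tupAt (X : α → RMSeq Ω) (p : ℕ+ × Ω) : α → Mat p.1 := fun a => (X a).1 p.1 p.2

/-- Sequences which consist of random matrices measurable with respect to a sigma-algebra. -/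
def IsMeas (X : RMSeq Ω) (m : MeasurableSpace Ω) : Prop := ∀ n, Measurable[m] (X.1 n)

lemma toQ_add (X Y : RMSeq Ω) : toQ V (X + Y) = toQ V X + toQ V Y := by simp [toQ]

lemma toQ_sub (X Y : RMSeq Ω) : toQ V (X - Y) = toQ V X - toQ V Y := by simp [toQ]

lemma toQ_mul (X Y : RMSeq Ω) : toQ V (X * Y) = toQ V X * toQ V Y := by simp [toQ]

lemma toQ_smul (c : ℂ) (X : RMSeq Ω) : toQ V (c • X) = c • toQ V X := by simp [toQ]

lemma toQ_star (X : RMSeq Ω) : toQ V (star X) = star (toQ V X) := rfl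

lemma toQ_one : toQ V (1 : RMSeq Ω) = 1 := by simp [toQ]

lemma toQ_algebraMap (c : ℂ) :
    toQ V (algebraMap ℂ (RMSeq Ω) c) = algebraMap ℂ (RMQuotient V) c := by
  rw [Algebra.algebraMap_eq_smul_one, Algebra.algebraMap_eq_smul_one, toQ_smul, toQ_one]

lemma toQ_opRe (X : RMSeq Ω) : toQ V (opRe X) = opRe (toQ V X) := by
  rw [opRe, opRe, toQ_smul, toQ_add, toQ_star]

lemma toQ_opIm (X : RMSeq Ω) : toQ V (opIm X) = opIm (toQ V X) := by
  rw [opIm, opIm, toQ_smul, toQ_sub, toQ_star]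

lemma toQ_eval (p : StarPoly β) (X : β → RMSeq Ω) :
    toQ V (p.eval X) = p.eval fun b => toQ V (X b) := by
  induction p with
  | var b => rfl
  | one => exact toQ_one V
  | add p q hp hq => simp only [StarPoly.eval, toQ_add, hp, hq]
  | mul p q hp hq => simp only [StarPoly.eval, toQ_mul, hp, hq]
  | adj p hp => simp only [StarPoly.eval, toQ_star, hp]
  | smul c p hp => simp only [StarPoly.eval, toQ_smul, hp]

lemma eval_apply (p : StarPoly β) (X : β → RMSeq Ω) (q : ℕ+ × Ω) :
    (p.eval X).1 q.1 q.2 = p.eval (tupAt X q) := by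
  induction p with
  | var b => rfl
  | one => rfl
  | add p q hp hq => simp only [StarPoly.eval, ← hp, ← hq]; rfl
  | mul p q hp hq => simp only [StarPoly.eval, ← hp, ← hq]; rfl
  | adj p hp => simp only [StarPoly.eval, ← hp]; rfl
  | smul c p hp => simp only [StarPoly.eval, ← hp]; rfl

lemma isMeas_eval (p : StarPoly β) {X : β → RMSeq Ω} {𝓖 : Filtration ℝ≥0 mΩ} {t : ℝ≥0}
    (hX : ∀ b, IsMeas (X b) (𝓖 t)) : IsMeas (p.eval X) (𝓖 t) := by
  induction p with
  | var b => exact hX b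
  | one => exact fun n => measurable_const
  | add p q hp hq => exact fun n => (hp n).add (hq n)
  | mul p q hp hq => exact fun n => (hp n).mul (hq n)
  | adj p hp => exact fun n => continuous_star.measurable.comp (hp n)
  | smul c p hp => exact fun n => (hp n).const_smul c

lemma tendsto_quotTrace (X : RMSeq Ω) :
    Tendsto (fun p : ℕ+ × Ω => normTr (X.1 p.1 p.2)) (charFilter V) (𝓝 (quotTrace V (toQ V X))) :=
  tendsto_charFilter V (isBddScalar_normTr X)

lemma tendsto_charSq (X : RMSeq Ω) :
    Tendsto (fun p : ℕ+ × Ω => hsSq (X.1 p.1 p.2)) (charFilter V) (𝓝 (charSq V X)) := by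
  have := (Complex.continuous_re.tendsto _).comp (tendsto_charFilter V (isBddScalar_hsSq X))
  simpa only [Function.comp_def, Complex.ofReal_re, charSq] using this

lemma quotTrace_star_mul (X : RMSeq Ω) :
    quotTrace V (star (toQ V X) * toQ V X) = charSq V X := by
  rw [← char_centerTrace_star_mul]
  rfl

/-- The character value whose vanishing defines the ideal is the limit of the squared
Hilbert-Schmidt norms of the difference. -/
lemma toQ_eq_iff {X Y : RMSeq Ω} : toQ V X = toQ V Y ↔
    Tendsto (fun p : ℕ+ × Ω => hsN (X.1 p.1 p.2 - Y.1 p.1 p.2)) (charFilter V) (𝓝 0) := by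
  rw [toQ, toQ, quotMk_eq_iff, ← map_sub, ultraMk_mem_ultrafiberIdeal]
  have h := tendsto_charSq V (X - Y)
  constructor
  · intro h0
    rw [h0] at h
    have := (Real.continuous_sqrt.tendsto _).comp h
    rw [Real.sqrt_zero] at this
    exact this
  · intro h0
    have := h0.pow 2
    simp only [hsN_sq] at this
    rw [zero_pow two_ne_zero] at this
    exact tendsto_nhds_unique h this

lemma continuous_resolvent_aux {n : ℕ+} {f : Mat n → Mat n} (hf : Continuous f)
    (hs : ∀ X, IsSelfAdjoint (f X)) : Continuous fun X => resolventI (f X) := by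
  rw [continuous_iff_continuousAt]
  intro X
  rw [ContinuousAt, tendsto_iff_norm_sub_tendsto_zero]
  have h : Tendsto (fun Y => ‖f Y - f X‖) (𝓝 X) (𝓝 0) :=
    tendsto_iff_norm_sub_tendsto_zero.1 (hf.tendsto X)
  refine squeeze_zero (fun _ => norm_nonneg _) (fun Y => ?_) h
  have e : resolventI (f Y) - resolventI (f X) =
      resolventI (f Y) * (f X - f Y) * resolventI (f X) := by
    have : f X - f Y = (f X + algebraMap ℂ (Mat n) Complex.I) -
      (f Y + algebraMap ℂ (Mat n) Complex.I) := by abel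
    rw [this, mul_sub, sub_mul, resolventI_mul (hs _), one_mul, mul_assoc,
      mul_resolventI (hs _), mul_one]
  rw [e, norm_sub_rev (f Y)]
  refine (norm_mul_le _ _).trans ?_
  refine (mul_le_of_le_one_right (norm_nonneg _) (norm_resolventI_le (hs _))).trans ?_
  refine (norm_mul_le _ _).trans ?_
  exact mul_le_of_le_one_left (norm_nonneg _) (norm_resolventI_le (hs _))

lemma continuous_opRe {n : ℕ+} : Continuous (opRe : Mat n → Mat n) := by unfold opRe; fun_prop

lemma continuous_opIm {n : ℕ+} : Continuous (opIm : Mat n → Mat n) := by unfold opIm; fun_prop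

/-- The resolvents of a tuple of bounded sequences. -/
noncomputable def resSeq (X : α → RMSeq Ω) (b : α ⊕ α) : RMSeq Ω :=
  ⟨fun n ω => resolvents (tupAt X (n, ω)) b, fun n => by
    rcases b with a | a
    · exact (continuous_resolvent_aux continuous_opRe isSelfAdjoint_opRe).measurable.comp
        ((X a).measurable n)
    · exact (continuous_resolvent_aux continuous_opIm isSelfAdjoint_opIm).measurable.comp
        ((X a).measurable n), 1, fun n ω => norm_resolvents_le _ _⟩

lemma resolventI_eq_of_mul_eq_one {A : Type*} [Ring A] [Algebra ℂ A] {x y : A}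
    (h₁ : (x + algebraMap ℂ A Complex.I) * y = 1) (h₂ : y * (x + algebraMap ℂ A Complex.I) = 1) :
    resolventI x = y := by
  have := Ring.inverse_unit (⟨_, y, h₁, h₂⟩ : Aˣ)
  exact this

/-- The matrix identities expressing that resolvents are two-sided inverses pass to the quotient, so
`Ring.inverse` there is a genuine inverse. -/
lemma toQ_resSeq (X : α → RMSeq Ω) :
    (fun b => toQ V (resSeq X b)) = resolvents fun a => toQ V (X a) := by
  funext b
  rcases b with a | a
  · symm
    refine resolventI_eq_of_mul_eq_one ?_ ?_
    · rw [← toQ_opRe, ← toQ_algebraMap, ← toQ_add, ← toQ_mul, ← toQ_one V]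
      congr 1
      refine Subtype.ext (funext fun n => funext fun ω => ?_)
      exact mul_resolventI (isSelfAdjoint_opRe ((X a).1 n ω))
    · rw [← toQ_opRe, ← toQ_algebraMap, ← toQ_add, ← toQ_mul, ← toQ_one V]
      congr 1
      refine Subtype.ext (funext fun n => funext fun ω => ?_)
      exact resolventI_mul (isSelfAdjoint_opRe ((X a).1 n ω))
  · symm
    refine resolventI_eq_of_mul_eq_one ?_ ?_
    · rw [← toQ_opIm, ← toQ_algebraMap, ← toQ_add, ← toQ_mul, ← toQ_one V]
      congr 1
      refine Subtype.ext (funext fun n => funext fun ω => ?_)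
      exact mul_resolventI (isSelfAdjoint_opIm ((X a).1 n ω))
    · rw [← toQ_opIm, ← toQ_algebraMap, ← toQ_add, ← toQ_mul, ← toQ_one V]
      congr 1
      refine Subtype.ext (funext fun n => funext fun ω => ?_)
      exact resolventI_mul (isSelfAdjoint_opIm ((X a).1 n ω))

/-! ## Limits of restricted formulas along sequences -/

variable (Z : ∀ n : ℕ+, ℝ≥0 → ℕ → Ω → Mat n)

/-- The value of a restricted formula on a tuple of sequences. -/
noncomputable def Lseq (P : Measure Ω) (φ : RFormula α) (X : α → RMSeq Ω) (p : ℕ+ × Ω) : ℝ :=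
  φ.Lam P (Z p.1) (tupAt X p)

/-- The limit of the values of a restricted formula on a tuple of sequences. -/
noncomputable def ev (φ : RFormula α) (X : α → RMSeq Ω) : ℝ :=
  limUnder (charFilter V) (Lseq Z P φ X)

variable {Z} (hZ : ∀ n t j, Measurable (Z n t j))
include hZ

lemma measurable_Lam (P : Measure Ω) [IsProbabilityMeasure P] {Ω₁ : Type*}
    {m : MeasurableSpace Ω₁} (φ : RFormula α) {n : ℕ+} {X : Ω₁ → α → Mat n}
    (hX : ∀ a, Measurable fun ω => X ω a) :
    Measurable fun ω => φ.Lam P (Z n) (X ω) := by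
  obtain ⟨C, s, _, h⟩ := φ.exists_lipschitz P
  exact measurable_of_lipschitz (h n (Z n) (hZ n)) fun a _ => hX a

lemma isBddScalar_Lseq (φ : RFormula α) (X : α → RMSeq Ω) :
    IsBddScalar fun n ω => (Lseq Z P φ X (n, ω) : ℂ) := by
  obtain ⟨B, hB, h⟩ := φ.exists_bound P
  refine ⟨fun n => Complex.measurable_ofReal.comp
    (measurable_Lam hZ P φ fun a => (X a).measurable n), B, fun n ω => ?_⟩
  rw [Complex.norm_real]
  exact h n _ _

lemma tendsto_ev (φ : RFormula α) (X : α → RMSeq Ω) :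
    Tendsto (Lseq Z P φ X) (charFilter V) (𝓝 (ev V Z φ X)) := by
  refine tendsto_nhds_limUnder
    ⟨(V (scalarCenter P U _ (isBddScalar_Lseq (P := P) hZ φ X))).re, ?_⟩
  have := (Complex.continuous_re.tendsto _).comp
    (tendsto_charFilter V (isBddScalar_Lseq (P := P) hZ φ X))
  simpa only [Function.comp_def, Complex.ofReal_re] using this

omit [IsProbabilityMeasure P] hZ in
lemma tendsto_tD_zero {I : Type*} {G : Filter I} {n : I → ℕ+} {s : Finset α}
    {X Y : ∀ i, α → Mat (n i)}
    (h : ∀ a ∈ s, Tendsto (fun i => hsN (X i a - Y i a)) G (𝓝 0)) :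
    Tendsto (fun i => tD s (X i) (Y i)) G (𝓝 0) := by
  unfold tD
  rw [← Finset.sum_const_zero (s := s)]
  exact tendsto_finsetSum s h

lemma tendsto_Lam_sub_zero {I : Type*} {G : Filter I} {n : I → ℕ+} (φ : RFormula α)
    {X Y : ∀ i, α → Mat (n i)}
    (h : ∀ a, Tendsto (fun i => hsN (X i a - Y i a)) G (𝓝 0)) :
    Tendsto (fun i => φ.Lam P (Z (n i)) (X i) - φ.Lam P (Z (n i)) (Y i)) G (𝓝 0) := by
  obtain ⟨C, s, hC, hl⟩ := φ.exists_lipschitz P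
  have := (tendsto_tD_zero (s := s) fun a _ => h a).const_mul C
  rw [mul_zero] at this
  exact squeeze_zero_norm (fun i => hl (n i) _ (hZ _) _ _) this

/-- The limits depend only on classes in Q: sequences with the same classes are close in
Hilbert-Schmidt norm along `charFilter`, and formulas are uniformly Lipschitz. -/
lemma ev_congr (φ : RFormula α) {X Y : α → RMSeq Ω} (h : ∀ a, toQ V (X a) = toQ V (Y a)) :
    ev V Z φ X = ev V Z φ Y := by
  have h1 := tendsto_Lam_sub_zero (P := P) hZ φ (n := Prod.fst) (G := charFilter V) (X := tupAt X)
    (Y := tupAt Y) fun a => (toQ_eq_iff V).1 (h a)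
  have h2 := (tendsto_ev V hZ φ X).sub (tendsto_ev V hZ φ Y)
  exact sub_eq_zero.1 (tendsto_nhds_unique h2 h1)

omit hZ in
lemma ev_eq_of_tendsto {φ : RFormula α} {X : α → RMSeq Ω} {c : ℝ}
    (h : Tendsto (Lseq Z P φ X) (charFilter V) (𝓝 c)) : ev V Z φ X = c := h.limUnder_eq

end Reps

end ChronOT

namespace ChronOT

/-! ## Gaussian measures: rotations and the Poincaré inequality -/

section Gaussian

variable {E : Type*} [NormedAddCommGroup E] [InnerProductSpace ℝ E] [FiniteDimensional ℝ E]
  [MeasurableSpace E] [BorelSpace E]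

/-- The rotation by the angle `θ` of a pair of vectors. -/
noncomputable def rotate (θ : ℝ) (p : E × E) : E × E :=
  (Real.cos θ • p.1 + Real.sin θ • p.2, -Real.sin θ • p.1 + Real.cos θ • p.2)

lemma map_rotate (θ : ℝ) :
    ((stdGaussian E).prod (stdGaussian E)).map (rotate θ) =
      (stdGaussian E).prod (stdGaussian E) :=
  IsGaussian.map_rotation_eq_self (by simp) θ

lemma continuous_rotate : Continuous fun q : ℝ × (E × E) => rotate q.1 q.2 := by
  unfold rotate; fun_prop

lemma measurable_rotate (θ : ℝ) : Measurable (rotate θ : E × E → E × E) := by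
  unfold rotate; fun_prop

lemma measurePreserving_rotate (θ : ℝ) :
    MeasurePreserving (rotate θ : E × E → E × E) ((stdGaussian E).prod (stdGaussian E))
      ((stdGaussian E).prod (stdGaussian E)) :=
  ⟨measurable_rotate θ, map_rotate θ⟩

lemma rotate_zero (p : E × E) : rotate 0 p = p := by simp [rotate]

/-- The integral of the squared deviation of g from its mean is nonnegative. -/
lemma sq_intervalIntegral_le {g : ℝ → ℝ} (hg : Continuous g) {a : ℝ} (ha : 0 < a) :
    (∫ t in 0..a, g t) ^ 2 ≤ a * ∫ t in 0..a, g t ^ 2 := by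
  set I := ∫ t in 0..a, g t
  have h0 : 0 ≤ ∫ t in 0..a, (g t - I / a) ^ 2 :=
    intervalIntegral.integral_nonneg ha.le fun t _ => sq_nonneg _
  have i1 : IntervalIntegrable (fun t => g t ^ 2) volume 0 a := (hg.pow 2).intervalIntegrable _ _
  have i2 : IntervalIntegrable (fun t => 2 * (I / a) * g t) volume 0 a :=
    (hg.const_mul _).intervalIntegrable _ _
  have e : ∫ t in 0..a, (g t - I / a) ^ 2 = (∫ t in 0..a, g t ^ 2) - 2 * (I / a) * I +
      a * (I / a) ^ 2 := by
    have : ∀ t, (g t - I / a) ^ 2 = g t ^ 2 - 2 * (I / a) * g t + (I / a) ^ 2 := fun t => by ring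
    simp only [this]
    rw [intervalIntegral.integral_add (i1.sub i2) (by simp), intervalIntegral.integral_sub i1 i2,
      intervalIntegral.integral_const_mul, intervalIntegral.integral_const, sub_zero, smul_eq_mul]
  rw [e] at h0
  have : a * ((∫ t in 0..a, g t ^ 2) - 2 * (I / a) * I + a * (I / a) ^ 2) =
      a * (∫ t in 0..a, g t ^ 2) - I ^ 2 := by field_simp; ring
  nlinarith [mul_nonneg ha.le h0]

/-- The Poincaré inequality for differentiable functions, by rotation of an independent copy. -/
lemma lintegral_sub_sq_le_of_hasDerivAt {ν : Measure (E × E)} [SFinite ν]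
    (hν : ∀ θ, MeasurePreserving (rotate θ) ν ν) {F : E → ℝ} {G : E × E → ℝ} (hG : Continuous G)
    (h : ∀ p θ, HasDerivAt (fun θ => F (rotate θ p).1) (G (rotate θ p)) θ) :
    ∫⁻ p, ENNReal.ofReal ((F p.2 - F p.1) ^ 2) ∂ν ≤
      ENNReal.ofReal ((Real.pi / 2) ^ 2) *
        ∫⁻ p, ENNReal.ofReal (G p ^ 2) ∂ν := by
  -- The first component of the rotated pair runs from `p.1` at angle 0 to `p.2` at angle π/2.
  set a := Real.pi / 2 with ha
  have ha0 : 0 < a := by positivity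
  have hc2 : Continuous fun q : ℝ × (E × E) => G (rotate q.1 q.2) := hG.comp continuous_rotate
  have hGr : ∀ p, Continuous fun θ => G (rotate θ p) := fun p =>
    Continuous.comp (f := fun θ : ℝ => (θ, p)) hc2 (by fun_prop)
  have key : ∀ p, ENNReal.ofReal ((F p.2 - F p.1) ^ 2) ≤
      ENNReal.ofReal a * ∫⁻ θ in Set.Ioc 0 a, ENNReal.ofReal (G (rotate θ p) ^ 2) := fun p => by
    have e : F p.2 - F p.1 = ∫ θ in 0..a, G (rotate θ p) := by
      rw [intervalIntegral.integral_eq_sub_of_hasDerivAt (fun θ _ => h p θ)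
        ((hGr p).intervalIntegrable _ _)]
      simp [rotate, ha]
    rw [e]
    refine (ENNReal.ofReal_le_ofReal (sq_intervalIntegral_le (hGr p) ha0)).trans ?_
    rw [ENNReal.ofReal_mul ha0.le]
    refine mul_le_mul_right (le_of_eq ?_) _
    rw [intervalIntegral.integral_of_le ha0.le, ofReal_integral_eq_lintegral_ofReal]
    · have h2 : Continuous fun θ => G (rotate θ p) ^ 2 := (hGr p).pow 2
      exact (h2.intervalIntegrable 0 a).1
    · exact Eventually.of_forall fun θ => sq_nonneg _
  have hm : Measurable fun q : (E × E) × ℝ => ENNReal.ofReal (G (rotate q.2 q.1) ^ 2) :=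
    (hc2.measurable.comp measurable_swap).pow_const 2 |>.ennreal_ofReal
  -- After Fubini, invariance of ν removes the rotation at every fixed angle; the interval
  -- contributes the second factor π/2.
  have hm' : Measurable fun p => ENNReal.ofReal (G p ^ 2) :=
    (hG.measurable.pow_const 2).ennreal_ofReal
  calc _ ≤ ∫⁻ p, (ENNReal.ofReal a *
        ∫⁻ θ in Set.Ioc 0 a, ENNReal.ofReal (G (rotate θ p) ^ 2)) ∂ν := lintegral_mono key
    _ = ENNReal.ofReal a *
        ∫⁻ θ in Set.Ioc 0 a, ∫⁻ p, ENNReal.ofReal (G (rotate θ p) ^ 2) ∂ν := by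
      rw [lintegral_const_mul' _ _ ENNReal.ofReal_ne_top, lintegral_lintegral_swap]
      exact hm.aemeasurable
    _ = ENNReal.ofReal a *
        ∫⁻ θ in Set.Ioc 0 a, ∫⁻ p, ENNReal.ofReal (G p ^ 2) ∂ν := by
      congr 1
      refine lintegral_congr fun θ => ?_
      exact (hν θ).lintegral_comp hm'
    _ = _ := by
      rw [lintegral_const, Measure.restrict_apply_univ, Real.volume_Ioc, sub_zero, sq a,
        ENNReal.ofReal_mul ha0.le, mul_comm _ (ENNReal.ofReal a), mul_assoc]

/-- Gaussian integration by parts, by rotation of an independent copy. -/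
lemma integral_eq_zero_of_hasDerivAt {ν : Measure (E × E)} [IsProbabilityMeasure ν]
    (hν : ∀ θ, MeasurePreserving (rotate θ) ν ν) {F G : E × E → ℂ} (hG : Continuous G)
    (hFi : Integrable F ν)
    (hGi : Integrable G ν)
    (h : ∀ p θ, HasDerivAt (fun θ => F (rotate θ p)) (G (rotate θ p)) θ) :
    ∫ p, G p ∂ν = 0 := by
  have hc2 : Continuous fun q : ℝ × (E × E) => G (rotate q.1 q.2) := hG.comp continuous_rotate
  have hGr : ∀ p, Continuous fun θ => G (rotate θ p) := fun p =>
    Continuous.comp (f := fun θ : ℝ => (θ, p)) hc2 (by fun_prop)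
  -- The angle 1 is arbitrary. By invariance the left side has mean 0, and the right side has mean
  -- the integral of G.
  have e : ∀ p, F (rotate 1 p) - F p = ∫ θ in Set.Ioc (0 : ℝ) 1, G (rotate θ p) := fun p => by
    rw [← intervalIntegral.integral_of_le zero_le_one,
      intervalIntegral.integral_eq_sub_of_hasDerivAt (fun θ _ => h p θ)
        ((hGr p).intervalIntegrable _ _), rotate_zero]
  have hF1 : Integrable (fun p => F (rotate 1 p)) ν :=
    (hν 1).integrable_comp_of_integrable hFi
  have i1 : ∫ p, F (rotate 1 p) ∂ν = ∫ p, F p ∂ν := by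
    conv_rhs => rw [← (hν 1).map_eq]
    rw [integral_map (measurable_rotate 1).aemeasurable]
    rw [(hν 1).map_eq]; exact hFi.aestronglyMeasurable
  have i2 : ∀ θ, ∫ p, G (rotate θ p) ∂ν = ∫ p, G p ∂ν := fun θ => by
    conv_rhs => rw [← (hν θ).map_eq]
    rw [integral_map (measurable_rotate θ).aemeasurable hG.aestronglyMeasurable]
  have hint : Integrable (Function.uncurry fun (θ : ℝ) p => G (rotate θ p))
      ((volume.restrict (Set.Ioc (0 : ℝ) 1)).prod ν) := by
    change Integrable (fun q : ℝ × (E × E) => G (rotate q.1 q.2)) _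
    rw [integrable_prod_iff hc2.aestronglyMeasurable]
    constructor
    · exact Eventually.of_forall fun θ => (hν θ).integrable_comp_of_integrable hGi
    · have : ∀ θ, ∫ p, ‖G (rotate θ p)‖ ∂ν = ∫ p, ‖G p‖ ∂ν := fun θ => by
        conv_rhs => rw [← (hν θ).map_eq]
        rw [integral_map (measurable_rotate θ).aemeasurable hG.norm.aestronglyMeasurable]
      simp only [this]
      exact integrable_const _
  have : (0 : ℂ) = ∫ p, (F (rotate 1 p) - F p) ∂ν := by
    rw [integral_sub hF1 hFi, i1, sub_self]
  simp only [e] at this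
  rw [← integral_integral_swap hint] at this
  simp only [i2] at this
  rw [this]
  simp

lemma integral_dual_sq_stdGaussian (L : StrongDual ℝ E) :
    ∫⁻ y, ENNReal.ofReal (L y ^ 2) ∂(stdGaussian E) = ENNReal.ofReal (‖L‖ ^ 2) := by
  have hL : MemLp L 2 (stdGaussian E) := IsGaussian.memLp_dual _ L 2 (by norm_num)
  rw [← variance_dual_stdGaussian, variance_eq_integral L.continuous.aemeasurable,
    integral_strongDual_stdGaussian, ← ofReal_integral_eq_lintegral_ofReal]
  · simp
  · exact hL.integrable_sq
  · exact Eventually.of_forall fun _ => sq_nonneg _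

/-- Convolution with a probability bump supported in the unit ball preserves the Lipschitz constant
and moves values by at most L. -/
lemma exists_smooth_approx {f : E → ℝ} {L : ℝ≥0} (hf : LipschitzWith L f) :
    ∃ g : E → ℝ, ContDiff ℝ 1 g ∧ LipschitzWith L g ∧ ∀ x, |g x - f x| ≤ L := by
  let φ : ContDiffBump (0 : E) := ⟨1 / 2, 1, by norm_num, by norm_num⟩
  have hc : ConvolutionExists (φ.normed volume) f (ContinuousLinearMap.lsmul ℝ ℝ) volume :=
    φ.hasCompactSupport_normed.convolutionExists_left _ φ.continuous_normed
      hf.continuous.locallyIntegrable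
  refine ⟨convolution (φ.normed volume) f (ContinuousLinearMap.lsmul ℝ ℝ) volume,
    φ.hasCompactSupport_normed.contDiff_convolution_left _ (n := 1) φ.contDiff_normed
      hf.continuous.locallyIntegrable, ?_, fun x => ?_⟩
  · refine LipschitzWith.of_dist_le_mul fun x y => ?_
    rw [dist_eq_norm, convolution_def, convolution_def, ← integral_sub (hc x) (hc y)]
    refine (norm_integral_le_of_norm_le (φ.integrable_normed.mul_const (L * dist x y))
      (Eventually.of_forall fun t => ?_)).trans (le_of_eq ?_)
    · simp only [ContinuousLinearMap.lsmul_apply, smul_eq_mul]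
      rw [← mul_sub, norm_mul, Real.norm_of_nonneg (φ.nonneg_normed t)]
      refine mul_le_mul_of_nonneg_left ?_ (φ.nonneg_normed t)
      have := hf.dist_le_mul (x - t) (y - t)
      rwa [dist_sub_right, Real.dist_eq] at this
    · rw [integral_mul_const, φ.integral_normed, one_mul]
  · have := φ.dist_normed_convolution_le (μ := volume) (x₀ := x) (ε := L) (g := f)
      hf.continuous.aestronglyMeasurable (fun y hy => by
        refine (hf.dist_le_mul y x).trans ?_
        have : dist y x < 1 := hy
        nlinarith [L.2])
    rwa [Real.dist_eq] at this

/-- The Gaussian Poincaré inequality for Lipschitz functions, with a non-optimal constant. -/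
lemma lintegral_sub_sq_le_of_lipschitz {f : E → ℝ} {L : ℝ≥0} (hf : LipschitzWith L f) :
    ∫⁻ p, ENNReal.ofReal ((f p.2 - f p.1) ^ 2) ∂((stdGaussian E).prod (stdGaussian E)) ≤
      ENNReal.ofReal (16 * L ^ 2) := by
  obtain ⟨g, hg, hgL, hgf⟩ := exists_smooth_approx hf
  set ν := (stdGaussian E).prod (stdGaussian E)
  have hgd : Differentiable ℝ g := hg.differentiable one_ne_zero
  have hgc : Continuous (fderiv ℝ g) := hg.continuous_fderiv one_ne_zero
  set G : E × E → ℝ := fun p => fderiv ℝ g p.1 p.2 with hGdef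
  have hG : Continuous G := by
    have : Continuous fun p : E × E => (fderiv ℝ g p.1) p.2 :=
      (hgc.comp continuous_fst).clm_apply continuous_snd
    exact this
  have h1 := lintegral_sub_sq_le_of_hasDerivAt (measurePreserving_rotate (E := E)) (F := g) hG fun p θ => by
    have hd : HasDerivAt (fun θ => (rotate θ p).1) (rotate θ p).2 θ := by
      have := ((Real.hasDerivAt_cos θ).smul_const p.1).add ((Real.hasDerivAt_sin θ).smul_const p.2)
      exact this
    exact (hgd _).hasFDerivAt.comp_hasDerivAt θ hd
  have h2 : ∫⁻ p, ENNReal.ofReal (G p ^ 2) ∂ν ≤ ENNReal.ofReal (L ^ 2) := by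
    rw [lintegral_prod (fun p => ENNReal.ofReal (G p ^ 2))
      (hG.measurable.pow_const 2).ennreal_ofReal.aemeasurable]
    have : ∀ x, ∫⁻ y, ENNReal.ofReal (G (x, y) ^ 2) ∂(stdGaussian E) ≤ ENNReal.ofReal (L ^ 2) :=
      fun x => by
        have := integral_dual_sq_stdGaussian (fderiv ℝ g x)
        rw [hGdef]
        simp only
        rw [this]
        exact ENNReal.ofReal_le_ofReal
          (pow_le_pow_left₀ (norm_nonneg _) (norm_fderiv_le_of_lipschitz ℝ hgL) 2)
    refine (lintegral_mono this).trans ?_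
    simp
  -- With u and v the increments of g and f, |v - u| ≤ 2 L gives v² ≤ 2 u² + 8 L². The crude bound
  -- (π/2)² ≤ 4 then leads to 2·4 + 8 = 16.
  have h3 : ∀ p : E × E, ENNReal.ofReal ((f p.2 - f p.1) ^ 2) ≤
      2 * ENNReal.ofReal ((g p.2 - g p.1) ^ 2) + ENNReal.ofReal (8 * L ^ 2) := fun p => by
    have : (2 : ℝ≥0∞) = ENNReal.ofReal 2 := by simp
    rw [this, ← ENNReal.ofReal_mul (by norm_num), ← ENNReal.ofReal_add (by positivity)
      (by positivity)]
    refine ENNReal.ofReal_le_ofReal ?_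
    have a1 := abs_le.1 (hgf p.1)
    have a2 := abs_le.1 (hgf p.2)
    set u := g p.2 - g p.1
    set v := f p.2 - f p.1
    have hd : |v - u| ≤ 2 * L := abs_le.2 ⟨by linarith [a1.1, a1.2, a2.1, a2.2],
      by linarith [a1.1, a1.2, a2.1, a2.2]⟩
    have hd2 : (v - u) ^ 2 ≤ (2 * L) ^ 2 := by
      rw [← sq_abs (v - u)]; exact pow_le_pow_left₀ (abs_nonneg _) hd 2
    nlinarith [sq_nonneg (2 * u - v)]
  have hpi : (Real.pi / 2) ^ 2 ≤ 4 := by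
    have := Real.pi_le_four
    have := Real.pi_pos
    nlinarith
  calc _ ≤ ∫⁻ p, (2 * ENNReal.ofReal ((g p.2 - g p.1) ^ 2) + ENNReal.ofReal (8 * L ^ 2)) ∂ν :=
        lintegral_mono h3
    _ = 2 * ∫⁻ p, ENNReal.ofReal ((g p.2 - g p.1) ^ 2) ∂ν + ENNReal.ofReal (8 * L ^ 2) := by
      rw [lintegral_add_right _ measurable_const, lintegral_const_mul' _ _ (by simp)]
      simp
    _ ≤ 2 * (ENNReal.ofReal 4 * ENNReal.ofReal (L ^ 2)) + ENNReal.ofReal (8 * L ^ 2) := by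
      gcongr
      exact h1.trans (mul_le_mul' (ENNReal.ofReal_le_ofReal hpi) h2)
    _ = _ := by
      have : (2 : ℝ≥0∞) = ENNReal.ofReal 2 := by simp
      rw [this, ← ENNReal.ofReal_mul (by norm_num), ← ENNReal.ofReal_mul (by norm_num),
        ← ENNReal.ofReal_add (by positivity) (by positivity)]
      congr 1; ring

end Gaussian

end ChronOT

namespace ChronOT

/-! ### Spectral formulas -/

/-- One list of eigenvalues serves all f: the diagonalizing unitary cancels under the trace. -/
lemma exists_normTr_cfc {n : ℕ+} {A : Mat n} (hA : IsSelfAdjoint A) :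
    ∃ l : Fin n → ℝ, ∀ f : ℝ → ℝ, normTr (cfc f A) = (((∑ i, f (l i)) / n : ℝ) : ℂ) := by
  have hA' : A.IsHermitian := hA
  refine ⟨hA'.eigenvalues, fun f => ?_⟩
  rw [hA'.cfc_eq, Matrix.IsHermitian.cfc]
  simp only [normTr]
  rw [Unitary.conjStarAlgAut_apply, Matrix.trace_mul_comm, ← mul_assoc]
  simp [Matrix.trace]

lemma exists_normTr_pow {n : ℕ+} {A : Mat n} (hA : IsSelfAdjoint A) :
    ∃ l : Fin n → ℝ, (∀ p : ℕ, normTr (A ^ p) = (((∑ i, l i ^ p) / n : ℝ) : ℂ)) ∧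
      ∀ R : ℝ, hsSq (A - cfc (cutoff R) A) = (∑ i, (l i - cutoff R (l i)) ^ 2) / n := by
  obtain ⟨l, hl⟩ := exists_normTr_cfc hA
  refine ⟨l, fun p => ?_, fun R => ?_⟩
  · rw [← hl fun t => t ^ p, cfc_pow_id (R := ℝ) A p]
  · have hc := continuous_cutoff R
    have e1 : A - cfc (cutoff R) A = cfc (fun t => t - cutoff R t) A := by
      rw [cfc_sub (fun t => t) (cutoff R) A, cfc_id' ℝ A]
    have e2 : star (A - cfc (cutoff R) A) * (A - cfc (cutoff R) A) =
        cfc (fun t => (t - cutoff R t) ^ 2) A := by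
      have : IsSelfAdjoint (A - cfc (cutoff R) A) := by
        rw [e1]; exact cfc_predicate _ A
      rw [this.star_eq, e1, ← cfc_mul _ _ A (by fun_prop) (by fun_prop)]
      simp only [sq]
    rw [hsSq, e2, hl, Complex.ofReal_re]

/-- The real part of the normalized trace of a power. -/
noncomputable def trPow {n : ℕ+} (p : ℕ) (A : Mat n) : ℝ := (normTr (A ^ p)).re

lemma ofReal_trPow {n : ℕ+} {A : Mat n} (hA : IsSelfAdjoint A) (p : ℕ) :
    ((trPow p A : ℝ) : ℂ) = normTr (A ^ p) := by
  obtain ⟨l, hl, -⟩ := exists_normTr_pow hA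
  rw [trPow, hl, Complex.ofReal_re]

lemma trPow_zero {n : ℕ+} (A : Mat n) : trPow 0 A = 1 := by
  simp [trPow, normTr_one]

lemma continuous_trPow {n : ℕ+} (p : ℕ) : Continuous (trPow p : Mat n → ℝ) := by
  unfold trPow
  exact Complex.continuous_re.comp (continuous_normTr.comp (continuous_pow p))

lemma abs_trPow_le {n : ℕ+} (A : Mat n) (p : ℕ) : |trPow p A| ≤ ‖A‖ ^ p := by
  unfold trPow
  refine (Complex.abs_re_le_norm _).trans ((norm_normTr_le _).trans ((hsN_le_norm _).trans ?_))
  exact norm_pow_le _ _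

/-- Chebyshev's sum inequality: |λ|ᵖ and |λ|^q are ordered in the same way along the spectrum, so
the product of their means is at most the mean of their product. -/
lemma abs_trPow_mul_trPow_le {n : ℕ+} {A : Mat n} (hA : IsSelfAdjoint A) {p q k : ℕ}
    (h : p + q = 2 * k) : |trPow p A * trPow q A| ≤ trPow (2 * k) A := by
  obtain ⟨l, hl, -⟩ := exists_normTr_pow hA
  have hn : (0 : ℝ) < (n : ℝ) := by exact_mod_cast n.pos
  simp only [trPow, hl, Complex.ofReal_re]
  rw [abs_mul, abs_div, abs_div, abs_of_pos hn, div_mul_div_comm,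
    div_le_div_iff₀ (by positivity) hn]
  have h1 : Monovary (fun i => |l i| ^ p) (fun i => |l i| ^ q) := by
    intro i j hij
    by_contra! hc
    have : |l j| < |l i| := lt_of_pow_lt_pow_left₀ p (abs_nonneg _) hc
    exact absurd (pow_le_pow_left₀ (abs_nonneg _) this.le q) (not_le.2 hij)
  have h2 := h1.sum_mul_sum_le_card_mul_sum
  have h3 : ∑ i, |l i| ^ p * |l i| ^ q = ∑ i, l i ^ (2 * k) :=
    Finset.sum_congr rfl fun i _ => by rw [← pow_add, h, pow_mul, sq_abs, ← pow_mul]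
  have h4 : ∀ p, |∑ i, l i ^ p| ≤ ∑ i, |l i| ^ p := fun p =>
    (Finset.abs_sum_le_sum_abs _ _).trans (by simp [abs_pow])
  rw [h3, Fintype.card_fin] at h2
  calc |∑ i, l i ^ p| * |∑ i, l i ^ q| * n ≤ ((∑ i, |l i| ^ p) * ∑ i, |l i| ^ q) * n := by
        gcongr <;> apply h4
    _ ≤ (n * ∑ i, l i ^ (2 * k)) * n := by gcongr
    _ = _ := by ring

lemma trPow_two_mul_nonneg {n : ℕ+} {A : Mat n} (hA : IsSelfAdjoint A) (k : ℕ) :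
    0 ≤ trPow (2 * k) A :=
  (abs_nonneg _).trans (abs_trPow_mul_trPow_le hA (p := k) (q := k) (by ring))

/-- Nothing is cut off when |t| ≤ R. Otherwise the residual is at most |t|, and the right side
equals t² (t²/R²)ᵏ with t²/R² > 1. -/
lemma sq_sub_cutoff_le {R : ℝ} (hR : 0 < R) (t : ℝ) (k : ℕ) :
    (t - cutoff R t) ^ 2 ≤ R ^ 2 * (t ^ (2 * (k + 1)) / R ^ (2 * (k + 1))) := by
  rcases le_or_gt |t| R with h | h
  · have : cutoff R t = t := by
      rw [abs_le] at h
      rw [cutoff, max_eq_left h.1, min_eq_left h.2]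
    rw [this, sub_self, zero_pow two_ne_zero, pow_mul t]
    positivity
  · have h1 : (t - cutoff R t) ^ 2 ≤ t ^ 2 := by
      rw [sq_le_sq]
      unfold cutoff
      rcases lt_abs.1 h with h | h
      · rw [max_eq_left (by linarith), min_eq_right h.le, abs_of_pos (by linarith),
          abs_of_pos (by linarith)]
        linarith
      · rw [max_eq_right (by linarith), min_eq_left (by linarith), abs_of_neg (by linarith),
          abs_of_neg (by linarith)]
        linarith
    have h2 : 1 ≤ t ^ 2 / R ^ 2 := by
      rw [one_le_div (by positivity)]
      exact sq_le_sq.2 (by rw [abs_of_pos hR]; exact h.le)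
    refine h1.trans ?_
    rw [pow_mul t, pow_mul R, ← div_pow]
    calc t ^ 2 = R ^ 2 * (1 * (t ^ 2 / R ^ 2)) := by field_simp
      _ ≤ R ^ 2 * ((t ^ 2 / R ^ 2) ^ k * (t ^ 2 / R ^ 2)) := by
          gcongr; exact one_le_pow₀ h2
      _ = _ := by rw [pow_succ (t ^ 2 / R ^ 2)]

lemma hsSq_sub_cutoff_le {n : ℕ+} {A : Mat n} (hA : IsSelfAdjoint A) {R : ℝ} (hR : 0 < R)
    (k : ℕ) : hsSq (A - cfc (cutoff R) A) ≤
      R ^ 2 * (trPow (2 * (k + 1)) A / R ^ (2 * (k + 1))) := by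
  obtain ⟨l, hl, hl'⟩ := exists_normTr_pow hA
  have hn : (0 : ℝ) < (n : ℝ) := by exact_mod_cast n.pos
  rw [hl', trPow, hl, Complex.ofReal_re, div_right_comm, ← mul_div_assoc]
  gcongr
  rw [Finset.sum_div, Finset.mul_sum]
  exact Finset.sum_le_sum fun i _ => sq_sub_cutoff_le hR _ k

/-! ### Moments of Gaussian Hermitian matrices -/

section Gaussian

lemma integrable_of_norm_le_pow {F : Type*} [NormedAddCommGroup F] [NormedSpace ℝ F]
    [MeasurableSpace F] [BorelSpace F] [CompleteSpace F] [SecondCountableTopology F]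
    {ν : Measure F} [IsGaussian ν] {G : Type*} [NormedAddCommGroup G]
    [SecondCountableTopology G] [MeasurableSpace G] [BorelSpace G]
    {f : F → G} (hf : Continuous f) {C : ℝ} {k : ℕ} (h : ∀ x, ‖f x‖ ≤ C * ‖x‖ ^ k) :
    Integrable f ν := by
  have h1 : Integrable (fun x : F => ‖x‖ ^ k) ν := by
    simpa using (IsGaussian.memLp_id ν k (by simp)).integrable_norm_pow'
  exact Integrable.mono' (h1.const_mul C) hf.aestronglyMeasurable (Eventually.of_forall h)

variable {E : Type*} [NormedAddCommGroup E] [InnerProductSpace ℝ E] [FiniteDimensional ℝ E]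
  [MeasurableSpace E] [BorelSpace E]

/-- A linear image of the standard Gaussian vector that is a Gaussian unitary ensemble with
covariance `τ / n`. -/
structure IsGUE {n : ℕ+} (H : E →L[ℝ] Mat n) (τ : ℝ) : Prop where
  isSelfAdjoint : ∀ x, IsSelfAdjoint (H x)
  nonneg : 0 ≤ τ
  cov : ∀ a b c d, ∫ x, H x a b * H x c d ∂(stdGaussian E) =
    if a = d ∧ b = c then ((τ / n : ℝ) : ℂ) else 0

variable {n : ℕ+} {H : E →L[ℝ] Mat n} {τ : ℝ}

lemma norm_entry_le (A : Mat n) (a b : Fin n) : ‖A a b‖ ≤ ‖A‖ := by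
  have h := A.l2_opNorm_mulVec (EuclideanSpace.single b 1)
  rw [PiLp.norm_single, norm_one, mul_one] at h
  refine le_trans ?_ h
  refine le_trans (le_of_eq ?_) (PiLp.norm_apply_le _ a)
  simp

lemma integrable_entry_mul (H : E →L[ℝ] Mat n) (a b c d : Fin n) :
    Integrable (fun x => H x a b * H x c d) (stdGaussian E) := by
  have hc : ∀ a b, Continuous fun x => H x a b := fun a b =>
    (continuous_id.matrix_elem a b).comp H.continuous
  refine integrable_of_norm_le_pow (C := ‖H‖ ^ 2) (k := 2) ((hc a b).mul (hc c d)) fun x => ?_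
  rw [norm_mul, ← mul_pow, sq]
  exact mul_le_mul ((norm_entry_le _ _ _).trans (H.le_opNorm x))
    ((norm_entry_le _ _ _).trans (H.le_opNorm x)) (norm_nonneg _) (by positivity)

/-- The covariance pairs the outer and the inner indices separately, so the single trace splits into
a product of two. -/
lemma IsGUE.integral_normTr_mul (h : IsGUE H τ) (A B : Mat n) :
    ∫ y, normTr (H y * A * H y * B) ∂(stdGaussian E) = τ * normTr A * normTr B := by
  have e : ∀ y, normTr (H y * A * H y * B) =
      ∑ a, ∑ d, ∑ c, ∑ b, (A b c * B d a / n) * (H y a b * H y c d) := by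
    intro y
    simp only [normTr, Matrix.trace, Matrix.diag_apply, Matrix.mul_apply, Finset.sum_mul,
      Finset.sum_div]
    refine Finset.sum_congr rfl fun a _ => Finset.sum_congr rfl fun d _ =>
      Finset.sum_congr rfl fun c _ => Finset.sum_congr rfl fun b _ => ?_
    ring
  simp only [e]
  have hi : ∀ a b c d, Integrable (fun y => (A b c * B d a / n) * (H y a b * H y c d))
    (stdGaussian E) := fun a b c d => (integrable_entry_mul H a b c d).const_mul _
  rw [integral_finsetSum _ fun a _ => integrable_finsetSum _ fun d _ =>
    integrable_finsetSum _ fun c _ => integrable_finsetSum _ fun b _ => hi a b c d]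
  calc _ = ∑ a, ∑ d, ∑ c, ∑ b, (A b c * B d a / n) *
        (if a = d ∧ b = c then ((τ / n : ℝ) : ℂ) else 0) := by
        refine Finset.sum_congr rfl fun a _ => ?_
        rw [integral_finsetSum _ fun d _ =>
          integrable_finsetSum _ fun c _ => integrable_finsetSum _ fun b _ => hi a b c d]
        refine Finset.sum_congr rfl fun d _ => ?_
        rw [integral_finsetSum _ fun c _ => integrable_finsetSum _ fun b _ => hi a b c d]
        refine Finset.sum_congr rfl fun c _ => ?_
        rw [integral_finsetSum _ fun b _ => hi a b c d]
        exact Finset.sum_congr rfl fun b _ => by rw [integral_const_mul, h.cov]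
    _ = ∑ a, ∑ c, A c c * B a a / n * (τ / n) := by
        refine Finset.sum_congr rfl fun a _ => ?_
        rw [Finset.sum_eq_single a (fun d _ hd => Finset.sum_eq_zero fun c _ =>
          Finset.sum_eq_zero fun b _ => by
            rw [if_neg fun hh => hd hh.1.symm, mul_zero]) (by simp)]
        refine Finset.sum_congr rfl fun c _ => ?_
        rw [Finset.sum_eq_single c (fun b _ hb => by
            rw [if_neg fun hh => hb hh.2, mul_zero]) (by simp)]
        simp
    _ = _ := by
        simp only [normTr, Matrix.trace, Matrix.diag_apply, Finset.sum_mul, Finset.mul_sum,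
          Finset.sum_div]
        exact Finset.sum_congr rfl fun a _ => Finset.sum_congr rfl fun c _ => by ring

lemma normTr_eq_re {A : Mat n} (hA : IsSelfAdjoint A) : ((normTr A).re : ℂ) = normTr A := by
  simpa [trPow] using ofReal_trPow hA 1

/-- The pairing leaves one trace only. The factor n⁻² appearing here is the source of the
concentration of traces. -/
lemma IsGUE.integral_sq_re_normTr_mul (h : IsGUE H τ) {B : Mat n} (hB : IsSelfAdjoint B) :
    ∫ y, (normTr (B * H y)).re ^ 2 ∂(stdGaussian E) = τ / n ^ 2 * (normTr (B * B)).re := by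
  have e0 : ∀ y, (((normTr (B * H y)).re : ℝ) : ℂ) = normTr (B * H y) := by
    intro y
    rw [Complex.ext_iff]
    refine ⟨rfl, ?_⟩
    have : normTr (star (B * H y)) = normTr (B * H y) := by
      rw [star_mul, hB.star_eq, (h.isSelfAdjoint y).star_eq, normTr_mul_comm]
    rw [normTr_star] at this
    exact (Complex.conj_eq_iff_im.1 this).symm
  have e : ∀ y, normTr (B * H y) ^ 2 =
      ∑ a, ∑ b, ∑ c, ∑ d, (B a b * B c d / n ^ 2) * (H y b a * H y d c) := by
    intro y
    simp only [normTr, Matrix.trace, Matrix.diag_apply, Matrix.mul_apply, sq, Finset.sum_mul,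
      Finset.sum_div]
    refine Finset.sum_congr rfl fun a _ => Finset.sum_congr rfl fun b _ => ?_
    simp only [Finset.mul_sum]
    refine Finset.sum_congr rfl fun c _ => Finset.sum_congr rfl fun d _ => ?_
    ring
  apply Complex.ofReal_injective
  rw [← integral_complex_ofReal]
  push_cast
  simp only [e0, e]
  have hi : ∀ a b c d, Integrable (fun y => (B a b * B c d / n ^ 2) * (H y b a * H y d c))
    (stdGaussian E) := fun a b c d => (integrable_entry_mul H b a d c).const_mul _
  rw [integral_finsetSum _ fun a _ => integrable_finsetSum _ fun b _ =>
    integrable_finsetSum _ fun c _ => integrable_finsetSum _ fun d _ => hi a b c d]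
  calc _ = ∑ a, ∑ b, ∑ c, ∑ d, (B a b * B c d / n ^ 2) *
        (if b = c ∧ a = d then ((τ / n : ℝ) : ℂ) else 0) := by
        refine Finset.sum_congr rfl fun a _ => ?_
        rw [integral_finsetSum _ fun b _ =>
          integrable_finsetSum _ fun c _ => integrable_finsetSum _ fun d _ => hi a b c d]
        refine Finset.sum_congr rfl fun b _ => ?_
        rw [integral_finsetSum _ fun c _ => integrable_finsetSum _ fun d _ => hi a b c d]
        refine Finset.sum_congr rfl fun c _ => ?_
        rw [integral_finsetSum _ fun d _ => hi a b c d]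
        exact Finset.sum_congr rfl fun d _ => by rw [integral_const_mul, h.cov]
    _ = ∑ a, ∑ b, B a b * B b a / n ^ 2 * (τ / n) := by
        refine Finset.sum_congr rfl fun a _ => Finset.sum_congr rfl fun b _ => ?_
        rw [Finset.sum_eq_single b (fun c _ hc => Finset.sum_eq_zero fun d _ => by
            rw [if_neg fun hh => hc hh.1.symm, mul_zero]) (by simp),
          Finset.sum_eq_single a (fun d _ hd => by
            rw [if_neg fun hh => hd hh.2.symm, mul_zero]) (by simp)]
        simp
    _ = _ := by
        have hBB : IsSelfAdjoint (B * B) := by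
          rw [isSelfAdjoint_iff, star_mul, hB.star_eq]
        rw [normTr_eq_re hBB]
        simp only [normTr, Matrix.trace, Matrix.diag_apply, Matrix.mul_apply, Finset.mul_sum,
          Finset.sum_div]
        exact Finset.sum_congr rfl fun a _ => Finset.sum_congr rfl fun c _ => by ring

lemma hasDerivAt_rotate_fst (q : E × E) (θ : ℝ) :
    HasDerivAt (fun θ => (rotate θ q).1) ((rotate θ q).2) θ :=
  ((Real.hasDerivAt_cos θ).smul_const q.1).add ((Real.hasDerivAt_sin θ).smul_const q.2)

lemma hasDerivAt_rotate_snd (q : E × E) (θ : ℝ) :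
    HasDerivAt (fun θ => (rotate θ q).2) (-(rotate θ q).1) θ := by
  have h : HasDerivAt (fun θ => (rotate θ q).2)
      (-Real.cos θ • q.1 + -Real.sin θ • q.2) θ :=
    (HasDerivAt.smul_const (c := fun θ => -Real.sin θ) (Real.hasDerivAt_sin θ).neg q.1).add
      ((Real.hasDerivAt_cos θ).smul_const q.2)
  refine h.congr_deriv ?_
  simp only [rotate, neg_add, neg_smul]

lemma hasDerivAt_normTr {f : ℝ → Mat n} {f' : Mat n} {θ : ℝ} (h : HasDerivAt f f' θ) :
    HasDerivAt (fun t => normTr (f t)) (normTr f') θ := by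
  let L : Mat n →ₗ[ℝ] ℂ :=
    { toFun := normTr
      map_add' := fun X Y => normTr_add X Y
      map_smul' := fun c X => by
        simp [normTr, Matrix.trace_smul, mul_div_assoc] }
  exact (LinearMap.toContinuousLinearMap L).hasFDerivAt.comp_hasDerivAt θ h

/-- The Schwinger-Dyson recursion. -/
lemma IsGUE.integral_trPow (h : IsGUE H τ) (p : ℕ) :
    ∫ x, trPow (p + 2) (H x) ∂(stdGaussian E) =
      τ * ∑ i ∈ Finset.range (p + 1),
        ∫ x, trPow i (H x) * trPow (p - i) (H x) ∂(stdGaussian E) := by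
  set μ := stdGaussian E with hμ
  -- Differentiating F along the rotation produces -`G₁` from the factor `H q.2` and the sum of the
  -- `G₂ i` from the power. The derivative has mean zero, and averaging `G₂ i` over the second copy
  -- gives a product of two traces.
  set F : E × E → ℂ := fun q => normTr (H q.2 * H q.1 ^ (p + 1)) with hF
  set G₁ : E × E → ℂ := fun q => normTr (H q.1 * H q.1 ^ (p + 1)) with hG1
  set G₂ : ℕ → E × E → ℂ := fun i q =>
    normTr (H q.2 * H q.1 ^ (p - i) * H q.2 * H q.1 ^ i) with hG2
  have hc1 : Continuous fun q : E × E => H q.1 := H.continuous.comp continuous_fst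
  have hc2 : Continuous fun q : E × E => H q.2 := H.continuous.comp continuous_snd
  have cF : Continuous F := continuous_normTr.comp (hc2.mul (hc1.pow _))
  have cG1 : Continuous G₁ := continuous_normTr.comp (hc1.mul (hc1.pow _))
  have cG2 : ∀ i, Continuous (G₂ i) := fun i =>
    continuous_normTr.comp (((hc2.mul (hc1.pow _)).mul hc2).mul (hc1.pow _))
  have hb1 : ∀ q : E × E, ‖H q.1‖ ≤ ‖H‖ * ‖q‖ := fun q =>
    (H.le_opNorm _).trans (by gcongr; exact norm_fst_le q)
  have hb2 : ∀ q : E × E, ‖H q.2‖ ≤ ‖H‖ * ‖q‖ := fun q =>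
    (H.le_opNorm _).trans (by gcongr; exact norm_snd_le q)
  have hbp : ∀ (q : E × E) (i : ℕ), ‖H q.1 ^ i‖ ≤ (‖H‖ * ‖q‖) ^ i := fun q i =>
    (_root_.norm_pow_le _ _).trans (pow_le_pow_left₀ (norm_nonneg _) (hb1 q) i)
  have htr : ∀ X : Mat n, ‖normTr X‖ ≤ ‖X‖ := fun X =>
    (norm_normTr_le X).trans (hsN_le_norm X)
  have iF : Integrable F (μ.prod μ) := by
    refine integrable_of_norm_le_pow (C := ‖H‖ ^ (p + 2)) (k := p + 2) cF fun q => ?_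
    refine (htr _).trans ((norm_mul_le _ _).trans ?_)
    rw [← mul_pow, pow_succ' _ (p + 1)]
    exact mul_le_mul (hb2 q) (hbp q _) (norm_nonneg _) (by positivity)
  have iG1 : Integrable G₁ (μ.prod μ) := by
    refine integrable_of_norm_le_pow (C := ‖H‖ ^ (p + 2)) (k := p + 2) cG1 fun q => ?_
    refine (htr _).trans ((norm_mul_le _ _).trans ?_)
    rw [← mul_pow, pow_succ' _ (p + 1)]
    exact mul_le_mul (hb1 q) (hbp q _) (norm_nonneg _) (by positivity)
  have iG2 : ∀ i ∈ Finset.range (p + 1), Integrable (G₂ i) (μ.prod μ) := by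
    intro i hi
    have hi' : i ≤ p := by simpa [Nat.lt_succ_iff] using hi
    refine integrable_of_norm_le_pow (C := ‖H‖ ^ (p + 2)) (k := p + 2) (cG2 i) fun q => ?_
    refine (htr _).trans ?_
    have e : ‖H‖ ^ (p + 2) * ‖q‖ ^ (p + 2) = (‖H‖ * ‖q‖) * (‖H‖ * ‖q‖) ^ (p - i) *
        (‖H‖ * ‖q‖) * (‖H‖ * ‖q‖) ^ i := by
      rw [← mul_pow]
      obtain ⟨j, rfl⟩ := Nat.exists_eq_add_of_le hi'
      rw [Nat.add_sub_cancel_left]; ring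
    rw [e]
    refine (norm_mul_le _ _).trans (mul_le_mul ?_ (hbp q _) (norm_nonneg _) (by positivity))
    refine (norm_mul_le _ _).trans (mul_le_mul ?_ (hb2 q) (norm_nonneg _) (by positivity))
    exact (norm_mul_le _ _).trans (mul_le_mul (hb2 q) (hbp q _) (norm_nonneg _) (by positivity))
  have iS : Integrable (fun q => ∑ i ∈ Finset.range (p + 1), G₂ i q) (μ.prod μ) :=
    integrable_finsetSum _ iG2
  have key : ∫ q, (-G₁ q + ∑ i ∈ Finset.range (p + 1), G₂ i q) ∂(μ.prod μ) = 0 := by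
    refine integral_eq_zero_of_hasDerivAt measurePreserving_rotate
      (cG1.neg.add (continuous_finsetSum _ fun i _ => cG2 i)) iF (iG1.neg.add iS) ?_
    intro q θ
    have e1 : HasDerivAt (fun θ => H (rotate θ q).1) (H (rotate θ q).2) θ :=
      H.hasFDerivAt.comp_hasDerivAt θ (hasDerivAt_rotate_fst q θ)
    have e2 : HasDerivAt (fun θ => H (rotate θ q).2) (H (-(rotate θ q).1)) θ :=
      H.hasFDerivAt.comp_hasDerivAt θ (hasDerivAt_rotate_snd q θ)
    have e3 := hasDerivAt_normTr (e2.mul (e1.fun_pow' (p + 1)))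
    refine HasDerivAt.congr_deriv e3 ?_
    rw [normTr_add, map_neg, neg_mul, Finset.mul_sum]
    congr 1
    · simp only [hG1, normTr, Matrix.trace_neg, neg_div]
    · simp only [hG2, normTr, Matrix.trace_sum, Finset.sum_div]
      exact Finset.sum_congr rfl fun i _ => by simp only [Nat.pred_succ, mul_assoc]
  have iN : Integrable (fun q => -G₁ q) (μ.prod μ) := iG1.neg
  rw [integral_add iN iS, integral_neg, integral_finsetSum _ iG2, neg_add_eq_zero,
    integral_prod _ iG1] at key
  apply Complex.ofReal_injective
  push_cast
  rw [← integral_complex_ofReal, Finset.mul_sum]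
  convert key using 1
  · simp only [hG1, integral_const, probReal_univ, one_smul, ← pow_succ']
    exact integral_congr_ae (Eventually.of_forall fun x => ofReal_trPow (h.isSelfAdjoint x) _)
  · refine Finset.sum_congr rfl fun i hi => ?_
    rw [integral_prod _ (iG2 i hi), ← integral_complex_ofReal, ← integral_const_mul]
    refine integral_congr_ae (Eventually.of_forall fun x => ?_)
    simp only [hG2]
    rw [h.integral_normTr_mul]
    push_cast
    rw [ofReal_trPow (h.isSelfAdjoint x), ofReal_trPow (h.isSelfAdjoint x)]
    ring

lemma integrable_trPow (H : E →L[ℝ] Mat n) (p : ℕ) :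
    Integrable (fun x => trPow p (H x)) (stdGaussian E) := by
  refine integrable_of_norm_le_pow (C := ‖H‖ ^ p) (k := p)
    ((continuous_trPow p).comp H.continuous) fun x => ?_
  rw [← mul_pow]
  exact (abs_trPow_le _ _).trans (pow_le_pow_left₀ (norm_nonneg _) (H.le_opNorm x) p)

lemma integrable_trPow_mul_trPow (H : E →L[ℝ] Mat n) (p q : ℕ) :
    Integrable (fun x => trPow p (H x) * trPow q (H x)) (stdGaussian E) := by
  refine integrable_of_norm_le_pow (C := ‖H‖ ^ (p + q)) (k := p + q)
    (((continuous_trPow p).comp H.continuous).mul ((continuous_trPow q).comp H.continuous))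
    fun x => ?_
  rw [← mul_pow, pow_add, norm_mul]
  exact mul_le_mul
    ((abs_trPow_le _ _).trans (pow_le_pow_left₀ (norm_nonneg _) (H.le_opNorm x) p))
    ((abs_trPow_le _ _).trans (pow_le_pow_left₀ (norm_nonneg _) (H.le_opNorm x) q))
    (norm_nonneg _) (by positivity)

/-- The crude moment bounds `∏ τ (2 i + 1)`. -/
noncomputable def crudeMoment (τ : ℝ) : ℕ → ℝ
  | 0 => 1
  | k + 1 => τ * ((2 * k + 1) * crudeMoment τ k)

/-- Each of the 2k+1 terms of the recursion is at most the moment of order 2k. These weak bounds are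
used only to control variances. -/
lemma IsGUE.integral_trPow_le_crudeMoment (h : IsGUE H τ) (k : ℕ) :
    ∫ x, trPow (2 * k) (H x) ∂(stdGaussian E) ≤ crudeMoment τ k := by
  induction k with
  | zero => simp [trPow_zero, crudeMoment]
  | succ k ih =>
    rw [show 2 * (k + 1) = 2 * k + 2 by ring, h.integral_trPow, crudeMoment]
    refine mul_le_mul_of_nonneg_left ?_ h.nonneg
    calc _ ≤ ∑ i ∈ Finset.range (2 * k + 1), crudeMoment τ k := by
          refine Finset.sum_le_sum fun i hi => le_trans ?_ ih
          have hi' : i ≤ 2 * k := by simpa [Nat.lt_succ_iff] using hi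
          refine integral_mono (integrable_trPow_mul_trPow H _ _) (integrable_trPow H _) fun x => ?_
          exact (le_abs_self _).trans
            (abs_trPow_mul_trPow_le (h.isSelfAdjoint x) (by omega))
      _ = _ := by simp

/-- Rotation by π preserves the Gaussian measure and changes the sign of H. -/
lemma integral_trPow_odd (H : E →L[ℝ] Mat n) (k : ℕ) :
    ∫ x, trPow (2 * k + 1) (H x) ∂(stdGaussian E) = 0 := by
  have h1 : ∫ p, trPow (2 * k + 1) (H p.1) ∂((stdGaussian E).prod (stdGaussian E)) =
      ∫ p, -trPow (2 * k + 1) (H p.1) ∂((stdGaussian E).prod (stdGaussian E)) := by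
    have hm := measurable_rotate (E := E) Real.pi
    have hc : Continuous fun p : E × E => trPow (2 * k + 1) (H p.1) :=
      (continuous_trPow _).comp (H.continuous.comp continuous_fst)
    conv_lhs => rw [← map_rotate (E := E) Real.pi,
      integral_map hm.aemeasurable hc.aestronglyMeasurable]
    congr 1
    funext p
    have : H (rotate Real.pi p).1 = -H p.1 := by simp [rotate]
    rw [this, trPow, trPow, Odd.neg_pow ⟨k, rfl⟩]
    simp [normTr, neg_div]
  rw [integral_neg, integral_fun_fst (μ := stdGaussian E) (ν := stdGaussian E)
    (f := fun x => trPow (2 * k + 1) (H x))] at h1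
  simp only [probReal_univ, one_smul] at h1
  linarith

/-- Poincaré's inequality for tr H^(p+1): its derivative is (p+1) tr(Hᵖ H'), whose second moment
over the independent copy is (p+1)² τ n⁻² tr H^(2p). -/
lemma IsGUE.integral_sq_sub_le (h : IsGUE H τ) (p : ℕ) :
    ∫ q, (trPow (p + 1) (H q.2) - trPow (p + 1) (H q.1)) ^ 2
        ∂((stdGaussian E).prod (stdGaussian E)) ≤
      (Real.pi / 2) ^ 2 * ((p + 1) ^ 2 * τ * crudeMoment τ p) / n ^ 2 := by
  set μ := stdGaussian E with hμ
  set G : E × E → ℝ := fun q => (p + 1) * (normTr (H q.1 ^ p * H q.2)).re with hG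
  have hc1 : Continuous fun q : E × E => H q.1 := H.continuous.comp continuous_fst
  have hc2 : Continuous fun q : E × E => H q.2 := H.continuous.comp continuous_snd
  have cG : Continuous G := continuous_const.mul
    (Complex.continuous_re.comp (continuous_normTr.comp ((hc1.pow _).mul hc2)))
  have key := lintegral_sub_sq_le_of_hasDerivAt (E := E) (F := fun x => trPow (p + 1) (H x))
    measurePreserving_rotate cG (fun q θ => by
      have e1 : HasDerivAt (fun θ => H (rotate θ q).1) (H (rotate θ q).2) θ :=
        H.hasFDerivAt.comp_hasDerivAt θ (hasDerivAt_rotate_fst q θ)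
      have e2 := hasDerivAt_normTr (e1.fun_pow' (p + 1))
      have e3 : HasDerivAt (fun θ => (normTr (H (rotate θ q).1 ^ (p + 1))).re) _ θ :=
        Complex.reCLM.hasFDerivAt.comp_hasDerivAt θ e2
      refine HasDerivAt.congr_deriv e3 ?_
      have : ∀ i ∈ Finset.range (p + 1), normTr (H (rotate θ q).1 ^ ((p + 1).pred - i) *
          H (rotate θ q).2 * H (rotate θ q).1 ^ i) =
          normTr (H (rotate θ q).1 ^ p * H (rotate θ q).2) := by
        intro i hi
        have hi' : i ≤ p := by simpa [Nat.lt_succ_iff] using hi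
        rw [normTr_mul_comm, ← mul_assoc, ← pow_add, Nat.pred_succ, Nat.add_sub_cancel' hi']
      have hs : normTr (∑ i ∈ Finset.range (p + 1), H (rotate θ q).1 ^ ((p + 1).pred - i) *
          H (rotate θ q).2 * H (rotate θ q).1 ^ i) =
          (p + 1) * normTr (H (rotate θ q).1 ^ p * H (rotate θ q).2) := by
        rw [normTr, Matrix.trace_sum, Finset.sum_div]
        change ∑ i ∈ Finset.range (p + 1), normTr _ = _
        rw [Finset.sum_congr rfl this]; simp
      rw [hs]
      simp [hG])
  have htr : ∀ X : Mat n, ‖normTr X‖ ≤ ‖X‖ := fun X =>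
    (norm_normTr_le X).trans (hsN_le_norm X)
  have iG : Integrable (fun q => G q ^ 2) (μ.prod μ) := by
    refine integrable_of_norm_le_pow (C := (p + 1) ^ 2 * ‖H‖ ^ (2 * (p + 1))) (k := 2 * (p + 1))
      (cG.pow 2) fun q => ?_
    rw [norm_pow]
    have : ‖G q‖ ≤ (p + 1) * (‖H‖ * ‖q‖) ^ (p + 1) := by
      rw [hG, norm_mul, Real.norm_of_nonneg (by positivity : (0 : ℝ) ≤ p + 1)]
      gcongr
      refine (Complex.abs_re_le_norm _).trans ((htr _).trans ((norm_mul_le _ _).trans ?_))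
      rw [pow_succ]
      refine mul_le_mul ((_root_.norm_pow_le _ _).trans (pow_le_pow_left₀ (norm_nonneg _) ?_ _))
        ?_ (norm_nonneg _) (by positivity)
      · exact (H.le_opNorm _).trans (by gcongr; exact norm_fst_le q)
      · exact (H.le_opNorm _).trans (by gcongr; exact norm_snd_le q)
    refine (pow_le_pow_left₀ (norm_nonneg _) this 2).trans (le_of_eq ?_)
    ring
  have hGi : ∫ q, G q ^ 2 ∂(μ.prod μ) ≤ (p + 1) ^ 2 * τ * crudeMoment τ p / n ^ 2 := by
    rw [integral_prod _ iG]
    have : ∀ x, ∫ y, G (x, y) ^ 2 ∂μ = (p + 1) ^ 2 * (τ / n ^ 2) * trPow (2 * p) (H x) := by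
      intro x
      simp only [hG, mul_pow, integral_const_mul]
      rw [h.integral_sq_re_normTr_mul ((h.isSelfAdjoint x).pow p), ← pow_add, ← two_mul, trPow]
      ring
    simp only [this, integral_const_mul]
    calc _ ≤ (p + 1) ^ 2 * (τ / n ^ 2) * crudeMoment τ p := by
          refine mul_le_mul_of_nonneg_left (h.integral_trPow_le_crudeMoment p) ?_
          have := h.nonneg
          positivity
      _ = _ := by ring
  have cT : Continuous fun q : E × E => (trPow (p + 1) (H q.2) - trPow (p + 1) (H q.1)) ^ 2 :=
    (((continuous_trPow _).comp hc2).sub ((continuous_trPow _).comp hc1)).pow 2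
  rw [integral_eq_lintegral_of_nonneg_ae (Eventually.of_forall fun q => sq_nonneg _)
    cT.aestronglyMeasurable]
  refine ENNReal.toReal_le_of_le_ofReal ?_ (key.trans ?_)
  · have := h.nonneg
    have := (integral_nonneg fun x => trPow_two_mul_nonneg (h.isSelfAdjoint x) p).trans
      (h.integral_trPow_le_crudeMoment p)
    positivity
  · rw [← ofReal_integral_eq_lintegral_ofReal iG (Eventually.of_forall fun q => sq_nonneg _),
      ← ENNReal.ofReal_mul (by positivity), mul_div_assoc]
    exact ENNReal.ofReal_le_ofReal (by gcongr)

lemma exists_integral_sq_sub_le (τ : ℝ) (p : ℕ) : ∃ D : ℝ, 0 ≤ D ∧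
    ∀ {E : Type} [NormedAddCommGroup E] [InnerProductSpace ℝ E] [FiniteDimensional ℝ E]
      [MeasurableSpace E] [BorelSpace E] {n : ℕ+} {H : E →L[ℝ] Mat n}, IsGUE H τ →
      ∫ q, (trPow p (H q.2) - trPow p (H q.1)) ^ 2
        ∂((stdGaussian E).prod (stdGaussian E)) ≤ D / n ^ 2 := by
  cases p with
  | zero => exact ⟨0, le_rfl, fun h => by simp [trPow_zero]⟩
  | succ p =>
    refine ⟨max ((Real.pi / 2) ^ 2 * ((p + 1) ^ 2 * τ * crudeMoment τ p)) 0, le_max_right _ _,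
      fun h => (h.integral_sq_sub_le p).trans ?_⟩
    gcongr
    exact le_max_left _ _

/-- The covariance is half the mean of the product of the two differences over independent copies,
and a product is at most the sum of the squares. -/
lemma integral_trPow_mul_le (H : E →L[ℝ] Mat n) (i j : ℕ) :
    ∫ x, trPow i (H x) * trPow j (H x) ∂(stdGaussian E) ≤
      (∫ x, trPow i (H x) ∂(stdGaussian E)) * (∫ x, trPow j (H x) ∂(stdGaussian E)) +
      (∫ q, (trPow i (H q.2) - trPow i (H q.1)) ^ 2
        ∂((stdGaussian E).prod (stdGaussian E)) +
      ∫ q, (trPow j (H q.2) - trPow j (H q.1)) ^ 2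
        ∂((stdGaussian E).prod (stdGaussian E))) := by
  set μ := stdGaussian E
  set f : E → ℝ := fun x => trPow i (H x)
  set g : E → ℝ := fun x => trPow j (H x)
  have hf : Integrable f μ := integrable_trPow H i
  have hg : Integrable g μ := integrable_trPow H j
  have hff : Integrable (fun x => f x * f x) μ := integrable_trPow_mul_trPow H i i
  have hgg : Integrable (fun x => g x * g x) μ := integrable_trPow_mul_trPow H j j
  have hfg : Integrable (fun x => f x * g x) μ := integrable_trPow_mul_trPow H i j
  have h2 : ∀ (a b : E → ℝ), Integrable a μ → Integrable b μ → Integrable (fun x => a x * b x) μ →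
      Integrable (fun q : E × E => (a q.2 - a q.1) * (b q.2 - b q.1)) (μ.prod μ) ∧
      ∫ q, (a q.2 - a q.1) * (b q.2 - b q.1) ∂(μ.prod μ) =
        2 * (∫ x, a x * b x ∂μ - (∫ x, a x ∂μ) * ∫ x, b x ∂μ) := by
    intro a b ha hb hab
    have i1 : Integrable (fun q : E × E => a q.2 * b q.2) (μ.prod μ) := hab.comp_snd μ
    have i2 : Integrable (fun q : E × E => a q.1 * b q.1) (μ.prod μ) := hab.comp_fst μ
    have i3 : Integrable (fun q : E × E => a q.1 * b q.2) (μ.prod μ) := ha.mul_prod hb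
    have i4 : Integrable (fun q : E × E => b q.1 * a q.2) (μ.prod μ) := hb.mul_prod ha
    have e : (fun q : E × E => (a q.2 - a q.1) * (b q.2 - b q.1)) =
        fun q => (a q.2 * b q.2 + a q.1 * b q.1) - (a q.1 * b q.2 + b q.1 * a q.2) := by
      funext q; ring
    rw [e]
    refine ⟨(i1.add i2).sub (i3.add i4), ?_⟩
    have i5 : Integrable (fun q : E × E => a q.2 * b q.2 + a q.1 * b q.1) (μ.prod μ) := i1.add i2
    have i6 : Integrable (fun q : E × E => a q.1 * b q.2 + b q.1 * a q.2) (μ.prod μ) := i3.add i4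
    rw [integral_sub i5 i6, integral_add i1 i2, integral_add i3 i4,
      integral_prod_mul, integral_prod_mul, integral_fun_snd (f := fun x => a x * b x),
      integral_fun_fst (f := fun x => a x * b x)]
    simp only [probReal_univ, one_smul]
    ring
  obtain ⟨j1, e1⟩ := h2 f g hf hg hfg
  obtain ⟨j2, e2⟩ := h2 f f hf hf hff
  obtain ⟨j3, e3⟩ := h2 g g hg hg hgg
  have e4 : ∀ a : E → ℝ, (fun q : E × E => (a q.2 - a q.1) ^ 2) =
      fun q => (a q.2 - a q.1) * (a q.2 - a q.1) := fun a => by funext q; ring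
  have h5 := integral_mono j1 (j2.add j3) (fun q => by
    change (f q.2 - f q.1) * (g q.2 - g q.1) ≤ (f q.2 - f q.1) * (f q.2 - f q.1) +
      (g q.2 - g q.1) * (g q.2 - g q.1)
    nlinarith [sq_nonneg (f q.2 - f q.1 - (g q.2 - g q.1)), sq_nonneg (f q.2 - f q.1),
      sq_nonneg (g q.2 - g q.1)])
  have h6 : 0 ≤ ∫ q, (f q.2 - f q.1) * (f q.2 - f q.1) ∂(μ.prod μ) :=
    integral_nonneg fun q => mul_self_nonneg _
  have h7 : 0 ≤ ∫ q, (g q.2 - g q.1) * (g q.2 - g q.1) ∂(μ.prod μ) :=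
    integral_nonneg fun q => mul_self_nonneg _
  rw [integral_add' j2 j3] at h5
  change _ ≤ _ + (∫ q, (fun q : E × E => (f q.2 - f q.1) ^ 2) q ∂(μ.prod μ) +
    ∫ q, (fun q : E × E => (g q.2 - g q.1) ^ 2) q ∂(μ.prod μ))
  rw [e4 f, e4 g]
  linarith

lemma sum_range_eq_sum_even (f : ℕ → ℝ) (hf : ∀ i, f (2 * i + 1) = 0) (k : ℕ) :
    ∑ i ∈ Finset.range (2 * k + 1), f i = ∑ a ∈ Finset.range (k + 1), f (2 * a) := by
  induction k with
  | zero => simp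
  | succ k ih =>
    rw [show 2 * (k + 1) + 1 = 2 * k + 1 + 1 + 1 by ring, Finset.sum_range_succ,
      Finset.sum_range_succ, ih, hf, Finset.sum_range_succ _ (k + 1)]
    ring_nf

/-- The even moments are bounded by those of the semicircle law, up to `O (n⁻²)`. -/
lemma exists_integral_trPow_le_catalan {τ : ℝ} (hτ : 0 ≤ τ) (k : ℕ) : ∃ D : ℝ, 0 ≤ D ∧
    ∀ {E : Type} [NormedAddCommGroup E] [InnerProductSpace ℝ E] [FiniteDimensional ℝ E]
      [MeasurableSpace E] [BorelSpace E] {n : ℕ+} {H : E →L[ℝ] Mat n}, IsGUE H τ →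
      ∫ x, trPow (2 * k) (H x) ∂(stdGaussian E) ≤ catalan k * τ ^ k + D / n ^ 2 := by
  induction k using Nat.strong_induction_on with
  | _ k ih =>
  cases k with
  | zero => exact ⟨0, le_rfl, fun h => by simp [trPow_zero]⟩
  | succ k =>
    -- The induction hypothesis is made total in `a`, with value 0 beyond `k`, so that the constants
    -- can be chosen as a function.
    have hD : ∀ a, ∃ D : ℝ, 0 ≤ D ∧ (a ≤ k → ∀ {E : Type} [NormedAddCommGroup E] [InnerProductSpace ℝ E] [FiniteDimensional ℝ E]
          [MeasurableSpace E] [BorelSpace E] {n : ℕ+} {H : E →L[ℝ] Mat n}, IsGUE H τ →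
        ∫ x, trPow (2 * a) (H x) ∂(stdGaussian E) ≤ catalan a * τ ^ a + D / n ^ 2) := by
      intro a
      by_cases ha : a ≤ k
      · obtain ⟨D, h1, h2⟩ := ih a (by omega)
        exact ⟨D, h1, fun _ => h2⟩
      · exact ⟨0, le_rfl, fun h => absurd h ha⟩
    choose D hD0 hD using hD
    choose C hC0 hC using exists_integral_sq_sub_le τ
    refine ⟨τ * (∑ a ∈ Finset.range (k + 1), (catalan a * τ ^ a * D (k - a) +
      D a * (catalan (k - a) * τ ^ (k - a)) + D a * D (k - a)) +
      ∑ i ∈ Finset.range (2 * k + 1), (C i + C (2 * k - i))), ?_, ?_⟩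
    · refine mul_nonneg hτ (add_nonneg (Finset.sum_nonneg fun a _ => ?_)
        (Finset.sum_nonneg fun a _ => add_nonneg (hC0 _) (hC0 _)))
      have h1 := hD0 a
      have h2 := hD0 (k - a)
      positivity
    · intro E _ _ _ _ _ n H h
      have hn : (0 : ℝ) < (n : ℝ) := by exact_mod_cast n.pos
      have hn1 : (1 : ℝ) ≤ (n : ℝ) := by exact_mod_cast n.pos
      set mo : ℕ → ℝ := fun i => ∫ x, trPow i (H x) ∂(stdGaussian E) with hmo
      -- Odd moments vanish, so after decoupling the products the recursion becomes Segner's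
      -- recursion for the Catalan numbers, with errors of order n⁻².
      have hodd : ∀ i, mo (2 * i + 1) * mo (2 * k - (2 * i + 1)) = 0 := fun i => by
        rw [show mo (2 * i + 1) = 0 from integral_trPow_odd H i, zero_mul]
      have hnn : ∀ a, 0 ≤ mo (2 * a) := fun a =>
        integral_nonneg fun x => trPow_two_mul_nonneg (h.isSelfAdjoint x) a
      have s1 : ∑ i ∈ Finset.range (2 * k + 1),
          ∫ x, trPow i (H x) * trPow (2 * k - i) (H x) ∂(stdGaussian E) ≤
          ∑ i ∈ Finset.range (2 * k + 1), (mo i * mo (2 * k - i) +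
            (C i + C (2 * k - i)) / n ^ 2) := by
        refine Finset.sum_le_sum fun i _ => (integral_trPow_mul_le H _ _).trans ?_
        rw [add_div]
        gcongr
        · exact hC i h
        · exact hC (2 * k - i) h
      have s2 : ∑ i ∈ Finset.range (2 * k + 1), mo i * mo (2 * k - i) ≤
          ∑ a ∈ Finset.range (k + 1), (catalan a * catalan (k - a) * τ ^ k +
            (catalan a * τ ^ a * D (k - a) +
            D a * (catalan (k - a) * τ ^ (k - a)) + D a * D (k - a)) / n ^ 2) := by
        rw [sum_range_eq_sum_even (fun i => mo i * mo (2 * k - i)) hodd]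
        refine Finset.sum_le_sum fun a ha => ?_
        have ha' : a ≤ k := by simpa [Nat.lt_succ_iff] using ha
        rw [← Nat.mul_sub]
        have hDa := hD0 a
        have hDb := hD0 (k - a)
        refine (mul_le_mul (hD a ha' h) (hD (k - a) (Nat.sub_le _ _) h) (hnn _)
          (by positivity)).trans ?_
        have e : D a / (n : ℝ) ^ 2 * (D (k - a) / n ^ 2) ≤ D a * D (k - a) / n ^ 2 := by
          rw [div_mul_div_comm]
          refine div_le_div_of_nonneg_left (by positivity) (by positivity) ?_
          nlinarith [one_le_pow₀ hn1 (n := 2)]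
        have e2 : τ ^ k = τ ^ a * τ ^ (k - a) := by rw [← pow_add, Nat.add_sub_cancel' ha']
        rw [e2, add_div, add_div]
        calc _ = (catalan a : ℝ) * catalan (k - a) * (τ ^ a * τ ^ (k - a)) +
              (catalan a * τ ^ a * D (k - a) / n ^ 2 +
                D a * (catalan (k - a) * τ ^ (k - a)) / n ^ 2) +
              D a / (n : ℝ) ^ 2 * (D (k - a) / n ^ 2) := by ring
          _ ≤ _ := by rw [← add_assoc]; linarith
      have s3 : ((catalan (k + 1) : ℕ) : ℝ) =
          ∑ a ∈ Finset.range (k + 1), (catalan a : ℝ) * catalan (k - a) := by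
        rw [catalan_succ, ← Fin.sum_univ_eq_sum_range
          (fun a => (catalan a : ℝ) * catalan (k - a))]
        push_cast
        rfl
      rw [show 2 * (k + 1) = 2 * k + 2 by ring, h.integral_trPow]
      refine (mul_le_mul_of_nonneg_left s1 hτ).trans ?_
      rw [Finset.sum_add_distrib]
      refine (mul_le_mul_of_nonneg_left (add_le_add s2 le_rfl) hτ).trans (le_of_eq ?_)
      rw [Finset.sum_add_distrib, ← Finset.sum_mul, ← s3, ← Finset.sum_div, ← Finset.sum_div]
      ring

lemma catalan_le_four_pow (k : ℕ) : catalan k ≤ 4 ^ k := by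
  rw [catalan_eq_centralBinom_div]
  exact (Nat.div_le_self _ _).trans (Nat.centralBinom_le_four_pow k)

/-- The truncation at `3 √τ` is asymptotically invisible. -/
lemma exists_integral_hsSq_sub_cutoff_le {τ : ℝ} (hτ : 0 < τ) {ε : ℝ} (hε : 0 < ε) :
    ∃ N : ℕ, ∀ {E : Type} [NormedAddCommGroup E] [InnerProductSpace ℝ E] [FiniteDimensional ℝ E]
      [MeasurableSpace E] [BorelSpace E] {n : ℕ+} {H : E →L[ℝ] Mat n}, N ≤ n → IsGUE H τ →
      ∫ x, hsSq (H x - cfc (cutoff (3 * Real.sqrt τ)) (H x)) ∂(stdGaussian E) ≤ ε := by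
  set R := 3 * Real.sqrt τ with hR
  have hR0 : 0 < R := by positivity
  have hR2 : R ^ 2 = 9 * τ := by rw [hR, mul_pow, Real.sq_sqrt hτ.le]; norm_num
  -- The moment of order 2(k+1) is at most (4τ)^(k+1) up to O(n⁻²), while R² = 9τ; the ratio 4/9 < 1
  -- decides. First k is fixed, then n is taken large.
  obtain ⟨k, hk⟩ : ∃ k : ℕ, (4 / 9 : ℝ) ^ k < ε / 2 / (9 * τ) :=
    exists_pow_lt_of_lt_one (by positivity) (by norm_num)
  obtain ⟨D, hD0, hD⟩ := exists_integral_trPow_le_catalan hτ.le (k + 1)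
  obtain ⟨N, hN⟩ := exists_nat_gt (9 * τ * D / (9 * τ) ^ (k + 1) / (ε / 2))
  refine ⟨N, fun {E} _ _ _ _ _ {n H} hn h => ?_⟩
  have hn1 : (1 : ℝ) ≤ (n : ℝ) := by exact_mod_cast n.pos
  have hn0 : (0 : ℝ) < (n : ℝ) := by linarith
  have hNn : (N : ℝ) ≤ (n : ℝ) := by exact_mod_cast hn
  have hint : Integrable (fun x => R ^ 2 * (trPow (2 * (k + 1)) (H x) / R ^ (2 * (k + 1))))
    (stdGaussian E) := ((integrable_trPow H _).div_const _).const_mul _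
  calc _ ≤ ∫ x, R ^ 2 * (trPow (2 * (k + 1)) (H x) / R ^ (2 * (k + 1))) ∂(stdGaussian E) := by
        refine integral_mono_of_nonneg (Eventually.of_forall fun x => hsSq_nonneg _) hint
          (Eventually.of_forall fun x => hsSq_sub_cutoff_le (h.isSelfAdjoint x) hR0 k)
    _ = R ^ 2 * ((∫ x, trPow (2 * (k + 1)) (H x) ∂(stdGaussian E)) / R ^ (2 * (k + 1))) := by
        rw [integral_const_mul, integral_div]
    _ ≤ 9 * τ * ((4 ^ (k + 1) * τ ^ (k + 1) + D / n ^ 2) / (9 * τ) ^ (k + 1)) := by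
        rw [pow_mul R, hR2]
        gcongr
        refine (hD h).trans ?_
        gcongr
        exact_mod_cast catalan_le_four_pow (k + 1)
    _ = 9 * τ * (4 / 9) ^ (k + 1) + 9 * τ * D / (9 * τ) ^ (k + 1) / n ^ 2 := by
        rw [← mul_pow, add_div, ← div_pow, mul_div_mul_right _ _ hτ.ne']
        ring
    _ ≤ ε / 2 + ε / 2 := by
        refine add_le_add ?_ ?_
        · rw [lt_div_iff₀ (by positivity)] at hk
          have : (4 / 9 : ℝ) ^ (k + 1) ≤ (4 / 9) ^ k :=
            pow_le_pow_of_le_one (by norm_num) (by norm_num) (Nat.le_succ k)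
          nlinarith
        · rw [div_lt_iff₀ (by positivity)] at hN
          rw [div_le_iff₀ (by positivity)]
          have : (N : ℝ) ≤ (n : ℝ) ^ 2 := by nlinarith
          nlinarith
    _ = ε := by ring

end Gaussian

end ChronOT

namespace ChronOT

/-! ### Gaussian increments -/

section Increments

/-- Indices of the real and imaginary parts of the entries of a finite family of matrices. -/
abbrev EntryIdx (J : Finset ℕ) (n : ℕ+) : Type := (J × Fin n × Fin n) ⊕ (J × Fin n × Fin n)

/-- The family of matrices with given real and imaginary parts of the entries, times `√v`. -/
noncomputable def ofEntries (J : Finset ℕ) (n : ℕ+) (v : ℝ) :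
    EuclideanSpace ℝ (EntryIdx J n) →ₗ[ℝ] (J → Mat n) where
  toFun x j := Matrix.of fun a b => (Real.sqrt v : ℂ) *
    ((x (.inl (j, a, b)) : ℂ) + Complex.I * (x (.inr (j, a, b)) : ℂ))
  map_add' x y := by
    funext j; ext a b
    simp; ring
  map_smul' c x := by
    funext j; ext a b
    simp; ring

/-- The operator `c (X + σ X*)`, for the `j`-th matrix of the family. -/
noncomputable def gueMap (J : Finset ℕ) (n : ℕ+) (v : ℝ) (j : J) (c σ : ℂ) :
    EuclideanSpace ℝ (EntryIdx J n) →L[ℝ] Mat n :=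
  LinearMap.toContinuousLinearMap
    { toFun := fun x => c • (ofEntries J n v x j + σ • star (ofEntries J n v x j))
      map_add' := fun x y => by
        simp only [map_add, Pi.add_apply, star_add, smul_add]; abel
      map_smul' := fun r x => by
        simp only [map_smul, Pi.smul_apply, star_smul, star_trivial, RingHom.id_apply, smul_add]
        simp only [smul_comm r] }

variable {J : Finset ℕ} {n : ℕ+} {v : ℝ}

lemma ofEntries_apply (x : EuclideanSpace ℝ (EntryIdx J n)) (j : J) (a b : Fin n) :
    ofEntries J n v x j a b = (Real.sqrt v : ℂ) *
      ((x (.inl (j, a, b)) : ℂ) + Complex.I * (x (.inr (j, a, b)) : ℂ)) := rfl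

lemma gueMap_apply (j : J) (c σ : ℂ) (x : EuclideanSpace ℝ (EntryIdx J n)) :
    gueMap J n v j c σ x = c • (ofEntries J n v x j + σ • star (ofEntries J n v x j)) := rfl

lemma integral_coord_mul {ι : Type} [Fintype ι] [DecidableEq ι] (i j : ι) :
    Integrable (fun x : EuclideanSpace ℝ ι => x i * x j) (stdGaussian (EuclideanSpace ℝ ι)) ∧
    ∫ x : EuclideanSpace ℝ ι, x i * x j ∂(stdGaussian (EuclideanSpace ℝ ι)) =
      if i = j then 1 else 0 := by
  have hi : ∀ i, MemLp (fun x : EuclideanSpace ℝ ι => x i) 2 (stdGaussian (EuclideanSpace ℝ ι)) :=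
    fun i => IsGaussian.memLp_dual _ (EuclideanSpace.proj i) 2 (by norm_num)
  refine ⟨(hi i).integrable_mul (hi j), ?_⟩
  have h := covarianceBilin_apply (μ := stdGaussian (EuclideanSpace ℝ ι)) IsGaussian.memLp_two_id
    (EuclideanSpace.single i 1) (EuclideanSpace.single j 1)
  have h0 : (stdGaussian (EuclideanSpace ℝ ι))[id] = 0 := integral_id_stdGaussian
  rw [covarianceBilin_stdGaussian, h0] at h
  simp only [sub_zero, EuclideanSpace.inner_single_left, map_one, one_mul] at h
  rw [← h, innerSL_apply_apply, EuclideanSpace.inner_single_left]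
  simp [PiLp.single_apply]

/-- Isotropy of the standard Gaussian, extended bilinearly to complex coefficients; no conjugation
is involved. -/
lemma integral_dotProduct_mul {ι : Type} [Fintype ι] [DecidableEq ι] (α β : ι → ℂ) :
    ∫ x : EuclideanSpace ℝ ι, (α ⬝ᵥ fun i => (x i : ℂ)) * (β ⬝ᵥ fun i => (x i : ℂ))
      ∂(stdGaussian (EuclideanSpace ℝ ι)) = α ⬝ᵥ β := by
  have e : ∀ x : EuclideanSpace ℝ ι, (α ⬝ᵥ fun i => (x i : ℂ)) * (β ⬝ᵥ fun i => (x i : ℂ)) =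
      ∑ i, ∑ j, (α i * β j) * ((x i * x j : ℝ) : ℂ) := by
    intro x
    rw [dotProduct, dotProduct, Finset.sum_mul_sum]
    refine Finset.sum_congr rfl fun i _ => Finset.sum_congr rfl fun j _ => ?_
    push_cast; ring
  have hi : ∀ i j, Integrable (fun x : EuclideanSpace ℝ ι => (α i * β j) * ((x i * x j : ℝ) : ℂ))
      (stdGaussian (EuclideanSpace ℝ ι)) := fun i j =>
    (integral_coord_mul i j).1.ofReal.const_mul _
  simp only [e]
  rw [integral_finsetSum _ fun i _ => integrable_finsetSum _ fun j _ => hi i j, dotProduct]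
  refine Finset.sum_congr rfl fun i _ => ?_
  rw [integral_finsetSum _ fun j _ => hi i j, Finset.sum_eq_single i]
  · rw [integral_const_mul, integral_complex_ofReal, (integral_coord_mul i i).2]; simp
  · intro j _ hj
    rw [integral_const_mul, integral_complex_ofReal, (integral_coord_mul i j).2, if_neg hj.symm]
    simp
  · simp

/-- The pairs (c, σ) = (1/2, 1) and (1/(2i), -1) give the operator real and imaginary parts. The
three identities for c and σ express unitarity of σ, self-adjointness and the normalization of the
variance. -/
lemma isGUE_gueMap (j : J) {τ : ℝ} (hτ : 0 ≤ τ) {c σ : ℂ} (hs : star σ * σ = 1)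
    (hc : star c = c * σ) (h4 : 4 * c ^ 2 * σ = 1) :
    IsGUE (gueMap J n (τ / n) j c σ) τ where
  isSelfAdjoint x := by
    rw [isSelfAdjoint_iff, gueMap_apply, star_smul, star_add, star_smul, star_star, hc, mul_smul,
      smul_add, smul_smul, mul_comm σ, hs, one_smul, add_comm]
  nonneg := hτ
  cov a b d e := by
    have hv : (Real.sqrt (τ / n) : ℂ) * Real.sqrt (τ / n) = (τ / n : ℝ) := by
      rw [← Complex.ofReal_mul, Real.mul_self_sqrt (by positivity)]
    have h : ∀ (x : EuclideanSpace ℝ (EntryIdx J n)) a b, gueMap J n (τ / n) j c σ x a b =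
        ((Real.sqrt (τ / n) * c) • (Pi.single (.inl (j, a, b)) 1 +
          Pi.single (.inr (j, a, b)) Complex.I + (Pi.single (.inl (j, b, a)) σ +
          Pi.single (.inr (j, b, a)) (-(σ * Complex.I))))) ⬝ᵥ fun i => (x i : ℂ) := by
      intro x a b
      simp only [smul_dotProduct, add_dotProduct, single_dotProduct, gueMap_apply,
        Matrix.smul_apply, Matrix.add_apply, Matrix.star_apply, ofEntries_apply, smul_eq_mul,
        star_mul', star_add, RCLike.star_def, Complex.conj_ofReal, Complex.conj_I]
      ring
    simp only [h]
    rw [integral_dotProduct_mul]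
    simp only [smul_dotProduct, dotProduct_smul, add_dotProduct, dotProduct_add, single_dotProduct,
      Pi.single_apply, smul_eq_mul, Sum.inl.injEq, Sum.inr.injEq, Prod.mk.injEq, true_and,
      reduceCtorEq, if_false, mul_zero, add_zero, zero_add]
    have hI : Complex.I * Complex.I = -1 := Complex.I_mul_I
    have h4' : (Real.sqrt (τ / n) : ℂ) * Real.sqrt (τ / n) * (4 * c ^ 2 * σ) = (τ / n : ℝ) := by
      rw [hv, h4, mul_one]
    simp only [and_comm (a := b = e), and_comm (a := b = d)]
    set S : ℂ := (Real.sqrt (τ / n) : ℂ) ^ 2 * c ^ 2 with hS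
    split_ifs
    · linear_combination S * ((1 + σ ^ 2) - 2 * σ) * hI + h4'
    · linear_combination S * (1 + σ ^ 2) * hI
    · linear_combination S * (-2 * σ) * hI + h4'
    · ring

/-- The factor 1/n comes from the normalized trace. With v = s/n the matrices are thus
√s/n-Lipschitz functions of the Gaussian vector. -/
lemma hsSq_ofEntries_le (hv : 0 ≤ v) (x : EuclideanSpace ℝ (EntryIdx J n)) (j : J) :
    hsSq (ofEntries J n v x j) ≤ v / n * ‖x‖ ^ 2 := by
  have e : ∀ a b : Fin n, ‖ofEntries J n v x j a b‖ ^ 2 =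
      v * (x (.inl (j, a, b)) ^ 2 + x (.inr (j, a, b)) ^ 2) := by
    intro a b
    rw [ofEntries_apply, norm_mul, mul_pow, Complex.norm_real, Real.norm_eq_abs, sq_abs,
      Real.sq_sqrt hv, mul_comm Complex.I, Complex.sq_norm, Complex.normSq_add_mul_I]
  have e2 : ∀ f : J × Fin n × Fin n → ℝ, ∑ b, ∑ a, f (j, a, b) ^ 2 ≤ ∑ i, f i ^ 2 := by
    intro f
    rw [Fintype.sum_prod_type, Finset.sum_comm]
    refine le_trans (le_of_eq ?_) (Finset.single_le_sum
      (f := fun j => ∑ y : Fin n × Fin n, f (j, y) ^ 2)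
      (fun i _ => Finset.sum_nonneg fun _ _ => sq_nonneg _) (Finset.mem_univ j))
    rw [Fintype.sum_prod_type]
  rw [hsSq_eq, EuclideanSpace.real_norm_sq_eq, Fintype.sum_sum_type, div_mul_eq_mul_div]
  gcongr
  simp only [e]
  simp only [← Finset.mul_sum, Finset.sum_add_distrib]
  gcongr
  · exact e2 fun i => x (.inl i)
  · exact e2 fun i => x (.inr i)

end Increments

/-! ### Law of the Brownian increments and the truncation error -/

section Law

variable {Ω : Type*} [mΩ : MeasurableSpace Ω] {P : Measure Ω} [IsProbabilityMeasure P]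
  {𝓖 : Filtration ℝ≥0 mΩ} {n : ℕ+} {Z : ℝ≥0 → ℕ → Ω → Mat n}

/-- Independent coordinates with equal Gaussian laws form a multiple of the standard Gaussian
vector. Finite families suffice, because a formula sees finitely many increments. -/
lemma IsMatrixBM.map_increments (hZ : IsMatrixBM P 𝓖 n Z) {s t : ℝ≥0} (hst : s < t)
    (J : Finset ℕ) :
    P.map (fun ω (j : J) => Z t j ω - Z s j ω) =
      (stdGaussian (EuclideanSpace ℝ (EntryIdx J n))).map
        (ofEntries J n (((t : ℝ) - s) / n)) := by
  set v : ℝ≥0 := (t - s) / n with hv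
  have hv' : (v : ℝ) = ((t : ℝ) - s) / n := by
    rw [hv, NNReal.coe_div, NNReal.coe_sub hst.le]; simp
  set f : EntryIdx J n → Ω → ℝ := fun i ω => Sum.elim
    (fun e : J × Fin n × Fin n => (Z t e.1 ω e.2.1 e.2.2 - Z s e.1 ω e.2.1 e.2.2).re)
    (fun e => (Z t e.1 ω e.2.1 e.2.2 - Z s e.1 ω e.2.1 e.2.2).im) i with hf
  have hme : ∀ (r : ℝ≥0) (j : ℕ) (a b : Fin n), Measurable fun ω => Z r j ω a b := fun r j a b =>
    (measurable_pi_apply b).comp ((measurable_pi_apply a).comp (hZ.measurable r j))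
  have hmf : ∀ i, Measurable (f i) := by
    rintro (e | e)
    · exact Complex.measurable_re.comp ((hme _ _ _ _).sub (hme _ _ _ _))
    · exact Complex.measurable_im.comp ((hme _ _ _ _).sub (hme _ _ _ _))
  have hind : iIndepFun f P := by
    let g : EntryIdx J n → (ℕ × Fin n × Fin n) ⊕ (ℕ × Fin n × Fin n) :=
      Sum.map (fun e => ((e.1 : ℕ), e.2)) (fun e => ((e.1 : ℕ), e.2))
    have hg : g.Injective := by
      refine Sum.map_injective.2 ⟨?_, ?_⟩ <;>
      · rintro ⟨⟨a, ha⟩, b⟩ ⟨⟨c, hc⟩, d⟩ h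
        simpa using h
    have := (hZ.indep_entries s t hst).precomp hg
    convert this using 1
    funext i ω
    rcases i with e | e <;> rfl
  have hlaw : ∀ i, P.map (f i) = gaussianReal 0 v := by
    rintro (e | e)
    · exact (hZ.law s t hst e.1 e.2.1 e.2.2).1
    · exact (hZ.law s t hst e.1 e.2.1 e.2.2).2
  have h1 := (iIndepFun_iff_map_fun_eq_pi_map (fun i => (hmf i).aemeasurable)).1 hind
  simp only [hlaw] at h1
  have h2 : gaussianReal 0 v = (gaussianReal 0 1).map (Real.sqrt v * ·) := by
    rw [gaussianReal_map_const_mul]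
    congr 1
    · simp
    · ext; simp
  rw [h2, ← Measure.pi_map_pi (fun i => by fun_prop)] at h1
  rw [← map_pi_eq_stdGaussian]
  set G : (EntryIdx J n → ℝ) → (J → Mat n) := fun x j => Matrix.of fun a b =>
    ((x (.inl (j, a, b)) : ℂ) + Complex.I * (x (.inr (j, a, b)) : ℂ)) with hG
  have hGm : Measurable G := by
    refine measurable_pi_lambda _ fun j => measurable_pi_lambda _ fun a =>
      measurable_pi_lambda _ fun b => ?_
    change Measurable fun x : EntryIdx J n → ℝ =>
      ((x (.inl (j, a, b)) : ℂ) + Complex.I * (x (.inr (j, a, b)) : ℂ))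
    fun_prop
  have e1 : (fun ω (j : J) => Z t j ω - Z s j ω) = G ∘ fun ω i => f i ω := by
    funext ω j
    ext a b
    simp only [hG, hf, Function.comp, Matrix.of_apply, Sum.elim_inl, Sum.elim_inr]
    rw [mul_comm, Complex.re_add_im, Matrix.sub_apply]
  have hoe : Measurable (ofEntries J n (((t : ℝ) - s) / n)) :=
    (LinearMap.continuous_of_finiteDimensional _).measurable
  rw [e1, ← Measure.map_map hGm (measurable_pi_lambda _ hmf), h1,
    Measure.map_map hGm (by fun_prop), Measure.map_map hoe (by fun_prop)]
  congr 1
  funext x j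
  ext a b
  simp only [hG, Function.comp, Matrix.of_apply, ofEntries_apply, ← hv']
  push_cast
  ring

lemma opRe_ofEntries {J : Finset ℕ} {v : ℝ} (j : J) (x : EuclideanSpace ℝ (EntryIdx J n)) :
    opRe (ofEntries J n v x j) = gueMap J n v j (1 / 2) 1 x := by
  rw [gueMap_apply, one_smul, opRe]

lemma opIm_ofEntries {J : Finset ℕ} {v : ℝ} (j : J) (x : EuclideanSpace ℝ (EntryIdx J n)) :
    opIm (ofEntries J n v x j) = gueMap J n v j (1 / (2 * Complex.I)) (-1) x := by
  rw [gueMap_apply, neg_smul, one_smul, ← sub_eq_add_neg, opIm]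

lemma isGUE_opRe {J : Finset ℕ} (j : J) {τ : ℝ} (hτ : 0 ≤ τ) :
    IsGUE (gueMap J n (τ / n) j (1 / 2) 1) τ :=
  isGUE_gueMap j hτ (by simp) (by simp) (by norm_num)

lemma isGUE_opIm {J : Finset ℕ} (j : J) {τ : ℝ} (hτ : 0 ≤ τ) :
    IsGUE (gueMap J n (τ / n) j (1 / (2 * Complex.I)) (-1)) τ :=
  isGUE_gueMap j hτ (by simp) (by simp) (by
    rw [div_pow, mul_pow, Complex.I_sq]; norm_num)

lemma hsSq_sub_truncMat_le (R : ℝ) (X : Mat n) : hsSq (X - truncMat R X) ≤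
    2 * hsSq (opRe X - cfc (cutoff R) (opRe X)) + 2 * hsSq (opIm X - cfc (cutoff R) (opIm X)) := by
  have e : X - truncMat R X = (opRe X - cfc (cutoff R) (opRe X)) +
      Complex.I • (opIm X - cfc (cutoff R) (opIm X)) := by
    have hX := opRe_add_opIm X
    rw [truncMat, smul_sub]
    nth_rewrite 1 [← hX]
    abel
  have e2 : ∀ Y : Mat n, hsSq (Complex.I • Y) = hsSq Y := fun Y => by
    simp [hsSq_eq]
  rw [e]
  refine (hsSq_add_le _ _).trans (le_of_eq ?_)
  rw [e2]

lemma integrable_hsSq_sub_cutoff {E : Type} [NormedAddCommGroup E] [InnerProductSpace ℝ E]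
    [FiniteDimensional ℝ E] [MeasurableSpace E] [BorelSpace E] {H : E →L[ℝ] Mat n} {τ R : ℝ}
    (h : IsGUE H τ) (hR : 0 < R) :
    Integrable (fun x => hsSq (H x - cfc (cutoff R) (H x))) (stdGaussian E) := by
  have hc : Continuous fun x => cfc (cutoff R) (H x) :=
    Continuous.cfc_of_mem_nhdsSet (cutoff R) (s := Set.univ) (by simp) H.continuous
      (fun X => h.isSelfAdjoint X) (continuous_cutoff R).continuousOn
  refine Integrable.mono' ((integrable_trPow H (2 * (0 + 1))).div_const (R ^ (2 * (0 + 1))) |>.const_mul (R ^ 2))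
    (continuous_hsSq.comp (H.continuous.sub hc)).aestronglyMeasurable
    (Eventually.of_forall fun x => ?_)
  rw [Real.norm_of_nonneg (hsSq_nonneg _)]
  exact hsSq_sub_cutoff_le (h.isSelfAdjoint x) hR 0

lemma truncRadius_pos {s t : ℝ≥0} (hst : s < t) : 0 < truncRadius s t := by
  unfold truncRadius
  have : (s : ℝ) < t := by exact_mod_cast hst
  have : (0 : ℝ) < t - s := by linarith
  positivity

/-- The truncation of the increments of a matrix Brownian motion is asymptotically invisible. -/
lemma exists_integral_truncError_le {s t : ℝ≥0} (hst : s < t) {ε : ℝ} (hε : 0 < ε) :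
    ∃ N : ℕ, ∀ {n : ℕ+} {Z : ℝ≥0 → ℕ → Ω → Mat n}, IsMatrixBM P 𝓖 n Z → N ≤ n → ∀ j,
      Integrable (fun ω => hsSq ((Z t j ω - Z s j ω) -
        truncMat (truncRadius s t) (Z t j ω - Z s j ω))) P ∧
      ∫ ω, hsSq ((Z t j ω - Z s j ω) - truncMat (truncRadius s t) (Z t j ω - Z s j ω)) ∂P ≤ ε := by
  have hst' : (s : ℝ) < t := by exact_mod_cast hst
  have hτ : (0 : ℝ) < t - s := by linarith
  obtain ⟨N, hN⟩ := exists_integral_hsSq_sub_cutoff_le hτ (by positivity : 0 < ε / 4)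
  refine ⟨N, fun {n Z} hZ hn j => ?_⟩
  set R := truncRadius s t with hR
  have hR0 : 0 < R := truncRadius_pos hst
  set j' : ({j} : Finset ℕ) := ⟨j, Finset.mem_singleton_self j⟩ with hj'
  set L := ofEntries {j} n (((t : ℝ) - s) / n) with hL
  have hlaw := hZ.map_increments hst {j}
  have hLc : Continuous L := LinearMap.continuous_of_finiteDimensional _
  have hLj : Continuous fun x => L x j' := (continuous_apply j').comp hLc
  have hf : Continuous fun X : Mat n => hsSq (X - truncMat R X) :=
    continuous_hsSq.comp (continuous_id.sub (continuous_truncMat R))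
  have hg : Measurable fun w : (({j} : Finset ℕ) → Mat n) => hsSq (w j' - truncMat R (w j')) :=
    hf.measurable.comp (measurable_pi_apply j')
  have hW : Measurable fun ω (i : ({j} : Finset ℕ)) => Z t i ω - Z s i ω :=
    measurable_pi_lambda _ fun i => (hZ.measurable _ _).sub (hZ.measurable _ _)
  have i1 := integrable_hsSq_sub_cutoff (isGUE_opRe (n := n) j' hτ.le) hR0
  have i2 := integrable_hsSq_sub_cutoff (isGUE_opIm (n := n) j' hτ.le) hR0
  have hle : ∀ x, hsSq (L x j' - truncMat R (L x j')) ≤ _ := fun x =>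
    hsSq_sub_truncMat_le R (L x j')
  simp only [hL, opRe_ofEntries, opIm_ofEntries] at hle
  have i3 : Integrable (fun x => hsSq (L x j' - truncMat R (L x j'))) (stdGaussian _) := by
    refine Integrable.mono' ((i1.const_mul 2).add (i2.const_mul 2))
      (hf.comp hLj).aestronglyMeasurable (Eventually.of_forall fun x => ?_)
    rw [Real.norm_of_nonneg (hsSq_nonneg _)]
    exact hle x
  have i4 : Integrable (fun w : (({j} : Finset ℕ) → Mat n) => hsSq (w j' - truncMat R (w j')))
      (P.map fun ω (i : ({j} : Finset ℕ)) => Z t i ω - Z s i ω) := by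
    rw [hlaw]
    exact (integrable_map_measure hg.aestronglyMeasurable hLc.measurable.aemeasurable).2 i3
  refine ⟨(integrable_map_measure hg.aestronglyMeasurable hW.aemeasurable).1 i4, ?_⟩
  have e : ∫ ω, hsSq ((Z t j ω - Z s j ω) - truncMat R (Z t j ω - Z s j ω)) ∂P =
      ∫ w, hsSq (w j' - truncMat R (w j'))
        ∂(P.map fun ω (i : ({j} : Finset ℕ)) => Z t i ω - Z s i ω) :=
    (integral_map hW.aemeasurable hg.aestronglyMeasurable).symm
  rw [e, hlaw, integral_map hLc.measurable.aemeasurable hg.aestronglyMeasurable]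
  refine (integral_mono i3 ((i1.const_mul 2).add (i2.const_mul 2)) hle).trans ?_
  rw [integral_add' (i1.const_mul 2) (i2.const_mul 2), integral_const_mul, integral_const_mul]
  have a1 := hN hn (isGUE_opRe (n := n) j' hτ.le)
  have a2 := hN hn (isGUE_opIm (n := n) j' hτ.le)
  change 2 * ∫ x, hsSq (_ - cfc (cutoff (3 * Real.sqrt ((t : ℝ) - s))) _) ∂_ +
    2 * ∫ x, hsSq (_ - cfc (cutoff (3 * Real.sqrt ((t : ℝ) - s))) _) ∂_ ≤ ε
  linarith

lemma integral_sq_of_map_eq_gaussianReal {X : Ω → ℝ} (hX : Measurable X) {v : ℝ≥0}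
    (h : P.map X = gaussianReal 0 v) :
    Integrable (fun ω => X ω ^ 2) P ∧ ∫ ω, X ω ^ 2 ∂P = v := by
  have hm : AEStronglyMeasurable (fun x : ℝ => x ^ 2) (P.map X) :=
    (continuous_pow 2).aestronglyMeasurable
  have h1 : MemLp (fun x : ℝ => x) 2 (gaussianReal 0 v) := memLp_id_gaussianReal 2
  refine ⟨(integrable_map_measure hm hX.aemeasurable).1 (by rw [h]; exact h1.integrable_sq), ?_⟩
  have e : ∫ ω, X ω ^ 2 ∂P = ∫ x, x ^ 2 ∂(P.map X) := (integral_map hX.aemeasurable hm).symm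
  rw [e, h]
  have h2 := variance_fun_id_gaussianReal (μ := 0) (v := v)
  rw [variance_eq_integral (by fun_prop), integral_id_gaussianReal] at h2
  simpa using h2

/-- There are 2n² real coordinates of variance (t - s)/n, and the normalized trace divides their sum
by n. -/
lemma IsMatrixBM.integral_hsSq_sub (hZ : IsMatrixBM P 𝓖 n Z) {s t : ℝ≥0} (hst : s ≤ t) (j : ℕ) :
    Integrable (fun ω => hsSq (Z t j ω - Z s j ω)) P ∧
    ∫ ω, hsSq (Z t j ω - Z s j ω) ∂P = 2 * ((t : ℝ) - s) := by
  have hn : (0 : ℝ) < (n : ℝ) := by exact_mod_cast n.pos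
  rcases hst.eq_or_lt with rfl | hst
  · have : hsSq (0 : Mat n) = 0 := by simp [hsSq_eq]
    simp [this]
  have hme : ∀ (r : ℝ≥0) (a b : Fin n), Measurable fun ω => Z r j ω a b := fun r a b =>
    (measurable_pi_apply b).comp ((measurable_pi_apply a).comp (hZ.measurable r j))
  have h1 : ∀ a b, Integrable (fun ω => (Z t j ω a b - Z s j ω a b).re ^ 2) P ∧
      ∫ ω, (Z t j ω a b - Z s j ω a b).re ^ 2 ∂P = ((t - s) / n : ℝ≥0) := fun a b =>
    integral_sq_of_map_eq_gaussianReal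
      (Complex.measurable_re.comp ((hme t a b).sub (hme s a b))) (hZ.law s t hst j a b).1
  have h2 : ∀ a b, Integrable (fun ω => (Z t j ω a b - Z s j ω a b).im ^ 2) P ∧
      ∫ ω, (Z t j ω a b - Z s j ω a b).im ^ 2 ∂P = ((t - s) / n : ℝ≥0) := fun a b =>
    integral_sq_of_map_eq_gaussianReal
      (Complex.measurable_im.comp ((hme t a b).sub (hme s a b))) (hZ.law s t hst j a b).2
  have e : ∀ ω, hsSq (Z t j ω - Z s j ω) = (∑ b, ∑ a, ((Z t j ω a b - Z s j ω a b).re ^ 2 +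
      (Z t j ω a b - Z s j ω a b).im ^ 2)) / n := by
    intro ω
    rw [hsSq_eq]
    simp only [Matrix.sub_apply, Complex.sq_norm, Complex.normSq_apply, ← sq]
  have h3 : ∀ a b, Integrable (fun ω => (Z t j ω a b - Z s j ω a b).re ^ 2 +
      (Z t j ω a b - Z s j ω a b).im ^ 2) P := fun a b => (h1 a b).1.add (h2 a b).1
  simp only [e]
  refine ⟨(integrable_finsetSum _ fun b _ => integrable_finsetSum _ fun a _ => h3 a b).div_const _,
    ?_⟩
  rw [integral_div, integral_finsetSum _ fun b _ => integrable_finsetSum _ fun a _ => h3 a b]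
  have h4 : ∀ b, ∫ ω, ∑ a, ((Z t j ω a b - Z s j ω a b).re ^ 2 +
      (Z t j ω a b - Z s j ω a b).im ^ 2) ∂P = ∑ _a : Fin n, 2 * (((t - s) / n : ℝ≥0) : ℝ) := by
    intro b
    rw [integral_finsetSum _ fun a _ => h3 a b]
    refine Finset.sum_congr rfl fun a _ => ?_
    rw [integral_add (h1 a b).1 (h2 a b).1, (h1 a b).2, (h2 a b).2, two_mul]
  simp only [h4, NNReal.coe_div, NNReal.coe_sub hst.le, Finset.sum_const,
    Finset.card_univ, Fintype.card_fin, nsmul_eq_mul, NNReal.coe_natCast]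
  field_simp

lemma sq_integral_le {Ω : Type*} [MeasurableSpace Ω] {P : Measure Ω} [IsProbabilityMeasure P]
    {f : Ω → ℝ} (hf : Integrable f P) (hf2 : Integrable (fun ω => f ω ^ 2) P) :
    (∫ ω, f ω ∂P) ^ 2 ≤ ∫ ω, f ω ^ 2 ∂P := by
  set m := ∫ ω, f ω ∂P
  have h : 0 ≤ ∫ ω, (f ω - m) ^ 2 ∂P := integral_nonneg fun ω => sq_nonneg _
  have e : ∀ ω, (f ω - m) ^ 2 = f ω ^ 2 - (2 * m * f ω - m ^ 2) := fun ω => by ring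
  have i1 : Integrable (fun ω => 2 * m * f ω - m ^ 2) P :=
    (hf.const_mul (2 * m)).sub (integrable_const _)
  simp only [e] at h
  rw [integral_sub hf2 i1, integral_sub (hf.const_mul _) (integrable_const _),
    integral_const_mul] at h
  simp only [integral_const, probReal_univ, one_smul] at h
  change 0 ≤ _ - (2 * m * m - m ^ 2) at h
  linarith

/-- Independence lets X be frozen at x by Fubini. Jensen's inequality in the second copy then bounds
the variance by the mean squared difference of two independent copies. -/
lemma integral_sq_sub_integral_le {Ω : Type*} [MeasurableSpace Ω] {P : Measure Ω}
    [IsProbabilityMeasure P] {S T : Type*} [MeasurableSpace S] [MeasurableSpace T] {X : Ω → S}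
    {W : Ω → T} (hX : Measurable X) (hW : Measurable W) (hind : IndepFun X W P) {g : S → T → ℝ}
    (hg : Measurable (Function.uncurry g)) {B : ℝ} (hB : ∀ x w, |g x w| ≤ B) {c : ℝ}
    (h : ∀ x, ∫ p, (g x p.2 - g x p.1) ^ 2 ∂((P.map W).prod (P.map W)) ≤ c) :
    ∫ ω, (g (X ω) (W ω) - ∫ w, g (X ω) w ∂(P.map W)) ^ 2 ∂P ≤ c := by
  set ν := P.map W
  have hν : IsProbabilityMeasure ν := Measure.isProbabilityMeasure_map hW.aemeasurable
  have hμ : IsProbabilityMeasure (P.map X) := Measure.isProbabilityMeasure_map hX.aemeasurable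
  have hgx : ∀ x, Measurable (g x) := fun x => hg.comp measurable_prodMk_left
  have hgi : ∀ x, Integrable (g x) ν := fun x =>
    Integrable.of_bound (hgx x).aestronglyMeasurable B (Eventually.of_forall (hB x))
  set m : S → ℝ := fun x => ∫ w, g x w ∂ν with hm
  have hmm : Measurable m := (hg.stronglyMeasurable.integral_prod_right (ν := ν)).measurable
  have hmB : ∀ x, |m x| ≤ B := fun x => by
    have hb : ∀ᵐ w ∂ν, ‖g x w‖ ≤ B := Eventually.of_forall fun w => hB x w
    exact (norm_integral_le_of_norm_le_const hb).trans (by simp)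
  have hF : Measurable fun p : S × T => (g p.1 p.2 - m p.1) ^ 2 :=
    (hg.sub (hmm.comp measurable_fst)).pow_const 2
  have hFb : ∀ p : S × T, ‖(g p.1 p.2 - m p.1) ^ 2‖ ≤ (2 * B) ^ 2 := fun p => by
    rw [norm_pow]
    refine pow_le_pow_left₀ (norm_nonneg _) ((abs_sub _ _).trans ?_) 2
    linarith [hB p.1 p.2, hmB p.1]
  have e : ∫ ω, (g (X ω) (W ω) - m (X ω)) ^ 2 ∂P =
      ∫ p, (g p.1 p.2 - m p.1) ^ 2 ∂((P.map X).prod ν) := by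
    rw [← (indepFun_iff_map_prod_eq_prod_map_map hX.aemeasurable hW.aemeasurable).1 hind,
      integral_map (hX.prodMk hW).aemeasurable hF.aestronglyMeasurable]
  change ∫ ω, (g (X ω) (W ω) - m (X ω)) ^ 2 ∂P ≤ c
  have hFi : Integrable (fun p : S × T => (g p.1 p.2 - m p.1) ^ 2) ((P.map X).prod ν) :=
    Integrable.of_bound hF.aestronglyMeasurable _ (Eventually.of_forall hFb)
  rw [e, integral_prod _ hFi]
  have key : ∀ x, ∫ w, (g x w - m x) ^ 2 ∂ν ≤ c := by
    intro x
    refine le_trans ?_ (h x)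
    have hDm : Measurable fun p : T × T => (g x p.2 - g x p.1) ^ 2 :=
      (((hgx x).comp measurable_snd).sub ((hgx x).comp measurable_fst)).pow_const 2
    have hDb : ∀ p : T × T, ‖(g x p.2 - g x p.1) ^ 2‖ ≤ (2 * B) ^ 2 := fun p => by
      rw [norm_pow]
      refine pow_le_pow_left₀ (norm_nonneg _) ((abs_sub _ _).trans ?_) 2
      linarith [hB x p.1, hB x p.2]
    have hDi : Integrable (fun p : T × T => (g x p.2 - g x p.1) ^ 2) (ν.prod ν) :=
      Integrable.of_bound hDm.aestronglyMeasurable _ (Eventually.of_forall hDb)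
    rw [integral_prod _ hDi]
    refine integral_mono_of_nonneg (Eventually.of_forall fun w => sq_nonneg _)
      hDi.integral_prod_left (Eventually.of_forall fun w => ?_)
    have i1 : Integrable (fun w' => g x w' - g x w) ν := (hgi x).sub (integrable_const _)
    have i2 : Integrable (fun w' => (g x w' - g x w) ^ 2) ν :=
      Integrable.of_bound (((hgx x).sub_const _).pow_const 2).aestronglyMeasurable _
        (Eventually.of_forall fun w' => hDb (w, w'))
    refine le_trans (le_of_eq ?_) (sq_integral_le i1 i2)
    change (g x w - m x) ^ 2 = (∫ w', (g x w' - g x w) ∂ν) ^ 2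
    rw [integral_sub (hgi x) (integrable_const _)]
    simp only [integral_const, probReal_univ, one_smul]
    change (g x w - m x) ^ 2 = (m x - g x w) ^ 2
    ring
  calc _ ≤ ∫ x, c ∂(P.map X) := integral_mono_of_nonneg
        (Eventually.of_forall fun x => integral_nonneg fun w => sq_nonneg _) (integrable_const _)
        (Eventually.of_forall key)
    _ = c := by simp

end Law

/-! ### Concentration of formulas in the Brownian increments -/

section Concentration

variable {Ω : Type*} [mΩ : MeasurableSpace Ω] {P : Measure Ω} [IsProbabilityMeasure P]
  {𝓖 : Filtration ℝ≥0 mΩ} {Z : ∀ n : ℕ+, ℝ≥0 → ℕ → Ω → Mat n} {α : Type}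

lemma truncRadius_add (u s : ℝ≥0) : truncRadius u (u + s) = truncRadius 0 s := by
  simp [truncRadius]

lemma hsN_ofEntries_sub_le {J : Finset ℕ} {n : ℕ+} {v : ℝ} (hv : 0 ≤ v)
    (x y : EuclideanSpace ℝ (EntryIdx J n)) (j : J) :
    hsN (ofEntries J n v x j - ofEntries J n v y j) ≤ Real.sqrt (v / n) * dist x y := by
  rw [← Pi.sub_apply, ← map_sub, hsN, dist_eq_norm]
  refine (Real.sqrt_le_sqrt (hsSq_ofEntries_le hv (x - y) j)).trans (le_of_eq ?_)
  rw [Real.sqrt_mul (by positivity), Real.sqrt_sq (norm_nonneg _)]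

/-- Concentration of restricted formulas in the truncated increments. -/
lemma exists_concentration (hZ : ∀ n, IsMatrixBM P 𝓖 n (Z n)) (φ : RFormula (α ⊕ ℕ)) :
    ∃ D : ℝ, 0 ≤ D ∧ ∀ (n : ℕ+) (u s : ℝ≥0) (hs : 0 < s) (X : Ω → α → Mat n),
      (∀ a, Measurable[𝓖 u] fun ω => X ω a) →
      ∫ ω, (φ.Lam P (Z n) (Sum.elim (X ω) fun j =>
          truncMat (truncRadius u (u + s)) (Z n (u + s) j ω - Z n u j ω)) -
        (RFormula.brownian s hs φ).Lam P (Z n) (X ω)) ^ 2 ∂P ≤ D * s / n ^ 2 := by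
  classical
  obtain ⟨C, S, hC0, hC⟩ := φ.exists_lipschitz P
  obtain ⟨B, hB0, hB⟩ := φ.exists_bound P
  have hZm : ∀ n t j, Measurable (Z n t j) := fun n => (hZ n).measurable
  set J := S.toRight with hJ
  set A := S.toLeft with hA
  -- The Poincaré constant 16 times `K` squared, with `K` the Lipschitz constant introduced below.
  refine ⟨64 * C ^ 2 * (J.card : ℝ) ^ 2, by positivity, fun n u s hs X hX => ?_⟩
  rw [truncRadius_add]
  set R := truncRadius 0 s with hR
  have hR0 : 0 ≤ R := (truncRadius_pos hs).le
  have hn : (0 : ℝ) < (n : ℝ) := by exact_mod_cast n.pos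
  -- The formula depends on finitely many variables and increments; the others are replaced by 0.
  set g : (A → Mat n) → (J → Mat n) → ℝ := fun x w => φ.Lam P (Z n)
    (Sum.elim (fun a => if h : a ∈ A then x ⟨a, h⟩ else 0)
      (fun j => if h : j ∈ J then truncMat R (w ⟨j, h⟩) else 0)) with hg
  have hge : ∀ (X : α → Mat n) (w : ℕ → Mat n),
      φ.Lam P (Z n) (Sum.elim X fun j => truncMat R (w j)) = g (fun a => X a) (fun j => w j) := by
    intro X w
    have h := hC n (Z n) (hZm n) (Sum.elim X fun j => truncMat R (w j))
      (Sum.elim (fun a => if h : a ∈ A then X a else 0)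
        (fun j => if h : j ∈ J then truncMat R (w j) else 0))
    have h0 : tD S (Sum.elim X fun j => truncMat R (w j))
      (Sum.elim (fun a => if h : a ∈ A then X a else 0)
        (fun j => if h : j ∈ J then truncMat R (w j) else 0)) = 0 := by
      refine Finset.sum_eq_zero fun b hb => ?_
      rcases b with a | j
      · have : a ∈ A := Finset.mem_toLeft.2 hb
        simp [this, hsN_zero]
      · have : j ∈ J := Finset.mem_toRight.2 hb
        simp [this, hsN_zero]
    rw [h0, mul_zero] at h
    exact sub_eq_zero.1 (abs_eq_zero.1 (le_antisymm h (abs_nonneg _)))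
  have hgm : Measurable (Function.uncurry g) := by
    refine measurable_Lam hZm P φ fun b => ?_
    rcases b with a | j
    · by_cases h : a ∈ A
      · simp only [Sum.elim_inl, h, dif_pos]
        exact (measurable_pi_apply (⟨a, h⟩ : A)).comp measurable_fst
      · simp only [Sum.elim_inl, h, dif_neg, not_false_eq_true]
        exact measurable_const
    · by_cases h : j ∈ J
      · simp only [Sum.elim_inr, h, dif_pos]
        exact (continuous_truncMat R).measurable.comp
          ((measurable_pi_apply (⟨j, h⟩ : J)).comp measurable_snd)
      · simp only [Sum.elim_inr, h, dif_neg, not_false_eq_true]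
        exact measurable_const
  have hgB : ∀ x w, |g x w| ≤ B := fun x w => hB n (Z n) _
  have hgl : ∀ x w w', |g x w - g x w'| ≤ C * ∑ j : J, 2 * hsN (w j - w' j) := by
    intro x w w'
    refine (hC n (Z n) (hZm n) _ _).trans (mul_le_mul_of_nonneg_left ?_ hC0)
    rw [tD_sum]
    simp only [Sum.elim_inl, Sum.elim_inr]
    have h1 : tD S.toLeft (fun a => if h : a ∈ A then x ⟨a, h⟩ else 0)
        (fun a => if h : a ∈ A then x ⟨a, h⟩ else 0) = 0 :=
      Finset.sum_eq_zero fun a _ => by rw [sub_self, hsN_zero]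
    rw [h1, zero_add, tD, ← Finset.sum_attach, ← Finset.univ_eq_attach]
    refine Finset.sum_le_sum fun j _ => ?_
    rw [dif_pos j.2, dif_pos j.2]
    exact (hsN_truncMat_sub_le hR0 _ _).trans (by simp)
  set W : ℝ≥0 → Ω → J → Mat n := fun u ω j => Z n (u + s) j ω - Z n u j ω with hW
  have hWm : ∀ u, Measurable (W u) := fun u =>
    measurable_pi_lambda _ fun j => (hZm _ _ _).sub (hZm _ _ _)
  have hlaw : ∀ u, P.map (W u) = (stdGaussian (EuclideanSpace ℝ (EntryIdx J n))).map
      (ofEntries J n ((s : ℝ) / n)) := by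
    intro u
    rw [hW, (hZ n).map_increments (lt_add_of_pos_right u hs)]
    simp
  set L := ofEntries J n ((s : ℝ) / n) with hL
  have hLc : Continuous L := LinearMap.continuous_of_finiteDimensional _
  have hXm : Measurable[𝓖 u] fun ω (a : A) => X ω a :=
    (@measurable_pi_iff _ _ _ (𝓖 u) _ _).2 fun a => hX a
  have hgx : ∀ x, Measurable (g x) := fun x => hgm.comp measurable_prodMk_left
  have hind : IndepFun (fun ω (a : A) => X ω a) (W u) P := by
    rw [IndepFun_iff_Indep]
    have h := (hZ n).indep_past u (u + s) (lt_add_of_pos_right u hs)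
    refine (indep_of_indep_of_le_left (indep_of_indep_of_le_right h ?_) ?_).symm
    · exact hXm.comap_le
    · have : W u = (fun w (j : J) => w j) ∘ fun ω (j : ℕ) => Z n (u + s) j ω - Z n u j ω := rfl
      rw [this, ← MeasurableSpace.comap_comp]
      exact MeasurableSpace.comap_mono
        (measurable_pi_lambda _ fun j => measurable_pi_apply _).comap_le
  -- Lipschitz constant C of the formula, 2 of the truncation, √(s/n/n) of each of the increments
  -- indexed by `J`.
  set K : ℝ := 2 * C * J.card * Real.sqrt (s / n / n) with hK
  have hK0 : 0 ≤ K := by positivity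
  have key := integral_sq_sub_integral_le (hXm.mono (𝓖.le u) le_rfl) (hWm u) hind hgm hgB
    (c := 16 * K ^ 2) fun x => by
      have hlip : LipschitzWith (Real.toNNReal K) fun e => g x (L e) := by
        refine LipschitzWith.of_dist_le_mul fun e e' => ?_
        rw [Real.coe_toNNReal _ hK0, Real.dist_eq]
        refine (hgl x _ _).trans ?_
        calc _ ≤ C * ∑ j : J, 2 * (Real.sqrt (s / n / n) * dist e e') := by
              gcongr with j
              exact hsN_ofEntries_sub_le (by positivity) e e' j
          _ = _ := by simp [hK]; ring
      have hLx : Measurable fun e => g x (L e) := (hgx x).comp hLc.measurable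
      have hm2 : Measurable fun p : (J → Mat n) × (J → Mat n) => (g x p.2 - g x p.1) ^ 2 :=
        (((hgx x).comp measurable_snd).sub ((hgx x).comp measurable_fst)).pow_const 2
      have hm3 : Measurable fun p : EuclideanSpace ℝ (EntryIdx J n) ×
          EuclideanSpace ℝ (EntryIdx J n) => (g x (L p.2) - g x (L p.1)) ^ 2 :=
        ((hLx.comp measurable_snd).sub (hLx.comp measurable_fst)).pow_const 2
      rw [hlaw u, Measure.map_prod_map _ _ hLc.measurable hLc.measurable,
        integral_map (hLc.measurable.prodMap hLc.measurable).aemeasurable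
          hm2.aestronglyMeasurable]
      simp only [Prod.map_fst, Prod.map_snd]
      rw [integral_eq_lintegral_of_nonneg_ae (Eventually.of_forall fun q => sq_nonneg _)
          hm3.aestronglyMeasurable]
      refine ENNReal.toReal_le_of_le_ofReal (by positivity) ?_
      refine (lintegral_sub_sq_le_of_lipschitz hlip).trans (le_of_eq ?_)
      rw [Real.coe_toNNReal _ hK0]
  have hcongr : ∀ ω, φ.Lam P (Z n) (Sum.elim (X ω) fun j =>
          truncMat R (Z n (u + s) j ω - Z n u j ω)) -
        (RFormula.brownian s hs φ).Lam P (Z n) (X ω) =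
      g (fun a => X ω a) (W u ω) - ∫ w, g (fun a => X ω a) w ∂(P.map (W u)) := by
    intro ω
    rw [hge]
    congr 1
    -- The law of the increment does not depend on its starting time, so the average is the one over
    -- [0, s] appearing in the Brownian rule.
    rw [hlaw u, ← hlaw 0, integral_map (hWm 0).aemeasurable (hgx fun a => X ω a).aestronglyMeasurable,
      RFormula.Lam, ← hR]
    simp only [hge, hW, zero_add]
  simp only [hcongr]
  refine key.trans (le_of_eq ?_)
  rw [hK, mul_pow, Real.sq_sqrt (by positivity)]
  field_simp
  ring

end Concentration

end ChronOT

namespace ChronOT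

/-! ### Values of restricted formulas in the quotient as limits -/

section Structure

variable {Ω : Type*} [mΩ : MeasurableSpace Ω] {P : Measure Ω} [IsProbabilityMeasure P]
  {𝓖 : Filtration ℝ≥0 mΩ} {Z : ∀ n : ℕ+, ℝ≥0 → ℕ → Ω → Mat n}
  {U : Filter ℕ+} (V : Subalgebra.center ℂ (RMUltraproduct P U) →ₐ[ℂ] ℂ)
  (hZ : ∀ n, IsMatrixBM P 𝓖 n (Z n)) {α : Type}

include hZ in
lemma measurable_increments (n : ℕ+) (t : ℝ≥0) (j : ℕ) : Measurable (Z n t j) :=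
  (hZ n).measurable t j

lemma tendsto_atTop_of_le_cofinite {U : Filter ℕ+} (hU : U ≤ cofinite) :
    Tendsto (fun n : ℕ+ => ((n : ℕ) : ℝ)) U atTop := by
  refine tendsto_natCast_atTop_atTop.comp ?_
  refine Tendsto.mono_left ?_ hU
  rw [← Nat.cofinite_eq_atTop]
  exact PNat.coe_injective.tendsto_cofinite

lemma hsN_truncIncrement_le (s t : ℝ≥0) (j : ℕ) (n : ℕ+) (ω : Ω) :
    ‖(truncIncrement hZ s t j).1 n ω‖ ≤ 2 * truncRadius s t :=
  norm_truncMat_le (by unfold truncRadius; positivity) _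

lemma isMeas_truncIncrement {s t : ℝ≥0} (hst : s ≤ t) (j : ℕ) :
    IsMeas (truncIncrement hZ s t j) (𝓖 t) := fun n => by
  have h1 : Measurable[𝓖 t] (Z n t j) := (hZ n).adapted t j
  have h2 : Measurable[𝓖 t] (Z n s j) := ((hZ n).adapted s j).mono (𝓖.mono hst) le_rfl
  exact (continuous_truncMat _).measurable.comp (h1.sub h2)

/-- The error of the truncation of the increments. -/
lemma tendsto_truncError (hU : U ≤ cofinite) {s t : ℝ≥0} (hst : s ≤ t) (j : ℕ) :
    Tendsto (fun n => ∫ ω, hsSq ((Z n t j ω - Z n s j ω) - (truncIncrement hZ s t j).1 n ω) ∂P)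
      U (𝓝 0) ∧
    ∀ᶠ n in U, Integrable
      (fun ω => hsSq ((Z n t j ω - Z n s j ω) - (truncIncrement hZ s t j).1 n ω)) P := by
  rcases hst.eq_or_lt with rfl | hst
  · have : ∀ n ω, hsSq ((Z n s j ω - Z n s j ω) - (truncIncrement hZ s s j).1 n ω) = 0 := by
      intro n ω
      have h : (truncIncrement hZ s s j).1 n ω = 0 := by
        have := hsN_truncIncrement_le hZ s s j n ω
        rw [truncRadius, sub_self, Real.sqrt_zero, mul_zero, mul_zero] at this
        exact norm_le_zero_iff.1 this
      rw [h]
      simp [hsSq_eq]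
    simp only [this, integral_zero]
    exact ⟨tendsto_const_nhds, Eventually.of_forall fun _ => integrable_zero _ _ _⟩
  · have hN : ∀ N : ℕ, ∀ᶠ n : ℕ+ in U, N ≤ (n : ℕ) := fun N => by
      filter_upwards [(tendsto_atTop_of_le_cofinite hU).eventually_ge_atTop (N : ℝ)] with n hn
      exact_mod_cast hn
    constructor
    · rw [Metric.tendsto_nhds]
      intro ε hε
      obtain ⟨N, h⟩ := exists_integral_truncError_le (P := P) (𝓖 := 𝓖) hst (half_pos hε)
      filter_upwards [hN N] with n hn
      rw [Real.dist_eq, sub_zero, abs_of_nonneg (integral_nonneg fun ω => hsSq_nonneg _)]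
      exact ((h (hZ n) hn j).2).trans_lt (half_lt_self hε)
    · obtain ⟨N, h⟩ := exists_integral_truncError_le (P := P) (𝓖 := 𝓖) hst one_pos
      filter_upwards [hN N] with n hn
      exact (h (hZ n) hn j).1

lemma toQ_eq_of_tendsto_integral {X Y : RMSeq Ω}
    (h : Tendsto (fun n => ∫ ω, hsSq (X.1 n ω - Y.1 n ω) ∂P) U (𝓝 0)) : toQ V X = toQ V Y := by
  have : ultraMk P U X = ultraMk P U Y := by
    rw [ultraMk_eq_iff, mem_nullIdeal]
    exact h
  rw [toQ, this, toQ]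

/-- Untruncated increments add exactly, and the three truncation errors vanish in L² along U. -/
lemma toQ_truncIncrement_add (hU : U ≤ cofinite) {a u b : ℝ≥0} (hau : a ≤ u) (hub : u ≤ b)
    (j : ℕ) : toQ V (truncIncrement hZ a b j) =
      toQ V (truncIncrement hZ a u j) + toQ V (truncIncrement hZ u b j) := by
  rw [← toQ_add]
  refine toQ_eq_of_tendsto_integral V ?_
  obtain ⟨h1, i1⟩ := tendsto_truncError hZ hU (hau.trans hub) j
  obtain ⟨h2, i2⟩ := tendsto_truncError hZ hU hau j
  obtain ⟨h3, i3⟩ := tendsto_truncError hZ hU hub j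
  refine squeeze_zero' (Eventually.of_forall fun n => integral_nonneg fun ω => hsSq_nonneg _) ?_
    (by simpa using (h1.const_mul 2).add ((h2.const_mul 4).add (h3.const_mul 4)))
  filter_upwards [i1, i2, i3] with n j1 j2 j3
  rw [← integral_const_mul, ← integral_const_mul, ← integral_const_mul,
    ← integral_add (j2.const_mul 4) (j3.const_mul 4)]
  have k : Integrable (fun ω => 4 * hsSq ((Z n u j ω - Z n a j ω) -
      (truncIncrement hZ a u j).1 n ω) + 4 * hsSq ((Z n b j ω - Z n u j ω) -
      (truncIncrement hZ u b j).1 n ω)) P := (j2.const_mul 4).add (j3.const_mul 4)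
  rw [← integral_add (j1.const_mul 2) k]
  refine integral_mono_of_nonneg (Eventually.of_forall fun ω => hsSq_nonneg _)
    ((j1.const_mul 2).add k) (Eventually.of_forall fun ω => ?_)
  change hsSq ((truncIncrement hZ a b j).1 n ω -
    ((truncIncrement hZ a u j).1 n ω + (truncIncrement hZ u b j).1 n ω)) ≤ _
  set A := (truncIncrement hZ a b j).1 n ω
  set B := (truncIncrement hZ a u j).1 n ω
  set C := (truncIncrement hZ u b j).1 n ω
  have e : A - (B + C) = -((Z n b j ω - Z n a j ω) - A) + (((Z n u j ω - Z n a j ω) - B) +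
      ((Z n b j ω - Z n u j ω) - C)) := by abel
  have e2 : ∀ Y : Mat n, hsSq (-Y) = hsSq Y := fun Y => by simp [hsSq_eq]
  rw [e]
  refine (hsSq_add_le _ _).trans ?_
  rw [e2]
  have := hsSq_add_le ((Z n u j ω - Z n a j ω) - B) ((Z n b j ω - Z n u j ω) - C)
  change _ ≤ 2 * hsSq _ + (4 * hsSq _ + 4 * hsSq _)
  linarith

/-- Restricted formulas in the increments after an adapted tuple concentrate. -/
lemma tendsto_Lseq_brownian (hU : U ≤ cofinite) (φ : RFormula (α ⊕ ℕ)) {u s : ℝ≥0} (hs : 0 < s)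
    {X : α → RMSeq Ω} (hX : ∀ a, IsMeas (X a) (𝓖 u)) :
    Tendsto (fun p => Lseq Z P φ (Sum.elim X (truncIncrement hZ u (u + s))) p -
      Lseq Z P (RFormula.brownian s hs φ) X p) (charFilter V) (𝓝 0) := by
  have hZm := measurable_increments hZ
  obtain ⟨D, hD0, hD⟩ := exists_concentration hZ φ
  have hb : IsBddScalar fun n ω =>
      (((Lseq Z P φ (Sum.elim X (truncIncrement hZ u (u + s))) (n, ω) -
        Lseq Z P (RFormula.brownian s hs φ) X (n, ω) : ℝ)) : ℂ) := by
    have h1 := isBddScalar_Lseq (P := P) hZm φ (Sum.elim X (truncIncrement hZ u (u + s)))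
    have h2 := isBddScalar_Lseq (P := P) hZm (RFormula.brownian s hs φ) X
    have h3 := h1.add (h2.const_mul (-1))
    convert h3 using 3
    push_cast; ring
  have key := tendsto_charFilter_zero V hb ?_
  · have := (Complex.continuous_re.tendsto _).comp key
    simpa [Function.comp_def] using this
  · have hn := tendsto_atTop_of_le_cofinite hU
    have h0 : Tendsto (fun n : ℕ+ => D * s / ((n : ℕ) : ℝ) ^ 2) U (𝓝 0) :=
      Tendsto.div_atTop tendsto_const_nhds ((tendsto_pow_atTop two_ne_zero).comp hn)
    refine squeeze_zero (fun n => integral_nonneg fun ω => by positivity) (fun n => ?_) h0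
    refine le_trans (le_of_eq ?_) (hD n u s hs (fun ω a => (X a).1 n ω) fun a => hX a n)
    refine integral_congr_ae (Eventually.of_forall fun ω => ?_)
    simp only [Complex.norm_real, Real.norm_eq_abs, sq_abs]
    have : tupAt (Sum.elim X (truncIncrement hZ u (u + s))) (n, ω) =
      Sum.elim (fun a => (X a).1 n ω) fun j =>
        truncMat (truncRadius u (u + s)) (Z n (u + s) j ω - Z n u j ω) := by
      funext b
      rcases b with a | j <;> rfl
    rw [Lseq, this]
    rfl

lemma shift_shift {A : Type*} (S : ProcStructure A) (t s : ℝ≥0) :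
    (S.shift t).shift s = S.shift (t + s) := by
  simp only [ProcStructure.shift, add_assoc]

lemma shift_zero {A : Type*} (S : ProcStructure A) : S.shift 0 = S := by
  simp [ProcStructure.shift]

/-- Near-minimizers of adapted random functions can be chosen adapted. -/
lemma exists_adapted_argmin {m : ℕ} {r : Fin m → ℝ} (hr : ∀ j, 0 < r j) (t : ℝ≥0)
    (S : ∀ n : ℕ+, Ω → (Fin m → Mat n) → ℝ)
    (hS : ∀ n Y, Measurable[𝓖 t] fun ω => S n ω Y) :
    ∃ Y : Fin m → RMSeq Ω, (∀ j, IsMeas (Y j) (𝓖 t)) ∧ (∀ j n ω, ‖(Y j).1 n ω‖ ≤ r j) ∧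
      ∀ n ω (Y' : Fin m → Mat n), (∀ j, ‖Y' j‖ ≤ r j) → ∃ D : Fin m → Mat n,
        (∀ j, ‖D j‖ ≤ r j) ∧ (∀ j, ‖Y' j - D j‖ ≤ 1 / (n : ℝ)) ∧
        S n ω (fun j => (Y j).1 n ω) ≤ S n ω D := by
  have hn : ∀ n : ℕ+, (0 : ℝ) < 1 / (n : ℝ) := fun n => by
    have : (0 : ℝ) < (n : ℝ) := by exact_mod_cast n.pos
    positivity
  -- Nets of mesh 1/n make the minimum over finitely many points asymptotically as good as over the
  -- whole ball.
  choose N d hd hnet using fun n : ℕ+ => exists_finite_net n hr (hn n)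
  choose i hi him using fun n : ℕ+ => @exists_measurable_argmin Ω (𝓖 t) (N n)
    (fun ω k => S n ω (d n k)) (fun k => hS n (d n k))
  have hmeas : ∀ j (n : ℕ+), Measurable[𝓖 t] fun ω => d n (i n ω) j := fun j n =>
    (Measurable.of_discrete (f := fun k => d n k j)).comp (hi n)
  refine ⟨fun j => ⟨fun n ω => d n (i n ω) j, fun n => (hmeas j n).mono (𝓖.le t) le_rfl,
    r j, fun n ω => hd n _ j⟩, hmeas, fun j n ω => hd n _ j, fun n ω Y' hY' => ?_⟩
  obtain ⟨k, hk⟩ := hnet n Y' hY'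
  exact ⟨d n k, hd n k, hk, him n ω k⟩

lemma tupAt_option (Y : RMSeq Ω) (X : α → RMSeq Ω) (p : ℕ+ × Ω) :
    tupAt (fun o : Option α => o.elim Y X) p = fun o => o.elim (Y.1 p.1 p.2) (tupAt X p) := by
  funext o; cases o <;> rfl

lemma toQ_option (Y : RMSeq Ω) (X : α → RMSeq Ω) :
    (fun o : Option α => o.elim (toQ V Y) fun a => toQ V (X a)) =
      fun o => toQ V (o.elim Y X) := by
  funext o; cases o <;> rfl

lemma tendsto_one_div_charFilter (hU : U ≤ cofinite) :
    Tendsto (fun p : ℕ+ × Ω => 1 / ((p.1 : ℕ) : ℝ)) (charFilter V) (𝓝 0) :=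
  (tendsto_const_nhds.div_atTop (tendsto_atTop_of_le_cofinite hU)).comp (tendsto_fst_charFilter V)

include hZ in
/-- An adapted sequence that is asymptotically optimal in a quantifier. -/
lemma exists_adapted_optimizer (hU : U ≤ cofinite) {t : ℝ≥0} (φ : RFormula (Option α)) (σ : ℝ)
    {X : α → RMSeq Ω} (hX : ∀ a, IsMeas (X a) (𝓖 t)) {r : ℝ} (hr : 0 < r) :
    ∃ Y : RMSeq Ω, IsMeas Y (𝓖 t) ∧ (∀ n ω, ‖Y.1 n ω‖ ≤ r) ∧
      ∀ ε > 0, ∀ᶠ p in charFilter V, ∀ Y' : Mat p.1, ‖Y'‖ ≤ r →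
        σ * φ.Lam P (Z p.1) (fun o => o.elim Y' (tupAt X p)) ≤
          σ * Lseq Z P φ (fun o => o.elim Y X) p + ε := by
  have hZm := measurable_increments hZ
  obtain ⟨C, s, hC0, hC⟩ := φ.exists_lipschitz P
  -- Minimizing -σ φ maximizes φ for σ = 1 and minimizes it for σ = -1, which covers both
  -- quantifiers.
  obtain ⟨Y, hYm, hYr, hY⟩ := exists_adapted_argmin (r := fun _ : Fin 1 => r) (fun _ => hr) t
    (fun n ω D => -(σ * φ.Lam P (Z n) (fun o => o.elim (D 0) fun a => (X a).1 n ω)))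
    (fun n D => by
      refine ((@measurable_of_lipschitz _ _ _ (𝓖 t) _ _ _ (hC n (Z n) (hZm n)) _
        fun o _ => ?_).const_mul σ).neg
      cases o with
      | none => exact measurable_const
      | some a => exact hX a n)
  refine ⟨Y 0, hYm 0, hYr 0, fun ε hε => ?_⟩
  have h0 := (tendsto_one_div_charFilter V hU).const_mul (|σ| * C)
  rw [mul_zero] at h0
  filter_upwards [h0.eventually (gt_mem_nhds hε)] with p hp Y' hY'
  obtain ⟨D, hDr, hD, hmin⟩ := hY p.1 p.2 (fun _ => Y') fun _ => hY'
  have h1 := hC p.1 (Z p.1) (hZm p.1) (fun o => o.elim Y' (tupAt X p))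
    (fun o => o.elim (D 0) (tupAt X p))
  have h2 : tD s (fun o : Option α => o.elim Y' (tupAt X p))
      (fun o => o.elim (D 0) (tupAt X p)) ≤ 1 / ((p.1 : ℕ) : ℝ) := by
    refine (tD_option s _ _).trans ?_
    have : tD (Finset.eraseNone s) (tupAt X p) (tupAt X p) = 0 :=
      Finset.sum_eq_zero fun a _ => by rw [sub_self, hsN_zero]
    change hsN (Y' - D 0) + tD (Finset.eraseNone s) (tupAt X p) (tupAt X p) ≤ _
    rw [this, add_zero]
    exact (hsN_le_norm _).trans (hD 0)
  have h3 : |σ * φ.Lam P (Z p.1) (fun o => o.elim Y' (tupAt X p)) -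
      σ * φ.Lam P (Z p.1) (fun o => o.elim (D 0) (tupAt X p))| ≤
      |σ| * C * (1 / ((p.1 : ℕ) : ℝ)) := by
    rw [← mul_sub, abs_mul, mul_assoc]
    exact mul_le_mul_of_nonneg_left (h1.trans (mul_le_mul_of_nonneg_left h2 hC0)) (abs_nonneg _)
  have h4 := le_abs_self (σ * φ.Lam P (Z p.1) (fun o => o.elim Y' (tupAt X p)) -
      σ * φ.Lam P (Z p.1) (fun o => o.elim (D 0) (tupAt X p)))
  have h5 : Lseq Z P φ (fun o => o.elim (Y 0) X) p =
      φ.Lam P (Z p.1) (fun o => o.elim ((Y 0).1 p.1 p.2) (tupAt X p)) := by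
    rw [Lseq, tupAt_option]
  rw [h5]
  change -(σ * φ.Lam P (Z p.1) (fun o => o.elim ((Y 0).1 p.1 p.2) (tupAt X p))) ≤
    -(σ * φ.Lam P (Z p.1) (fun o => o.elim (D 0) (tupAt X p))) at hmin
  linarith

lemma RFormula.bddAbove_range (φ : RFormula α) {ι : Sort*} {n : ℕ+}
    (Z : ℝ≥0 → ℕ → Ω → Mat n) (f : ι → α → Mat n) :
    BddAbove (Set.range fun i => φ.Lam P Z (f i)) ∧
      BddBelow (Set.range fun i => φ.Lam P Z (f i)) := by
  obtain ⟨B, hB0, hB⟩ := φ.exists_bound P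
  refine ⟨⟨B, ?_⟩, ⟨-B, ?_⟩⟩
  · rintro _ ⟨i, rfl⟩
    exact (abs_le.1 (hB n Z _)).2
  · rintro _ ⟨i, rfl⟩
    exact (abs_le.1 (hB n Z _)).1

/-- The fundamental theorem for restricted formulas: the value in the quotient of an adapted tuple
is the limit of the values on the matrices. -/
theorem eval_eq_ev (hU : U ≤ cofinite) (φ : RFormula α) (t : ℝ≥0) (X : α → RMSeq Ω)
    (hX : ∀ a, IsMeas (X a) (𝓖 t)) :
    φ.eval ((quotStructure V hZ).shift t) (fun a => toQ V (X a)) = ev V Z φ X := by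
  have hZm := measurable_increments hZ
  induction φ generalizing t with
  | basic p =>
    symm
    refine ev_eq_of_tendsto V ?_
    simp only [RFormula.eval]
    rw [← toQ_resSeq, ← toQ_eval]
    refine ((Complex.continuous_re.tendsto _).comp (tendsto_quotTrace V _)).congr fun q => ?_
    simp only [Function.comp, eval_apply]
    rfl
  | conn f hf φ ih =>
    symm
    refine ev_eq_of_tendsto V ?_
    simp only [RFormula.eval, ih _ t X hX]
    obtain ⟨K, hK⟩ := hf
    exact (hK.continuous.tendsto _).comp (tendsto_pi_nhds.2 fun i => tendsto_ev V hZm (φ i) X)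
  | sup r hr φ ih =>
    simp only [RFormula.eval]
    have hev : ∀ Y : RMSeq Ω, IsMeas Y (𝓖 t) →
        φ.eval ((quotStructure V hZ).shift t) (fun o => o.elim (toQ V Y) fun a => toQ V (X a)) =
        ev V Z φ (fun o => o.elim Y X) := fun Y hY => by
      rw [toQ_option]
      exact ih t _ (fun o => by cases o; exacts [hY, hX _])
    -- At every (n, ω) a bounded sequence competes in the matrix supremum; this gives one
    -- inequality.
    have hle : ∀ Y : RMSeq Ω, (∀ n ω, ‖Y.1 n ω‖ ≤ r) →
        ev V Z φ (fun o => o.elim Y X) ≤ ev V Z (RFormula.sup r hr φ) X := fun Y hY => by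
      refine le_of_tendsto_of_tendsto' (tendsto_ev V hZm φ _) (tendsto_ev V hZm _ X) fun p => ?_
      rw [Lseq, tupAt_option]
      exact le_ciSup (f := fun Y : {Y : Mat p.1 // ‖Y‖ ≤ r} =>
        φ.Lam P (Z p.1) (fun o => o.elim (Y : Mat p.1) (tupAt X p)))
        (φ.bddAbove_range (Z p.1) _).1 ⟨Y.1 p.1 p.2, hY _ _⟩
    -- The reverse inequality: a single adapted sequence nearly attains the matrix supremum for
    -- almost all (n, ω) along the filter, and its class lies in the domain.
    obtain ⟨Y, hYm, hYr, hY⟩ := exists_adapted_optimizer V hZ hU φ 1 hX hr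
    have hdom : ∀ y : ((quotStructure V hZ).shift t).dom 0 r, ∃ Y : RMSeq Ω, IsMeas Y (𝓖 t) ∧
        (∀ n ω, ‖Y.1 n ω‖ ≤ r) ∧ toQ V Y = y := by
      rintro ⟨_, Y, h1, h2, rfl⟩
      exact ⟨Y, by rwa [add_zero] at h1, h2, rfl⟩
    have hmem : toQ V Y ∈ ((quotStructure V hZ).shift t).dom 0 r :=
      ⟨Y, by rw [add_zero]; exact hYm, hYr, rfl⟩
    have hub : ∀ y : ((quotStructure V hZ).shift t).dom 0 r,
        φ.eval ((quotStructure V hZ).shift t) (fun o => o.elim (y : RMQuotient V)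
          fun a => toQ V (X a)) ≤ ev V Z (RFormula.sup r hr φ) X := fun y => by
      obtain ⟨Y, h1, h2, h3⟩ := hdom y
      rw [← h3, hev Y h1]
      exact hle Y h2
    have hne : Nonempty (((quotStructure V hZ).shift t).dom 0 r) := ⟨⟨_, hmem⟩⟩
    refine le_antisymm (ciSup_le hub) ?_
    refine le_trans ?_ (le_ciSup ⟨_, by rintro _ ⟨y, rfl⟩; exact hub y⟩ ⟨_, hmem⟩)
    change _ ≤ φ.eval ((quotStructure V hZ).shift t) (fun o => o.elim (toQ V Y)
      fun a => toQ V (X a))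
    rw [hev Y hYm]
    refine le_of_forall_pos_le_add fun ε hε => ?_
    refine le_of_tendsto_of_tendsto (tendsto_ev V hZm _ X)
      ((tendsto_ev V hZm φ fun o => o.elim Y X).add_const ε) ?_
    filter_upwards [hY ε hε] with p hp
    have := nonempty_ball (n := p.1) hr
    refine ciSup_le fun D => ?_
    simpa using hp D D.2
  | inf r hr φ ih =>
    simp only [RFormula.eval]
    have hev : ∀ Y : RMSeq Ω, IsMeas Y (𝓖 t) →
        φ.eval ((quotStructure V hZ).shift t) (fun o => o.elim (toQ V Y) fun a => toQ V (X a)) =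
        ev V Z φ (fun o => o.elim Y X) := fun Y hY => by
      rw [toQ_option]
      exact ih t _ (fun o => by cases o; exacts [hY, hX _])
    have hle : ∀ Y : RMSeq Ω, (∀ n ω, ‖Y.1 n ω‖ ≤ r) →
        ev V Z (RFormula.inf r hr φ) X ≤ ev V Z φ (fun o => o.elim Y X) := fun Y hY => by
      refine le_of_tendsto_of_tendsto' (tendsto_ev V hZm _ X) (tendsto_ev V hZm φ _) fun p => ?_
      conv_rhs => rw [Lseq, tupAt_option]
      exact ciInf_le (f := fun Y : {Y : Mat p.1 // ‖Y‖ ≤ r} =>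
        φ.Lam P (Z p.1) (fun o => o.elim (Y : Mat p.1) (tupAt X p)))
        (φ.bddAbove_range (Z p.1) _).2 ⟨Y.1 p.1 p.2, hY _ _⟩
    obtain ⟨Y, hYm, hYr, hY⟩ := exists_adapted_optimizer V hZ hU φ (-1) hX hr
    have hdom : ∀ y : ((quotStructure V hZ).shift t).dom 0 r, ∃ Y : RMSeq Ω, IsMeas Y (𝓖 t) ∧
        (∀ n ω, ‖Y.1 n ω‖ ≤ r) ∧ toQ V Y = y := by
      rintro ⟨_, Y, h1, h2, rfl⟩
      exact ⟨Y, by rwa [add_zero] at h1, h2, rfl⟩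
    have hmem : toQ V Y ∈ ((quotStructure V hZ).shift t).dom 0 r :=
      ⟨Y, by rw [add_zero]; exact hYm, hYr, rfl⟩
    have hub : ∀ y : ((quotStructure V hZ).shift t).dom 0 r,
        ev V Z (RFormula.inf r hr φ) X ≤ φ.eval ((quotStructure V hZ).shift t)
          (fun o => o.elim (y : RMQuotient V) fun a => toQ V (X a)) := fun y => by
      obtain ⟨Y, h1, h2, h3⟩ := hdom y
      rw [← h3, hev Y h1]
      exact hle Y h2
    have hne : Nonempty (((quotStructure V hZ).shift t).dom 0 r) := ⟨⟨_, hmem⟩⟩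
    refine le_antisymm ?_ (le_ciInf hub)
    refine le_trans (ciInf_le ⟨_, by rintro _ ⟨y, rfl⟩; exact hub y⟩ ⟨_, hmem⟩) ?_
    change φ.eval ((quotStructure V hZ).shift t) (fun o => o.elim (toQ V Y)
      fun a => toQ V (X a)) ≤ _
    rw [hev Y hYm]
    refine le_of_forall_pos_le_add fun ε hε => ?_
    refine le_of_tendsto_of_tendsto (tendsto_ev V hZm φ fun o => o.elim Y X)
      ((tendsto_ev V hZm _ X).add_const ε) ?_
    filter_upwards [hY ε hε] with p hp
    have := nonempty_ball (n := p.1) hr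
    refine sub_le_iff_le_add.1 (le_ciInf fun D => ?_)
    have := hp D D.2
    linarith
  | brownian t₀ ht₀ φ ih =>
    symm
    refine ev_eq_of_tendsto V ?_
    simp only [RFormula.eval]
    rw [shift_shift]
    -- In the structure shifted by t, the increments over [0, t₀] are those over [t, t + t₀], and
    -- the enlarged tuple is adapted at time t + t₀.
    have hz : (Sum.elim (fun a => toQ V (X a)) (((quotStructure V hZ).shift t).z 0 t₀)) =
        fun b => toQ V (Sum.elim X (truncIncrement hZ t (t + t₀)) b) := by
      funext b
      rcases b with a | j
      · rfl
      · change toQ V (truncIncrement hZ (t + 0) (t + t₀) j) = _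
        rw [add_zero]; rfl
    rw [hz, ih (t + t₀) (Sum.elim X (truncIncrement hZ t (t + t₀))) (fun b => by
      rcases b with a | j
      · exact fun n => (hX a n).mono (𝓖.mono le_self_add) le_rfl
      · exact isMeas_truncIncrement hZ le_self_add j)]
    -- By concentration the value on the actual increments and the averaged value have the same
    -- limit.
    have h := (tendsto_ev V hZm φ (Sum.elim X (truncIncrement hZ t (t + t₀)))).sub
      (tendsto_Lseq_brownian V hZ hU φ ht₀ hX)
    simpa using h

end Structure

end ChronOT

namespace ChronOT

/-! ### Uniform approximation by polynomials in resolvents -/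

section Approx

variable {α : Type}

/-- Matrix-valued functions of bounded tuples that are uniform limits of star-polynomials in the
resolvents. -/
def IsResApprox (R : α → ℝ) (f : ∀ n : ℕ+, (α → Mat n) → Mat n) : Prop :=
  ∀ ε > 0, ∃ q : StarPoly (α ⊕ α), ∀ (n : ℕ+) (X : α → Mat n), (∀ a, ‖X a‖ ≤ R a) →
    ‖f n X - q.eval (resolvents X)‖ ≤ ε

variable {R : α → ℝ} {f g : ∀ n : ℕ+, (α → Mat n) → Mat n}

lemma IsResApprox.congr (hf : IsResApprox R f)
    (h : ∀ (n : ℕ+) (X : α → Mat n), (∀ a, ‖X a‖ ≤ R a) → f n X = g n X) : IsResApprox R g := by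
  intro ε hε
  obtain ⟨q, hq⟩ := hf ε hε
  exact ⟨q, fun n X hX => by rw [← h n X hX]; exact hq n X hX⟩

lemma IsResApprox.exists_bound (hf : IsResApprox R f) : ∃ C : ℝ, 0 ≤ C ∧
    ∀ (n : ℕ+) (X : α → Mat n), (∀ a, ‖X a‖ ≤ R a) → ‖f n X‖ ≤ C := by
  obtain ⟨q, hq⟩ := hf 1 one_pos
  obtain ⟨C, hC0, hC⟩ := q.exists_norm_le fun _ => 1
  refine ⟨1 + C, by positivity, fun n X hX => ?_⟩
  have h1 := hC n (resolvents X) (norm_resolvents_le X)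
  calc ‖f n X‖ = ‖(f n X - q.eval (resolvents X)) + q.eval (resolvents X)‖ := by
        rw [sub_add_cancel]
    _ ≤ 1 + C := (norm_add_le _ _).trans (add_le_add (hq n X hX) h1)

lemma IsResApprox.of_eval (q : StarPoly (α ⊕ α)) :
    IsResApprox R fun _ X => q.eval (resolvents X) := fun ε hε =>
  ⟨q, fun n X _ => by rw [sub_self, norm_zero]; exact hε.le⟩

lemma IsResApprox.of_limit (h : ∀ ε > 0, ∃ g : ∀ n : ℕ+, (α → Mat n) → Mat n, IsResApprox R g ∧
    ∀ (n : ℕ+) (X : α → Mat n), (∀ a, ‖X a‖ ≤ R a) → ‖f n X - g n X‖ ≤ ε) :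
    IsResApprox R f := by
  intro ε hε
  obtain ⟨g, hg, hfg⟩ := h (ε / 2) (half_pos hε)
  obtain ⟨q, hq⟩ := hg (ε / 2) (half_pos hε)
  refine ⟨q, fun n X hX => ?_⟩
  have := norm_add_le (f n X - g n X) (g n X - q.eval (resolvents X))
  rw [sub_add_sub_cancel] at this
  linarith [hfg n X hX, hq n X hX]

lemma IsResApprox.add (hf : IsResApprox R f) (hg : IsResApprox R g) :
    IsResApprox R fun n X => f n X + g n X := by
  intro ε hε
  obtain ⟨p, hp⟩ := hf (ε / 2) (half_pos hε)
  obtain ⟨q, hq⟩ := hg (ε / 2) (half_pos hε)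
  refine ⟨.add p q, fun n X hX => ?_⟩
  simp only [StarPoly.eval, add_sub_add_comm]
  linarith [norm_add_le (f n X - p.eval (resolvents X)) (g n X - q.eval (resolvents X)),
    hp n X hX, hq n X hX]

lemma IsResApprox.smul (hf : IsResApprox R f) (c : ℂ) :
    IsResApprox R fun n X => c • f n X := by
  intro ε hε
  obtain ⟨p, hp⟩ := hf (ε / (‖c‖ + 1)) (by positivity)
  refine ⟨.smul c p, fun n X hX => ?_⟩
  simp only [StarPoly.eval, ← smul_sub, norm_smul]
  calc ‖c‖ * _ ≤ (‖c‖ + 1) * (ε / (‖c‖ + 1)) := by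
        gcongr
        · linarith
        · exact hp n X hX
    _ = ε := by field_simp

lemma IsResApprox.star (hf : IsResApprox R f) :
    IsResApprox R fun n X => star (f n X) := by
  intro ε hε
  obtain ⟨p, hp⟩ := hf ε hε
  refine ⟨.adj p, fun n X hX => ?_⟩
  simp only [StarPoly.eval, ← star_sub, norm_star]
  exact hp n X hX

lemma IsResApprox.mul (hf : IsResApprox R f) (hg : IsResApprox R g) :
    IsResApprox R fun n X => f n X * g n X := by
  intro ε hε
  obtain ⟨C, hC0, hC⟩ := hf.exists_bound
  obtain ⟨q, hq⟩ := hg (ε / 2 / (C + 1)) (by positivity)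
  obtain ⟨D, hD0, hD⟩ := q.exists_norm_le fun _ => 1
  obtain ⟨p, hp⟩ := hf (ε / 2 / (D + 1)) (by positivity)
  refine ⟨.mul p q, fun n X hX => ?_⟩
  simp only [StarPoly.eval]
  have e : f n X * g n X - p.eval (resolvents X) * q.eval (resolvents X) =
      f n X * (g n X - q.eval (resolvents X)) +
        (f n X - p.eval (resolvents X)) * q.eval (resolvents X) := by noncomm_ring
  rw [e]
  have h1 : ‖f n X * (g n X - q.eval (resolvents X))‖ ≤ (C + 1) * (ε / 2 / (C + 1)) :=
    (norm_mul_le _ _).trans (mul_le_mul (by linarith [hC n X hX]) (hq n X hX) (norm_nonneg _)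
      (by positivity))
  have h2 : ‖(f n X - p.eval (resolvents X)) * q.eval (resolvents X)‖ ≤
      (ε / 2 / (D + 1)) * (D + 1) :=
    (norm_mul_le _ _).trans (mul_le_mul (hp n X hX)
      (by linarith [hD n (resolvents X) (norm_resolvents_le X)]) (norm_nonneg _) (by positivity))
  have e1 : (C + 1) * (ε / 2 / (C + 1)) = ε / 2 := by field_simp
  have e2 : (ε / 2 / (D + 1)) * (D + 1) = ε / 2 := by field_simp
  linarith [norm_add_le (f n X * (g n X - q.eval (resolvents X)))
    ((f n X - p.eval (resolvents X)) * q.eval (resolvents X))]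

lemma IsResApprox.one : IsResApprox R fun _ _ => 1 := IsResApprox.of_eval .one

lemma IsResApprox.pow (hf : IsResApprox R f) (k : ℕ) : IsResApprox R fun n X => f n X ^ k := by
  induction k with
  | zero => simpa using IsResApprox.one
  | succ k ih => simpa only [pow_succ] using ih.mul hf

lemma IsResApprox.sum {F : ℕ → ∀ n : ℕ+, (α → Mat n) → Mat n} (hF : ∀ k, IsResApprox R (F k))
    (N : ℕ) : IsResApprox R fun n X => ∑ k ∈ Finset.range N, F k n X := by
  induction N with
  | zero => simpa using IsResApprox.one.smul (R := R) 0
  | succ N ih => simpa only [Finset.sum_range_succ] using ih.add (hF N)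

/-- The remainder of the Neumann series for the inverse d of c is (1 - c)ᴺ d. -/
lemma norm_sum_pow_sub_le {n : ℕ+} {c d : Mat n} (h : c * d = 1) {q D : ℝ} (hq : ‖1 - c‖ ≤ q)
    (hD : ‖d‖ ≤ D) (N : ℕ) :
    ‖d - ∑ k ∈ Finset.range N, (1 - c) ^ k‖ ≤ q ^ N * D := by
  have e : d - ∑ k ∈ Finset.range N, (1 - c) ^ k = (1 - c) ^ N * d := by
    have h1 := geom_sum_mul_neg (1 - c) N
    rw [sub_sub_cancel] at h1
    have h2 : (1 - (1 - c) ^ N) * d = ∑ k ∈ Finset.range N, (1 - c) ^ k := by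
      rw [← h1, mul_assoc, h, mul_one]
    rw [← h2, sub_mul, one_mul, sub_sub_cancel]
  rw [e]
  have hq0 : 0 ≤ q := (norm_nonneg _).trans hq
  exact (norm_mul_le _ _).trans (mul_le_mul ((norm_pow_le _ _).trans
    (pow_le_pow_left₀ (norm_nonneg _) hq N)) hD (norm_nonneg _) (by positivity))

/-- Inverses by the geometric series. -/
lemma IsResApprox.of_mul_eq_one (hf : IsResApprox R f) {q D : ℝ} (hq1 : q < 1)
    (h : ∀ (n : ℕ+) (X : α → Mat n), (∀ a, ‖X a‖ ≤ R a) →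
      f n X * g n X = 1 ∧ ‖1 - f n X‖ ≤ q ∧ ‖g n X‖ ≤ D) : IsResApprox R g := by
  refine IsResApprox.of_limit fun ε hε => ?_
  -- If no tuple satisfies the norm bounds, the hypothesis does not exclude q < 0.
  have hq0 : 0 ≤ max q 0 := le_max_right _ _
  have hq1' : max q 0 < 1 := max_lt hq1 one_pos
  obtain ⟨N, hN⟩ := exists_pow_lt_of_lt_one (show 0 < ε / (|D| + 1) by positivity) hq1'
  refine ⟨_, IsResApprox.sum (fun k => (IsResApprox.one.add (hf.smul (-1))).pow k) N,
    fun n X hX => ?_⟩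
  obtain ⟨h1, h2, h3⟩ := h n X hX
  have := norm_sum_pow_sub_le h1 (h2.trans (le_max_left q 0)) (h3.trans
    ((le_abs_self D).trans (le_add_of_nonneg_right zero_le_one))) N
  simp only [neg_smul, one_smul, ← sub_eq_add_neg]
  refine this.trans ?_
  rw [lt_div_iff₀ (by positivity)] at hN
  exact hN.le

end Approx

/-! ### Recovering a self-adjoint matrix from its resolvent, and conversely -/

section ResolventAlgebra

variable {n : ℕ+} {A : Mat n}

lemma star_resolventI_mul (hA : IsSelfAdjoint A) :
    star (resolventI A) * (A - algebraMap ℂ (Mat n) Complex.I) = 1 := by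
  have h := congrArg star (mul_resolventI hA)
  rw [star_mul, star_add, hA.star_eq, star_one, ← algebraMap_star_comm] at h
  rw [sub_eq_add_neg, ← map_neg]
  simpa using h

lemma resolventI_mul_star_mul (hA : IsSelfAdjoint A) :
    resolventI A * star (resolventI A) * (A * A + 1) = 1 := by
  have e : A * A + 1 = (A - algebraMap ℂ (Mat n) Complex.I) *
      (A + algebraMap ℂ (Mat n) Complex.I) := by
    have h : algebraMap ℂ (Mat n) Complex.I * algebraMap ℂ (Mat n) Complex.I = -1 := by
      rw [← map_mul, Complex.I_mul_I, map_neg, map_one]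
    have hc := Algebra.commutes Complex.I A
    rw [sub_mul, mul_add, mul_add, h, hc]; abel
  rw [e, mul_assoc, ← mul_assoc (star _), star_resolventI_mul hA, one_mul, resolventI_mul hA]

lemma mul_resolventI_mul_star (hA : IsSelfAdjoint A) :
    (A * A + 1) * (resolventI A * star (resolventI A)) = 1 :=
  mul_eq_one_comm.1 (resolventI_mul_star_mul hA)

lemma resolventI_eq_mul (hA : IsSelfAdjoint A) : resolventI A =
    resolventI A * star (resolventI A) * (A - algebraMap ℂ (Mat n) Complex.I) := by
  rw [mul_assoc, star_resolventI_mul hA, mul_one]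

/-- With ρ the resolvent, ρ = ρ ρ* (A - i), so ρ + i ρ ρ* = ρ ρ* A, and A² + 1 is the inverse of ρ
ρ*. -/
lemma eq_mul_resolventI (hA : IsSelfAdjoint A) : A = (A * A + 1) * (resolventI A +
    Complex.I • (resolventI A * star (resolventI A))) := by
  have h : resolventI A + Complex.I • (resolventI A * star (resolventI A)) =
      resolventI A * star (resolventI A) * A := by
    nth_rewrite 1 [resolventI_eq_mul hA]
    rw [mul_sub, ← Algebra.commutes, ← Algebra.smul_def, sub_add_cancel]
  rw [h, ← mul_assoc, mul_resolventI_mul_star hA, one_mul]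

lemma cfc_sq_add_one (hA : IsSelfAdjoint A) : cfc (fun t : ℝ => t * t + 1) A = A * A + 1 := by
  rw [cfc_add_const (1 : ℝ) (fun t => t * t) A, cfc_mul (fun t : ℝ => t) (fun t => t) A,
    cfc_id' ℝ A, map_one]

/-- On the spectrum 1 - 1/(t² + 1) = t²/(t² + 1), which stays away from 1. The Neumann series
therefore inverts ρ ρ* uniformly over matrices of norm at most R. -/
lemma norm_one_sub_resolventI_mul_star_le (hA : IsSelfAdjoint A) {R : ℝ} (hR : ‖A‖ ≤ R) :
    ‖1 - resolventI A * star (resolventI A)‖ ≤ R ^ 2 / (R ^ 2 + 1) := by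
  have hc : Continuous fun t : ℝ => (t * t + 1)⁻¹ :=
    (by fun_prop : Continuous fun t : ℝ => t * t + 1).inv₀ fun t => by nlinarith [mul_self_nonneg t]
  have h1 : cfc (fun t : ℝ => (t * t + 1)⁻¹) A * (A * A + 1) = 1 := by
    rw [← cfc_sq_add_one hA, ← cfc_mul _ _ A hc.continuousOn (by fun_prop), ← cfc_one ℝ A]
    refine cfc_congr fun t _ => ?_
    exact inv_mul_cancel₀ (by nlinarith [mul_self_nonneg t])
  have h2 : resolventI A * star (resolventI A) = cfc (fun t : ℝ => (t * t + 1)⁻¹) A :=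
    (left_inv_eq_right_inv h1 (mul_resolventI_mul_star hA)).symm
  rw [h2, ← cfc_one ℝ A, ← cfc_sub _ _ A (by fun_prop) hc.continuousOn]
  have hR0 : 0 ≤ R := (norm_nonneg _).trans hR
  refine norm_cfc_le (by positivity) fun t ht => ?_
  have ht' : |t| ≤ R := (spectrum.norm_le_norm_of_mem ht).trans hR
  have e : 1 - (t * t + 1)⁻¹ = t ^ 2 / (t ^ 2 + 1) := by
    field_simp; ring
  have ht2 : t ^ 2 ≤ R ^ 2 := sq_le_sq.2 (by rwa [abs_of_nonneg hR0])
  change ‖1 - (t * t + 1)⁻¹‖ ≤ _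
  rw [e, Real.norm_of_nonneg (by positivity), div_le_div_iff₀ (by positivity) (by positivity)]
  nlinarith

/-- Division by R² + 1 brings the spectrum of A² + 1 into an interval [q', 1] with q' > 0, as the
Neumann series requires. -/
lemma norm_one_sub_sq_add_one_le (hA : IsSelfAdjoint A) {R : ℝ} (hR : ‖A‖ ≤ R) :
    ‖1 - ((R ^ 2 + 1)⁻¹ : ℝ) • (A * A + 1)‖ ≤ R ^ 2 / (R ^ 2 + 1) := by
  rw [← cfc_sq_add_one hA, ← cfc_smul _ _ A, ← cfc_one ℝ A, ← cfc_sub _ _ A]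
  have hR0 : 0 ≤ R := (norm_nonneg _).trans hR
  refine norm_cfc_le (by positivity) fun t ht => ?_
  have ht' : |t| ≤ R := (spectrum.norm_le_norm_of_mem ht).trans hR
  have ht2 : t ^ 2 ≤ R ^ 2 := sq_le_sq.2 (by rwa [abs_of_nonneg hR0])
  have e : 1 - (R ^ 2 + 1)⁻¹ * (t * t + 1) = (R ^ 2 - t ^ 2) / (R ^ 2 + 1) := by
    field_simp; ring
  change ‖1 - (R ^ 2 + 1)⁻¹ * (t * t + 1)‖ ≤ _
  rw [e, Real.norm_of_nonneg (div_nonneg (by linarith) (by positivity))]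
  gcongr
  nlinarith [sq_nonneg t]

end ResolventAlgebra

/-! ### Substitution of polynomials into restricted formulas -/

section Subst

variable {α β : Type} {R : α → ℝ}

/-- The inverse A² + 1 of ρ ρ* is obtained from the Neumann series, and `eq_mul_resolventI` then
recovers A by products. -/
lemma IsResApprox.of_resolventI {H : ∀ n : ℕ+, (α → Mat n) → Mat n}
    (hH : ∀ n X, IsSelfAdjoint (H n X)) {r : ℝ}
    (hr : ∀ (n : ℕ+) (X : α → Mat n), (∀ a, ‖X a‖ ≤ R a) → ‖H n X‖ ≤ r)
    (h : IsResApprox R fun n X => resolventI (H n X)) : IsResApprox R H := by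
  have hc := h.mul h.star
  have hd : IsResApprox R fun n X => H n X * H n X + 1 := by
    refine hc.of_mul_eq_one (q := r ^ 2 / (r ^ 2 + 1)) (D := r * r + 1)
      (by rw [div_lt_one (by positivity)]; linarith) fun n X hX =>
        ⟨resolventI_mul_star_mul (hH n X), norm_one_sub_resolventI_mul_star_le (hH n X) (hr n X hX),
          ?_⟩
    refine (norm_add_le _ _).trans (add_le_add ((norm_mul_le _ _).trans ?_) (norm_one_mat).le)
    have := hr n X hX
    exact mul_le_mul this this (norm_nonneg _) ((norm_nonneg _).trans this)
  exact (hd.mul (h.add (hc.smul Complex.I))).congr fun n X _ => (eq_mul_resolventI (hH n X)).symm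

/-- The converse direction: ρ = (A² + 1)⁻¹ (A - i), where the inverse comes from the Neumann series
after rescaling A² + 1. -/
lemma IsResApprox.resolventI {H : ∀ n : ℕ+, (α → Mat n) → Mat n}
    (hH : ∀ n X, IsSelfAdjoint (H n X)) (h : IsResApprox R H) :
    IsResApprox R fun n X => resolventI (H n X) := by
  obtain ⟨r, hr0, hr⟩ := h.exists_bound
  have hC := ((h.mul h).add IsResApprox.one).smul (((r ^ 2 + 1)⁻¹ : ℝ) : ℂ)
  have hD : IsResApprox R fun n X => ((r ^ 2 + 1 : ℝ) : ℂ) •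
      (ChronOT.resolventI (H n X) * Star.star (ChronOT.resolventI (H n X))) := by
    refine hC.of_mul_eq_one (q := r ^ 2 / (r ^ 2 + 1)) (D := (r ^ 2 + 1) * (1 * 1))
      (by rw [div_lt_one (by positivity)]; linarith) fun n X hX => ⟨?_, ?_, ?_⟩
    · rw [smul_mul_smul_comm, mul_resolventI_mul_star (hH n X), ← Complex.ofReal_mul,
        inv_mul_cancel₀ (by positivity), Complex.ofReal_one, one_smul]
    · simpa only [Complex.coe_smul] using norm_one_sub_sq_add_one_le (hH n X) (hr n X hX)
    · rw [norm_smul, Complex.norm_real, Real.norm_of_nonneg (by positivity)]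
      gcongr
      have := norm_resolventI_le (hH n X)
      exact (norm_mul_le _ _).trans (mul_le_mul this (by rwa [norm_star]) (norm_nonneg _)
        zero_le_one)
  have hc := hD.smul (((r ^ 2 + 1)⁻¹ : ℝ) : ℂ)
  refine (hc.mul (h.add (IsResApprox.one.smul (-Complex.I)))).congr fun n X _ => ?_
  conv_rhs => rw [resolventI_eq_mul (hH n X)]
  rw [smul_smul, ← Complex.ofReal_mul, inv_mul_cancel₀ (by positivity), Complex.ofReal_one,
    one_smul, neg_smul, ← sub_eq_add_neg, Algebra.algebraMap_eq_smul_one]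

lemma isResApprox_var (a : α) : IsResApprox R fun _ X => X a := by
  have h1 : IsResApprox R fun _ X => opRe (X a) := by
    refine IsResApprox.of_resolventI (fun n X => isSelfAdjoint_opRe _) (r := R a)
      (fun n X hX => (norm_opRe_le _).trans (hX a)) ?_
    exact (IsResApprox.of_eval (.var (.inl a))).congr fun n X _ => rfl
  have h2 : IsResApprox R fun _ X => opIm (X a) := by
    refine IsResApprox.of_resolventI (fun n X => isSelfAdjoint_opIm _) (r := R a)
      (fun n X hX => (norm_opIm_le _).trans (hX a)) ?_
    exact (IsResApprox.of_eval (.var (.inr a))).congr fun n X _ => rfl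
  exact (h1.add (h2.smul Complex.I)).congr fun n X _ => opRe_add_opIm _

lemma isResApprox_eval (p : StarPoly α) : IsResApprox R fun _ X => p.eval X := by
  induction p with
  | var b => exact isResApprox_var b
  | one => exact IsResApprox.one
  | add p q hp hq => exact hp.add hq
  | mul p q hp hq => exact hp.mul hq
  | adj p hp => exact hp.star
  | smul c p hp => exact hp.smul c

lemma isResApprox_resolvents (g : β → StarPoly α) (b : β ⊕ β) :
    IsResApprox R fun _ X => resolvents (fun b => (g b).eval X) b := by
  rcases b with b | b
  · refine IsResApprox.resolventI (fun n X => isSelfAdjoint_opRe _) ?_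
    have h := isResApprox_eval (R := R) (g b)
    exact ((h.add h.star).smul (1 / 2)).congr fun n X _ => rfl
  · refine IsResApprox.resolventI (fun n X => isSelfAdjoint_opIm _) ?_
    have h := isResApprox_eval (R := R) (g b)
    exact ((h.add (h.star.smul (-1))).smul (1 / (2 * Complex.I))).congr fun n X _ => by
      rw [neg_smul, one_smul, ← sub_eq_add_neg]; rfl

lemma IsResApprox.eval {f : β → ∀ n : ℕ+, (α → Mat n) → Mat n} (hf : ∀ b, IsResApprox R (f b))
    (p : StarPoly β) : IsResApprox R fun n X => p.eval fun b => f b n X := by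
  induction p with
  | var b => exact hf b
  | one => exact IsResApprox.one
  | add p q hp hq => exact hp.add hq
  | mul p q hp hq => exact hp.mul hq
  | adj p hp => exact hp.star
  | smul c p hp => exact hp.smul c

variable {Ω : Type*} [mΩ : MeasurableSpace Ω] (P : Measure Ω) [IsProbabilityMeasure P]

lemma IsResApprox.exists_formula {f : ∀ n : ℕ+, (α → Mat n) → Mat n} (hf : IsResApprox R f) {ε : ℝ}
    (hε : 0 < ε) : ∃ ψ : RFormula α, ∀ (n : ℕ+) (Z : ℝ≥0 → ℕ → Ω → Mat n) (X : α → Mat n),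
      (∀ a, ‖X a‖ ≤ R a) → |(normTr (f n X)).re - ψ.Lam P Z X| ≤ ε := by
  obtain ⟨q, hq⟩ := hf ε hε
  refine ⟨.basic q, fun n Z X hX => ?_⟩
  simp only [RFormula.Lam]
  rw [← Complex.sub_re, ← normTr_sub]
  exact (Complex.abs_re_le_norm _).trans ((norm_normTr_le _).trans
    ((hsN_le_norm _).trans (hq n X hX)))

lemma RFormula.integrable_increments {α : Type} (φ : RFormula (α ⊕ ℕ)) {n : ℕ+}
    {Z : ℝ≥0 → ℕ → Ω → Mat n} (hZ : ∀ t j, Measurable (Z t j)) (s t : ℝ≥0) (X : α → Mat n) :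
    Integrable (fun ω => φ.Lam P Z
      (Sum.elim X fun j => truncMat (truncRadius s t) (Z t j ω - Z s j ω))) P := by
  obtain ⟨C, S, hC, h⟩ := φ.exists_lipschitz P
  obtain ⟨B, hB, hb⟩ := φ.exists_bound P
  refine Integrable.of_bound (C := B) ?_ (Eventually.of_forall fun ω => hb n Z _)
  refine (measurable_of_lipschitz (h n Z hZ) fun b _ => ?_).aestronglyMeasurable
  rcases b with a | j
  · exact measurable_const
  · exact (continuous_truncMat _).measurable.comp ((hZ _ _).sub (hZ _ _))

lemma abs_integral_sub_le {f g : Ω → ℝ} (hf : Integrable f P) (hg : Integrable g P) {ε : ℝ}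
    (h : ∀ ω, |f ω - g ω| ≤ ε) : |∫ ω, f ω ∂P - ∫ ω, g ω ∂P| ≤ ε := by
  rw [← integral_sub hf hg]
  simpa using norm_integral_le_of_norm_le_const (μ := P) (f := fun ω => f ω - g ω)
    (Eventually.of_forall h)

/-- Substitution of star-polynomials in restricted formulas, up to a uniform error. -/
lemma RFormula.exists_subst (φ : RFormula β) (g : β → StarPoly α) (R : α → ℝ) {ε : ℝ}
    (hε : 0 < ε) : ∃ ψ : RFormula α, ∀ (n : ℕ+) (Z : ℝ≥0 → ℕ → Ω → Mat n),
      (∀ t j, Measurable (Z t j)) → ∀ X : α → Mat n, (∀ a, ‖X a‖ ≤ R a) →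
        |φ.Lam P Z (fun b => (g b).eval X) - ψ.Lam P Z X| ≤ ε := by
  induction φ generalizing α ε with
  | basic p =>
    obtain ⟨ψ, hψ⟩ := (IsResApprox.eval (isResApprox_resolvents (R := R) g) p).exists_formula P hε
    exact ⟨ψ, fun n Z _ X hX => hψ n Z X hX⟩
  | conn f hf φ ih =>
    obtain ⟨K, hK⟩ := hf
    choose ψ hψ using fun i => ih i g R (show 0 < ε / (K + 1) by positivity)
    refine ⟨.conn f ⟨K, hK⟩ ψ, fun n Z hZ X hX => ?_⟩
    simp only [RFormula.Lam]
    refine (hK.dist_le_mul _ _).trans ?_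
    calc (K : ℝ) * _ ≤ (K + 1) * (ε / (K + 1)) := by
          gcongr
          · linarith
          · exact (dist_pi_le_iff (by positivity)).2 fun i => hψ i n Z hZ X hX
      _ = ε := by field_simp
  | sup r hr φ ih =>
    -- The bound variable is substituted by itself, with the quantifier radius r as its norm bound.
    obtain ⟨ψ, hψ⟩ := ih (fun o => o.elim (.var none) fun b => (g b).bind fun a => .var (some a))
      (fun o => o.elim r R) hε
    refine ⟨.sup r hr ψ, fun n Z hZ X hX => ?_⟩
    simp only [RFormula.Lam]
    obtain ⟨B, hB0, hB⟩ := φ.exists_bound P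
    obtain ⟨B', hB0', hB'⟩ := ψ.exists_bound P
    have := nonempty_ball (n := n) hr
    refine abs_iSup_sub_iSup_le (B := max B B') (fun Y => (hB _ _ _).trans (le_max_left _ _))
      (fun Y => (hB' _ _ _).trans (le_max_right _ _)) fun Y => ?_
    refine le_trans (le_of_eq ?_) (hψ n Z hZ (fun o => o.elim (Y : Mat n) X) ?_)
    · congr 3
      funext o
      cases o with
      | none => rfl
      | some b => simp [StarPoly.eval_bind, StarPoly.eval]
    · rintro (_ | a)
      exacts [Y.2, hX a]
  | inf r hr φ ih =>
    obtain ⟨ψ, hψ⟩ := ih (fun o => o.elim (.var none) fun b => (g b).bind fun a => .var (some a))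
      (fun o => o.elim r R) hε
    refine ⟨.inf r hr ψ, fun n Z hZ X hX => ?_⟩
    simp only [RFormula.Lam]
    obtain ⟨B, hB0, hB⟩ := φ.exists_bound P
    obtain ⟨B', hB0', hB'⟩ := ψ.exists_bound P
    have := nonempty_ball (n := n) hr
    refine abs_iInf_sub_iInf_le (B := max B B') (fun Y => (hB _ _ _).trans (le_max_left _ _))
      (fun Y => (hB' _ _ _).trans (le_max_right _ _)) fun Y => ?_
    refine le_trans (le_of_eq ?_) (hψ n Z hZ (fun o => o.elim (Y : Mat n) X) ?_)
    · congr 3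
      funext o
      cases o with
      | none => rfl
      | some b => simp [StarPoly.eval_bind, StarPoly.eval]
    · rintro (_ | a)
      exacts [Y.2, hX a]
  | brownian t₀ ht₀ φ ih =>
    -- The increments are bounded by twice the truncation radius, so the uniform approximation
    -- applies to them too.
    obtain ⟨ψ, hψ⟩ := ih (Sum.elim (fun b => (g b).bind fun a => .var (.inl a))
      fun j => .var (.inr j)) (Sum.elim R fun _ => 2 * truncRadius 0 t₀) hε
    refine ⟨.brownian t₀ ht₀ ψ, fun n Z hZ X hX => ?_⟩
    simp only [RFormula.Lam]
    refine abs_integral_sub_le P (φ.integrable_increments P hZ _ _ _)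
      (ψ.integrable_increments P hZ _ _ _) fun ω => ?_
    set T : ℕ → Mat n := fun j => truncMat (truncRadius 0 t₀) (Z t₀ j ω - Z 0 j ω)
    refine le_trans (le_of_eq ?_) (hψ n Z hZ (Sum.elim X T) ?_)
    · congr 3
      funext b
      rcases b with b | j
      · simp [StarPoly.eval_bind, StarPoly.eval]
      · rfl
    · rintro (a | j)
      exacts [hX a, norm_truncMat_le (truncRadius_pos ht₀).le _]

end Subst

end ChronOT

namespace ChronOT

/-! ## Separability of the restricted formulas -/

/-- Countable sets of star-polynomials: construction depth at most `k` and scalars in a dense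
sequence. -/
def starPolySet (β : Type) : ℕ → Set (StarPoly β)
  | 0 => insert .one (Set.range .var)
  | k + 1 => starPolySet β k ∪ Set.image2 .add (starPolySet β k) (starPolySet β k) ∪
      Set.image2 .mul (starPolySet β k) (starPolySet β k) ∪ .adj '' starPolySet β k ∪
      Set.image2 .smul (Set.range (TopologicalSpace.denseSeq ℂ)) (starPolySet β k)

lemma starPolySet_countable (β : Type) [Countable β] (k : ℕ) : (starPolySet β k).Countable := by
  induction k with
  | zero => exact (Set.countable_range _).insert _
  | succ k ih =>
    exact (((ih.union (ih.image2 ih _)).union (ih.image2 ih _)).union (ih.image _)).union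
      ((Set.countable_range _).image2 ih _)

lemma starPolySet_mono (β : Type) : Monotone (starPolySet β) :=
  monotone_nat_of_le_succ fun k x hx => by
    simp only [starPolySet, Set.mem_union]
    exact Or.inl (Or.inl (Or.inl (Or.inl hx)))

lemma StarPoly.exists_mem_starPolySet {β : Type} (p : StarPoly β) (R : β → ℝ) {ε : ℝ}
    (hε : 0 < ε) : ∃ k, ∃ q ∈ starPolySet β k, ∀ (n : ℕ+) (v : β → Mat n), (∀ b, ‖v b‖ ≤ R b) →
      ‖p.eval v - q.eval v‖ ≤ ε := by
  induction p generalizing ε with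
  | var b => exact ⟨0, .var b, Or.inr ⟨b, rfl⟩, fun n v _ => by simpa using hε.le⟩
  | one => exact ⟨0, .one, Or.inl rfl, fun n v _ => by simpa using hε.le⟩
  | add p q hp hq =>
    obtain ⟨k, p', hp', h⟩ := hp (half_pos hε)
    obtain ⟨l, q', hq', h'⟩ := hq (half_pos hε)
    refine ⟨max k l + 1, .add p' q', ?_, fun n v hv => ?_⟩
    · exact Or.inl (Or.inl (Or.inl (Or.inr ⟨p', starPolySet_mono β (le_max_left _ _) hp', q',
        starPolySet_mono β (le_max_right _ _) hq', rfl⟩)))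
    · have e : (p.add q).eval v - (p'.add q').eval v =
          (p.eval v - p'.eval v) + (q.eval v - q'.eval v) := by simp only [StarPoly.eval]; abel
      rw [e]
      exact (norm_add_le _ _).trans (by linarith [h n v hv, h' n v hv])
  | mul p q hp hq =>
    obtain ⟨A, hA, ha⟩ := p.exists_norm_le R
    obtain ⟨B, hB, hb⟩ := q.exists_norm_le R
    obtain ⟨k, p', hp', h⟩ := hp (ε := ε / 2 / (B + 1)) (by positivity)
    -- The tolerance for the second factor must depend on the norm of the approximant `p'`, which is
    -- therefore chosen first.
    obtain ⟨A', hA', ha'⟩ := p'.exists_norm_le R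
    obtain ⟨l, q', hq', h'⟩ := hq (ε := ε / 2 / (A' + 1)) (by positivity)
    refine ⟨max k l + 1, .mul p' q', ?_, fun n v hv => ?_⟩
    · exact Or.inl (Or.inl (Or.inr ⟨p', starPolySet_mono β (le_max_left _ _) hp', q',
        starPolySet_mono β (le_max_right _ _) hq', rfl⟩))
    · have e : (p.mul q).eval v - (p'.mul q').eval v =
          (p.eval v - p'.eval v) * q.eval v + p'.eval v * (q.eval v - q'.eval v) := by
        simp only [StarPoly.eval]; noncomm_ring
      rw [e]
      have h1 : ‖(p.eval v - p'.eval v) * q.eval v‖ ≤ ε / 2 / (B + 1) * (B + 1) :=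
        (norm_mul_le _ _).trans (mul_le_mul (h n v hv) ((hb n v hv).trans (by linarith))
          (norm_nonneg _) (by positivity))
      have h2 : ‖p'.eval v * (q.eval v - q'.eval v)‖ ≤ (A' + 1) * (ε / 2 / (A' + 1)) :=
        (norm_mul_le _ _).trans (mul_le_mul ((ha' n v hv).trans (by linarith)) (h' n v hv)
          (norm_nonneg _) (by positivity))
      rw [div_mul_cancel₀ _ (by positivity)] at h1
      rw [mul_div_cancel₀ _ (by positivity)] at h2
      exact (norm_add_le _ _).trans (by linarith)
  | adj p hp =>
    obtain ⟨k, p', hp', h⟩ := hp hε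
    refine ⟨k + 1, .adj p', Or.inl (Or.inr ⟨p', hp', rfl⟩), fun n v hv => ?_⟩
    simp only [StarPoly.eval]
    rw [← star_sub, norm_star]
    exact h n v hv
  | smul c p hp =>
    obtain ⟨A, hA, ha⟩ := p.exists_norm_le R
    obtain ⟨_, hi, ⟨i, rfl⟩⟩ := Metric.dense_iff.1 (TopologicalSpace.denseRange_denseSeq ℂ) c
      (ε / 2 / (A + 1)) (by positivity)
    set d := TopologicalSpace.denseSeq ℂ i
    obtain ⟨k, p', hp', h⟩ := hp (ε := ε / 2 / (‖d‖ + 1)) (by positivity)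
    refine ⟨k + 1, .smul d p', Or.inr ⟨d, ⟨i, rfl⟩, p', hp', rfl⟩, fun n v hv => ?_⟩
    have e : (p.smul c).eval v - (p'.smul d).eval v =
        (c - d) • p.eval v + d • (p.eval v - p'.eval v) := by
      simp only [StarPoly.eval, sub_smul, smul_sub]; abel
    rw [e]
    have hcd : ‖c - d‖ ≤ ε / 2 / (A + 1) := by
      rw [← dist_eq_norm, dist_comm]; exact (Metric.mem_ball.1 hi).le
    have h1 : ‖(c - d) • p.eval v‖ ≤ ε / 2 / (A + 1) * (A + 1) := by
      rw [norm_smul]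
      exact mul_le_mul hcd ((ha n v hv).trans (by linarith)) (norm_nonneg _) (by positivity)
    have h2 : ‖d • (p.eval v - p'.eval v)‖ ≤ (‖d‖ + 1) * (ε / 2 / (‖d‖ + 1)) := by
      rw [norm_smul]
      exact mul_le_mul (by linarith) (h n v hv) (norm_nonneg _) (by positivity)
    rw [div_mul_cancel₀ _ (by positivity)] at h1
    rw [mul_div_cancel₀ _ (by positivity)] at h2
    exact (norm_add_le _ _).trans (by linarith)

/-- For the compact-open topology C(ℝᵏ, ℝ) is second countable, hence its subspace of Lipschitz
functions is separable. -/
lemma exists_dense_lipschitz (k : ℕ) : ∃ F : ℕ → {f : (Fin k → ℝ) → ℝ // ∃ K, LipschitzWith K f},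
    ∀ f : (Fin k → ℝ) → ℝ, (∃ K, LipschitzWith K f) → ∀ B ε : ℝ, 0 < ε → ∃ i, ∀ u : Fin k → ℝ,
      (∀ j, |u j| ≤ B) → |f u - (F i).1 u| ≤ ε := by
  set L : Set C(Fin k → ℝ, ℝ) := {f | ∃ K, LipschitzWith K f} with hL
  have hne : Nonempty L := ⟨⟨ContinuousMap.const _ 0, 0, LipschitzWith.const _⟩⟩
  refine ⟨fun i => ⟨(TopologicalSpace.denseSeq L i).1, (TopologicalSpace.denseSeq L i).2⟩,
    fun f hf B ε hε => ?_⟩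
  obtain ⟨K, hK⟩ := hf
  set f' : L := ⟨⟨f, hK.continuous⟩, K, hK⟩ with hf'
  have hcomp : IsCompact {u : Fin k → ℝ | ∀ j, |u j| ≤ B} := by
    have : {u : Fin k → ℝ | ∀ j, |u j| ≤ B} = Set.pi Set.univ fun _ => Metric.closedBall 0 B := by
      ext u; simp [Set.mem_pi, Real.norm_eq_abs]
    rw [this]
    exact isCompact_univ_pi fun _ => isCompact_closedBall _ _
  have hd := TopologicalSpace.denseRange_denseSeq L
  have hcl : f' ∈ closure (Set.range (TopologicalSpace.denseSeq L)) := hd f'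
  have hnh : {g : L | ∀ u ∈ {u : Fin k → ℝ | ∀ j, |u j| ≤ B}, dist (f'.1 u) (g.1 u) < ε} ∈ 𝓝 f' := by
    have ht : Tendsto (fun g : L => g.1) (𝓝 f') (𝓝 f'.1) := continuous_subtype_val.continuousAt
    have := (ContinuousMap.tendsto_iff_forall_isCompact_tendstoUniformlyOn.1 ht) _ hcomp
    exact Metric.tendstoUniformlyOn_iff.1 this ε hε
  obtain ⟨_, hg, ⟨i, rfl⟩⟩ := mem_closure_iff_nhds.1 hcl _ hnh
  exact ⟨i, fun u hu => by
    have := (hg u hu).le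
    rwa [Real.dist_eq] at this⟩

/-- A dense sequence of Lipschitz functions on `ℝᵏ`. -/
noncomputable def denseLipschitz (k : ℕ) : ℕ → {f : (Fin k → ℝ) → ℝ // ∃ K, LipschitzWith K f} :=
  (exists_dense_lipschitz k).choose

/-- Countable sets of restricted formulas: construction depth at most `k` and parameters in
countable dense sets. -/
def formulaSet : ℕ → (α : Type) → Set (RFormula α)
  | 0, _ => ∅
  | k + 1, α => formulaSet k α ∪ .basic '' (⋃ i, starPolySet (α ⊕ α) i) ∪
      (⋃ (l : ℕ) (i : ℕ), RFormula.conn (denseLipschitz l i).1 (denseLipschitz l i).2 ''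
        {φ | ∀ j, φ j ∈ formulaSet k α}) ∪
      (⋃ q : {q : ℚ // 0 < q}, RFormula.sup (q.1 : ℝ) (Rat.cast_pos.2 q.2) ''
        formulaSet k (Option α)) ∪
      (⋃ q : {q : ℚ // 0 < q}, RFormula.inf (q.1 : ℝ) (Rat.cast_pos.2 q.2) ''
        formulaSet k (Option α)) ∪
      (⋃ q : {q : ℚ // 0 < q}, RFormula.brownian (q.1 : ℝ).toNNReal
        (Real.toNNReal_pos.2 (Rat.cast_pos.2 q.2)) '' formulaSet k (α ⊕ ℕ))

lemma formulaSet_countable (k : ℕ) (α : Type) [Countable α] : (formulaSet k α).Countable := by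
  induction k generalizing α with
  | zero => exact Set.countable_empty
  | succ k ih =>
    refine (((((ih α).union ?_).union ?_).union ?_).union ?_).union ?_
    · exact (Set.countable_iUnion fun i => starPolySet_countable _ i).image _
    · exact Set.countable_iUnion fun l => Set.countable_iUnion fun i =>
        (Set.countable_pi fun _ => ih α).image _
    · exact Set.countable_iUnion fun q => (ih _).image _
    · exact Set.countable_iUnion fun q => (ih _).image _
    · exact Set.countable_iUnion fun q => (ih _).image _

lemma formulaSet_mono (α : Type) : Monotone fun k => formulaSet k α :=
  monotone_nat_of_le_succ fun k x hx => by
    simp only [formulaSet, Set.mem_union]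
    exact Or.inl (Or.inl (Or.inl (Or.inl (Or.inl hx))))

/-- Multiplication by the ratio of the radii maps one ball into the other and moves points by at
most the difference of the radii. This allows quantifier radii to be made rational. -/
lemma abs_iSup_ball_sub_le {n : ℕ+} {f g : Mat n → ℝ} {r r' B C d ε : ℝ} (hr : 0 < r) (hr' : 0 < r')
    (hC : 0 ≤ C) (hf : ∀ Y, |f Y| ≤ B) (hg : ∀ Y, |g Y| ≤ B)
    (hL : ∀ Y Y', |f Y - f Y'| ≤ C * hsN (Y - Y')) (hfg : ∀ Y, |f Y - g Y| ≤ d)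
    (h : C * |r - r'| + d ≤ ε) :
    |(⨆ Y : {Y : Mat n // ‖Y‖ ≤ r}, f Y) - ⨆ Y : {Y : Mat n // ‖Y‖ ≤ r'}, g Y| ≤ ε := by
  have := nonempty_ball (n := n) hr
  have := nonempty_ball (n := n) hr'
  have bdd : ∀ {u : Mat n → ℝ} (_ : ∀ Y, |u Y| ≤ B) (ρ : ℝ),
      BddAbove (Set.range fun Y : {Y : Mat n // ‖Y‖ ≤ ρ} => u Y) := fun hu ρ =>
    ⟨B, by rintro _ ⟨i, rfl⟩; exact (abs_le.1 (hu i)).2⟩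
  have scale : ∀ {ρ ρ' : ℝ}, 0 < ρ → 0 < ρ' → ∀ Y : Mat n, ‖Y‖ ≤ ρ →
      ∃ Y' : Mat n, ‖Y'‖ ≤ ρ' ∧ hsN (Y - Y') ≤ |ρ - ρ'| := by
    intro ρ ρ' hρ hρ' Y hY
    have hq : ‖((ρ' / ρ : ℝ) : ℂ)‖ = ρ' / ρ := by
      rw [Complex.norm_real, Real.norm_of_nonneg (by positivity)]
    refine ⟨((ρ' / ρ : ℝ) : ℂ) • Y, ?_, ?_⟩
    · rw [norm_smul, hq]
      calc ρ' / ρ * ‖Y‖ ≤ ρ' / ρ * ρ := by gcongr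
        _ = ρ' := by field_simp
    · have e : Y - ((ρ' / ρ : ℝ) : ℂ) • Y = ((1 - ρ' / ρ : ℝ) : ℂ) • Y := by
        push_cast; rw [sub_smul, one_smul]
      rw [e]
      refine (hsN_le_norm _).trans ?_
      rw [norm_smul, Complex.norm_real, Real.norm_eq_abs]
      calc |1 - ρ' / ρ| * ‖Y‖ ≤ |1 - ρ' / ρ| * ρ := by gcongr
        _ = |1 - ρ' / ρ| * |ρ| := by rw [abs_of_pos hρ]
        _ = |ρ - ρ'| := by rw [← abs_mul]; congr 1; field_simp
  rw [abs_le]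
  constructor
  · have : (⨆ Y : {Y : Mat n // ‖Y‖ ≤ r'}, g Y) ≤ (⨆ Y : {Y : Mat n // ‖Y‖ ≤ r}, f Y) + ε := by
      refine ciSup_le fun Y => ?_
      obtain ⟨Y', hY', hd⟩ := scale hr' hr Y.1 Y.2
      have h1 := le_ciSup (bdd hf r) ⟨Y', hY'⟩
      have h2 := (abs_le.1 (hfg Y.1)).1
      have h3 := (abs_le.1 (hL Y.1 Y')).2
      rw [abs_sub_comm] at hd
      have h4 := mul_le_mul_of_nonneg_left hd hC
      dsimp only at h1
      linarith
    linarith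
  · have : (⨆ Y : {Y : Mat n // ‖Y‖ ≤ r}, f Y) ≤ (⨆ Y : {Y : Mat n // ‖Y‖ ≤ r'}, g Y) + ε := by
      refine ciSup_le fun Y => ?_
      obtain ⟨Y', hY', hd⟩ := scale hr hr' Y.1 Y.2
      have h1 := le_ciSup (bdd hg r') ⟨Y', hY'⟩
      have h2 := (abs_le.1 (hfg Y')).2
      have h3 := (abs_le.1 (hL Y.1 Y')).2
      have h4 := mul_le_mul_of_nonneg_left hd hC
      dsimp only at h1
      linarith
    linarith

variable {Ω : Type*} [mΩ : MeasurableSpace Ω] (P : Measure Ω) [IsProbabilityMeasure P]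
  {𝓖 : Filtration ℝ≥0 mΩ}

lemma IsMatrixBM.integral_hsN_sub_le {n : ℕ+} {Z : ℝ≥0 → ℕ → Ω → Mat n} (hZ : IsMatrixBM P 𝓖 n Z)
    (s t : ℝ≥0) (j : ℕ) : Integrable (fun ω => hsN (Z t j ω - Z s j ω)) P ∧
    ∫ ω, hsN (Z t j ω - Z s j ω) ∂P ≤ Real.sqrt (2 * |(t : ℝ) - s|) := by
  wlog hst : s ≤ t generalizing s t
  · have := this t s (le_of_not_ge hst)
    rw [abs_sub_comm]
    simpa only [hsN_sub_comm (Z t j _)] using this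
  obtain ⟨h1, h2⟩ := hZ.integral_hsSq_sub hst j
  have hm : Measurable fun ω => hsN (Z t j ω - Z s j ω) :=
    continuous_hsN.measurable.comp ((hZ.measurable t j).sub (hZ.measurable s j))
  have i2 : Integrable (fun ω => hsN (Z t j ω - Z s j ω) ^ 2) P := by
    simpa only [hsN_sq] using h1
  have i1 : Integrable (fun ω => hsN (Z t j ω - Z s j ω)) P := by
    refine ((integrable_const (1 : ℝ)).add i2).mono' hm.aestronglyMeasurable
      (Eventually.of_forall fun ω => ?_)
    rw [Real.norm_of_nonneg (hsN_nonneg _)]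
    simp only [Pi.add_apply]
    nlinarith [sq_nonneg (hsN (Z t j ω - Z s j ω) - 1), sq_nonneg (hsN (Z t j ω - Z s j ω))]
  refine ⟨i1, Real.le_sqrt_of_sq_le ?_⟩
  refine (sq_integral_le i1 i2).trans ?_
  simp only [hsN_sq]
  rw [h2, abs_of_nonneg (sub_nonneg.2 (NNReal.coe_le_coe.2 hst))]

/-- Both the increment, in mean, and the truncation radius depend continuously on the time,
uniformly in n; this allows times to be made rational. -/
lemma RFormula.exists_brownian_close {α : Type} (φ : RFormula (α ⊕ ℕ)) (t₀ : ℝ≥0) {ε : ℝ}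
    (hε : 0 < ε) : ∃ δ > 0, ∀ t : ℝ≥0, |(t : ℝ) - t₀| ≤ δ → ∀ (n : ℕ+) (Z : ℝ≥0 → ℕ → Ω → Mat n),
      IsMatrixBM P 𝓖 n Z → ∀ X : α → Mat n,
        |(∫ ω, φ.Lam P Z
            (Sum.elim X fun j => truncMat (truncRadius 0 t₀) (Z t₀ j ω - Z 0 j ω)) ∂P) -
          ∫ ω, φ.Lam P Z
            (Sum.elim X fun j => truncMat (truncRadius 0 t) (Z t j ω - Z 0 j ω)) ∂P| ≤ ε := by
  obtain ⟨C, s, hC, hL⟩ := φ.exists_lipschitz P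
  set J := s.toRight with hJ
  have hcont : Tendsto (fun t : ℝ≥0 => C * (J.card * (2 * Real.sqrt (2 * |(t : ℝ) - t₀|) +
      2 * |truncRadius 0 t₀ - truncRadius 0 t|))) (𝓝 t₀) (𝓝 0) := by
    have : Continuous fun t : ℝ≥0 => C * (J.card * (2 * Real.sqrt (2 * |(t : ℝ) - t₀|) +
      2 * |truncRadius 0 t₀ - truncRadius 0 t|)) := by unfold truncRadius; fun_prop
    simpa using this.tendsto t₀
  obtain ⟨δ, hδ, h⟩ := Metric.eventually_nhds_iff.1 (hcont.eventually (gt_mem_nhds hε))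
  refine ⟨δ / 2, half_pos hδ, fun t ht n Z hZ X => ?_⟩
  have hlt := h (y := t) (by rw [NNReal.dist_eq]; linarith)
  have hZm := hZ.measurable
  have I1 := φ.integrable_increments P hZm 0 t₀ X
  have I2 := φ.integrable_increments P hZm 0 t X
  have hT : ∀ ω, |φ.Lam P Z
        (Sum.elim X fun j => truncMat (truncRadius 0 t₀) (Z t₀ j ω - Z 0 j ω)) -
      φ.Lam P Z (Sum.elim X fun j => truncMat (truncRadius 0 t) (Z t j ω - Z 0 j ω))| ≤
      C * ∑ j ∈ J, (2 * hsN (Z t₀ j ω - Z t j ω) + 2 * |truncRadius 0 t₀ - truncRadius 0 t|) := by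
    intro ω
    refine (hL n Z hZm _ _).trans (mul_le_mul_of_nonneg_left ?_ hC)
    rw [tD_sum]
    -- The ordinary variables are the same on both sides; only the increments in `J` move.
    have e0 : tD s.toLeft (fun a => Sum.elim (γ := Mat n) X (fun j => truncMat (truncRadius 0 t₀)
        (Z t₀ j ω - Z 0 j ω)) (.inl a)) (fun a => Sum.elim (γ := Mat n) X
        (fun j => truncMat (truncRadius 0 t) (Z t j ω - Z 0 j ω)) (.inl a)) = 0 := by
      simp [tD, hsN_zero]
    rw [e0, zero_add, tD]
    refine Finset.sum_le_sum fun j _ => ?_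
    simp only [Sum.elim_inr]
    refine (hsN_truncMat_sub_le (by unfold truncRadius; positivity) _ _).trans (le_of_eq ?_)
    congr 3
    abel
  have i3 : ∀ j, Integrable (fun ω => 2 * hsN (Z t₀ j ω - Z t j ω) +
      2 * |truncRadius 0 t₀ - truncRadius 0 t|) P := fun j =>
    (((hZ.integral_hsN_sub_le P t t₀ j).1).const_mul 2).add (integrable_const _)
  rw [← integral_sub I1 I2]
  refine (abs_integral_le_integral_abs).trans ?_
  refine (integral_mono (I1.sub I2).abs ((integrable_finsetSum J fun j _ => i3 j).const_mul C)
    hT).trans ?_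
  rw [integral_const_mul, integral_finsetSum J fun j _ => i3 j]
  refine le_trans (mul_le_mul_of_nonneg_left ?_ hC) hlt.le
  rw [← nsmul_eq_mul]
  refine Finset.sum_le_card_nsmul _ _ _ fun j _ => ?_
  rw [integral_add (((hZ.integral_hsN_sub_le P t t₀ j).1).const_mul 2) (integrable_const _),
    integral_const_mul]
  have := (hZ.integral_hsN_sub_le P t t₀ j).2
  rw [abs_sub_comm] at this
  simp only [integral_const, probReal_univ, one_smul]
  linarith

lemma exists_rat_near {r : ℝ} (hr : 0 < r) {δ : ℝ} (hδ : 0 < δ) :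
    ∃ q : {q : ℚ // 0 < q}, |(q.1 : ℝ) - r| ≤ δ := by
  obtain ⟨q, h1, h2⟩ := exists_rat_btwn (show r < r + δ by linarith)
  refine ⟨⟨q, by exact_mod_cast hr.trans h1⟩, ?_⟩
  rw [abs_of_pos (by simpa using h1)]
  simp only
  linarith

/-- Every restricted formula is a uniform limit of formulas from countably many. -/
lemma RFormula.exists_mem_formulaSet {α : Type} (φ : RFormula α) {ε : ℝ} (hε : 0 < ε) :
    ∃ k, ∃ ψ ∈ formulaSet k α, ∀ (n : ℕ+) (Z : ℝ≥0 → ℕ → Ω → Mat n),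
      IsMatrixBM P 𝓖 n Z → ∀ X : α → Mat n, |φ.Lam P Z X - ψ.Lam P Z X| ≤ ε := by
  induction φ generalizing ε with
  | basic p =>
    obtain ⟨k, q, hq, h⟩ := p.exists_mem_starPolySet (fun _ => 1) hε
    refine ⟨1, .basic q, ?_, fun n Z _ X => ?_⟩
    · exact Or.inl (Or.inl (Or.inl (Or.inl (Or.inr ⟨q, Set.mem_iUnion.2 ⟨k, hq⟩, rfl⟩))))
    · simp only [RFormula.Lam]
      rw [← Complex.sub_re, ← normTr_sub]
      exact (Complex.abs_re_le_norm _).trans ((norm_normTr_le _).trans ((hsN_le_norm _).trans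
        (h n _ (norm_resolvents_le X))))
  | @conn α k f hf φ ih =>
    choose B hB hb using fun i => (φ i).exists_bound P
    obtain ⟨K, hK⟩ := id hf
    have hM : ∀ i, B i ≤ ∑ j, B j := fun i =>
      Finset.single_le_sum (fun j _ => hB j) (Finset.mem_univ i)
    -- The margin 1 leaves room for the approximants of the subformulas, whose error is kept below
    -- 1.
    obtain ⟨i, hi⟩ := (exists_dense_lipschitz k).choose_spec f hf (∑ j, B j + 1) (ε / 2)
      (half_pos hε)
    have hη : 0 < min 1 (ε / 2 / (K + 1)) := lt_min one_pos (by positivity)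
    choose l ψ hψ h using fun j => ih j hη
    refine ⟨Finset.univ.sup l + 1, .conn (denseLipschitz k i).1 (denseLipschitz k i).2 ψ, ?_,
      fun n Z hZ X => ?_⟩
    · refine Or.inl (Or.inl (Or.inl (Or.inr (Set.mem_iUnion₂.2 ⟨k, i, ψ, fun j => ?_, rfl⟩))))
      exact formulaSet_mono α (Finset.le_sup (Finset.mem_univ j)) (hψ j)
    · have h1 : |f (fun j => (φ j).Lam P Z X) - f fun j => (ψ j).Lam P Z X| ≤ ε / 2 := by
        rw [← Real.dist_eq]
        refine (hK.dist_le_mul _ _).trans ?_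
        calc (K : ℝ) * dist (fun j => (φ j).Lam P Z X) (fun j => (ψ j).Lam P Z X)
            ≤ (K + 1) * (ε / 2 / (K + 1)) := by
              refine mul_le_mul (by linarith) ?_ dist_nonneg (by positivity)
              refine (dist_pi_le_iff (by positivity)).2 fun j => ?_
              rw [Real.dist_eq]
              exact (h j n Z hZ X).trans (min_le_right _ _)
          _ = ε / 2 := by field_simp
      have h2 := hi (fun j => (ψ j).Lam P Z X) fun j => by
        have a1 := abs_le.1 (hb j n Z X)
        have a2 := abs_le.1 ((h j n Z hZ X).trans (min_le_left _ _))
        rw [abs_le]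
        constructor <;> linarith [hM j]
      simp only [RFormula.Lam]
      refine (abs_sub_le _ (f fun j => (ψ j).Lam P Z X) _).trans ?_
      have h2' : |f (fun j => (ψ j).Lam P Z X) -
        (denseLipschitz k i).1 (fun j => (ψ j).Lam P Z X)| ≤ ε / 2 := h2
      linarith
  | @sup α r hr φ ih =>
    obtain ⟨B, hB, hb⟩ := φ.exists_bound P
    obtain ⟨C, s, hC, hL⟩ := φ.exists_lipschitz P
    obtain ⟨k, ψ, hψ, h⟩ := ih (half_pos hε)
    obtain ⟨B', hB', hb'⟩ := ψ.exists_bound P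
    obtain ⟨q, hq⟩ := exists_rat_near hr (δ := ε / 2 / (C + 1)) (by positivity)
    refine ⟨k + 1, .sup (q.1 : ℝ) (Rat.cast_pos.2 q.2) ψ, ?_, fun n Z hZ X => ?_⟩
    · exact Or.inl (Or.inl (Or.inr (Set.mem_iUnion.2 ⟨q, ψ, hψ, rfl⟩)))
    · simp only [RFormula.Lam]
      refine abs_iSup_ball_sub_le (f := fun Y => φ.Lam P Z fun o => o.elim Y X)
        (g := fun Y => ψ.Lam P Z fun o => o.elim Y X) (B := max B B') (C := C) (d := ε / 2)
        hr (Rat.cast_pos.2 q.2) hC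
        (fun Y => (hb n Z _).trans (le_max_left _ _)) (fun Y => (hb' n Z _).trans (le_max_right _ _))
        (fun Y Y' => ?_) (fun Y => h n Z hZ _) ?_
      · refine (hL n Z hZ.measurable _ _).trans (mul_le_mul_of_nonneg_left ?_ hC)
        refine (tD_option s _ _).trans ?_
        simp [tD, hsN_zero]
      · rw [abs_sub_comm] at hq
        have : C * |r - q.1| ≤ (C + 1) * (ε / 2 / (C + 1)) :=
          mul_le_mul (by linarith) hq (abs_nonneg _) (by positivity)
        rw [mul_div_cancel₀ _ (by positivity)] at this
        linarith
  | @inf α r hr φ ih =>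
    obtain ⟨B, hB, hb⟩ := φ.exists_bound P
    obtain ⟨C, s, hC, hL⟩ := φ.exists_lipschitz P
    obtain ⟨k, ψ, hψ, h⟩ := ih (half_pos hε)
    obtain ⟨B', hB', hb'⟩ := ψ.exists_bound P
    obtain ⟨q, hq⟩ := exists_rat_near hr (δ := ε / 2 / (C + 1)) (by positivity)
    refine ⟨k + 1, .inf (q.1 : ℝ) (Rat.cast_pos.2 q.2) ψ, ?_, fun n Z hZ X => ?_⟩
    · exact Or.inl (Or.inr (Set.mem_iUnion.2 ⟨q, ψ, hψ, rfl⟩))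
    · simp only [RFormula.Lam]
      rw [iInf_eq_neg_iSup_neg, iInf_eq_neg_iSup_neg, neg_sub_neg, abs_sub_comm]
      refine abs_iSup_ball_sub_le (f := fun Y => -φ.Lam P Z fun o => o.elim Y X)
        (g := fun Y => -ψ.Lam P Z fun o => o.elim Y X) (B := max B B') (C := C) (d := ε / 2)
        hr (Rat.cast_pos.2 q.2) hC
        (fun Y => by rw [abs_neg]; exact (hb n Z _).trans (le_max_left _ _))
        (fun Y => by rw [abs_neg]; exact (hb' n Z _).trans (le_max_right _ _))
        (fun Y Y' => ?_) (fun Y => ?_) ?_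
      · rw [neg_sub_neg, abs_sub_comm]
        refine (hL n Z hZ.measurable _ _).trans (mul_le_mul_of_nonneg_left ?_ hC)
        refine (tD_option s _ _).trans ?_
        simp [tD, hsN_zero]
      · rw [neg_sub_neg, abs_sub_comm]; exact h n Z hZ _
      · rw [abs_sub_comm] at hq
        have : C * |r - q.1| ≤ (C + 1) * (ε / 2 / (C + 1)) :=
          mul_le_mul (by linarith) hq (abs_nonneg _) (by positivity)
        rw [mul_div_cancel₀ _ (by positivity)] at this
        linarith
  | @brownian α t₀ ht₀ φ ih =>
    obtain ⟨δ, hδ, hcl⟩ := φ.exists_brownian_close P (𝓖 := 𝓖) t₀ (half_pos hε)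
    obtain ⟨k, ψ, hψ, h⟩ := ih (half_pos hε)
    obtain ⟨q, hq⟩ := exists_rat_near (NNReal.coe_pos.2 ht₀) hδ
    refine ⟨k + 1, .brownian (q.1 : ℝ).toNNReal (Real.toNNReal_pos.2 (Rat.cast_pos.2 q.2)) ψ, ?_,
      fun n Z hZ X => ?_⟩
    · exact Or.inr (Set.mem_iUnion.2 ⟨q, ψ, hψ, rfl⟩)
    · have hq0 : (0 : ℝ) ≤ q.1 := (Rat.cast_pos.2 q.2).le
      have h1 := hcl (q.1 : ℝ).toNNReal (by rwa [Real.coe_toNNReal _ hq0]) n Z hZ X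
      have h2 := abs_integral_sub_le P
        (φ.integrable_increments P hZ.measurable 0 (q.1 : ℝ).toNNReal X)
        (ψ.integrable_increments P hZ.measurable 0 (q.1 : ℝ).toNNReal X) fun ω => h n Z hZ _
      simp only [RFormula.Lam]
      exact (abs_sub_le _ _ _).trans (by linarith)

/-- A sequence of restricted formulas which is dense for uniform convergence. -/
lemma exists_dense_formula (𝓖 : Filtration ℝ≥0 mΩ) (α : Type) [Countable α] :
    ∃ D : ℕ → RFormula α, ∀ (φ : RFormula α) (ε : ℝ), 0 < ε → ∃ i, ∀ (n : ℕ+)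
      (Z : ℝ≥0 → ℕ → Ω → Mat n), IsMatrixBM P 𝓖 n Z → ∀ X : α → Mat n,
        |φ.Lam P Z X - (D i).Lam P Z X| ≤ ε := by
  have hc : (⋃ k, formulaSet k α).Countable := Set.countable_iUnion fun k => formulaSet_countable k α
  have hne : (⋃ k, formulaSet k α).Nonempty := by
    obtain ⟨k, ψ, hψ, -⟩ := (RFormula.basic (α := α) .one).exists_mem_formulaSet P (𝓖 := 𝓖) one_pos
    exact ⟨ψ, Set.mem_iUnion.2 ⟨k, hψ⟩⟩
  obtain ⟨D, hD⟩ := hc.exists_eq_range hne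
  refine ⟨D, fun φ ε hε => ?_⟩
  obtain ⟨k, ψ, hψ, h⟩ := φ.exists_mem_formulaSet P (𝓖 := 𝓖) hε
  have : ψ ∈ Set.range D := hD ▸ Set.mem_iUnion.2 ⟨k, hψ⟩
  obtain ⟨i, rfl⟩ := this
  exact ⟨i, h⟩

end ChronOT

namespace ChronOT

/-! ## Transfer of existential statements between families with the same limits -/

section Transfer

variable {Ω : Type*} [mΩ : MeasurableSpace Ω] (P : Measure Ω) [IsProbabilityMeasure P]
  {𝓖 : Filtration ℝ≥0 mΩ} {α : Type}

/-- The infimum over a finite product of balls is a restricted formula. -/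
lemma RFormula.exists_infs {m : ℕ} {r : Fin m → ℝ} (hr : ∀ j, 0 < r j)
    (θ : RFormula (Fin m ⊕ α)) : ∃ χ : RFormula α, ∀ (n : ℕ+) (Z : ℝ≥0 → ℕ → Ω → Mat n)
      (X : α → Mat n), (∀ Y : Fin m → Mat n, (∀ j, ‖Y j‖ ≤ r j) →
        χ.Lam P Z X ≤ θ.Lam P Z (Sum.elim Y X)) ∧
      ∀ ε > 0, ∃ Y : Fin m → Mat n, (∀ j, ‖Y j‖ ≤ r j) ∧
        θ.Lam P Z (Sum.elim Y X) ≤ χ.Lam P Z X + ε := by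
  induction m with
  | zero =>
    refine ⟨θ.map (Sum.elim Fin.elim0 id), fun n Z X => ?_⟩
    have e : ∀ Y : Fin 0 → Mat n, Sum.elim Y X = X ∘ Sum.elim Fin.elim0 id := fun Y => by
      funext a
      rcases a with j | a
      · exact j.elim0
      · rfl
    simp only [RFormula.Lam_map, e]
    exact ⟨fun Y _ => le_rfl, fun ε hε => ⟨Fin.elim0, fun j => j.elim0, by linarith⟩⟩
  | succ m ih =>
    -- The first entry of the tuple becomes the variable bound by the innermost infimum.
    set e : Fin (m + 1) ⊕ α → Option (Fin m ⊕ α) :=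
      Sum.elim (Fin.cases none fun j => some (.inl j)) fun a => some (.inr a) with he
    obtain ⟨χ, hχ⟩ := ih (r := fun j => r j.succ) (fun j => hr _) (.inf (r 0) (hr 0) (θ.map e))
    refine ⟨χ, fun n Z X => ?_⟩
    obtain ⟨h1, h2⟩ := hχ n Z X
    have key : ∀ (Y₀ : Mat n) (Y : Fin m → Mat n),
        (fun o : Option (Fin m ⊕ α) => o.elim Y₀ (Sum.elim Y X)) ∘ e =
          Sum.elim (Fin.cons Y₀ Y : Fin (m + 1) → Mat n) X := fun Y₀ Y => by
      funext a
      rcases a with j | a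
      · refine Fin.cases ?_ (fun j => ?_) j <;> simp [he]
      · rfl
    simp only [RFormula.Lam, RFormula.Lam_map, key] at h1 h2
    have := nonempty_ball (n := n) (hr 0)
    constructor
    · intro Y hY
      refine (h1 (fun j => Y j.succ) fun j => hY _).trans ?_
      refine (ciInf_le (θ.bddAbove_range Z _).2 (⟨Y 0, hY 0⟩ : {Y : Mat n // ‖Y‖ ≤ r 0})).trans
        (le_of_eq ?_)
      congr 2
      exact Fin.cons_self_tail Y
    · intro ε hε
      obtain ⟨Y, hY, hle⟩ := h2 (ε / 2) (half_pos hε)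
      obtain ⟨Y₀, hlt⟩ := exists_lt_of_ciInf_lt (lt_add_of_pos_right
        (⨅ Y₀ : {Y : Mat n // ‖Y‖ ≤ r 0}, θ.Lam P Z
          (Sum.elim (Fin.cons Y₀.1 Y : Fin (m + 1) → Mat n) X)) (half_pos hε))
      refine ⟨Fin.cons Y₀.1 Y, fun j => Fin.cases Y₀.2 (fun j => ?_) j, by linarith⟩
      simpa using hY j

variable (Z : ∀ n : ℕ+, ℝ≥0 → ℕ → Ω → Mat n)

/-- All restricted formulas converge along a family of tuples of matrices. -/
def HasLims {I : Type*} (G : Filter I) (n : I → ℕ+) (X : ∀ i, α → Mat (n i))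
    (c : RFormula α → ℝ) : Prop :=
  ∀ φ : RFormula α, Tendsto (fun i => φ.Lam P (Z (n i)) (X i)) G (𝓝 (c φ))

variable {P Z}

lemma HasLims.mono {I : Type*} {G G' : Filter I} {n : I → ℕ+} {X : ∀ i, α → Mat (n i)}
    {c : RFormula α → ℝ} (h : HasLims P Z G n X c) (hG : G' ≤ G) : HasLims P Z G' n X c :=
  fun φ => (h φ).mono_left hG

lemma HasLims.comp {β : Type} {I : Type*} {G : Filter I} {n : I → ℕ+} {X : ∀ i, α → Mat (n i)}
    {c : RFormula α → ℝ} (h : HasLims P Z G n X c) (e : β → α) :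
    HasLims P Z G n (fun i => X i ∘ e) fun φ => c (φ.map e) :=
  fun φ => by simpa only [RFormula.Lam_map] using h (φ.map e)

/-- The sum of the deviations of finitely many formulas from given values. -/
def deviation {β : Type} {k : ℕ} (ψ : Fin k → RFormula β) (a : Fin k → ℝ) : RFormula β :=
  .conn (fun u => ∑ i, |u i - a i|) ⟨∑ _ : Fin k, 1, by
    refine LipschitzWith.of_dist_le_mul fun u v => ?_
    rw [Real.dist_eq, ← Finset.sum_sub_distrib]
    push_cast
    rw [Finset.sum_mul]
    refine (Finset.abs_sum_le_sum_abs _ _).trans (Finset.sum_le_sum fun i _ => ?_)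
    rw [one_mul]
    refine (abs_abs_sub_abs_le _ _).trans ?_
    rw [sub_sub_sub_cancel_right, ← Real.dist_eq]
    exact dist_le_pi_dist u v i⟩ ψ

/-- The infimum over balls of the total deviation is again a restricted formula χ. The given
witnesses make its limit along G at most 0; the limit along G' is the same, so approximate witnesses
exist there. -/
lemma eventually_exists_close {m : ℕ} {r : Fin m → ℝ} (hr : ∀ j, 0 < r j)
    {I : Type*} {G : Filter I} [G.NeBot] {n : I → ℕ+} {X : ∀ i, α → Mat (n i)}
    {I' : Type*} {G' : Filter I'} {n' : I' → ℕ+} {X' : ∀ i, α → Mat (n' i)}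
    {c : RFormula α → ℝ} (hX : HasLims P Z G n X c) (hX' : HasLims P Z G' n' X' c)
    {Y : ∀ i, Fin m → Mat (n i)} (hYr : ∀ᶠ i in G, ∀ j, ‖Y i j‖ ≤ r j)
    {k : ℕ} (ψ : Fin k → RFormula (Fin m ⊕ α)) (a : Fin k → ℝ)
    (hY : ∀ l, Tendsto (fun i => (ψ l).Lam P (Z (n i)) (Sum.elim (Y i) (X i))) G (𝓝 (a l)))
    {ε : ℝ} (hε : 0 < ε) :
    ∀ᶠ i in G', ∃ Y' : Fin m → Mat (n' i), (∀ j, ‖Y' j‖ ≤ r j) ∧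
      ∀ l, |(ψ l).Lam P (Z (n' i)) (Sum.elim Y' (X' i)) - a l| < ε := by
  obtain ⟨χ, hχ⟩ := (deviation ψ a).exists_infs P hr
  have h0 : Tendsto (fun i => (deviation ψ a).Lam P (Z (n i)) (Sum.elim (Y i) (X i))) G (𝓝 0) := by
    simp only [deviation, RFormula.Lam]
    rw [← Finset.sum_const_zero (s := (Finset.univ : Finset (Fin k)))]
    refine tendsto_finsetSum _ fun l _ => ?_
    simpa using ((hY l).sub_const (a l)).abs
  have hc : c χ ≤ 0 := le_of_tendsto_of_tendsto (hX χ) h0 <| by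
    filter_upwards [hYr] with i hi
    exact (hχ _ _ _).1 _ hi
  filter_upwards [(hX' χ).eventually (gt_mem_nhds (show c χ < ε / 2 by linarith))] with i hi
  obtain ⟨Y', hY'r, hY'⟩ := (hχ _ (Z (n' i)) (X' i)).2 (ε / 2) (half_pos hε)
  refine ⟨Y', hY'r, fun l => ?_⟩
  have h1 : |(ψ l).Lam P (Z (n' i)) (Sum.elim Y' (X' i)) - a l| ≤
      (deviation ψ a).Lam P (Z (n' i)) (Sum.elim Y' (X' i)) := by
    simp only [deviation, RFormula.Lam]
    exact Finset.single_le_sum (f := fun l => |(ψ l).Lam P (Z (n' i)) (Sum.elim Y' (X' i)) - a l|)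
      (fun _ _ => abs_nonneg _) (Finset.mem_univ l)
  linarith

/-! ## Realization of types by adapted tuples -/

/-- The first K terms contribute at most 2δ and the tail at most twice 2⁻ᴷ, independently of N. -/
lemma sum_range_geometric_le (K N : ℕ) {u : ℕ → ℝ} {δ : ℝ} (hδ : 0 ≤ δ) (h1 : ∀ i, u i ≤ 1)
    (hK : ∀ i < K, u i ≤ δ) :
    ∑ i ∈ Finset.range N, (1 / 2 : ℝ) ^ i * u i ≤ 2 * δ + 2 * (1 / 2) ^ K := by
  have hg : ∀ M : ℕ, ∑ i ∈ Finset.range M, (1 / 2 : ℝ) ^ i ≤ 2 := fun M => by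
    have e : ∑ i ∈ Finset.range M, (1 / 2 : ℝ) ^ i = 2 - 2 * (1 / 2) ^ M := by
      induction M with
      | zero => simp
      | succ M ih => rw [Finset.sum_range_succ, ih, pow_succ]; ring
    have : (0 : ℝ) ≤ (1 / 2) ^ M := by positivity
    linarith
  have e1 : ∑ i ∈ Finset.range K, (if K ≤ i then (1 / 2 : ℝ) ^ i else 0) = 0 :=
    Finset.sum_eq_zero fun i hi => if_neg (not_le.2 (Finset.mem_range.1 hi))
  have e2 : ∑ i ∈ Finset.range N, (if K ≤ K + i then (1 / 2 : ℝ) ^ (K + i) else 0) =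
      (∑ i ∈ Finset.range N, (1 / 2 : ℝ) ^ i) * (1 / 2) ^ K := by
    rw [Finset.sum_mul]
    exact Finset.sum_congr rfl fun i _ => by rw [if_pos (Nat.le_add_right _ _), pow_add]; ring
  have h2 : ∑ i ∈ Finset.range (K + N), (if K ≤ i then (1 / 2 : ℝ) ^ i else 0) ≤
      2 * (1 / 2) ^ K := by
    rw [Finset.sum_range_add, e1, e2, zero_add]
    exact mul_le_mul_of_nonneg_right (hg N) (by positivity)
  have h3 : (∑ i ∈ Finset.range (K + N), (1 / 2 : ℝ) ^ i) * δ ≤ 2 * δ :=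
    mul_le_mul_of_nonneg_right (hg _) hδ
  calc ∑ i ∈ Finset.range N, (1 / 2 : ℝ) ^ i * u i
      ≤ ∑ i ∈ Finset.range N, ((1 / 2 : ℝ) ^ i * δ + if K ≤ i then (1 / 2 : ℝ) ^ i else 0) := by
        refine Finset.sum_le_sum fun i _ => ?_
        have hp : (0 : ℝ) < (1 / 2) ^ i := by positivity
        split_ifs with h
        · nlinarith [mul_nonneg hp.le hδ, h1 i]
        · rw [add_zero]
          exact mul_le_mul_of_nonneg_left (hK i (not_le.1 h)) hp.le
    _ ≤ ∑ i ∈ Finset.range (K + N), ((1 / 2 : ℝ) ^ i * δ + if K ≤ i then (1 / 2 : ℝ) ^ i else 0) :=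
        Finset.sum_le_sum_of_subset_of_nonneg (Finset.range_mono (Nat.le_add_left N K))
          fun i _ _ => by split_ifs <;> positivity
    _ ≤ 2 * δ + 2 * (1 / 2) ^ K := by
        rw [Finset.sum_add_distrib, ← Finset.sum_mul]
        exact add_le_add h3 h2

/-- The limits `a` already occur along the proper filter G, so `a φ` and `a (D k)` are as close as
the two formulas are uniformly. -/
lemma HasLims.of_dense {D : ℕ → RFormula α} (hZ : ∀ n, IsMatrixBM P 𝓖 n (Z n))
    (hD : ∀ (φ : RFormula α) (ε : ℝ), 0 < ε → ∃ i, ∀ (n : ℕ+)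
      (Z : ℝ≥0 → ℕ → Ω → Mat n), IsMatrixBM P 𝓖 n Z → ∀ X : α → Mat n,
        |φ.Lam P Z X - (D i).Lam P Z X| ≤ ε)
    {I : Type*} {G : Filter I} [G.NeBot] {n : I → ℕ+} {X : ∀ i, α → Mat (n i)}
    {I' : Type*} {G' : Filter I'} {n' : I' → ℕ+} {X' : ∀ i, α → Mat (n' i)}
    {a : RFormula α → ℝ} (h : HasLims P Z G n X a)
    (h' : ∀ k, Tendsto (fun i => (D k).Lam P (Z (n' i)) (X' i)) G' (𝓝 (a (D k)))) :
    HasLims P Z G' n' X' a := by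
  intro φ
  rw [Metric.tendsto_nhds]
  intro ε hε
  obtain ⟨k, hk⟩ := hD φ (ε / 4) (by positivity)
  have h1 : |a φ - a (D k)| ≤ ε / 4 :=
    le_of_tendsto ((h φ).sub (h (D k))).abs (Eventually.of_forall fun i => hk _ _ (hZ _) _)
  filter_upwards [Metric.tendsto_nhds.1 (h' k) (ε / 4) (by positivity)] with i hi
  have h2 := hk _ _ (hZ (n' i)) (X' i)
  rw [Real.dist_eq] at hi ⊢
  rw [abs_lt] at hi ⊢
  rw [abs_le] at h1 h2
  constructor <;> linarith

lemma tupAt_sum {β : Type} (Y : β → RMSeq Ω) (X : α → RMSeq Ω) (p : ℕ+ × Ω) :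
    tupAt (Sum.elim Y X) p = Sum.elim (tupAt Y p) (tupAt X p) := by
  funext a; rcases a with a | a <;> rfl

variable {U : Filter ℕ+} (V : Subalgebra.center ℂ (RMUltraproduct P U) →ₐ[ℂ] ℂ)

lemma hasLims_ev (hZ : ∀ n t j, Measurable (Z n t j)) (X : α → RMSeq Ω) :
    HasLims P Z (charFilter V) Prod.fst (tupAt X) fun φ => ev V Z φ X :=
  fun φ => tendsto_ev V hZ φ X

/-- A type over a tuple that occurs over some other tuple with the same limits is realized by an
adapted tuple. -/
theorem exists_adapted_realization (hU : U ≤ cofinite) (hZ : ∀ n, IsMatrixBM P 𝓖 n (Z n))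
    [Countable α] {m : ℕ} {r : Fin m → ℝ} (hr : ∀ j, 0 < r j) {t : ℝ≥0} {X : α → RMSeq Ω}
    (hX : ∀ a, IsMeas (X a) (𝓖 t))
    {I : Type*} {G : Filter I} [G.NeBot] {n : I → ℕ+} {X₁ : ∀ i, α → Mat (n i)}
    (hX₁ : HasLims P Z G n X₁ fun φ => ev V Z φ X)
    {Y : ∀ i, Fin m → Mat (n i)} (hYr : ∀ᶠ i in G, ∀ j, ‖Y i j‖ ≤ r j)
    {a : RFormula (Fin m ⊕ α) → ℝ} (hY : HasLims P Z G n (fun i => Sum.elim (Y i) (X₁ i)) a) :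
    ∃ Y' : Fin m → RMSeq Ω, (∀ j, IsMeas (Y' j) (𝓖 t)) ∧ (∀ j n ω, ‖(Y' j).1 n ω‖ ≤ r j) ∧
      ∀ ψ, ev V Z ψ (Sum.elim Y' X) = a ψ := by
  have hZm := measurable_increments hZ
  obtain ⟨D, hD⟩ := exists_dense_formula P 𝓖 (Fin m ⊕ α)
  choose C s hC hL using fun i => (D i).exists_lipschitz P
  -- Capping at 1 makes the geometric weights control the tail.
  set dev : ∀ i : ℕ, ∀ n : ℕ+, Ω → (Fin m → Mat n) → ℝ := fun i n ω Y' =>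
    min 1 |(D i).Lam P (Z n) (Sum.elim Y' (tupAt X (n, ω))) - a (D i)| with hdev
  -- One score for all formulas: at size n only the first n enter, so the score is a finite
  -- measurable sum, yet every formula eventually takes part.
  set S : ∀ n : ℕ+, Ω → (Fin m → Mat n) → ℝ := fun n ω Y' =>
    ∑ i ∈ Finset.range n, (1 / 2 : ℝ) ^ i * dev i n ω Y' with hS
  have hSm : ∀ n Y', Measurable[𝓖 t] fun ω => S n ω Y' := fun n Y' => by
    refine Finset.measurable_fun_sum _ fun i _ => Measurable.const_mul ?_ _
    refine measurable_const.min ?_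
    have : Measurable[𝓖 t] fun ω => (D i).Lam P (Z n) (Sum.elim Y' (tupAt X (n, ω))) :=
      @measurable_of_lipschitz _ _ _ (𝓖 t) _ _ _ (hL i n (Z n) (hZm n)) _ fun b _ => by
        rcases b with j | b
        · exact measurable_const
        · exact hX b n
    exact continuous_abs.measurable.comp (this.sub measurable_const)
  obtain ⟨Y', hYm, hYr', hmin⟩ := exists_adapted_argmin hr t S hSm
  refine ⟨Y', hYm, hYr', ?_⟩
  have hdev1 : ∀ i n ω Y', dev i n ω Y' ≤ 1 := fun i n ω Y' => min_le_left _ _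
  have hdev0 : ∀ i n ω Y', 0 ≤ dev i n ω Y' := fun i n ω Y' =>
    le_min zero_le_one (abs_nonneg _)
  have hlim : HasLims P Z (charFilter V) Prod.fst (tupAt (Sum.elim Y' X)) a := by
    refine HasLims.of_dense hZ hD hY fun i => ?_
    rw [Metric.tendsto_nhds]
    intro ε hε
    -- A score below η forces the i-th capped deviation below `min ε 1`, where the cap is inactive.
    -- The errors below add up to less than 3η/4.
    set η := min ε 1 * (1 / 2 : ℝ) ^ i with hη
    have hη0 : 0 < η := by positivity
    obtain ⟨K, hK⟩ := exists_pow_lt_of_lt_one (show (0 : ℝ) < η / 4 by positivity)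
      (by norm_num : (1 / 2 : ℝ) < 1)
    -- By transfer some matrices nearly fit the first K formulas at most points; the measurable
    -- minimizer of the score on the net is no worse.
    have hclose := eventually_exists_close hr hX₁ (hasLims_ev V hZm X) hYr
      (fun l : Fin K => D l) (fun l => a (D l)) (fun l => hY _) (show 0 < η / 16 by positivity)
    have hN : ∀ᶠ p : ℕ+ × Ω in charFilter V, (i : ℝ) < ((p.1 : ℕ) : ℝ) :=
      ((tendsto_atTop_of_le_cofinite hU).comp (tendsto_fst_charFilter V)).eventually_gt_atTop _
    have hnet : ∀ᶠ p : ℕ+ × Ω in charFilter V, ∀ l : Fin K,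
        C l * (m * (1 / ((p.1 : ℕ) : ℝ))) < η / 16 := by
      refine eventually_all.2 fun l => ?_
      have := ((tendsto_one_div_charFilter V hU).const_mul (m : ℝ)).const_mul (C l)
      rw [mul_zero, mul_zero] at this
      exact this.eventually (gt_mem_nhds (by positivity))
    filter_upwards [hclose, hN, hnet] with p ⟨Y₁, hY₁r, hY₁⟩ hi hp
    obtain ⟨D', hD'r, hD', hle⟩ := hmin p.1 p.2 Y₁ hY₁r
    have hsmall : S p.1 p.2 D' ≤ 2 * (η / 8) + 2 * (1 / 2) ^ K := by
      refine sum_range_geometric_le K _ (by positivity) (fun l => hdev1 _ _ _ _) fun l hl => ?_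
      refine (min_le_right _ _).trans ?_
      have h1 := (hY₁ ⟨l, hl⟩).le
      have h2 := hL l p.1 (Z p.1) (hZm p.1) (Sum.elim D' (tupAt X p)) (Sum.elim Y₁ (tupAt X p))
      have h3 : tD (s l) (Sum.elim D' (tupAt X p)) (Sum.elim Y₁ (tupAt X p)) ≤
          m * (1 / ((p.1 : ℕ) : ℝ)) := by
        rw [tD_sum]
        have e0 : tD (s l).toRight (fun a => Sum.elim D' (tupAt X p) (.inr a))
            (fun a => Sum.elim Y₁ (tupAt X p) (.inr a)) = 0 := by simp [tD, hsN_zero]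
        rw [e0, add_zero]
        refine (tD_mono (Finset.subset_univ _) _ _).trans ?_
        refine (Finset.sum_le_card_nsmul _ _ (1 / ((p.1 : ℕ) : ℝ)) fun j _ => ?_).trans ?_
        · simp only [Sum.elim_inl]
          rw [hsN_sub_comm]
          exact (hsN_le_norm _).trans (hD' j)
        · simp
      have h4 := (mul_le_mul_of_nonneg_left h3 (hC l)).trans (hp ⟨l, hl⟩).le
      have h5 := abs_sub_le ((D l).Lam P (Z p.1) (Sum.elim D' (tupAt X p)))
        ((D l).Lam P (Z p.1) (Sum.elim Y₁ (tupAt X p))) (a (D l))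
      change |(D l).Lam P (Z p.1) (Sum.elim D' (tupAt X p)) - a (D l)| ≤ _
      change |(D l).Lam P (Z p.1) (Sum.elim Y₁ (tupAt X p)) - a (D l)| ≤ _ at h1
      linarith
    have hbig : (1 / 2 : ℝ) ^ i * dev i p.1 p.2 (tupAt Y' p) ≤ S p.1 p.2 (tupAt Y' p) :=
      Finset.single_le_sum (f := fun i => (1 / 2 : ℝ) ^ i * dev i p.1 p.2 (tupAt Y' p))
        (fun l _ => mul_nonneg (by positivity) (hdev0 _ _ _ _))
        (Finset.mem_range.2 (by exact_mod_cast hi))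
    have hlt : (1 / 2 : ℝ) ^ i * dev i p.1 p.2 (tupAt Y' p) < (1 / 2 : ℝ) ^ i * min ε 1 := by
      have : S p.1 p.2 (tupAt Y' p) ≤ S p.1 p.2 D' := hle
      rw [mul_comm ((1 / 2 : ℝ) ^ i) (min ε 1), ← hη]
      linarith
    have hlt' := lt_of_mul_lt_mul_left hlt (by positivity)
    rw [Real.dist_eq, tupAt_sum]
    rcases min_lt_iff.1 hlt' with h | h
    · exact absurd (min_le_right ε 1) (not_le.2 h)
    · exact h.trans_le (min_le_left _ _)
  exact fun ψ => ev_eq_of_tendsto V (hlim ψ)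

end Transfer

end ChronOT

namespace ChronOT

/-! ## Restricted formulas determine chronological types -/

section ChronTypes

variable {Ω : Type*} [mΩ : MeasurableSpace Ω] {P : Measure Ω} [IsProbabilityMeasure P]
  {𝓖 : Filtration ℝ≥0 mΩ} {Z : ∀ n : ℕ+, ℝ≥0 → ℕ → Ω → Mat n}
  {U : Filter ℕ+} (V : Subalgebra.center ℂ (RMUltraproduct P U) →ₐ[ℂ] ℂ)
  (hZ : ∀ n, IsMatrixBM P 𝓖 n (Z n)) {α β : Type}

lemma IsMeas.mono {X : RMSeq Ω} {u v : ℝ≥0} (h : IsMeas X (𝓖 u)) (huv : u ≤ v) :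
    IsMeas X (𝓖 v) := fun n => (h n).mono (𝓖.mono huv) le_rfl

variable (Z) in
/-- Two tuples of sequences have the same limits of restricted formulas. -/
def ResEq (X X' : α → RMSeq Ω) : Prop := ∀ φ : RFormula α, ev V Z φ X = ev V Z φ X'

variable {V} {X X' : α → RMSeq Ω}

lemma ev_map (φ : RFormula β) (e : β → α) (X : α → RMSeq Ω) :
    ev V Z (φ.map e) X = ev V Z φ (X ∘ e) := by
  have : Lseq Z P (φ.map e) X = Lseq Z P φ (X ∘ e) := by
    funext p
    simp only [Lseq, RFormula.Lam_map]
    rfl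
  rw [ev, ev, this]

lemma ResEq.comp (h : ResEq Z V X X') (e : β → α) : ResEq Z V (X ∘ e) (X' ∘ e) := fun φ => by
  rw [← ev_map, ← ev_map, h]

include hZ in
lemma ResEq.congr (h : ResEq Z V X X') {Y Y' : α → RMSeq Ω} (hY : ∀ a, toQ V (Y a) = toQ V (X a))
    (hY' : ∀ a, toQ V (Y' a) = toQ V (X' a)) : ResEq Z V Y Y' := fun φ => by
  have hZm := measurable_increments hZ
  rw [ev_congr V hZm φ hY, ev_congr V hZm φ hY', h]

-- On a norm ball containing both tuples the substituted formula is uniformly close to a restricted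
-- formula, to which the hypothesis applies.
include hZ in
lemma ResEq.subst (h : ResEq Z V X X') (g : β → StarPoly α) :
    ResEq Z V (fun b => (g b).eval X) (fun b => (g b).eval X') := by
  have hZm := measurable_increments hZ
  intro φ
  refine eq_of_forall_dist_le fun ε hε => ?_
  choose C hC0 hC using fun a => (X a).exists_bound
  choose C' hC0' hC' using fun a => (X' a).exists_bound
  obtain ⟨ψ, hψ⟩ := φ.exists_subst P g (fun a => max (C a) (C' a)) (half_pos hε)
  have key : ∀ Y : α → RMSeq Ω, (∀ a n ω, ‖(Y a).1 n ω‖ ≤ max (C a) (C' a)) →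
      |ev V Z φ (fun b => (g b).eval Y) - ev V Z ψ Y| ≤ ε / 2 := fun Y hY => by
    refine le_of_tendsto ((tendsto_ev V hZm φ _).sub (tendsto_ev V hZm ψ Y)).abs
      (Eventually.of_forall fun p => ?_)
    have := hψ p.1 (Z p.1) (hZm p.1) (tupAt Y p) fun a => hY a p.1 p.2
    refine le_trans (le_of_eq ?_) this
    have e : tupAt (fun b => (g b).eval Y) p = fun b => (g b).eval (tupAt Y p) :=
      funext fun b => eval_apply (g b) Y p
    rw [Lseq, Lseq, e]
  have h1 := key X fun a n ω => (hC a n ω).trans (le_max_left _ _)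
  have h2 := key X' fun a n ω => (hC' a n ω).trans (le_max_right _ _)
  rw [h ψ] at h1
  rw [Real.dist_eq]
  rw [abs_le] at *
  constructor <;> linarith

/-- By concentration the increments after time u may be averaged out, leaving a restricted formula
of the tuple at time u. -/
lemma ResEq.brownian (hU : U ≤ cofinite) (h : ResEq Z V X X') {u w : ℝ≥0} (huw : u < w)
    (hX : ∀ a, IsMeas (X a) (𝓖 u)) (hX' : ∀ a, IsMeas (X' a) (𝓖 u)) :
    ResEq Z V (Sum.elim X (truncIncrement hZ u w)) (Sum.elim X' (truncIncrement hZ u w)) := by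
  have hZm := measurable_increments hZ
  intro φ
  have hs : 0 < w - u := tsub_pos_of_lt huw
  have key : ∀ Y : α → RMSeq Ω, (∀ a, IsMeas (Y a) (𝓖 u)) →
      ev V Z φ (Sum.elim Y (truncIncrement hZ u w)) = ev V Z (RFormula.brownian _ hs φ) Y :=
    fun Y hY => by
      have h1 := tendsto_Lseq_brownian V hZ hU φ hs hY
      rw [add_tsub_cancel_of_le huw.le] at h1
      have h2 := (tendsto_ev V hZm φ (Sum.elim Y (truncIncrement hZ u w))).sub
        (tendsto_ev V hZm (RFormula.brownian _ hs φ) Y)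
      exact sub_eq_zero.1 (tendsto_nhds_unique h2 h1)
  rw [key X hX, key X' hX', h]

-- A trace of a polynomial in the variables themselves is not a restricted formula, but on
-- norm-bounded tuples it is a uniform limit of such.
include hZ in
lemma re_quotTrace_eq (h : ResEq Z V X X') (p : StarPoly α) :
    (quotTrace V (toQ V (p.eval X))).re = (quotTrace V (toQ V (p.eval X'))).re := by
  have hZm := measurable_increments hZ
  refine eq_of_forall_dist_le fun ε hε => ?_
  choose C hC0 hC using fun a => (X a).exists_bound
  choose C' hC0' hC' using fun a => (X' a).exists_bound
  obtain ⟨ψ, hψ⟩ := (isResApprox_eval (R := fun a => max (C a) (C' a)) p).exists_formula P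
    (half_pos hε)
  have key : ∀ Y : α → RMSeq Ω, (∀ a n ω, ‖(Y a).1 n ω‖ ≤ max (C a) (C' a)) →
      |(quotTrace V (toQ V (p.eval Y))).re - ev V Z ψ Y| ≤ ε / 2 := fun Y hY => by
    refine le_of_tendsto (((Complex.continuous_re.tendsto _).comp
      (tendsto_quotTrace V (p.eval Y))).sub (tendsto_ev V hZm ψ Y)).abs
      (Eventually.of_forall fun q => ?_)
    have := hψ q.1 (Z q.1) (tupAt Y q) fun a => hY a q.1 q.2
    simp only [Function.comp, eval_apply]
    exact this
  have h1 := key X fun a n ω => (hC a n ω).trans (le_max_left _ _)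
  have h2 := key X' fun a n ω => (hC' a n ω).trans (le_max_right _ _)
  rw [h ψ] at h1
  rw [Real.dist_eq]
  rw [abs_le] at *
  constructor <;> linarith

include hZ in
lemma quotTrace_eq (h : ResEq Z V X X') (p : StarPoly α) :
    quotTrace V (toQ V (p.eval X)) = quotTrace V (toQ V (p.eval X')) := by
  refine Complex.ext (re_quotTrace_eq hZ h p) ?_
  -- The imaginary part of the trace of p is the real part of the trace of -i p.
  have h1 := re_quotTrace_eq hZ h (p.smul (-Complex.I))
  have key : ∀ Y : α → RMSeq Ω, quotTrace V (toQ V ((p.smul (-Complex.I)).eval Y)) =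
      -Complex.I * quotTrace V (toQ V (p.eval Y)) := fun Y => by
    refine tendsto_nhds_unique (tendsto_quotTrace V _)
      (((tendsto_quotTrace V (p.eval Y)).const_mul (-Complex.I)).congr fun q => ?_)
    rw [eval_apply, eval_apply, StarPoly.eval, normTr_smul]
  rw [key, key] at h1
  simpa using h1

lemma toQ_truncIncrement_self (s : ℝ≥0) (j : ℕ) :
    toQ V (truncIncrement hZ s s j) = 0 := by
  have : truncIncrement hZ s s j = 0 := by
    refine Subtype.ext (funext fun n => funext fun ω => ?_)
    have h := hsN_truncIncrement_le hZ s s j n ω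
    have h0 : truncRadius s s = 0 := by simp [truncRadius]
    rw [h0, mul_zero] at h
    exact norm_le_zero_iff.1 h
  rw [this]
  simp [toQ]

lemma toQ_zero : toQ V (0 : RMSeq Ω) = 0 := by simp [toQ]

/-- The increments of the Brownian motion between times of a finite set that are at most `u`. -/
noncomputable def bmTuple (T : Finset ℝ≥0) (u : ℝ≥0) (c : T × T × ℕ) : RMSeq Ω :=
  if c.1.1 ≤ c.2.1.1 ∧ c.2.1.1 ≤ u then truncIncrement hZ c.1.1 c.2.1.1 c.2.2 else 0

lemma isMeas_bmTuple (T : Finset ℝ≥0) (u : ℝ≥0) (c : T × T × ℕ) :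
    IsMeas (bmTuple hZ T u c) (𝓖 u) := by
  unfold bmTuple
  split_ifs with h
  · exact (isMeas_truncIncrement hZ h.1 _).mono h.2
  · exact fun n => measurable_const

lemma isMeas_sum_bmTuple {T : Finset ℝ≥0} {u : ℝ≥0} (hX : ∀ a, IsMeas (X a) (𝓖 u)) :
    ∀ b, IsMeas (Sum.elim X (bmTuple hZ T u) b) (𝓖 u) := by
  rintro (a | c)
  · exact hX a
  · exact isMeas_bmTuple hZ T u c

/-- For consecutive times u < w of T, every increment ending by w is zero, an increment ending by u,
or the sum of one ending at u and the increment over [u, w]. The last is added by concentration, the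
rest is substitution. -/
lemma ResEq.succ (hU : U ≤ cofinite) {T : Finset ℝ≥0} {u w : ℝ≥0} (hu : u ∈ T) (huw : u < w)
    (hT : ∀ x ∈ T, u < x → w ≤ x) (hX : ∀ a, IsMeas (X a) (𝓖 u)) (hX' : ∀ a, IsMeas (X' a) (𝓖 u))
    (h : ResEq Z V (Sum.elim X (bmTuple hZ T u)) (Sum.elim X' (bmTuple hZ T u))) :
    ResEq Z V (Sum.elim X (bmTuple hZ T w)) (Sum.elim X' (bmTuple hZ T w)) := by
  classical
  set g : α ⊕ T × T × ℕ → StarPoly ((α ⊕ T × T × ℕ) ⊕ ℕ) := Sum.elim (fun a => .var (.inl (.inl a)))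
    fun c => if c.1.1 ≤ c.2.1.1 ∧ c.2.1.1 ≤ w then
        if c.2.1.1 ≤ u then .var (.inl (.inr c))
        else if c.1.1 ≤ u then
          .add (.var (.inl (.inr (c.1, ⟨u, hu⟩, c.2.2)))) (.var (.inr c.2.2))
        else .smul 0 .one
      else .smul 0 .one with hg
  have key : ∀ (Y : α → RMSeq Ω) (b : α ⊕ T × T × ℕ), toQ V (Sum.elim Y (bmTuple hZ T w) b) =
      toQ V ((g b).eval (Sum.elim (Sum.elim Y (bmTuple hZ T u)) (truncIncrement hZ u w))) := by
    rintro Y (a | ⟨⟨a, ha⟩, ⟨b, hb⟩, j⟩)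
    · rfl
    · simp only [hg, Sum.elim_inr, bmTuple]
      by_cases h1 : a ≤ b ∧ b ≤ w
      · rw [if_pos h1, if_pos h1]
        by_cases h2 : b ≤ u
        · rw [if_pos h2]
          simp only [StarPoly.eval, Sum.elim_inl, Sum.elim_inr, bmTuple]
          rw [if_pos ⟨h1.1, h2⟩]
        -- An end point in T beyond u and at most w is w itself, and a starting point beyond u is
        -- also w, giving a zero increment.
        · obtain rfl : b = w := le_antisymm h1.2 (hT b hb (not_le.1 h2))
          rw [if_neg h2]
          by_cases h3 : a ≤ u
          · rw [if_pos h3]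
            simp only [StarPoly.eval, Sum.elim_inl, Sum.elim_inr, bmTuple]
            rw [if_pos ⟨h3, le_rfl⟩, toQ_add, ← toQ_truncIncrement_add V hZ hU h3 huw.le]
          · obtain rfl : a = b := le_antisymm h1.1 (hT a ha (not_le.1 h3))
            rw [if_neg h3]
            simp only [StarPoly.eval, zero_smul]
            rw [toQ_truncIncrement_self, toQ_zero]
      · rw [if_neg h1, if_neg h1]
        simp only [StarPoly.eval, zero_smul]
  exact ((h.brownian hZ hU huw (isMeas_sum_bmTuple hZ hX) (isMeas_sum_bmTuple hZ hX')).subst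
    hZ g).congr hZ (key X) (key X')

/-- Induction on the number of times of T after u, moving to the next one each time. -/
lemma ResEq.step (hU : U ≤ cofinite) {T : Finset ℝ≥0} {u v : ℝ≥0} (hu : u ∈ T) (hv : v ∈ T)
    (huv : u ≤ v) (hX : ∀ a, IsMeas (X a) (𝓖 u)) (hX' : ∀ a, IsMeas (X' a) (𝓖 u))
    (h : ResEq Z V (Sum.elim X (bmTuple hZ T u)) (Sum.elim X' (bmTuple hZ T u))) :
    ResEq Z V (Sum.elim X (bmTuple hZ T v)) (Sum.elim X' (bmTuple hZ T v)) := by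
  classical
  induction hn : (T.filter fun x => u < x).card using Nat.strong_induction_on generalizing u with
  | _ n ih =>
    subst hn
    rcases huv.eq_or_lt with rfl | hlt
    · exact h
    have hne : (T.filter fun x => u < x).Nonempty := ⟨v, Finset.mem_filter.2 ⟨hv, hlt⟩⟩
    set w := (T.filter fun x => u < x).min' hne with hw
    obtain ⟨hwT, huw⟩ := Finset.mem_filter.1 (Finset.min'_mem _ hne)
    rw [← hw] at hwT huw
    have hmin : ∀ x ∈ T, u < x → w ≤ x := fun x hx hux =>
      Finset.min'_le _ _ (Finset.mem_filter.2 ⟨hx, hux⟩)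
    refine ih _ (Finset.card_lt_card ?_) hwT (hmin v hv hlt) (fun a => (hX a).mono huw.le)
      (fun a => (hX' a).mono huw.le) (h.succ hZ hU hu huw hmin hX hX') rfl
    refine Finset.ssubset_iff_of_subset (fun x hx => ?_) |>.2
      ⟨w, Finset.mem_filter.2 ⟨hwT, huw⟩, by simp⟩
    rw [Finset.mem_filter] at hx ⊢
    exact ⟨hx.1, huw.trans hx.2⟩

/-- All increments ending by time 0 vanish, so adjoining them adds nothing. -/
lemma ResEq.bmTuple_zero (T : Finset ℝ≥0) (h : ResEq Z V X X') :
    ResEq Z V (Sum.elim X (bmTuple hZ T 0)) (Sum.elim X' (bmTuple hZ T 0)) := by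
  set g : α ⊕ T × T × ℕ → StarPoly α := Sum.elim .var fun _ => .smul 0 .one with hg
  have key : ∀ (Y : α → RMSeq Ω) (b : α ⊕ T × T × ℕ), toQ V (Sum.elim Y (bmTuple hZ T 0) b) =
      toQ V ((g b).eval Y) := by
    rintro Y (a | ⟨⟨a, ha⟩, ⟨b, hb⟩, j⟩)
    · rfl
    · simp only [hg, Sum.elim_inr, StarPoly.eval, zero_smul, bmTuple]
      split_ifs with h
      · obtain rfl : b = 0 := le_antisymm h.2 zero_le
        obtain rfl : a = 0 := le_antisymm h.1 zero_le
        rw [toQ_truncIncrement_self, toQ_zero]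
      · rfl
  exact (h.subst hZ g).congr hZ (key X) (key X')

/-- A term mentions finitely many times. The claim is made for every larger T, so that the sets of
several subterms can be merged. -/
lemma StarPoly.exists_times {α : Type} (p : StarPoly (α ⊕ ZConst)) : ∃ T₀ : Finset ℝ≥0,
    ∀ T : Finset ℝ≥0, T₀ ⊆ T → ∃ q : StarPoly (α ⊕ T × T × ℕ), ∀ {A : Type _} [Ring A] [Algebra ℂ A]
      [Star A] (x : α → A) (z : ZConst → A) (z' : T × T × ℕ → A),
      (∀ (a b : T) (h : a.1 ≤ b.1) (j : ℕ), z' (a, b, j) = z ⟨a.1, b.1, h, j⟩) →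
        p.eval (Sum.elim x z) = q.eval (Sum.elim x z') := by
  classical
  induction p with
  | var b =>
    rcases b with a | ⟨s, t, hst, j⟩
    · exact ⟨∅, fun T _ => ⟨.var (.inl a), fun x z z' _ => rfl⟩⟩
    · refine ⟨{s, t}, fun T hT => ⟨.var (.inr (⟨s, hT (by simp)⟩, ⟨t, hT (by simp)⟩, j)),
        fun x z z' h => ?_⟩⟩
      exact (h ⟨s, hT (by simp)⟩ ⟨t, hT (by simp)⟩ hst j).symm
  | one => exact ⟨∅, fun T _ => ⟨.one, fun x z z' _ => rfl⟩⟩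
  | add p q hp hq =>
    obtain ⟨T₁, h₁⟩ := hp
    obtain ⟨T₂, h₂⟩ := hq
    refine ⟨T₁ ∪ T₂, fun T hT => ?_⟩
    obtain ⟨p', hp'⟩ := h₁ T (Finset.subset_union_left.trans hT)
    obtain ⟨q', hq'⟩ := h₂ T (Finset.subset_union_right.trans hT)
    exact ⟨.add p' q', fun x z z' h => by
      simp only [StarPoly.eval, hp' x z z' h, hq' x z z' h]⟩
  | mul p q hp hq =>
    obtain ⟨T₁, h₁⟩ := hp
    obtain ⟨T₂, h₂⟩ := hq
    refine ⟨T₁ ∪ T₂, fun T hT => ?_⟩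
    obtain ⟨p', hp'⟩ := h₁ T (Finset.subset_union_left.trans hT)
    obtain ⟨q', hq'⟩ := h₂ T (Finset.subset_union_right.trans hT)
    exact ⟨.mul p' q', fun x z z' h => by
      simp only [StarPoly.eval, hp' x z z' h, hq' x z z' h]⟩
  | adj p hp =>
    obtain ⟨T₁, h₁⟩ := hp
    refine ⟨T₁, fun T hT => ?_⟩
    obtain ⟨p', hp'⟩ := h₁ T hT
    exact ⟨.adj p', fun x z z' h => by simp only [StarPoly.eval, hp' x z z' h]⟩
  | smul c p hp =>
    obtain ⟨T₁, h₁⟩ := hp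
    refine ⟨T₁, fun T hT => ?_⟩
    obtain ⟨p', hp'⟩ := h₁ T hT
    exact ⟨.smul c p', fun x z z' h => by simp only [StarPoly.eval, hp' x z z' h]⟩

/-- Traces of terms are determined by restricted formulas of the variables and of finitely many
increments. -/
lemma exists_times_trace (hU : U ≤ cofinite) (p : StarPoly (α ⊕ ZConst)) : ∃ T₀ : Finset ℝ≥0,
    ∀ T : Finset ℝ≥0, T₀ ⊆ T → ∀ u ∈ T, ∀ X X' : α → RMSeq Ω, (∀ a, IsMeas (X a) (𝓖 u)) →
      (∀ a, IsMeas (X' a) (𝓖 u)) →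
      ResEq Z V (Sum.elim X (bmTuple hZ T u)) (Sum.elim X' (bmTuple hZ T u)) →
        quotTrace V (termValue (quotStructure V hZ) (fun a => toQ V (X a)) p) =
          quotTrace V (termValue (quotStructure V hZ) (fun a => toQ V (X' a)) p) := by
  obtain ⟨T₀, h₀⟩ := p.exists_times
  refine ⟨T₀, fun T hT u hu X X' hX hX' h => ?_⟩
  obtain ⟨q, hq⟩ := h₀ T hT
  have hne : T.Nonempty := ⟨u, hu⟩
  have hv := h.step hZ hU hu (T.max'_mem hne) (T.le_max' u hu) hX hX'
  have key : ∀ Y : α → RMSeq Ω, termValue (quotStructure V hZ) (fun a => toQ V (Y a)) p =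
      toQ V (q.eval (Sum.elim Y (bmTuple hZ T (T.max' hne)))) := fun Y => by
    rw [toQ_eval, termValue, hq _ _ fun c => toQ V (bmTuple hZ T (T.max' hne) c)]
    · congr 1
      funext b
      rcases b with b | c <;> rfl
    · intro a b hab j
      simp only [bmTuple]
      rw [if_pos ⟨hab, T.le_max' _ b.2⟩]
      rfl
  rw [key, key]
  exact quotTrace_eq hZ hv q

/-- The forth step of back-and-forth: equivalence is first pushed to time s, and saturation then
produces an adapted partner for Y over the other tuple. -/
lemma exists_equiv_element (hU : U ≤ cofinite) [Countable α] {T : Finset ℝ≥0} {u s : ℝ≥0}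
    (hu : u ∈ T) (hs : s ∈ T) (hus : u ≤ s) (hX : ∀ a, IsMeas (X a) (𝓖 u))
    (hX' : ∀ a, IsMeas (X' a) (𝓖 u))
    (h : ResEq Z V (Sum.elim X (bmTuple hZ T u)) (Sum.elim X' (bmTuple hZ T u)))
    {r : ℝ} (hr : 0 < r) {Y : RMSeq Ω} (hYr : ∀ n ω, ‖Y.1 n ω‖ ≤ r) :
    ∃ Y' : RMSeq Ω, IsMeas Y' (𝓖 s) ∧ (∀ n ω, ‖Y'.1 n ω‖ ≤ r) ∧
      ResEq Z V (Sum.elim (fun o : Option α => o.elim Y X) (bmTuple hZ T s))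
        (Sum.elim (fun o : Option α => o.elim Y' X') (bmTuple hZ T s)) := by
  have hZm := measurable_increments hZ
  have hs' := h.step hZ hU hu hs hus hX hX'
  obtain ⟨Y', hYm', hYr', hY'⟩ := exists_adapted_realization V hU hZ (m := 1) (r := fun _ => r)
    (fun _ => hr) (t := s) (X := Sum.elim X' (bmTuple hZ T s))
    (isMeas_sum_bmTuple hZ fun a => (hX' a).mono hus)
    (I := ℕ+ × Ω) (G := charFilter V) (n := Prod.fst) (X₁ := tupAt (Sum.elim X (bmTuple hZ T s)))
    (fun φ => by
      have := hasLims_ev V hZm (Sum.elim X (bmTuple hZ T s)) φ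
      simp only [hs' φ] at this
      exact this)
    (Y := fun p _ => Y.1 p.1 p.2) (Eventually.of_forall fun p _ => hYr _ _)
    (a := fun ψ => ev V Z ψ (Sum.elim (fun _ => Y) (Sum.elim X (bmTuple hZ T s))))
    (fun φ => by
      have := hasLims_ev V hZm (Sum.elim (fun _ : Fin 1 => Y) (Sum.elim X (bmTuple hZ T s))) φ
      simp only [tupAt_sum] at this ⊢
      exact this)
  refine ⟨Y' 0, hYm' 0, hYr' 0, ?_⟩
  have hR : ResEq Z V (Sum.elim (fun _ => Y) (Sum.elim X (bmTuple hZ T s)))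
    (Sum.elim Y' (Sum.elim X' (bmTuple hZ T s))) := fun ψ => (hY' ψ).symm
  have := hR.comp (Sum.elim (fun o : Option α => o.elim (Sum.inl 0) fun a => .inr (.inl a))
    fun c => .inr (.inr c))
  convert this using 1
  · funext b
    rcases b with (_ | a) | c <;> rfl
  · funext b
    rcases b with (_ | a) | c <;> rfl

/-- Applied in both directions it makes the two sets of values under a quantifier equal, so suprema
and infima agree without any boundedness. -/
lemma range_eval_subset (hU : U ≤ cofinite) [Countable α] {s t : ℝ≥0} {T : Finset ℝ≥0} {r : ℝ}
    (hr : 0 < r) (φ : ChronFormula t (Option α)) (hs : s ∈ T)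
    (hφ : ∀ X X' : Option α → RMSeq Ω, (∀ a, IsMeas (X a) (𝓖 s)) → (∀ a, IsMeas (X' a) (𝓖 s)) →
      ResEq Z V (Sum.elim X (bmTuple hZ T s)) (Sum.elim X' (bmTuple hZ T s)) →
        φ.eval (quotStructure V hZ) (fun a => toQ V (X a)) =
          φ.eval (quotStructure V hZ) (fun a => toQ V (X' a)))
    {u : ℝ≥0} (hu : u ∈ T) (hus : u ≤ s) (hX : ∀ a, IsMeas (X a) (𝓖 u))
    (hX' : ∀ a, IsMeas (X' a) (𝓖 u))
    (h : ResEq Z V (Sum.elim X (bmTuple hZ T u)) (Sum.elim X' (bmTuple hZ T u))) :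
    (Set.range fun y : (quotStructure V hZ).dom s r =>
      φ.eval (quotStructure V hZ) fun o => o.elim (y : RMQuotient V) fun a => toQ V (X a)) ⊆
    Set.range fun y : (quotStructure V hZ).dom s r =>
      φ.eval (quotStructure V hZ) fun o => o.elim (y : RMQuotient V) fun a => toQ V (X' a) := by
  rintro _ ⟨⟨_, Y, hYm, hYr, rfl⟩, rfl⟩
  obtain ⟨Y', hYm', hYr', hR⟩ := exists_equiv_element hZ hU hu hs hus hX hX' h hr hYr
  refine ⟨⟨toQ V Y', Y', hYm', hYr', rfl⟩, ?_⟩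
  have := hφ _ _ (fun o => ?_) (fun o => ?_) hR
  · rw [← toQ_option, ← toQ_option] at this
    exact this.symm
  · cases o with
    | none => exact hYm
    | some a => exact (hX a).mono hus
  · cases o with
    | none => exact hYm'
    | some a => exact (hX' a).mono hus

/-- Induction on formulas by back-and-forth. T₀ collects all times in the formula. Countability of
the variables is an explicit premise so that the induction can pass to `Option α`. -/
lemma exists_times_formula (hU : U ≤ cofinite) {t : ℝ≥0} {α : Type}
    (φ : ChronFormula t α) : Countable α → ∃ T₀ : Finset ℝ≥0, ∀ T : Finset ℝ≥0, T₀ ⊆ T → ∀ u ∈ T, u ≤ t →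
      ∀ X X' : α → RMSeq Ω, (∀ a, IsMeas (X a) (𝓖 u)) → (∀ a, IsMeas (X' a) (𝓖 u)) →
      ResEq Z V (Sum.elim X (bmTuple hZ T u)) (Sum.elim X' (bmTuple hZ T u)) →
        φ.eval (quotStructure V hZ) (fun a => toQ V (X a)) =
          φ.eval (quotStructure V hZ) (fun a => toQ V (X' a)) := by
  classical
  induction φ with
  | reTr p =>
    intro hα
    obtain ⟨T₀, h₀⟩ := exists_times_trace hZ hU p (V := V)
    exact ⟨T₀, fun T hT u hu _ X X' hX hX' h => congrArg Complex.re (h₀ T hT u hu X X' hX hX' h)⟩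
  | imTr p =>
    intro hα
    obtain ⟨T₀, h₀⟩ := exists_times_trace hZ hU p (V := V)
    exact ⟨T₀, fun T hT u hu _ X X' hX hX' h => congrArg Complex.im (h₀ T hT u hu X X' hX hX' h)⟩
  -- The distance is the square root of the trace of (p - q)* (p - q), which is again a term.
  | dist p q =>
    intro hα
    obtain ⟨T₀, h₀⟩ := exists_times_trace hZ hU
      (.mul (.adj (.add p (.smul (-1) q))) (.add p (.smul (-1) q))) (V := V)
    refine ⟨T₀, fun T hT u hu _ X X' hX hX' h => ?_⟩
    have := h₀ T hT u hu X X' hX hX' h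
    have e : ∀ a b : RMQuotient V, a + (-1 : ℂ) • b = a - b := fun a b => by
      rw [Algebra.smul_def, map_neg, map_one, neg_one_mul, ← sub_eq_add_neg]
    simp only [termValue, StarPoly.eval, e] at this
    exact congrArg (fun c => Real.sqrt (Complex.re c)) this
  | conn f hf φ ih =>
    intro hα
    choose T₀ h₀ using fun i => ih i hα
    refine ⟨Finset.univ.biUnion T₀, fun T hT u hu hut X X' hX hX' h => ?_⟩
    simp only [ChronFormula.eval]
    congr 1
    funext i
    exact h₀ i T ((Finset.subset_biUnion_of_mem T₀ (Finset.mem_univ i)).trans hT) u hu hut X X'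
      hX hX' h
  | @sup s t α hst r hr φ ih =>
    intro hα
    obtain ⟨T₀, h₀⟩ := ih inferInstance
    refine ⟨insert s T₀, fun T hT u hu hus X X' hX hX' h => ?_⟩
    have hs : s ∈ T := hT (Finset.mem_insert_self _ _)
    have hφ := h₀ T ((Finset.subset_insert _ _).trans hT) s hs hst
    simp only [ChronFormula.eval]
    rw [iSup, iSup]
    congr 1
    exact (range_eval_subset hZ hU hr φ hs hφ hu hus hX hX' h).antisymm
      (range_eval_subset hZ hU hr φ hs hφ hu hus hX' hX fun ψ => (h ψ).symm)
  | @inf s t α hst r hr φ ih =>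
    intro hα
    obtain ⟨T₀, h₀⟩ := ih inferInstance
    refine ⟨insert s T₀, fun T hT u hu hus X X' hX hX' h => ?_⟩
    have hs : s ∈ T := hT (Finset.mem_insert_self _ _)
    have hφ := h₀ T ((Finset.subset_insert _ _).trans hT) s hs hst
    simp only [ChronFormula.eval]
    rw [iInf, iInf]
    congr 1
    exact (range_eval_subset hZ hU hr φ hs hφ hu hus hX hX' h).antisymm
      (range_eval_subset hZ hU hr φ hs hφ hu hus hX' hX fun ψ => (h ψ).symm)

/-- The chronological type of a tuple at time `0` is determined by the limits of restricted
formulas. -/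
theorem tpChron_eq_of_resEq (hU : U ≤ cofinite) [Countable α] (hX : ∀ a, IsMeas (X a) (𝓖 0))
    (hX' : ∀ a, IsMeas (X' a) (𝓖 0)) (h : ResEq Z V X X') :
    tpChron (quotStructure V hZ) (fun a => toQ V (X a)) =
      tpChron (quotStructure V hZ) (fun a => toQ V (X' a)) := by
  classical
  funext ⟨t, φ⟩
  obtain ⟨T₀, h₀⟩ := exists_times_formula hZ hU φ (V := V) inferInstance
  exact h₀ (insert 0 T₀) (Finset.subset_insert _ _) 0 (Finset.mem_insert_self _ _) zero_le X X'
    hX hX' (h.bmTuple_zero hZ _)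

end ChronTypes

end ChronOT

namespace ChronOT

/-! ## Inner products of tuples and uniqueness along optimal couplings -/

section InnerProducts

/-- The sum of the normalized Hilbert-Schmidt inner products of the entries of two tuples. -/
noncomputable def tupIn {n : ℕ+} {m : ℕ} (X Y : Fin m → Mat n) : ℝ := ∑ j, hsIn (X j) (Y j)

lemma tupIn_sub_self {n : ℕ+} {m : ℕ} (X Y : Fin m → Mat n) :
    ∑ j, hsSq (X j - Y j) = tupIn X X - 2 * tupIn X Y + tupIn Y Y := by
  simp only [tupIn, Finset.mul_sum, ← Finset.sum_sub_distrib, ← Finset.sum_add_distrib, hsSq_sub,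
    hsIn_self]
  exact Finset.sum_congr rfl fun j _ => by ring

lemma tupIn_combo {n : ℕ+} {m : ℕ} (X Y Y' : Fin m → Mat n) (a b : ℝ) :
    tupIn X (fun j => (a : ℂ) • Y j + (b : ℂ) • Y' j) = a * tupIn X Y + b * tupIn X Y' := by
  simp only [tupIn, Finset.mul_sum, ← Finset.sum_add_distrib, hsIn_add_right, hsIn_smul_right]

variable {Ω : Type*} [mΩ : MeasurableSpace Ω] {P : Measure Ω} [IsProbabilityMeasure P]
  {𝓖 : Filtration ℝ≥0 mΩ} {Z : ∀ n : ℕ+, ℝ≥0 → ℕ → Ω → Mat n}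
  {U : Filter ℕ+} (V : Subalgebra.center ℂ (RMUltraproduct P U) →ₐ[ℂ] ℂ)
  (hZ : ∀ n, IsMatrixBM P 𝓖 n (Z n)) {α κ : Type} {m : ℕ}

/-- The real inner product of tuples in the quotient. -/
noncomputable def seqIn (A B : Fin m → RMSeq Ω) : ℝ :=
  ∑ j, (quotTrace V (toQ V (star (A j) * B j))).re

lemma tendsto_seqIn (A B : Fin m → RMSeq Ω) :
    Tendsto (fun p => tupIn (tupAt A p) (tupAt B p)) (charFilter V) (𝓝 (seqIn V A B)) :=
  tendsto_finsetSum _ fun j _ => (Complex.continuous_re.tendsto _).comp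
    (tendsto_quotTrace V (star (A j) * B j))

/-- The interpolation `(1 - t) A + t B` of two tuples. -/
noncomputable def interp (t : ℝ) (A B : Fin m → RMSeq Ω) (j : Fin m) : RMSeq Ω :=
  ((1 - t : ℝ) : ℂ) • A j + (t : ℂ) • B j

lemma seqIn_interp (t : ℝ) (X A B : Fin m → RMSeq Ω) :
    seqIn V X (interp t A B) = (1 - t) * seqIn V X A + t * seqIn V X B :=
  tendsto_nhds_unique (tendsto_seqIn V X (interp t A B))
    ((((tendsto_seqIn V X A).const_mul (1 - t)).add ((tendsto_seqIn V X B).const_mul t)).congr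
      fun p => (tupIn_combo _ _ _ _ _).symm)

lemma norm_interp_le {t : ℝ} (h0 : 0 ≤ t) (h1 : t ≤ 1) {A B : Fin m → RMSeq Ω} {r : Fin m → ℝ}
    (hA : ∀ j n ω, ‖(A j).1 n ω‖ ≤ r j) (hB : ∀ j n ω, ‖(B j).1 n ω‖ ≤ r j) (j : Fin m) (n : ℕ+)
    (ω : Ω) : ‖(interp t A B j).1 n ω‖ ≤ r j := by
  change ‖((1 - t : ℝ) : ℂ) • (A j).1 n ω + (t : ℂ) • (B j).1 n ω‖ ≤ r j
  refine (norm_add_le _ _).trans ?_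
  rw [norm_smul, norm_smul, Complex.norm_real, Complex.norm_real,
    Real.norm_of_nonneg (sub_nonneg.2 h1), Real.norm_of_nonneg h0]
  nlinarith [mul_le_mul_of_nonneg_left (hA j n ω) (sub_nonneg.2 h1),
    mul_le_mul_of_nonneg_left (hB j n ω) h0]

variable {V}

include hZ in
lemma ResEq.seqIn_eq {X X' : α → RMSeq Ω} (h : ResEq Z V X X') (e e' : Fin m → α) :
    seqIn V (X ∘ e) (X ∘ e') = seqIn V (X' ∘ e) (X' ∘ e') :=
  Finset.sum_congr rfl fun j _ =>
    re_quotTrace_eq hZ h (.mul (.adj (.var (e j))) (.var (e' j)))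

/-- The expression is the limit of the squared distances of the tuples, so it is nonnegative and its
vanishing identifies the classes. -/
lemma toQ_eq_of_seqIn {A A' : Fin m → RMSeq Ω}
    (h : seqIn V A A - 2 * seqIn V A A' + seqIn V A' A' ≤ 0) (j : Fin m) :
    toQ V (A j) = toQ V (A' j) := by
  have ht : Tendsto (fun p => ∑ j, hsSq (tupAt A p j - tupAt A' p j)) (charFilter V)
      (𝓝 (seqIn V A A - 2 * seqIn V A A' + seqIn V A' A')) :=
    (((tendsto_seqIn V A A).sub ((tendsto_seqIn V A A').const_mul 2)).add
      (tendsto_seqIn V A' A')).congr fun p => (tupIn_sub_self _ _).symm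
  have h0 : seqIn V A A - 2 * seqIn V A A' + seqIn V A' A' = 0 := le_antisymm h
    (ge_of_tendsto' ht fun p => Finset.sum_nonneg fun j _ => hsSq_nonneg _)
  rw [h0] at ht
  rw [toQ_eq_iff]
  have hs := (Real.continuous_sqrt.tendsto _).comp ht
  rw [Real.sqrt_zero] at hs
  refine squeeze_zero (fun p => hsN_nonneg _) (fun p => Real.sqrt_le_sqrt ?_) hs
  exact Finset.single_le_sum (f := fun j => hsSq (tupAt A p j - tupAt A' p j))
    (fun j _ => hsSq_nonneg _) (Finset.mem_univ j)

include hZ in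
/-- An element with the type of a point inside a displacement interpolation, which is at least as
close to the first end point, has the same joint type with the first end point. -/
lemma resEq_of_optimal (hU : U ≤ cofinite) [Countable κ] {t : ℝ} (ht0 : 0 < t) (ht1 : t < 1)
    {A B Y : Fin m → RMSeq Ω} {C : κ → RMSeq Ω} (hA : ∀ j, IsMeas (A j) (𝓖 0))
    (hY : ∀ j, IsMeas (Y j) (𝓖 0)) (hC : ∀ j, IsMeas (C j) (𝓖 0))
    {r : Fin m → ℝ} (hr : ∀ j, 0 < r j) (hAr : ∀ j n ω, ‖(A j).1 n ω‖ ≤ r j)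
    (hopt : ∀ A' B' : Fin m → RMSeq Ω, (∀ j, IsMeas (A' j) (𝓖 0)) → (∀ j, IsMeas (B' j) (𝓖 0)) →
      ResEq Z V (Sum.elim A' C) (Sum.elim A C) → ResEq Z V (Sum.elim B' C) (Sum.elim B C) →
        seqIn V A' B' ≤ seqIn V A B)
    (hR : ResEq Z V (Sum.elim Y C) (Sum.elim (interp t A B) C))
    (hge : seqIn V A (interp t A B) ≤ seqIn V A Y) :
    ResEq Z V (Sum.elim Y (Sum.elim A C)) (Sum.elim (interp t A B) (Sum.elim A C)) := by
  have hZm := measurable_increments hZ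
  have hYC : ∀ b, IsMeas (Sum.elim Y C b) (𝓖 0) := by
    rintro (j | k)
    exacts [hY j, hC k]
  -- A partner of Y: since Y has the type of the interpolated point over C, some `A'` is to Y what A
  -- is to that point.
  obtain ⟨A', hA'm, hA'r, hA'⟩ := exists_adapted_realization V hU hZ hr (t := 0)
    (X := Sum.elim Y C) hYC (I := ℕ+ × Ω) (G := charFilter V) (n := Prod.fst)
    (X₁ := tupAt (Sum.elim (interp t A B) C))
    (fun φ => by
      have := hasLims_ev V hZm (Sum.elim (interp t A B) C) φ
      simp only [← hR φ] at this
      exact this)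
    (Y := tupAt A) (Eventually.of_forall fun p j => hAr _ _ _)
    (a := fun ψ => ev V Z ψ (Sum.elim A (Sum.elim (interp t A B) C)))
    (fun φ => by
      have := hasLims_ev V hZm (Sum.elim A (Sum.elim (interp t A B) C)) φ
      simpa only [tupAt_sum] using this)
  have hR' : ResEq Z V (Sum.elim A' (Sum.elim Y C)) (Sum.elim A (Sum.elim (interp t A B) C)) := hA'
  -- The other end point B' = t⁻¹ (Y - (1-t) A'), obtained by solving Y = (1-t) A' + t B'. Applied
  -- to A and the interpolated point the same polynomial returns B, so B' has the type of B.
  set gB : Fin m → StarPoly (Fin m ⊕ Fin m ⊕ κ) := fun j => .smul ((t⁻¹ : ℝ) : ℂ)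
    (.add (.var (.inr (.inl j))) (.smul ((-(1 - t) : ℝ) : ℂ) (.var (.inl j)))) with hgB
  set B' : Fin m → RMSeq Ω := fun j => (gB j).eval (Sum.elim A' (Sum.elim Y C)) with hB'
  have htc : (t : ℂ) ≠ 0 := by exact_mod_cast ht0.ne'
  have hBB' : ResEq Z V (Sum.elim B' C) (Sum.elim B C) := by
    refine (hR'.subst hZ (Sum.elim gB fun k => .var (.inr (.inr k)))).congr hZ ?_ ?_
    · rintro (j | k) <;> rfl
    · rintro (j | k)
      · congr 1
        simp only [Sum.elim_inl, hgB, StarPoly.eval, Sum.elim_inr, interp]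
        push_cast
        rw [neg_smul, smul_add, smul_add, smul_smul, smul_smul, smul_neg, smul_smul,
          inv_mul_cancel₀ htc, one_smul]
        abel
      · rfl
  have hB'm : ∀ j, IsMeas (B' j) (𝓖 0) := fun j => isMeas_eval _ (by
    rintro (j | j | k)
    exacts [hA'm j, hY j, hC k])
  have hYint : ∀ j, Y j = interp t A' B' j := fun j => by
    simp only [interp, hB', hgB, StarPoly.eval, Sum.elim_inl, Sum.elim_inr]
    push_cast
    rw [smul_smul, mul_inv_cancel₀ htc, one_smul, neg_smul]
    abel
  have h1 : seqIn V A B' ≤ seqIn V A B := hopt A B' hA hB'm (fun _ => rfl) hBB'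
  have h2 : seqIn V A Y = (1 - t) * seqIn V A A' + t * seqIn V A B' := by
    rw [← seqIn_interp]
    congr 1
    exact funext hYint
  rw [seqIn_interp, h2] at hge
  -- As B' gains nothing over B, the inequality for Y must come from A', whose weight 1 - t is
  -- positive. Together with ‖A'‖ = ‖A‖ this gives equality in Q.
  have h3 : seqIn V A A ≤ seqIn V A A' := by
    refine le_of_mul_le_mul_left (a := 1 - t) ?_ (by linarith)
    nlinarith
  have h4 : seqIn V A' A' = seqIn V A A := hR'.seqIn_eq hZ (fun j => .inl j) fun j => .inl j
  have h5 := toQ_eq_of_seqIn (V := V) (A := A) (A' := A') (by linarith)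
  refine (hR'.comp (Sum.elim (fun j => .inr (.inl j))
    (Sum.elim (fun j => .inl j) fun k => .inr (.inr k)))).congr hZ ?_ ?_
  · rintro (j | j | k)
    exacts [rfl, h5 j, rfl]
  · rintro (j | j | k) <;> rfl

variable (V)

/-- The tuple distance in terms of inner products. -/
lemma tupleDist_sq (A B : Fin m → RMSeq Ω) :
    (quotStructure V hZ).tupleDist (fun j => toQ V (A j)) (fun j => toQ V (B j)) ^ 2 =
      seqIn V A A - 2 * seqIn V A B + seqIn V B B := by
  have ht : Tendsto (fun p => ∑ j, hsSq (tupAt A p j - tupAt B p j)) (charFilter V)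
      (𝓝 (seqIn V A A - 2 * seqIn V A B + seqIn V B B)) :=
    (((tendsto_seqIn V A A).sub ((tendsto_seqIn V A B).const_mul 2)).add
      (tendsto_seqIn V B B)).congr fun p => (tupIn_sub_self _ _).symm
  have h2 : Tendsto (fun p => ∑ j, hsSq (tupAt A p j - tupAt B p j)) (charFilter V)
      (𝓝 (∑ j, ((quotStructure V hZ).tr
        (star (toQ V (A j) - toQ V (B j)) * (toQ V (A j) - toQ V (B j)))).re)) := by
    refine tendsto_finsetSum _ fun j _ => ?_
    rw [← toQ_sub, ← toQ_star, ← toQ_mul]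
    exact (Complex.continuous_re.tendsto _).comp
      (tendsto_quotTrace V (star (A j - B j) * (A j - B j)))
  have e := tendsto_nhds_unique h2 ht
  rw [ProcStructure.tupleDist, Real.sq_sqrt, e]
  rw [e]
  exact ge_of_tendsto' ht fun p => Finset.sum_nonneg fun j _ => hsSq_nonneg _

/-- Optimal couplings maximize the inner product. -/
lemma seqIn_le_of_isOptimalCoupling (hU : U ≤ cofinite) [Countable κ] {A B : Fin m → RMSeq Ω}
    {C : κ → RMSeq Ω} (hA : ∀ j, IsMeas (A j) (𝓖 0)) (hB : ∀ j, IsMeas (B j) (𝓖 0))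
    (hC : ∀ j, IsMeas (C j) (𝓖 0)) {μ₀ μ₁ : ChronType (Fin m ⊕ κ)}
    (hopt : IsOptimalCoupling (quotStructure V hZ) (fun k => toQ V (C k)) μ₀ μ₁
      (fun j => toQ V (A j)) fun j => toQ V (B j))
    {A' B' : Fin m → RMSeq Ω} (hA' : ∀ j, IsMeas (A' j) (𝓖 0)) (hB' : ∀ j, IsMeas (B' j) (𝓖 0))
    (hAA' : ResEq Z V (Sum.elim A' C) (Sum.elim A C))
    (hBB' : ResEq Z V (Sum.elim B' C) (Sum.elim B C)) :
    seqIn V A' B' ≤ seqIn V A B := by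
  obtain ⟨⟨-, -, h0, h1⟩, hd⟩ := hopt
  have hlev : ∀ {X : RMSeq Ω}, IsMeas X (𝓖 0) → toQ V X ∈ (quotStructure V hZ).level 0 := by
    intro X hX
    obtain ⟨R, hR0, hR⟩ := X.exists_bound
    exact ⟨R + 1, by linarith, X, hX, fun n ω => (hR n ω).trans (by linarith), rfl⟩
  have htp : ∀ {X X' : Fin m → RMSeq Ω} {μ : ChronType (Fin m ⊕ κ)}, (∀ j, IsMeas (X j) (𝓖 0)) →
      (∀ j, IsMeas (X' j) (𝓖 0)) → ResEq Z V (Sum.elim X' C) (Sum.elim X C) →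
      tpChron (quotStructure V hZ) (Sum.elim (fun j => toQ V (X j)) fun k => toQ V (C k)) = μ →
      tpChron (quotStructure V hZ) (Sum.elim (fun j => toQ V (X' j)) fun k => toQ V (C k)) = μ := by
    intro X X' μ hX hX' hR h
    have e : ∀ X : Fin m → RMSeq Ω, (Sum.elim (fun j => toQ V (X j)) fun k => toQ V (C k)) =
        fun b => toQ V (Sum.elim X C b) := fun X => by
      funext b; rcases b with j | k <;> rfl
    rw [← h, e, e]
    refine tpChron_eq_of_resEq hZ hU ?_ ?_ hR
    · rintro (j | k)
      exacts [hX' j, hC k]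
    · rintro (j | k)
      exacts [hX j, hC k]
  have hcoup : IsCoupling (quotStructure V hZ) (fun k => toQ V (C k)) μ₀ μ₁
      (fun j => toQ V (A' j)) fun j => toQ V (B' j) :=
    ⟨fun j => hlev (hA' j), fun j => hlev (hB' j), htp hA hA' hAA' h0, htp hB hB' hBB' h1⟩
  have hle : (quotStructure V hZ).tupleDist (fun j => toQ V (A j)) (fun j => toQ V (B j)) ≤
      (quotStructure V hZ).tupleDist (fun j => toQ V (A' j)) fun j => toQ V (B' j) := by
    rw [hd]
    refine csInf_le ⟨0, ?_⟩ ⟨_, _, hcoup, rfl⟩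
    rintro _ ⟨_, _, _, rfl⟩
    exact Real.sqrt_nonneg _
  have hsq := pow_le_pow_left₀ (show 0 ≤ (quotStructure V hZ).tupleDist (fun j => toQ V (A j))
    fun j => toQ V (B j) from Real.sqrt_nonneg _) hle 2
  rw [tupleDist_sq, tupleDist_sq] at hsq
  -- Norms are determined by types, so a smaller distance means a larger inner product.
  have e1 : seqIn V A' A' = seqIn V A A := hAA'.seqIn_eq hZ (fun j => .inl j) fun j => .inl j
  have e2 : seqIn V B' B' = seqIn V B B := hBB'.seqIn_eq hZ (fun j => .inl j) fun j => .inl j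
  linarith

/-- The membership in the domains at time `0` is determined by the chronological type. -/
lemma exists_rep_of_mem_typeSpace (hU : U ≤ cofinite) {r : Fin m → ℝ} (hr : ∀ j, 0 < r j)
    {y : κ → RMQuotient V} {x : Fin m → RMQuotient V} {μ : ChronType (Fin m ⊕ κ)}
    (hμ : μ ∈ typeSpace (quotStructure V hZ) r y) (hx : ∀ j, x j ∈ (quotStructure V hZ).level 0)
    (htp : tpChron (quotStructure V hZ) (Sum.elim x y) = μ) :
    ∃ A : Fin m → RMSeq Ω, (∀ j, IsMeas (A j) (𝓖 0)) ∧ (∀ j n ω, ‖(A j).1 n ω‖ ≤ r j) ∧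
      ∀ j, toQ V (A j) = x j := by
  have key : ∀ j, ∃ A : RMSeq Ω, IsMeas A (𝓖 0) ∧ (∀ n ω, ‖A.1 n ω‖ ≤ r j) ∧ toQ V A = x j := by
    intro j
    obtain ⟨x', hx', htp'⟩ := hμ
    set S := quotStructure V hZ with hS
    -- The distance to the ball is a chronological formula; it vanishes at the witness `x'` of the
    -- type space, hence also at x.
    set φ : ChronFormula 0 (Fin m ⊕ κ) := .inf le_rfl (r j) (hr j)
      (.dist (t := 0) (.var (.inl none)) (.var (.inl (some (.inl j))))) with hφ
    have hval : ∀ w : Fin m → RMQuotient V, φ.eval S (Sum.elim w y) =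
        ⨅ q : S.dom 0 (r j), S.dist (q : RMQuotient V) (w j) := fun w => rfl
    have hbdd : ∀ q : RMQuotient V, BddBelow (Set.range fun q' : S.dom 0 (r j) =>
        S.dist (q' : RMQuotient V) q) := fun q =>
      ⟨0, by rintro _ ⟨q', rfl⟩; exact Real.sqrt_nonneg _⟩
    have hzero : (⨅ q : S.dom 0 (r j), S.dist (q : RMQuotient V) (x j)) ≤ 0 := by
      have e := congrFun (htp.trans htp'.symm) ⟨0, φ⟩
      change φ.eval S (Sum.elim x y) = φ.eval S (Sum.elim x' y) at e
      rw [hval, hval] at e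
      rw [e]
      refine (ciInf_le (hbdd _) ⟨x' j, hx' j⟩).trans (le_of_eq ?_)
      simp only [ProcStructure.dist, sub_self, mul_zero]
      have : S.tr 0 = 0 := by
        have := quotTrace_star_mul V (0 : RMSeq Ω)
        rw [toQ_zero, mul_zero] at this
        have h0 : charSq V (0 : RMSeq Ω) = 0 := by
          refine tendsto_nhds_unique (tendsto_charSq V 0) ?_
          refine tendsto_const_nhds.congr fun p => ?_
          change 0 = hsSq (0 : Mat p.1)
          simp [hsSq_eq]
        rw [h0, Complex.ofReal_zero] at this
        exact this
      rw [this]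
      simp
    obtain ⟨R, hR, X, hXm, hXR, hXq⟩ := hx j
    -- Adapted nearest points in the matrix balls attain this infimum, so distance zero yields a
    -- representative inside the ball.
    obtain ⟨A, hAm, hAr, hmin⟩ := exists_adapted_argmin (𝓖 := 𝓖) (m := 1) (r := fun _ => r j)
      (fun _ => hr j) 0 (fun n ω D => hsN (D 0 - X.1 n ω)) fun n D =>
        continuous_hsN.measurable.comp (measurable_const.sub (hXm n))
    refine ⟨A 0, hAm 0, hAr 0, ?_⟩
    rw [← hXq]
    change toQ V (A 0) = toQ V X
    have hdist : ∀ Y : RMSeq Ω, Tendsto (fun p : ℕ+ × Ω => hsN (Y.1 p.1 p.2 - X.1 p.1 p.2))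
        (charFilter V) (𝓝 (S.dist (toQ V Y) (toQ V X))) := fun Y => by
      have h := (Real.continuous_sqrt.tendsto _).comp ((Complex.continuous_re.tendsto _).comp
        (tendsto_quotTrace V (star (Y - X) * (Y - X))))
      rw [toQ_mul, toQ_star, toQ_sub] at h
      exact h
    have hle : ∀ q : S.dom 0 (r j), S.dist (toQ V (A 0)) (toQ V X) ≤ S.dist q (toQ V X) := by
      rintro ⟨_, Y, hYm, hYr, rfl⟩
      have h1 := (hdist Y).add (tendsto_one_div_charFilter V hU)
      rw [add_zero] at h1
      refine le_of_tendsto_of_tendsto' (hdist (A 0)) h1 fun p => ?_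
      obtain ⟨D, hDr, hD, hl⟩ := hmin p.1 p.2 (fun _ => Y.1 p.1 p.2) fun _ => hYr _ _
      refine hl.trans ?_
      have e : D 0 - X.1 p.1 p.2 = (Y.1 p.1 p.2 - X.1 p.1 p.2) - (Y.1 p.1 p.2 - D 0) := by abel
      rw [e]
      exact (hsN_sub_le _ _).trans (add_le_add le_rfl ((hsN_le_norm _).trans (hD 0)))
    have hne : Nonempty (S.dom 0 (r j)) := ⟨⟨x' j, hx' j⟩⟩
    have h0 : S.dist (toQ V (A 0)) (toQ V X) ≤ 0 := by
      refine le_trans (le_ciInf fun q => hle q) ?_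
      have : toQ V X = x j := hXq
      rw [this]
      exact hzero
    have h00 : S.dist (toQ V (A 0)) (toQ V X) = 0 := le_antisymm h0 (Real.sqrt_nonneg _)
    rw [toQ_eq_iff]
    have := hdist (A 0)
    rwa [h00] at this
  choose A h1 h2 h3 using key
  exact ⟨A, h1, h2, h3⟩

end InnerProducts

end ChronOT

namespace ChronOT

/-! ## Convergence in probability along a filter -/

section ProbFilter

variable {Ω' : Type*} [MeasurableSpace Ω'] (P' : Measure Ω') (U : Filter ℕ+)

/-- The filter on `ℕ+ × Ω'` of sets whose sections have probabilities converging to `1` along `U`: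
convergence along it is convergence in probability. -/
def probFilter : Filter (ℕ+ × Ω') where
  sets := {S | Tendsto (fun n => P' {ω | (n, ω) ∉ S}) U (𝓝 0)}
  univ_sets := by
    simpa using (tendsto_const_nhds : Tendsto (fun _ : ℕ+ => (0 : ℝ≥0∞)) U (𝓝 0))
  sets_of_superset := fun {S T} hS hST => tendsto_of_tendsto_of_tendsto_of_le_of_le
    tendsto_const_nhds hS (fun _ => zero_le) fun n => measure_mono fun ω hω h => hω (hST h)
  inter_sets := fun {S T} hS hT => by
    have h1 : Tendsto (fun n => P' {ω | (n, ω) ∉ S}) U (𝓝 0) := hS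
    have h2 : Tendsto (fun n => P' {ω | (n, ω) ∉ T}) U (𝓝 0) := hT
    have h3 := h1.add h2
    rw [add_zero] at h3
    refine tendsto_of_tendsto_of_tendsto_of_le_of_le tendsto_const_nhds h3 (fun _ => zero_le)
      fun n => ?_
    refine (measure_mono fun ω hω => ?_).trans (measure_union_le _ _)
    by_contra hc
    simp only [Set.mem_union, Set.mem_ofPred_eq, not_or, not_not] at hc
    exact hω hc

variable {P' U}

lemma mem_probFilter {S : Set (ℕ+ × Ω')} :
    S ∈ probFilter P' U ↔ Tendsto (fun n => P' {ω | (n, ω) ∉ S}) U (𝓝 0) := Iff.rfl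

lemma tendstoInMeasure_iff_probFilter {f : ℕ+ → Ω' → ℝ} {c : ℝ} :
    TendstoInMeasure P' f U (fun _ => c) ↔
      Tendsto (fun p : ℕ+ × Ω' => f p.1 p.2) (probFilter P' U) (𝓝 c) := by
  rw [tendstoInMeasure_iff_dist, Metric.tendsto_nhds]
  refine forall₂_congr fun ε _ => ?_
  rw [Filter.Eventually, mem_probFilter]
  simp only [Set.mem_ofPred_eq, not_lt]

lemma tendsto_fst_probFilter : Tendsto Prod.fst (probFilter P' U) U := by
  intro S hS
  rw [mem_map, mem_probFilter]
  refine tendsto_const_nhds.congr' ?_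
  filter_upwards [hS] with n hn
  simp [hn]

lemma eventually_probFilter_of_ae {p : ℕ+ → Ω' → Prop} (h : ∀ n, ∀ᵐ ω ∂P', p n ω) :
    ∀ᶠ q in probFilter P' U, p q.1 q.2 := by
  rw [Filter.Eventually, mem_probFilter]
  refine tendsto_const_nhds.congr fun n => ?_
  exact (ae_iff.1 (h n)).symm

/-- K(n) is the largest k ≤ n for which the exceptional probability at n is at most 1/k. -/
lemma exists_diagonal (hU : U ≤ cofinite) {E : ℕ → Set (ℕ+ × Ω')}
    (hE : ∀ k, E k ∈ probFilter P' U) :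
    ∃ K : ℕ+ → ℕ, Tendsto K U atTop ∧ ∀ᶠ p in probFilter P' U, p ∈ E (K p.1) := by
  classical
  set K : ℕ+ → ℕ := fun n =>
    Nat.findGreatest (fun k => P' {ω | (n, ω) ∉ E k} ≤ (k : ℝ≥0∞)⁻¹) n with hK
  have hKt : Tendsto K U atTop := by
    refine tendsto_atTop.2 fun k => ?_
    have h1 : ∀ᶠ n in U, P' {ω | (n, ω) ∉ E k} ≤ (k : ℝ≥0∞)⁻¹ :=
      ((mem_probFilter.1 (hE k)).eventually (gt_mem_nhds
        (ENNReal.inv_pos.2 (ENNReal.natCast_ne_top k)))).mono fun n hn => hn.le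
    have h2 : ∀ᶠ n : ℕ+ in U, (k : ℝ) ≤ ((n : ℕ) : ℝ) :=
      (tendsto_atTop_of_le_cofinite hU).eventually_ge_atTop _
    filter_upwards [h1, h2] with n hn hkn
    exact Nat.le_findGreatest (by exact_mod_cast hkn) hn
  refine ⟨K, hKt, ?_⟩
  rw [Filter.Eventually, mem_probFilter]
  refine tendsto_of_tendsto_of_tendsto_of_le_of_le' tendsto_const_nhds
    (ENNReal.tendsto_inv_nat_nhds_zero.comp hKt) (Eventually.of_forall fun _ => zero_le) ?_
  -- The greatest index satisfies its defining bound unless it is the default value 0.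
  filter_upwards [hKt.eventually_ge_atTop 1] with n hn
  exact Nat.findGreatest_of_ne_zero (P := fun k => P' {ω | (n, ω) ∉ E k} ≤ (k : ℝ≥0∞)⁻¹)
    (n := n) rfl (by have : 1 ≤ K n := hn; omega)

end ProbFilter

/-! ## Classical optimality of maximizers -/

section Classical

variable {Ω' : Type*} [MeasurableSpace Ω'] (P' : Measure Ω') [IsProbabilityMeasure P'] {n : ℕ+}
  {m : ℕ}

lemma continuous_cost : Continuous fun p : (Fin m → Mat n) × (Fin m → Mat n) =>
    ∑ j, hsSq (p.1 j - p.2 j) :=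
  continuous_finsetSum _ fun j _ => continuous_hsSq.comp (by fun_prop)

/-- Kantorovich duality: F(x) minimizes c(x, y) - h(y) over y in N. Integrating the inequality
against any coupling γ of the same marginals, the h-terms cancel, since y and F(x) have the same
law. -/
lemma isClassicalOptimalCoupling_of_dual {X : Ω' → Fin m → Mat n} (hX : Measurable X)
    {F : (Fin m → Mat n) → Fin m → Mat n} (hF : Measurable F) {h : (Fin m → Mat n) → ℝ}
    (hh : Measurable h) {M : ℝ} (hM : ∀ y, |h y| ≤ M) {N : Set (Fin m → Mat n)}
    (hN : MeasurableSet N) (hFN : ∀ x, F x ∈ N)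
    (hopt : ∀ x, ∀ y ∈ N, ∑ j, hsSq (x j - F x j) + h y ≤ ∑ j, hsSq (x j - y j) + h (F x)) :
    IsClassicalOptimalCoupling P' X (fun ω => F (X ω)) := by
  intro γ h1 h2
  have hc := (continuous_cost (n := n) (m := m)).measurable
  have hc0 : ∀ x y : Fin m → Mat n, 0 ≤ ∑ j, hsSq (x j - y j) := fun x y =>
    Finset.sum_nonneg fun j _ => hsSq_nonneg _
  -- The shift by M makes the potential nonnegative, so that all integrals can be lower integrals;
  -- the added terms are finite and can be cancelled.
  have hM0 : ∀ y, 0 ≤ h y + M := fun y => by linarith [(abs_le.1 (hM y)).1]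
  have hFX : Measurable fun ω => F (X ω) := hF.comp hX
  have hcF : Measurable fun x : Fin m → Mat n => ENNReal.ofReal (∑ j, hsSq (x j - F x j)) :=
    (hc.comp (measurable_id.prodMk hF)).ennreal_ofReal
  have hhM : Measurable fun y => ENNReal.ofReal (h y + M) := (hh.add_const M).ennreal_ofReal
  have e1 : transportCost (P'.map fun ω => (X ω, F (X ω))) =
      ∫⁻ p, ENNReal.ofReal (∑ j, hsSq (p.1 j - F p.1 j)) ∂γ := by
    rw [transportCost, lintegral_map hc.ennreal_ofReal (hX.prodMk hFX)]
    rw [← lintegral_map (f := fun x => ENNReal.ofReal (∑ j, hsSq (x j - F x j))) hcF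
      measurable_fst, h1, lintegral_map hcF hX]
  have e2 : ∫⁻ p, ENNReal.ofReal (h p.2 + M) ∂γ = ∫⁻ ω, ENNReal.ofReal (h (F (X ω)) + M) ∂P' := by
    rw [← lintegral_map (f := fun y => ENNReal.ofReal (h y + M)) hhM measurable_snd, h2,
      lintegral_map hhM hFX]
  have hhF : Measurable fun x => ENNReal.ofReal (h (F x) + M) := hhM.comp hF
  have e3 : ∫⁻ p, ENNReal.ofReal (h (F p.1) + M) ∂γ =
      ∫⁻ ω, ENNReal.ofReal (h (F (X ω)) + M) ∂P' := by
    rw [← lintegral_map (f := fun x => ENNReal.ofReal (h (F x) + M)) hhF measurable_fst, h1,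
      lintegral_map hhF hX]
  have hfin : ∫⁻ ω, ENNReal.ofReal (h (F (X ω)) + M) ∂P' ≠ ∞ := by
    refine ne_top_of_le_ne_top (b := ENNReal.ofReal (2 * M)) ENNReal.ofReal_ne_top ?_
    calc _ ≤ ∫⁻ _, ENNReal.ofReal (2 * M) ∂P' := lintegral_mono fun ω =>
          ENNReal.ofReal_le_ofReal (by linarith [(abs_le.1 (hM (F (X ω)))).2])
      _ = _ := by simp
  -- The second marginal of γ is the law of F(X), which is carried by N.
  have hae : ∀ᵐ p ∂γ, p.2 ∈ N := by
    have : ∀ᵐ y ∂(γ.map Prod.snd), y ∈ N := by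
      rw [h2]
      exact (ae_map_iff (p := fun y => y ∈ N) hFX.aemeasurable hN).2
        (Eventually.of_forall fun ω => hFN _)
    exact ae_of_ae_map measurable_snd.aemeasurable this
  refine ENNReal.le_of_add_le_add_right hfin ?_
  rw [e1, ← e3]
  nth_rewrite 1 [e3]
  have m2 : Measurable fun p : (Fin m → Mat n) × (Fin m → Mat n) => ENNReal.ofReal (h p.2 + M) :=
    hhM.comp measurable_snd
  have m1 : Measurable fun p : (Fin m → Mat n) × (Fin m → Mat n) =>
    ENNReal.ofReal (h (F p.1) + M) := hhF.comp measurable_fst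
  rw [← e2, transportCost, ← lintegral_add_right _ m2, ← lintegral_add_right _ m1]
  refine lintegral_mono_ae (hae.mono fun p hp => ?_)
  rw [← ENNReal.ofReal_add (hc0 _ _) (hM0 _), ← ENNReal.ofReal_add (hc0 _ _) (hM0 _)]
  exact ENNReal.ofReal_le_ofReal (by linarith [hopt p.1 p.2 hp])

/-- Measurable maximizers of penalized inner products on a net are classically optimal. -/
lemma exists_optimal_map {X : Ω' → Fin m → Mat n} (hX : Measurable X) {r : Fin m → ℝ}
    (hr : ∀ j, 0 < r j) {g : (Fin m → Mat n) → ℝ} (hg : Measurable g) {M : ℝ}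
    (hM : ∀ y, |g y| ≤ M) {ε : ℝ} (hε : 0 < ε) :
    ∃ F : (Fin m → Mat n) → Fin m → Mat n, Measurable F ∧ (∀ x j, ‖F x j‖ ≤ r j) ∧
      IsClassicalOptimalCoupling P' X (fun ω => F (X ω)) ∧
      ∀ x y : Fin m → Mat n, (∀ j, ‖y j‖ ≤ r j) → ∃ d : Fin m → Mat n, (∀ j, ‖d j‖ ≤ r j) ∧
        (∀ j, ‖y j - d j‖ ≤ ε) ∧ tupIn x d - g d ≤ tupIn x (F x) - g (F x) := by
  obtain ⟨N, d, hd, hnet⟩ := exists_finite_net n hr hε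
  have hti : ∀ i, Measurable fun x : Fin m → Mat n => tupIn x (d i) := fun i => by
    -- Polarization, which reduces measurability of the inner product to that of squared norms.
    have e : (fun x : Fin m → Mat n => tupIn x (d i)) = fun x =>
        (∑ j, hsSq (x j) + ∑ j, hsSq (d i j) - ∑ j, hsSq (x j - d i j)) / 2 := by
      funext x
      rw [tupIn_sub_self]
      simp only [tupIn, hsIn_self]
      ring
    rw [e]
    have c1 : Continuous fun x : Fin m → Mat n => ∑ j, hsSq (x j) :=
      continuous_finsetSum _ fun j _ => continuous_hsSq.comp (continuous_apply j)
    have c2 : Continuous fun x : Fin m → Mat n => ∑ j, hsSq (x j - d i j) :=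
      continuous_finsetSum _ fun j _ => continuous_hsSq.comp (by fun_prop)
    exact (((c1.add continuous_const).sub c2).div_const 2).measurable
  obtain ⟨i, hi, hmin⟩ := exists_measurable_argmin (Ω := Fin m → Mat n)
    (G := fun x k => g (d k) - tupIn x (d k)) fun k => measurable_const.sub (hti k)
  have hF : Measurable fun x => d (i x) := (Measurable.of_discrete (f := d)).comp hi
  refine ⟨fun x => d (i x), hF, fun x j => hd _ j, ?_, fun x y hy => ?_⟩
  · set R : ℝ := ∑ j, r j ^ 2 with hR
    have hdR : ∀ k, ∑ j, hsSq (d k j) ≤ R := fun k => Finset.sum_le_sum fun j _ =>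
      (hsSq_le _).trans (pow_le_pow_left₀ (norm_nonneg _) (hd k j) 2)
    have hR0 : 0 ≤ R := Finset.sum_nonneg fun j _ => sq_nonneg _
    have hs0 : ∀ y : Fin m → Mat n, 0 ≤ ∑ j, hsSq (y j) := fun y =>
      Finset.sum_nonneg fun j _ => hsSq_nonneg _
    have c1 : Continuous fun x : Fin m → Mat n => ∑ j, hsSq (x j) :=
      continuous_finsetSum _ fun j _ => continuous_hsSq.comp (continuous_apply j)
    -- Minimizing ‖x - y‖² - h(y) with h(y) = ‖y‖² - 2 g(y) amounts to maximizing ⟨x, y⟩ - g(y). The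
    -- cap at R only makes h bounded; it is inactive on the net.
    refine isClassicalOptimalCoupling_of_dual P' hX hF
      (h := fun y => min (∑ j, hsSq (y j)) R - 2 * g y) (M := R + 2 * M) (N := Set.range d)
      ((c1.measurable.min measurable_const).sub (hg.const_mul 2)) (fun y => ?_)
      (Set.finite_range d).measurableSet (fun x => ⟨_, rfl⟩) ?_
    · have h1 := abs_le.1 (hM y)
      have h2 := min_le_right (∑ j, hsSq (y j)) R
      have h3 := le_min (hs0 y) hR0
      rw [abs_le]
      constructor <;> linarith
    · rintro x _ ⟨k, rfl⟩
      have h1 := hmin x k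
      rw [min_eq_left (hdR _), min_eq_left (hdR _), tupIn_sub_self, tupIn_sub_self]
      have e : ∀ y : Fin m → Mat n, tupIn y y = ∑ j, hsSq (y j) := fun y => by
        simp only [tupIn, hsIn_self]
      rw [e (d k), e (d (i x))]
      linarith
  · obtain ⟨k, hk⟩ := hnet y hy
    exact ⟨d k, hd k, hk, by linarith [hmin x k]⟩

end Classical

end ChronOT

namespace ChronOT

/-! ## Optimal transport to a point inside a displacement interpolation -/

section Transport

variable {Ω : Type*} [mΩ : MeasurableSpace Ω] {P : Measure Ω} [IsProbabilityMeasure P]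
  {𝓖 : Filtration ℝ≥0 mΩ} {Z : ∀ n : ℕ+, ℝ≥0 → ℕ → Ω → Mat n}
  {U : Filter ℕ+} {V : Subalgebra.center ℂ (RMUltraproduct P U) →ₐ[ℂ] ℂ} {β κ : Type} {m : ℕ}

lemma eventually_exists_close_fintype {α ι : Type} [Fintype ι] {r : Fin m → ℝ} (hr : ∀ j, 0 < r j)
    {I : Type*} {G : Filter I} [G.NeBot] {n : I → ℕ+} {X : ∀ i, α → Mat (n i)}
    {I' : Type*} {G' : Filter I'} {n' : I' → ℕ+} {X' : ∀ i, α → Mat (n' i)}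
    {c : RFormula α → ℝ} (hX : HasLims P Z G n X c) (hX' : HasLims P Z G' n' X' c)
    {Y : ∀ i, Fin m → Mat (n i)} (hYr : ∀ᶠ i in G, ∀ j, ‖Y i j‖ ≤ r j)
    (ψ : ι → RFormula (Fin m ⊕ α)) (a : ι → ℝ)
    (hY : ∀ l, Tendsto (fun i => (ψ l).Lam P (Z (n i)) (Sum.elim (Y i) (X i))) G (𝓝 (a l)))
    {ε : ℝ} (hε : 0 < ε) :
    ∀ᶠ i in G', ∃ Y' : Fin m → Mat (n' i), (∀ j, ‖Y' j‖ ≤ r j) ∧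
      ∀ l, |(ψ l).Lam P (Z (n' i)) (Sum.elim Y' (X' i)) - a l| < ε := by
  set e := Fintype.equivFin ι
  filter_upwards [eventually_exists_close hr hX hX' hYr (fun k => ψ (e.symm k))
    (fun k => a (e.symm k)) (fun k => hY _) hε] with i ⟨Y', hY'r, hY'⟩
  refine ⟨Y', hY'r, fun l => ?_⟩
  simpa using hY' (e l)

/-- On norm-bounded tuples inner products are uniform limits of restricted formulas, so they
converge with them. -/
lemma tendsto_tupIn_of_hasLims (hZ : ∀ n t j, Measurable (Z n t j)) {W : β → RMSeq Ω}
    {I : Type*} {G : Filter I} {n : I → ℕ+} {X : ∀ i, β → Mat (n i)} {R : β → ℝ}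
    (hXR : ∀ᶠ i in G, ∀ b, ‖X i b‖ ≤ R b) (hX : HasLims P Z G n X fun φ => ev V Z φ W)
    (e e' : Fin m → β) :
    Tendsto (fun i => tupIn (fun j => X i (e j)) fun j => X i (e' j)) G
      (𝓝 (seqIn V (W ∘ e) (W ∘ e'))) := by
  refine tendsto_finsetSum _ fun j _ => ?_
  choose C hC0 hC using fun b => (W b).exists_bound
  set p : StarPoly β := .mul (.adj (.var (e j))) (.var (e' j)) with hp
  rw [Metric.tendsto_nhds]
  intro ε hε
  obtain ⟨ψ, hψ⟩ := (isResApprox_eval (R := fun b => max (C b) (R b)) p).exists_formula P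
    (show 0 < ε / 4 by positivity)
  have h1 : |(quotTrace V (toQ V (p.eval W))).re - ev V Z ψ W| ≤ ε / 4 := by
    refine le_of_tendsto (((Complex.continuous_re.tendsto _).comp
      (tendsto_quotTrace V (p.eval W))).sub (tendsto_ev V hZ ψ W)).abs
      (Eventually.of_forall fun q => ?_)
    have := hψ q.1 (Z q.1) (tupAt W q) fun b => (hC b q.1 q.2).trans (le_max_left _ _)
    simp only [Function.comp, eval_apply]
    exact this
  filter_upwards [hXR, Metric.tendsto_nhds.1 (hX ψ) (ε / 4) (by positivity)] with i hi hi'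
  have h2 := hψ (n i) (Z (n i)) (X i) fun b => (hi b).trans (le_max_right _ _)
  rw [Real.dist_eq] at hi' ⊢
  change |(normTr (p.eval (X i))).re - (quotTrace V (toQ V (p.eval W))).re| < ε
  rw [abs_lt] at hi' ⊢
  rw [abs_le] at h1 h2
  constructor <;> linarith

/-- The transfer principle for D over (A, C): inner products with A are encoded by finitely many
approximating formulas, and the types over C by the given formulas read without the A-variables. -/
lemma eventually_exists_near (hZ : ∀ n t j, Measurable (Z n t j)) {r : Fin m → ℝ}
    (hr : ∀ j, 0 < r j) {A D : Fin m → RMSeq Ω} {C : κ → RMSeq Ω}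
    (hAr : ∀ j n ω, ‖(A j).1 n ω‖ ≤ r j) (hDr : ∀ j n ω, ‖(D j).1 n ω‖ ≤ r j)
    {I : Type*} {G : Filter I} {n : I → ℕ+} {X₀ : ∀ i, Fin m → Mat (n i)}
    {Y₀ : ∀ i, κ → Mat (n i)} {R : κ → ℝ} (hX₀ : ∀ᶠ i in G, ∀ j, ‖X₀ i j‖ ≤ r j)
    (hY₀ : ∀ i k, ‖Y₀ i k‖ ≤ R k)
    (hlim : HasLims P Z G n (fun i => Sum.elim (X₀ i) (Y₀ i)) fun φ => ev V Z φ (Sum.elim A C))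
    {K : ℕ} (ψ : Fin K → RFormula (Fin m ⊕ κ)) {δ : ℝ} (hδ : 0 < δ) :
    ∀ᶠ i in G, ∃ Y' : Fin m → Mat (n i), (∀ j, ‖Y' j‖ ≤ r j) ∧
      seqIn V A D - δ < tupIn (X₀ i) Y' ∧
      ∀ l, |(ψ l).Lam P (Z (n i)) (Sum.elim Y' (Y₀ i)) - ev V Z (ψ l) (Sum.elim D C)| < δ := by
  choose RC hRC0 hRC using fun k => (C k).exists_bound
  set Rb : Fin m ⊕ Fin m ⊕ κ → ℝ := Sum.elim r (Sum.elim r fun k => max (RC k) (R k)) with hRb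
  -- Each coordinate of the inner product suffers three errors η: two approximations by formulas and
  -- one transfer.
  set η : ℝ := δ / (4 * (m + 1)) with hη
  have hη0 : 0 < η := by positivity
  have hηδ : η ≤ δ := by
    rw [hη, div_le_iff₀ (by positivity)]
    nlinarith [(Nat.cast_nonneg m : (0 : ℝ) ≤ m)]
  have hηm : m * (3 * η) < δ := by
    have : η * (4 * (m + 1)) = δ := by rw [hη]; field_simp
    nlinarith [(Nat.cast_nonneg m : (0 : ℝ) ≤ m)]
  set p : Fin m → StarPoly (Fin m ⊕ Fin m ⊕ κ) := fun j =>
    .mul (.adj (.var (.inr (.inl j)))) (.var (.inl j)) with hp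
  choose χ hχ using fun j => (isResApprox_eval (R := Rb) (p j)).exists_formula P hη0
  set W : Fin m ⊕ Fin m ⊕ κ → RMSeq Ω := Sum.elim D (Sum.elim A C) with hW
  have hWR : ∀ b n ω, ‖(W b).1 n ω‖ ≤ Rb b := by
    rintro (j | j | k) n ω
    exacts [hDr j n ω, hAr j n ω, (hRC k n ω).trans (le_max_left _ _)]
  have ha : ∀ j, |(quotTrace V (toQ V (star (A j) * D j))).re - ev V Z (χ j) W| ≤ η := fun j => by
    refine le_of_tendsto (((Complex.continuous_re.tendsto _).comp
      (tendsto_quotTrace V ((p j).eval W))).sub (tendsto_ev V hZ (χ j) W)).abs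
      (Eventually.of_forall fun q => ?_)
    have := hχ j q.1 (Z q.1) (tupAt W q) fun b => hWR b q.1 q.2
    simp only [Function.comp, eval_apply]
    exact this
  set e : Fin m ⊕ κ → Fin m ⊕ Fin m ⊕ κ := Sum.elim .inl fun k => .inr (.inr k) with he
  have hcl := eventually_exists_close_fintype (ι := Fin m ⊕ Fin K) hr
    (hasLims_ev V hZ (Sum.elim A C)) hlim (Y := tupAt D)
    (Eventually.of_forall fun q j => hDr j q.1 q.2)
    (Sum.elim χ fun l => (ψ l).map e)
    (Sum.elim (fun j => ev V Z (χ j) W) fun l => ev V Z (ψ l) (Sum.elim D C))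
    (by
      rintro (j | l)
      · have := hasLims_ev V hZ W (χ j)
        simpa only [hW, tupAt_sum, Sum.elim_inl] using this
      · have := hasLims_ev V hZ (Sum.elim D C) (ψ l)
        simp only [Sum.elim_inr, RFormula.Lam_map]
        refine this.congr fun q => ?_
        congr 1
        funext b
        rcases b with j | k <;> rfl) hη0
  filter_upwards [hcl, hX₀] with i ⟨Y', hY'r, hY'⟩ hi
  refine ⟨Y', hY'r, ?_, fun l => ?_⟩
  · have hj : ∀ j, (quotTrace V (toQ V (star (A j) * D j))).re - 3 * η ≤ hsIn (X₀ i j) (Y' j) := by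
      intro j
      have h1 := hY' (.inl j)
      have h2 := hχ j (n i) (Z (n i)) (Sum.elim Y' (Sum.elim (X₀ i) (Y₀ i))) (by
        rintro (j | j | k)
        exacts [hY'r j, hi j, (hY₀ i k).trans (le_max_right _ _)])
      have h3 := ha j
      simp only [Sum.elim_inl] at h1
      change |hsIn (X₀ i j) (Y' j) - _| ≤ η at h2
      rw [abs_lt] at h1
      rw [abs_le] at h2 h3
      linarith
    have hs := Finset.sum_le_sum fun j (_ : j ∈ Finset.univ) => hj j
    rw [Finset.sum_sub_distrib] at hs
    simp only [Finset.sum_const, Finset.card_univ, Fintype.card_fin, nsmul_eq_mul] at hs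
    change seqIn V A D - m * (3 * η) ≤ tupIn (X₀ i) Y' at hs
    linarith
  · have h1 := hY' (.inr l)
    simp only [Sum.elim_inr, RFormula.Lam_map] at h1
    have e1 : Sum.elim Y' (Sum.elim (X₀ i) (Y₀ i)) ∘ e = Sum.elim Y' (Y₀ i) := by
      funext b
      rcases b with j | k <;> rfl
    rw [e1] at h1
    exact h1.trans_le hηδ

lemma tD_sum_elim_le {n : ℕ+} (s : Finset (Fin m ⊕ κ)) (X Y : Fin m → Mat n) (W : κ → Mat n) :
    tD s (Sum.elim X W) (Sum.elim Y W) ≤ ∑ j, hsN (X j - Y j) := by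
  rw [tD_sum]
  have e0 : tD s.toRight (fun a => Sum.elim X W (.inr a)) (fun a => Sum.elim Y W (.inr a)) = 0 := by
    simp [tD, hsN_zero]
  rw [e0, add_zero]
  exact tD_mono (Finset.subset_univ _) _ _

lemma abs_tupIn_le {n : ℕ+} {r : Fin m → ℝ} {X Y : Fin m → Mat n} (hX : ∀ j, ‖X j‖ ≤ r j)
    {δ : Fin m → ℝ} (hY : ∀ j, ‖Y j‖ ≤ δ j) : |tupIn X Y| ≤ ∑ j, r j * δ j := by
  refine (Finset.abs_sum_le_sum_abs _ _).trans (Finset.sum_le_sum fun j _ => ?_)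
  refine (abs_hsIn_le _ _).trans (mul_le_mul ((hsN_le_norm _).trans (hX j))
    ((hsN_le_norm _).trans (hY j)) (hsN_nonneg _) ((norm_nonneg _).trans (hX j)))

lemma tupIn_sub_right {n : ℕ+} (X Y Y' : Fin m → Mat n) :
    tupIn X (fun j => Y j - Y' j) = tupIn X Y - tupIn X Y' := by
  simp only [tupIn, hsIn_sub_right, Finset.sum_sub_distrib]

variable (P Z) in
/-- A penalty for the deviation of the first `K` formulas from given values. -/
noncomputable def penalty (ψ : ℕ → RFormula (Fin m ⊕ κ)) (c : ℕ → ℝ) (K : ℕ) {n : ℕ+}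
    (Y₀ : κ → Mat n) (Y : Fin m → Mat n) : ℝ :=
  K * ∑ i ∈ Finset.range K, |(ψ i).Lam P (Z n) (Sum.elim Y Y₀) - c i|

lemma penalty_nonneg (ψ : ℕ → RFormula (Fin m ⊕ κ)) (c : ℕ → ℝ) (K : ℕ) {n : ℕ+}
    (Y₀ : κ → Mat n) (Y : Fin m → Mat n) : 0 ≤ penalty P Z ψ c K Y₀ Y :=
  mul_nonneg (Nat.cast_nonneg _) (Finset.sum_nonneg fun _ _ => abs_nonneg _)

lemma measurable_penalty (hZ : ∀ n t j, Measurable (Z n t j)) (ψ : ℕ → RFormula (Fin m ⊕ κ))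
    (c : ℕ → ℝ) (K : ℕ) {n : ℕ+} (Y₀ : κ → Mat n) : Measurable (penalty P Z ψ c K Y₀) := by
  refine Measurable.const_mul (Finset.measurable_fun_sum _ fun i _ => ?_) _
  have : Measurable fun Y : Fin m → Mat n => (ψ i).Lam P (Z n) (Sum.elim Y Y₀) :=
    measurable_Lam hZ P (ψ i) (by
      rintro (j | k)
      exacts [measurable_pi_apply j, measurable_const])
  exact continuous_abs.measurable.comp (this.sub measurable_const)

lemma exists_penalty_le (ψ : ℕ → RFormula (Fin m ⊕ κ)) (c : ℕ → ℝ) (K : ℕ) :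
    ∃ M : ℝ, ∀ (n : ℕ+) (Y₀ : κ → Mat n) (Y : Fin m → Mat n), |penalty P Z ψ c K Y₀ Y| ≤ M := by
  choose b hb0 hb using fun i => (ψ i).exists_bound P
  refine ⟨K * ∑ i ∈ Finset.range K, (b i + |c i|), fun n Y₀ Y => ?_⟩
  rw [abs_of_nonneg (penalty_nonneg ψ c K Y₀ Y)]
  refine mul_le_mul_of_nonneg_left (Finset.sum_le_sum fun i _ => ?_) (Nat.cast_nonneg _)
  exact (abs_sub _ _).trans (add_le_add (hb i n (Z n) _) le_rfl)

variable {Ω' : Type*} [MeasurableSpace Ω'] {P' : Measure Ω'} [IsProbabilityMeasure P']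

/-- For a fixed penalty, the maximizers on a fine net are asymptotically as good as the target. -/
lemma eventually_penalized_le (hZ : ∀ n, IsMatrixBM P 𝓖 n (Z n)) (hU : U ≤ cofinite)
    {r : Fin m → ℝ} (hr : ∀ j, 0 < r j) {A D : Fin m → RMSeq Ω} {C : κ → RMSeq Ω}
    (hAr : ∀ j n ω, ‖(A j).1 n ω‖ ≤ r j) (hDr : ∀ j n ω, ‖(D j).1 n ω‖ ≤ r j)
    {X₀ : ∀ n : ℕ+, Ω' → Fin m → Mat n} (hX₀r : ∀ n, ∀ᵐ ω ∂P', ∀ j, ‖X₀ n ω j‖ ≤ r j)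
    {Y₀ : ∀ n : ℕ+, κ → Mat n} {R : κ → ℝ} (hY₀ : ∀ n k, ‖Y₀ n k‖ ≤ R k)
    (hlim : HasLims P Z (probFilter P' U) Prod.fst
      (fun p => Sum.elim (X₀ p.1 p.2) (Y₀ p.1)) fun φ => ev V Z φ (Sum.elim A C))
    (ψ : ℕ → RFormula (Fin m ⊕ κ)) (K : ℕ) {F : ∀ n : ℕ+, (Fin m → Mat n) → Fin m → Mat n}
    (hF : ∀ (n : ℕ+) (x y : Fin m → Mat n), (∀ j, ‖y j‖ ≤ r j) → ∃ d : Fin m → Mat n,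
      (∀ j, ‖d j‖ ≤ r j) ∧ (∀ j, ‖y j - d j‖ ≤ 1 / (n : ℝ)) ∧
      tupIn x d - penalty P Z ψ (fun i => ev V Z (ψ i) (Sum.elim D C)) K (Y₀ n) d ≤
        tupIn x (F n x) - penalty P Z ψ (fun i => ev V Z (ψ i) (Sum.elim D C)) K (Y₀ n) (F n x)) :
    ∀ᶠ p in probFilter P' U, seqIn V A D - 1 / ((K : ℝ) + 1) ≤
      tupIn (X₀ p.1 p.2) (F p.1 (X₀ p.1 p.2)) -
        penalty P Z ψ (fun i => ev V Z (ψ i) (Sum.elim D C)) K (Y₀ p.1)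
          (F p.1 (X₀ p.1 p.2)) := by
  have hZm := measurable_increments hZ
  choose Cl s hCl hL using fun i => (ψ i).exists_lipschitz P
  have hK0 : (0 : ℝ) ≤ K := Nat.cast_nonneg K
  -- Of the allowance 1/(K+1), one half covers the inner product error δ and the penalty 2K²δ of the
  -- target, and a quarter covers the net.
  set δ : ℝ := 1 / (4 * ((K : ℝ) + 1) * ((K : ℝ) ^ 2 + 1)) with hδ
  have hδ0 : 0 < δ := by positivity
  have hδK : 2 * ((K : ℝ) ^ 2 + 1) * δ = 1 / 2 * (1 / ((K : ℝ) + 1)) := by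
    rw [hδ]; field_simp; ring
  have hXb := eventually_probFilter_of_ae (U := U) hX₀r
  have hnear := eventually_exists_near hZm hr hAr hDr hXb
    (fun p k => hY₀ p.1 k) hlim (fun i : Fin K => ψ i) hδ0
  have h1n : Tendsto (fun p : ℕ+ × Ω' => 1 / ((p.1 : ℕ) : ℝ)) (probFilter P' U) (𝓝 0) :=
    (tendsto_const_nhds.div_atTop (tendsto_atTop_of_le_cofinite hU)).comp tendsto_fst_probFilter
  have hn1 : ∀ᶠ p : ℕ+ × Ω' in probFilter P' U,
      ∑ j, r j * (1 / ((p.1 : ℕ) : ℝ)) < 1 / 4 * (1 / ((K : ℝ) + 1)) := by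
    have : Tendsto (fun p : ℕ+ × Ω' => ∑ j, r j * (1 / ((p.1 : ℕ) : ℝ))) (probFilter P' U)
        (𝓝 (∑ j, r j * 0)) := tendsto_finsetSum _ fun j _ => h1n.const_mul (r j)
    simp only [mul_zero, Finset.sum_const_zero] at this
    have hpos : (0 : ℝ) < 1 / 4 * (1 / ((K : ℝ) + 1)) := by positivity
    exact this.eventually_lt_const hpos
  have hn2 : ∀ᶠ p : ℕ+ × Ω' in probFilter P' U, ∀ i : Fin K,
      Cl i * (m * (1 / ((p.1 : ℕ) : ℝ))) < δ := by
    refine eventually_all.2 fun i => ?_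
    have := (h1n.const_mul (m : ℝ)).const_mul (Cl i)
    rw [mul_zero, mul_zero] at this
    exact this.eventually (gt_mem_nhds hδ0)
  filter_upwards [hnear, hn1, hn2, hXb] with p ⟨Y', hY'r, hY'I, hY'⟩ hp1 hp2 hX
  obtain ⟨d, hdr, hd, hle⟩ := hF p.1 (X₀ p.1 p.2) Y' hY'r
  refine le_trans ?_ hle
  have hin : tupIn (X₀ p.1 p.2) Y' - tupIn (X₀ p.1 p.2) d ≤ 1 / 4 * (1 / ((K : ℝ) + 1)) := by
    rw [← tupIn_sub_right]
    exact (le_abs_self _).trans ((abs_tupIn_le hX hd).trans hp1.le)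
  have hpen : penalty P Z ψ (fun i => ev V Z (ψ i) (Sum.elim D C)) K (Y₀ p.1) d ≤
      K * (K * (2 * δ)) := by
    refine mul_le_mul_of_nonneg_left ?_ hK0
    refine (Finset.sum_le_card_nsmul _ _ (2 * δ) fun i hi => ?_).trans (by simp)
    have hi' := Finset.mem_range.1 hi
    have h1 := hY' ⟨i, hi'⟩
    have h2 := hL i p.1 (Z p.1) (hZm p.1) (Sum.elim d (Y₀ p.1)) (Sum.elim Y' (Y₀ p.1))
    have h3 : tD (s i) (Sum.elim d (Y₀ p.1)) (Sum.elim Y' (Y₀ p.1)) ≤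
        m * (1 / ((p.1 : ℕ) : ℝ)) := by
      refine (tD_sum_elim_le _ _ _ _).trans ?_
      refine (Finset.sum_le_card_nsmul _ _ (1 / ((p.1 : ℕ) : ℝ)) fun j _ => ?_).trans (by simp)
      rw [hsN_sub_comm]
      exact (hsN_le_norm _).trans (hd j)
    have h4 := (mul_le_mul_of_nonneg_left h3 (hCl i)).trans (hp2 ⟨i, hi'⟩).le
    have h5 := abs_sub_le ((ψ i).Lam P (Z p.1) (Sum.elim d (Y₀ p.1)))
      ((ψ i).Lam P (Z p.1) (Sum.elim Y' (Y₀ p.1))) (ev V Z (ψ i) (Sum.elim D C))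
    simp only at h1
    linarith
  have hpos : (0 : ℝ) < 1 / ((K : ℝ) + 1) := by positivity
  nlinarith

end Transport

end ChronOT

namespace ChronOT

/-! ### Construction of the transport maps -/

section Construction

variable {Ω : Type*} [mΩ : MeasurableSpace Ω] {P : Measure Ω} [IsProbabilityMeasure P]
  {𝓖 : Filtration ℝ≥0 mΩ} {Z : ∀ n : ℕ+, ℝ≥0 → ℕ → Ω → Mat n}
  {U : Filter ℕ+} {V : Subalgebra.center ℂ (RMUltraproduct P U) →ₐ[ℂ] ℂ} {κ : Type} {m : ℕ}
  {Ω' : Type*} [MeasurableSpace Ω'] {P' : Measure Ω'} [IsProbabilityMeasure P']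

/-- Tuples whose types over `Y₀` and whose inner products with `X₀` are asymptotically those of a
point inside a displacement interpolation have the right joint limits with `X₀`. -/
lemma hasLims_of_penalized (hZ : ∀ n, IsMatrixBM P 𝓖 n (Z n)) (hU : U ≤ cofinite) [Countable κ]
    {t : ℝ} (ht0 : 0 < t) (ht1 : t < 1) {r : Fin m → ℝ} (hr : ∀ j, 0 < r j)
    {A B : Fin m → RMSeq Ω} {C : κ → RMSeq Ω} (hA : ∀ j, IsMeas (A j) (𝓖 0))
    (hC : ∀ j, IsMeas (C j) (𝓖 0)) (hAr : ∀ j n ω, ‖(A j).1 n ω‖ ≤ r j)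
    (hopt : ∀ A' B' : Fin m → RMSeq Ω, (∀ j, IsMeas (A' j) (𝓖 0)) → (∀ j, IsMeas (B' j) (𝓖 0)) →
      ResEq Z V (Sum.elim A' C) (Sum.elim A C) → ResEq Z V (Sum.elim B' C) (Sum.elim B C) →
        seqIn V A' B' ≤ seqIn V A B)
    {I : Type*} {G : Filter I} {n : I → ℕ+} {X₀ F : ∀ i, Fin m → Mat (n i)}
    {Y₀ : ∀ i, κ → Mat (n i)} {R : κ → ℝ} (hX₀ : ∀ᶠ i in G, ∀ j, ‖X₀ i j‖ ≤ r j)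
    (hF : ∀ i j, ‖F i j‖ ≤ r j) (hY₀ : ∀ i k, ‖Y₀ i k‖ ≤ R k)
    (hlim : HasLims P Z G n (fun i => Sum.elim (X₀ i) (Y₀ i)) fun φ => ev V Z φ (Sum.elim A C))
    (hlimF : HasLims P Z G n (fun i => Sum.elim (F i) (Y₀ i))
      fun φ => ev V Z φ (Sum.elim (interp t A B) C))
    {δ : I → ℝ} (hδ : Tendsto δ G (𝓝 0))
    (hin : ∀ᶠ i in G, seqIn V A (interp t A B) - δ i ≤ tupIn (X₀ i) (F i)) :
    HasLims P Z G n (fun i => Sum.elim (F i) (Sum.elim (X₀ i) (Y₀ i)))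
      fun φ => ev V Z φ (Sum.elim (interp t A B) (Sum.elim A C)) := by
  have hZm := measurable_increments hZ
  intro ψ
  -- Along an ultrafilter all bounded formulas converge, so the joint limits form a candidate type;
  -- the aim is to show that there is only one.
  rw [tendsto_iff_ultrafilter]
  intro g hg
  have hb : ∀ φ : RFormula (Fin m ⊕ Fin m ⊕ κ), ∃ b : ℝ, Tendsto
      (fun i => φ.Lam P (Z (n i)) (Sum.elim (F i) (Sum.elim (X₀ i) (Y₀ i)))) g (𝓝 b) := fun φ => by
    obtain ⟨B', -, hB'⟩ := φ.exists_bound P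
    obtain ⟨b, -, hb⟩ := (isCompact_Icc (a := -B') (b := B')).ultrafilter_le_nhds
      (g.map fun i => φ.Lam P (Z (n i)) (Sum.elim (F i) (Sum.elim (X₀ i) (Y₀ i))))
      (le_principal_iff.2 (mem_map.2 (univ_mem' fun i => abs_le.1 (hB' _ _ _))))
    exact ⟨b, hb⟩
  choose b hb using hb
  have hbl : HasLims P Z (g : Filter I) n
    (fun i => Sum.elim (F i) (Sum.elim (X₀ i) (Y₀ i))) b := hb
  have hAC : ∀ k, IsMeas (Sum.elim A C k) (𝓖 0) := by
    rintro (j | k)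
    exacts [hA j, hC k]
  -- The candidate is realized in Q over A and C. The realization inherits the type over C and the
  -- inner product bound, so the rigidity of interpolation applies.
  obtain ⟨Y, hYm, hYr, hY⟩ := exists_adapted_realization V hU hZ hr (t := 0) hAC
    (hlim.mono hg) (Eventually.of_forall hF) hbl
  have hbl' : HasLims P Z (g : Filter I) n (fun i => Sum.elim (F i) (Sum.elim (X₀ i) (Y₀ i)))
      fun φ => ev V Z φ (Sum.elim Y (Sum.elim A C)) := fun φ => by
    simp only [hY φ]
    exact hb φ
  have hR : ResEq Z V (Sum.elim Y C) (Sum.elim (interp t A B) C) := fun φ => by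
    have h1 := hbl'.comp (Sum.elim (fun j : Fin m => .inl j) fun k : κ => .inr (.inr k)) φ
    have h2 := (hlimF.mono hg) φ
    simp only [ev_map] at h1
    have e1 : ∀ i, Sum.elim (F i) (Sum.elim (X₀ i) (Y₀ i)) ∘
        (Sum.elim (fun j : Fin m => .inl j) fun k : κ => .inr (.inr k)) =
          Sum.elim (F i) (Y₀ i) := fun i => by
      funext b
      rcases b with j | k <;> rfl
    have e2 : Sum.elim Y (Sum.elim A C) ∘
        (Sum.elim (fun j : Fin m => .inl j) fun k : κ => .inr (.inr k)) = Sum.elim Y C := by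
      funext b
      rcases b with j | k <;> rfl
    simp only [e1, e2] at h1
    exact tendsto_nhds_unique h1 h2
  have hge : seqIn V A (interp t A B) ≤ seqIn V A Y := by
    have h1 := tendsto_tupIn_of_hasLims hZm (R := Sum.elim r (Sum.elim r R))
      (by
        filter_upwards [hg hX₀] with i hi
        rintro (j | j | k)
        exacts [hF i j, hi j, hY₀ i k]) hbl' (fun j : Fin m => .inr (.inl j))
      fun j : Fin m => .inl j
    have h2 : Tendsto (fun i => seqIn V A (interp t A B) - δ i) g
        (𝓝 (seqIn V A (interp t A B) - 0)) := (hδ.mono_left hg).const_sub _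
    rw [sub_zero] at h2
    exact le_of_tendsto_of_tendsto h2 h1 (hg hin)
  have := resEq_of_optimal hZ hU ht0 ht1 hA hYm hC hr hAr hopt hR hge
  have h := hbl' ψ
  simp only [this ψ] at h
  exact h

/-- Optimal transport of `X₀` to a point inside the displacement interpolation. -/
theorem exists_transport_interp (hZ : ∀ n, IsMatrixBM P 𝓖 n (Z n)) (hU : U ≤ cofinite)
    [U.NeBot] [Countable κ] {t : ℝ} (ht0 : 0 < t) (ht1 : t < 1) {r : Fin m → ℝ}
    (hr : ∀ j, 0 < r j) {A B : Fin m → RMSeq Ω} {C : κ → RMSeq Ω} (hA : ∀ j, IsMeas (A j) (𝓖 0))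
    (hC : ∀ j, IsMeas (C j) (𝓖 0)) (hAr : ∀ j n ω, ‖(A j).1 n ω‖ ≤ r j)
    (hBr : ∀ j n ω, ‖(B j).1 n ω‖ ≤ r j)
    (hopt : ∀ A' B' : Fin m → RMSeq Ω, (∀ j, IsMeas (A' j) (𝓖 0)) → (∀ j, IsMeas (B' j) (𝓖 0)) →
      ResEq Z V (Sum.elim A' C) (Sum.elim A C) → ResEq Z V (Sum.elim B' C) (Sum.elim B C) →
        seqIn V A' B' ≤ seqIn V A B)
    {X₀ : ∀ n : ℕ+, Ω' → Fin m → Mat n} (hX₀ : ∀ n, Measurable (X₀ n))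
    (hX₀r : ∀ n, ∀ᵐ ω ∂P', ∀ j, ‖X₀ n ω j‖ ≤ r j)
    {Y₀ : ∀ n : ℕ+, κ → Mat n} {R : κ → ℝ} (hY₀ : ∀ n k, ‖Y₀ n k‖ ≤ R k)
    (hlim : HasLims P Z (probFilter P' U) Prod.fst
      (fun p => Sum.elim (X₀ p.1 p.2) (Y₀ p.1)) fun φ => ev V Z φ (Sum.elim A C)) :
    ∃ F : ∀ n : ℕ+, (Fin m → Mat n) → Fin m → Mat n, (∀ n, Measurable (F n)) ∧
      (∀ n x j, ‖F n x j‖ ≤ r j) ∧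
      (∀ n, IsClassicalOptimalCoupling P' (X₀ n) fun ω => F n (X₀ n ω)) ∧
      HasLims P Z (probFilter P' U) Prod.fst
        (fun p => Sum.elim (F p.1 (X₀ p.1 p.2)) (Sum.elim (X₀ p.1 p.2) (Y₀ p.1)))
        fun φ => ev V Z φ (Sum.elim (interp t A B) (Sum.elim A C)) := by
  have hZm := measurable_increments hZ
  set D := interp t A B with hD
  have hDr : ∀ j n ω, ‖(D j).1 n ω‖ ≤ r j := norm_interp_le ht0.le ht1.le hAr hBr
  obtain ⟨ψ, hψ⟩ := exists_dense_formula P 𝓖 (Fin m ⊕ κ)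
  set c : ℕ → ℝ := fun i => ev V Z (ψ i) (Sum.elim D C) with hc
  choose M hM using fun K => exists_penalty_le (P := P) (Z := Z) ψ c K
  have hn : ∀ n : ℕ+, (0 : ℝ) < 1 / (n : ℝ) := fun n => by
    have : (0 : ℝ) < (n : ℝ) := by exact_mod_cast n.pos
    positivity
  choose F hFm hFr hFo hFmax using fun (K : ℕ) (n : ℕ+) => exists_optimal_map P' (hX₀ n) hr
    (measurable_penalty (P := P) hZm ψ c K (Y₀ n)) (hM K n (Y₀ n)) (hn n)
  -- The weight of the penalty grows slowly enough with n for the estimate at fixed K to persist in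
  -- probability.
  obtain ⟨K, hK, hKE⟩ := exists_diagonal (P' := P') hU fun k =>
    eventually_penalized_le hZ hU hr hAr hDr hX₀r hY₀ hlim ψ k (F := F k) (hFmax k)
  refine ⟨fun n => F (K n) n, fun n => hFm _ _, fun n => hFr _ _, fun n => hFo _ _, ?_⟩
  have hXb := eventually_probFilter_of_ae (U := U) hX₀r
  have hKt : Tendsto (fun p : ℕ+ × Ω' => ((K p.1 : ℕ) : ℝ)) (probFilter P' U) atTop :=
    tendsto_natCast_atTop_atTop.comp (hK.comp tendsto_fst_probFilter)
  have hδ : Tendsto (fun p : ℕ+ × Ω' => 1 / ((K p.1 : ℝ) + 1)) (probFilter P' U) (𝓝 0) :=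
    tendsto_const_nhds.div_atTop (tendsto_atTop_add_const_right _ 1 hKt)
  refine hasLims_of_penalized hZ hU ht0 ht1 hr hA hC hAr hopt hXb (fun p => hFr _ _ _)
    (fun p => hY₀ p.1) hlim ?_ hδ ?_
  · refine HasLims.of_dense hZ hψ (hasLims_ev V hZm (Sum.elim D C)) fun i => ?_
    -- Inner products are bounded, so the lower bound for the penalized value bounds the penalty by
    -- L, and each controlled deviation by L/K.
    set L : ℝ := ∑ j, r j * r j + |seqIn V A D| + 1 with hL
    have h0 : Tendsto (fun p : ℕ+ × Ω' => L / (K p.1 : ℝ)) (probFilter P' U) (𝓝 0) :=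
      tendsto_const_nhds.div_atTop hKt
    rw [tendsto_iff_dist_tendsto_zero]
    refine squeeze_zero' (Eventually.of_forall fun _ => dist_nonneg) ?_ h0
    filter_upwards [hKE, hXb, hKt.eventually_gt_atTop (i : ℝ)] with p hp hX hi
    have hi' : i < K p.1 := by exact_mod_cast hi
    have hKpos : (0 : ℝ) < K p.1 := by exact_mod_cast (Nat.zero_le i).trans_lt hi'
    have h1 := (abs_le.1 (abs_tupIn_le hX (hFr (K p.1) p.1 (X₀ p.1 p.2)))).2
    have h2 : 1 / ((K p.1 : ℝ) + 1) ≤ 1 := by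
      rw [div_le_one (by positivity)]; linarith
    have h3 := neg_abs_le (seqIn V A D)
    have h4 : (K p.1 : ℝ) * |(ψ i).Lam P (Z p.1) (Sum.elim (F (K p.1) p.1 (X₀ p.1 p.2)) (Y₀ p.1)) -
        c i| ≤ penalty P Z ψ c (K p.1) (Y₀ p.1) (F (K p.1) p.1 (X₀ p.1 p.2)) :=
      mul_le_mul_of_nonneg_left (Finset.single_le_sum
        (f := fun i => |(ψ i).Lam P (Z p.1) (Sum.elim (F (K p.1) p.1 (X₀ p.1 p.2)) (Y₀ p.1)) - c i|)
        (fun _ _ => abs_nonneg _) (Finset.mem_range.2 hi')) hKpos.le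
    rw [Real.dist_eq, le_div_iff₀ hKpos, mul_comm]
    have hp' : seqIn V A D - 1 / ((K p.1 : ℝ) + 1) ≤
      tupIn (X₀ p.1 p.2) (F (K p.1) p.1 (X₀ p.1 p.2)) -
        penalty P Z ψ c (K p.1) (Y₀ p.1) (F (K p.1) p.1 (X₀ p.1 p.2)) := hp
    refine h4.trans ?_
    linarith
  · filter_upwards [hKE] with p hp
    have hp' : seqIn V A D - 1 / ((K p.1 : ℝ) + 1) ≤
      tupIn (X₀ p.1 p.2) (F (K p.1) p.1 (X₀ p.1 p.2)) -
        penalty P Z ψ c (K p.1) (Y₀ p.1) (F (K p.1) p.1 (X₀ p.1 p.2)) := hp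
    have := penalty_nonneg (P := P) (Z := Z) ψ c (K p.1) (Y₀ p.1) (F (K p.1) p.1 (X₀ p.1 p.2))
    linarith

/-- The interpolated point differs from B by (1 - t)(A - B), and formulas are Lipschitz. -/
lemma tendsto_ev_interp (hZ : ∀ n t j, Measurable (Z n t j)) {A B : Fin m → RMSeq Ω}
    {W : κ → RMSeq Ω} (φ : RFormula (Fin m ⊕ κ)) :
    Tendsto (fun t => ev V Z φ (Sum.elim (interp t A B) W)) (𝓝 1)
      (𝓝 (ev V Z φ (Sum.elim B W))) := by
  obtain ⟨C, s, hC, hL⟩ := φ.exists_lipschitz P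
  choose RA hRA0 hRA using fun j => (A j).exists_bound
  choose RB hRB0 hRB using fun j => (B j).exists_bound
  set S : ℝ := ∑ j, (RA j + RB j) with hS
  have hb : ∀ t : ℝ, |ev V Z φ (Sum.elim (interp t A B) W) - ev V Z φ (Sum.elim B W)| ≤
      C * (|1 - t| * S) := fun t => by
    refine le_of_tendsto ((tendsto_ev V hZ φ _).sub (tendsto_ev V hZ φ _)).abs
      (Eventually.of_forall fun p => ?_)
    rw [Lseq, Lseq, tupAt_sum, tupAt_sum]
    refine (hL p.1 (Z p.1) (hZ p.1) _ _).trans (mul_le_mul_of_nonneg_left ?_ hC)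
    refine (tD_sum_elim_le _ _ _ _).trans ?_
    rw [hS, Finset.mul_sum]
    refine Finset.sum_le_sum fun j _ => ?_
    have e : tupAt (interp t A B) p j - tupAt B p j =
        ((1 - t : ℝ) : ℂ) • ((A j).1 p.1 p.2 - (B j).1 p.1 p.2) := by
      change ((1 - t : ℝ) : ℂ) • (A j).1 p.1 p.2 + (t : ℂ) • (B j).1 p.1 p.2 - (B j).1 p.1 p.2 = _
      push_cast
      rw [smul_sub, sub_smul 1 (t : ℂ) ((B j).1 p.1 p.2), one_smul]
      abel
    rw [e, hsN_smul, Complex.norm_real, Real.norm_eq_abs]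
    refine mul_le_mul_of_nonneg_left ((hsN_le_norm _).trans ?_) (abs_nonneg _)
    exact (norm_sub_le _ _).trans (add_le_add (hRA j _ _) (hRB j _ _))
  rw [tendsto_iff_dist_tendsto_zero]
  have h0 : Tendsto (fun t : ℝ => C * (|1 - t| * S)) (𝓝 1) (𝓝 0) := by
    have : Continuous fun t : ℝ => C * (|1 - t| * S) := by fun_prop
    simpa using this.tendsto 1
  exact squeeze_zero (fun _ => dist_nonneg) (fun t => by rw [Real.dist_eq]; exact hb t) h0

/-- Optimal transport maps with the joint limits of an optimal coupling. -/
theorem exists_transport (hZ : ∀ n, IsMatrixBM P 𝓖 n (Z n)) (hU : U ≤ cofinite)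
    [U.NeBot] [Countable κ] {r : Fin m → ℝ}
    (hr : ∀ j, 0 < r j) {A B : Fin m → RMSeq Ω} {C : κ → RMSeq Ω} (hA : ∀ j, IsMeas (A j) (𝓖 0))
    (hC : ∀ j, IsMeas (C j) (𝓖 0)) (hAr : ∀ j n ω, ‖(A j).1 n ω‖ ≤ r j)
    (hBr : ∀ j n ω, ‖(B j).1 n ω‖ ≤ r j)
    (hopt : ∀ A' B' : Fin m → RMSeq Ω, (∀ j, IsMeas (A' j) (𝓖 0)) → (∀ j, IsMeas (B' j) (𝓖 0)) →
      ResEq Z V (Sum.elim A' C) (Sum.elim A C) → ResEq Z V (Sum.elim B' C) (Sum.elim B C) →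
        seqIn V A' B' ≤ seqIn V A B)
    {X₀ : ∀ n : ℕ+, Ω' → Fin m → Mat n} (hX₀ : ∀ n, Measurable (X₀ n))
    (hX₀r : ∀ n, ∀ᵐ ω ∂P', ∀ j, ‖X₀ n ω j‖ ≤ r j)
    {Y₀ : ∀ n : ℕ+, κ → Mat n} {R : κ → ℝ} (hY₀ : ∀ n k, ‖Y₀ n k‖ ≤ R k)
    (hlim : HasLims P Z (probFilter P' U) Prod.fst
      (fun p => Sum.elim (X₀ p.1 p.2) (Y₀ p.1)) fun φ => ev V Z φ (Sum.elim A C)) :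
    ∃ F : ∀ n : ℕ+, (Fin m → Mat n) → Fin m → Mat n, (∀ n, Measurable (F n)) ∧
      (∀ n x j, ‖F n x j‖ ≤ r j) ∧
      (∀ n, IsClassicalOptimalCoupling P' (X₀ n) fun ω => F n (X₀ n ω)) ∧
      HasLims P Z (probFilter P' U) Prod.fst
        (fun p => Sum.elim (F p.1 (X₀ p.1 p.2)) (Sum.elim (X₀ p.1 p.2) (Y₀ p.1)))
        fun φ => ev V Z φ (Sum.elim B (Sum.elim A C)) := by
  have hZm := measurable_increments hZ
  -- The shift by 2 keeps t strictly between 0 and 1 from k = 0 on.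
  set t : ℕ → ℝ := fun k => 1 - 1 / ((k : ℝ) + 2) with ht
  have hpos : ∀ k : ℕ, 0 < 1 / ((k : ℝ) + 2) ∧ 1 / ((k : ℝ) + 2) < 1 := fun k => by
    have hk : (0 : ℝ) ≤ k := Nat.cast_nonneg k
    refine ⟨by positivity, ?_⟩
    rw [div_lt_one (by positivity)]
    linarith
  have ht1 : Tendsto t atTop (𝓝 1) := by
    have : Tendsto (fun k : ℕ => 1 / ((k : ℝ) + 2)) atTop (𝓝 0) :=
      tendsto_const_nhds.div_atTop
        (tendsto_atTop_add_const_right _ 2 tendsto_natCast_atTop_atTop)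
    have h := this.const_sub 1
    rw [sub_zero] at h
    exact h
  choose F hFm hFr hFo hFl using fun k => exists_transport_interp hZ hU
    (show 0 < t k by have := hpos k; simp only [ht]; linarith)
    (show t k < 1 by have := hpos k; simp only [ht]; linarith)
    hr hA hC hAr hBr hopt hX₀ hX₀r hY₀ hlim
  obtain ⟨ψ, hψ⟩ := exists_dense_formula P 𝓖 (Fin m ⊕ Fin m ⊕ κ)
  -- For each k the map for t k fits the first k dense formulas within 1/(k+1); a diagonal choice
  -- then lets t tend to 1. Classical optimality survives, since each size uses one of these maps.
  have hE : ∀ k : ℕ, ∀ᶠ p in probFilter P' U, ∀ i ∈ Finset.range k,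
      |(ψ i).Lam P (Z p.1) (Sum.elim (F k p.1 (X₀ p.1 p.2)) (Sum.elim (X₀ p.1 p.2) (Y₀ p.1))) -
        ev V Z (ψ i) (Sum.elim (interp (t k) A B) (Sum.elim A C))| < 1 / ((k : ℝ) + 1) := fun k => by
    refine (eventually_all_finset _).2 fun i _ => ?_
    have := Metric.tendsto_nhds.1 (hFl k (ψ i)) (1 / ((k : ℝ) + 1)) (by positivity)
    simpa only [Real.dist_eq] using this
  obtain ⟨K, hK, hKE⟩ := exists_diagonal (P' := P') hU hE
  refine ⟨fun n => F (K n) n, fun n => hFm _ _, fun n => hFr _ _, fun n => hFo _ _, ?_⟩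
  have hKW : Tendsto (fun p : ℕ+ × Ω' => K p.1) (probFilter P' U) atTop :=
    hK.comp tendsto_fst_probFilter
  refine HasLims.of_dense hZ hψ (hasLims_ev V hZm (Sum.elim B (Sum.elim A C))) fun i => ?_
  have h1 : Tendsto (fun p : ℕ+ × Ω' => ev V Z (ψ i)
      (Sum.elim (interp (t (K p.1)) A B) (Sum.elim A C))) (probFilter P' U)
      (𝓝 (ev V Z (ψ i) (Sum.elim B (Sum.elim A C)))) :=
    (tendsto_ev_interp hZm (ψ i)).comp (ht1.comp hKW)
  have h2 : Tendsto (fun p : ℕ+ × Ω' => 1 / ((K p.1 : ℝ) + 1)) (probFilter P' U) (𝓝 0) :=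
    tendsto_const_nhds.div_atTop (tendsto_atTop_add_const_right _ 1
      (tendsto_natCast_atTop_atTop.comp hKW))
  have h3 : Tendsto (fun p : ℕ+ × Ω' => (ψ i).Lam P (Z p.1)
        (Sum.elim (F (K p.1) p.1 (X₀ p.1 p.2)) (Sum.elim (X₀ p.1 p.2) (Y₀ p.1))) -
      ev V Z (ψ i) (Sum.elim (interp (t (K p.1)) A B) (Sum.elim A C)))
      (probFilter P' U) (𝓝 0) := by
    refine squeeze_zero_norm' ?_ h2
    filter_upwards [hKE, hKW.eventually_gt_atTop i] with p hp hi
    exact (hp i (Finset.mem_range.2 hi)).le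
  simpa using h3.add h1

end Construction

end ChronOT

/-! ### The transport theorem -/

theorem mainTheorem7
    {Ω : Type*} [mΩ : MeasurableSpace Ω] (P : Measure Ω) [IsProbabilityMeasure P]
    (𝓖 : Filtration ℝ≥0 mΩ)
    (Z : ∀ n : ℕ+, ℝ≥0 → ℕ → Ω → Mat n) (hZ : ∀ n, IsMatrixBM P 𝓖 n (Z n))
    (U : Ultrafilter ℕ+) (hU : (U : Filter ℕ+) ≤ cofinite)
    (V : Subalgebra.center ℂ (RMUltraproduct P (U : Filter ℕ+)) →ₐ[ℂ] ℂ)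
    (m : ℕ) (m' : ℕ∞) (r : Fin m → ℝ) (hr : ∀ j, 0 < r j)
    (y₀ : TupleIndex m' → RMQuotient V) (hy₀ : ∀ j, y₀ j ∈ (quotStructure V hZ).level 0)
    (μ₀ μ₁ : ChronType (Fin m ⊕ TupleIndex m'))
    (hμ₀ : μ₀ ∈ typeSpace (quotStructure V hZ) r y₀)
    (hμ₁ : μ₁ ∈ typeSpace (quotStructure V hZ) r y₀)
    (x₀ x₁ : Fin m → RMQuotient V)
    (hopt : IsOptimalCoupling (quotStructure V hZ) y₀ μ₀ μ₁ x₀ x₁)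
    (Y₀ : ∀ n : ℕ+, TupleIndex m' → Mat n) (hY₀ : ∀ j, ∃ C : ℝ, ∀ n, ‖Y₀ n j‖ ≤ C)
    {Ω' : Type*} [MeasurableSpace Ω'] (P' : Measure Ω') [IsProbabilityMeasure P']
    (X₀ : ∀ n : ℕ+, Ω' → Fin m → Mat n) (hX₀ : ∀ n, Measurable (X₀ n))
    (hX₀r : ∀ n, ∀ᵐ ω ∂P', ∀ j, ‖X₀ n ω j‖ ≤ r j)
    (hconv : ∀ φ : RFormula (Fin m ⊕ TupleIndex m'),
      TendstoInMeasure P' (fun n ω => φ.Lam P (Z n) (Sum.elim (X₀ n ω) (Y₀ n))) (U : Filter ℕ+)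
        (fun _ => φ.eval (quotStructure V hZ) (Sum.elim x₀ y₀))) :
    ∃ F : ∀ n : ℕ+, (Fin m → Mat n) → (Fin m → Mat n),
      (∀ n, Measurable (F n)) ∧
      (∀ n, ∀ᵐ ω ∂P', ∀ j, ‖F n (X₀ n ω) j‖ ≤ r j) ∧
      (∀ ψ : RFormula (Fin m ⊕ Fin m ⊕ TupleIndex m'),
        TendstoInMeasure P'
          (fun n ω => ψ.Lam P (Z n) (Sum.elim (X₀ n ω) (Sum.elim (F n (X₀ n ω)) (Y₀ n))))
          (U : Filter ℕ+)
          (fun _ => ψ.eval (quotStructure V hZ) (Sum.elim x₀ (Sum.elim x₁ y₀)))) ∧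
      (∀ n, IsClassicalOptimalCoupling P' (X₀ n) (fun ω => F n (X₀ n ω))) := by
  choose C hCm hC using fun j => show ∃ X : RMSeq Ω, IsMeas X (𝓖 0) ∧ toQ V X = y₀ j by
    obtain ⟨-, -, X, hX, -, h⟩ := hy₀ j
    exact ⟨X, hX, h⟩
  obtain rfl : (fun k => toQ V (C k)) = y₀ := funext hC
  -- A coupling only requires elements at time 0; the bounds r_j on representatives are recovered
  -- from the types.
  obtain ⟨A, hA, hAr, hAx⟩ := exists_rep_of_mem_typeSpace V hZ hU hr hμ₀ hopt.1.1 hopt.1.2.2.1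
  obtain ⟨B, hB, hBr, hBx⟩ := exists_rep_of_mem_typeSpace V hZ hU hr hμ₁ hopt.1.2.1 hopt.1.2.2.2
  obtain rfl : (fun j => toQ V (A j)) = x₀ := funext hAx
  obtain rfl : (fun j => toQ V (B j)) = x₁ := funext hBx
  choose R hR using hY₀
  have heval : ∀ {α : Type} (φ : RFormula α) (X : α → RMSeq Ω), (∀ a, IsMeas (X a) (𝓖 0)) →
      φ.eval (quotStructure V hZ) (fun a => toQ V (X a)) = ev V Z φ X := fun φ X hX => by
    simpa only [shift_zero] using eval_eq_ev V hZ hU φ 0 X hX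
  have hlim : HasLims P Z (probFilter P' U) Prod.fst
      (fun p => Sum.elim (X₀ p.1 p.2) (Y₀ p.1)) fun φ => ev V Z φ (Sum.elim A C) := fun φ => by
    have h := tendstoInMeasure_iff_probFilter.1 (hconv φ)
    have e : (Sum.elim (fun j => toQ V (A j)) fun k => toQ V (C k)) =
        fun b => toQ V (Sum.elim A C b) := by
      funext b
      rcases b with j | k <;> rfl
    rw [e, heval φ _ (by rintro (j | k); exacts [hA j, hCm k])] at h
    exact h
  obtain ⟨F, hFm, hFr, hFo, hF⟩ := exists_transport hZ hU hr hA hCm hAr hBr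
    (fun A' B' hA' hB' h h' => seqIn_le_of_isOptimalCoupling V hZ hU hA hB hCm hopt hA' hB' h h')
    hX₀ hX₀r (fun n k => hR k n) hlim
  refine ⟨F, hFm, fun n => Eventually.of_forall fun ω j => hFr n _ j, fun ψ => ?_, hFo⟩
  -- The construction lists the transported tuple first; renaming restores the order x₀, x₁, y₀.
  have h := hF.comp (Sum.elim (fun j : Fin m => .inr (.inl j))
    (Sum.elim (fun j : Fin m => .inl j) fun k : TupleIndex m' => .inr (.inr k))) ψ
  have e : (Sum.elim (fun j => toQ V (A j))
      (Sum.elim (fun j => toQ V (B j)) fun k => toQ V (C k))) =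
      fun b => toQ V (Sum.elim A (Sum.elim B C) b) := by
    funext b
    rcases b with j | j | k <;> rfl
  have e₁ : ∀ (n : ℕ+) (a b : Fin m → Mat n) (c : TupleIndex m' → Mat n),
      Sum.elim b (Sum.elim a c) ∘ (Sum.elim (fun j : Fin m => .inr (.inl j))
        (Sum.elim (fun j : Fin m => .inl j) fun k : TupleIndex m' => .inr (.inr k))) =
      Sum.elim a (Sum.elim b c) := fun _ a b c => by
    funext b
    rcases b with j | j | k <;> rfl
  have e₂ : ∀ (a b : Fin m → RMSeq Ω) (c : TupleIndex m' → RMSeq Ω),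
      Sum.elim b (Sum.elim a c) ∘ (Sum.elim (fun j : Fin m => .inr (.inl j))
        (Sum.elim (fun j : Fin m => .inl j) fun k : TupleIndex m' => .inr (.inr k))) =
      Sum.elim a (Sum.elim b c) := fun a b c => by
    funext b
    rcases b with j | j | k <;> rfl
  rw [e, heval ψ _ (by rintro (j | j | k); exacts [hA j, hB j, hCm k])]
  refine tendstoInMeasure_iff_probFilter.2 ?_
  simp only [ev_map, e₁, e₂] at h
  exact h
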